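/- **Theorem.** Let $M$ be a smooth 5-dimensional CR-manifold of CR-dimension 1 with CR-bundle $L\subset\mathbb C\otimes TM$ (a smooth complex line subbundle with $L\cap\overline L=0$), belonging to general class ${\sf III}_2$: for every local generator $\mathcal L$ of $L$, with $\mathcal T=i[\mathcal L,\overline{\mathcal L}]$, $\mathcal S=[\mathcal L,\mathcal T]$, $\mathcal R=[\mathcal L,\mathcal S]$, the ranks of $(\mathcal L,\overline{\mathcal L},\mathcal T)$, $(\mathcal L,\overline{\mathcal L},\mathcal T,\mathcal S)$, $(\mathcal L,\overline{\mathcal L},\mathcal T,\mathcal S,\overline{\mathcal S})$, $(\mathcal L,\overline{\mathcal L},\mathcal T,\mathcal S,\mathcal R)$ are $3,4,4,5$ at every point. *The model algebra.* Let ${\sf N}\subset\mathbb C^4$ be the model $w_1=\overline w_1+2iz\overline z$, $w_2=\overline w_2+2iz\overline z(z+\overline z)$, $w_3=\overline w_3+2iz\overline z(z^2+\tfrac32z\overline z+\overline z^2)$. Let $\mathfrak g$ be the 6-dimensional real Lie algebra of the elements $l e_\alpha+t e_\tau+s e_\sigma+r e_\rho+z e_\zeta+\overline z e_{\overline\zeta}$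 ($l,t,s,r\in\mathbb R$, $z\in\mathbb C$) with brackets $[e_\alpha,e_\tau]=-4e_\tau$, $[e_\alpha,e_\sigma]=-3e_\sigma$, $[e_\alpha,e_\rho]=-2e_\rho$, $[e_\alpha,e_\zeta]=-e_\zeta$, $[e_\alpha,e_{\overline\zeta}]=-e_{\overline\zeta}$, $[e_\sigma,e_\zeta]=[e_\sigma,e_{\overline\zeta}]=-e_\tau$, $[e_\rho,e_\zeta]=[e_\rho,e_{\overline\zeta}]=-e_\sigma$, $[e_\zeta,e_{\overline\zeta}]=-i\,e_\rho$, the remaining ones being zero. *The bundle $P^5$.* Let $G_1$ be the group of matrices $$\begin{pmatrix}a^3\overline a&0&0&0&0\\ f&a^2\overline a&0&0&0\\ g&c&a\overline a&0&0\\ h&d&b&a&0\\ k&e&\overline b&0&\overline a\end{pmatrix},\qquad a\in\mathbb C\setminus\{0\},\ b,\dots,k\in\mathbb C.$$ A normalized local coframe of $M$ is a smooth coframe $(\tau,\sigma,\rho,\zeta,\overline\zeta)$ on an open set, with $\tau,\sigma,\rho$ real, which at each point is of the form $g\cdot\omega_0$ with $g\in G_1$ and $\omega_0$ the coframe dual to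 $(\mathcal R,\mathcal S,\mathcal T,\mathcal L,\overline{\mathcal L})$ for some local generator $\mathcal L$, and which satisfies, for some smooth real 1-form $\Lambda$ and some coefficients $\mathfrak J_i$ with $\overline{\mathfrak J_3}=-\mathfrak J_3$, the structure equations $$d\tau=4\Lambda\wedge\tau+\mathfrak J_1\,\tau\wedge\zeta-\mathfrak J_1\,\tau\wedge\overline\zeta+3i\,\mathfrak J_1\,\sigma\wedge\rho+\sigma\wedge\zeta+\sigma\wedge\overline\zeta,$$ $$d\sigma=3\Lambda\wedge\sigma+\mathfrak J_2\,\tau\wedge\rho+\mathfrak J_3\,\tau\wedge\zeta+\overline{\mathfrak J_3}\,\tau\wedge\overline\zeta+\mathfrak J_4\,\sigma\wedge\rho-\tfrac{\mathfrak J_1}2\sigma\wedge\zeta+\tfrac{\mathfrak J_1}2\sigma\wedge\overline\zeta+\rho\wedge\zeta+\rho\wedge\overline\zeta,$$ $$d\rho=2\Lambda\wedge\rho+\mathfrak J_5\,\tau\wedge\sigma+\mathfrak J_6\,\tau\wedge\rho+\mathfrak J_7\,\tau\wedge\zeta+\overline{\mathfrak J_7}\,\tau\wedge\overline\zeta+\mathfrak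 J_8\,\sigma\wedge\rho+\mathfrak J_9\,\sigma\wedge\zeta+\overline{\mathfrak J_9}\,\sigma\wedge\overline\zeta-\tfrac{\mathfrak J_1}2\rho\wedge\zeta+\tfrac{\mathfrak J_1}2\rho\wedge\overline\zeta+i\,\zeta\wedge\overline\zeta,$$ $$d\zeta=\Lambda\wedge\zeta+\mathfrak J_{10}\,\tau\wedge\sigma+\mathfrak J_{11}\,\tau\wedge\rho+\mathfrak J_{12}\,\tau\wedge\zeta+\mathfrak J_{13}\,\tau\wedge\overline\zeta+\mathfrak J_{14}\,\sigma\wedge\rho+\mathfrak J_{15}\,\sigma\wedge\zeta+\mathfrak J_{16}\,\rho\wedge\zeta,$$ $$d\Lambda=\sum_{\nu,\mu}X_{\nu\mu}\,\nu\wedge\mu,\qquad \nu,\mu\in\{\tau,\sigma,\rho,\zeta,\overline\zeta\}.$$ Let $P^5$ be the set of all values of normalized local coframes at points of $M$; it carries the tautological forms $\tau,\sigma,\rho$ (real) and $\zeta$. Let $G_5=\{\mathrm{diag}(a^4,a^3,a^2,a,a):a\in\mathbb R\setminus\{0\}\}$. Its identity component is identified with the 1-dimensional group $\mathfrak G_0$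 generated by $e_\alpha$, $\exp(te_\alpha)$ corresponding to $a=e^t$, and $G_5$ acts on $\mathfrak g$ by the automorphisms ${\sf Ad}(a)$ which fix $e_\alpha$ and multiply $e_\tau,e_\sigma,e_\rho,e_\zeta,e_{\overline\zeta}$ by $a^{-4},a^{-3},a^{-2},a^{-1},a^{-1}$, so that ${\sf Ad}(e^t)=\exp(t\,{\sf ad}_{e_\alpha})$. Then: 1. $\mathfrak g$ is isomorphic to the Lie algebra of smooth infinitesimal CR-automorphisms of ${\sf N}$ (the real vector fields $X$ with $[X,\Gamma(T^{1,0}{\sf N})]\subset\Gamma(T^{1,0}{\sf N})$). 2. $P^5$ is a smooth 6-dimensional submanifold of the bundle of coframes, with the induced topology, and the action $\omega\mapsto g\cdot\omega$ of $G_5$ makes it a smooth principal $G_5$-bundle over $M$. 3. There is exactly one smooth real 1-form $\Lambda$ on $P^5$ that satisfies, together with the tautological forms, the structure equations above on $P^5$ (at each point for some coefficients $\mathfrak J_i$, $X_{\nu\mu}$ with $\overline{\mathfrak J_3}=-\mathfrak J_3$). 4. The $\mathfrak g$-valued 1-form $\omega=\Lambda e_\alpha+\tau e_\tau+\sigma e_\sigma+\rho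 e_\rho+\zeta e_\zeta+\overline\zeta e_{\overline\zeta}$ is a Cartan connection on $P^5$: it is smooth; $\omega(A^*)=A$ for every $A\in\mathbb R e_\alpha$ with fundamental vector field $A^*$; $R_a^*\omega={\sf Ad}(a^{-1})\,\omega$ for every $a\in G_5$ (in particular for every $a\in\mathfrak G_0$); and $\omega_p:T_pP^5\to\mathfrak g$ is an isomorphism for every $p\in P^5$. -/

import Mathlib

open scoped Manifold ContDiff TensorProduct
open Bundle VectorField

namespace CRThreeTwo

noncomputable section

/-! ## Complexified tangent spaces and complex vector fields -/

section ComplexFields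

variable (E : Type*) [NormedAddCommGroup E] [NormedSpace ℝ E]
  {M : Type*} [TopologicalSpace M] [ChartedSpace E M]

/-- The complexified tangent space `ℂ ⊗ T_x M`. -/
abbrev CTangent (x : M) : Type _ := ℂ ⊗[ℝ] TangentSpace 𝓘(ℝ, E) x

/-- Complex conjugation on `ℂ ⊗ T_x M`. -/
def conjC (x : M) : CTangent E x →ₗ[ℝ] CTangent E x :=
  LinearMap.rTensor (TangentSpace 𝓘(ℝ, E) x) Complex.conjAe.toLinearMap

variable (M)

/-- A complex vector field `re + i im` on `M` (a section of `ℂ ⊗ TM`). -/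
structure ComplexField where
  re : ∀ x : M, TangentSpace 𝓘(ℝ, E) x
  im : ∀ x : M, TangentSpace 𝓘(ℝ, E) x

variable {E M}

namespace ComplexField

/-- The value in `ℂ ⊗ T_x M`. -/
def val (Z : ComplexField E M) (x : M) : CTangent E x :=
  (1 : ℂ) ⊗ₜ[ℝ] Z.re x + Complex.I ⊗ₜ[ℝ] Z.im x

/-- The conjugate field. -/
def conj (Z : ComplexField E M) : ComplexField E M := ⟨Z.re, fun x => -Z.im x⟩

/-- Multiplication by the imaginary unit. -/
def mulI (Z : ComplexField E M) : ComplexField E M := ⟨fun x => -Z.im x, Z.re⟩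

/-- The complex bilinear extension of the Lie bracket of vector fields. -/
def bracket (Z W : ComplexField E M) : ComplexField E M where
  re := fun x => mlieBracket 𝓘(ℝ, E) Z.re W.re x - mlieBracket 𝓘(ℝ, E) Z.im W.im x
  im := fun x => mlieBracket 𝓘(ℝ, E) Z.re W.im x + mlieBracket 𝓘(ℝ, E) Z.im W.re x

/-- Smoothness on a set. -/
def SmoothOn [IsManifold 𝓘(ℝ, E) ∞ M] (Z : ComplexField E M) (U : Set M) : Prop :=
  ContMDiffOn 𝓘(ℝ, E) 𝓘(ℝ, E).tangent ∞ (fun x => (⟨x, Z.re x⟩ : TangentBundle 𝓘(ℝ, E) M)) U ∧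
  ContMDiffOn 𝓘(ℝ, E) 𝓘(ℝ, E).tangent ∞ (fun x => (⟨x, Z.im x⟩ : TangentBundle 𝓘(ℝ, E) M)) U

/-- `𝒯 = i [ℒ, ℒ̄]`. -/
def fieldT (Z : ComplexField E M) : ComplexField E M := (Z.bracket Z.conj).mulI

/-- `𝒮 = [ℒ, 𝒯]`. -/
def fieldS (Z : ComplexField E M) : ComplexField E M := Z.bracket Z.fieldT

/-- `ℛ = [ℒ, 𝒮]`. -/
def fieldR (Z : ComplexField E M) : ComplexField E M := Z.bracket Z.fieldS

end ComplexField

variable [IsManifold 𝓘(ℝ, E) ∞ M]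

/-- `Z` is a smooth generator over the open set `U` of the family `L` of complex subspaces. -/
structure IsLocalGenerator (L : ∀ x : M, Submodule ℂ (CTangent E x)) (U : Set M)
    (Z : ComplexField E M) : Prop where
  isOpen : IsOpen U
  smooth : Z.SmoothOn U
  ne_zero : ∀ x ∈ U, Z.val x ≠ 0
  span_eq : ∀ x ∈ U, L x = Submodule.span ℂ {Z.val x}

variable (E M)

/-- A CR-structure of CR-dimension one: a smooth complex line subbundle `L` of `ℂ ⊗ TM` with
`L ∩ L̄ = 0`. For a line bundle formal integrability `[L, L] ⊂ L` holds automatically,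
since `[f Z, g Z]` is a multiple of `Z`. -/
structure CRStructure where
  L : ∀ x : M, Submodule ℂ (CTangent E x)
  exists_generator : ∀ x : M, ∃ (U : Set M) (Z : ComplexField E M),
    x ∈ U ∧ IsLocalGenerator L U Z
  totally_real : ∀ (x : M), ∀ w ∈ L x, conjC E x w ∈ L x → w = 0

variable {E M}

/-- The rank conditions of general class III₂, for every local generator. -/
def CRStructure.IsClassIII2 (C : CRStructure E M) : Prop :=
  ∀ (U : Set M) (Z : ComplexField E M), IsLocalGenerator C.L U Z → ∀ x ∈ U,
    Module.finrank ℂ (Submodule.span ℂ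
      ({Z.val x, Z.conj.val x, Z.fieldT.val x} : Set (CTangent E x))) = 3 ∧
    Module.finrank ℂ (Submodule.span ℂ
      ({Z.val x, Z.conj.val x, Z.fieldT.val x, Z.fieldS.val x} : Set (CTangent E x))) = 4 ∧
    Module.finrank ℂ (Submodule.span ℂ
      ({Z.val x, Z.conj.val x, Z.fieldT.val x, Z.fieldS.val x, Z.fieldS.conj.val x} :
        Set (CTangent E x))) = 4 ∧
    Module.finrank ℂ (Submodule.span ℂ
      ({Z.val x, Z.conj.val x, Z.fieldT.val x, Z.fieldS.val x, Z.fieldR.val x} :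
        Set (CTangent E x))) = 5

/-- `X` is a smooth real vector field with `[X, Γ(L)] ⊂ Γ(L)`: an infinitesimal
CR-automorphism of `(M, L)`. -/
def IsInfinitesimalCRAut (L : ∀ x : M, Submodule ℂ (CTangent E x))
    (X : ∀ x : M, TangentSpace 𝓘(ℝ, E) x) : Prop :=
  ContMDiff 𝓘(ℝ, E) 𝓘(ℝ, E).tangent ∞ (fun x => (⟨x, X x⟩ : TangentBundle 𝓘(ℝ, E) M)) ∧
  ∀ (U : Set M) (Z : ComplexField E M), IsOpen U → Z.SmoothOn U → (∀ x ∈ U, Z.val x ∈ L x) →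
    ∀ x ∈ U, ((⟨X, fun _ => 0⟩ : ComplexField E M).bracket Z).val x ∈ L x

end ComplexFields

/-! ## Differential one-forms on a manifold -/

section Forms

variable {F : Type*} [NormedAddCommGroup F] [NormedSpace ℝ F]
  {X : Type*} [TopologicalSpace X] [ChartedSpace F X]
  {W : Type*} [NormedAddCommGroup W] [NormedSpace ℝ W]

/-- The expression of a one-form in the preferred chart at `x₀`. -/
def formInChart (η : ∀ x : X, TangentSpace 𝓘(ℝ, F) x →L[ℝ] W) (x₀ : X) (y : F) : F →L[ℝ] W :=
  (η ((extChartAt 𝓘(ℝ, F) x₀).symm y)).comp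
    (mfderiv 𝓘(ℝ, F) 𝓘(ℝ, F) (extChartAt 𝓘(ℝ, F) x₀).symm y)

/-- The exterior derivative of a one-form, with the convention
`dη(v, w) = v(η(w)) - w(η(v)) - η([v, w])`, computed in the preferred chart at the point. -/
def extD (η : ∀ x : X, TangentSpace 𝓘(ℝ, F) x →L[ℝ] W) (x : X)
    (v w : TangentSpace 𝓘(ℝ, F) x) : W :=
  let D : F →L[ℝ] F →L[ℝ] W := fderiv ℝ (formInChart η x) (extChartAt 𝓘(ℝ, F) x x)
  let v' : F := mfderiv 𝓘(ℝ, F) 𝓘(ℝ, F) (extChartAt 𝓘(ℝ, F) x) x v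
  let w' : F := mfderiv 𝓘(ℝ, F) 𝓘(ℝ, F) (extChartAt 𝓘(ℝ, F) x) x w
  D v' w' - D w' v'

/-- Smoothness of a one-form on a set, as a section of the bundle `Hom(TX, W)`. -/
def SmoothFormOn [IsManifold 𝓘(ℝ, F) ∞ X] (η : ∀ x : X, TangentSpace 𝓘(ℝ, F) x →L[ℝ] W) (U : Set X) : Prop :=
  ContMDiffOn 𝓘(ℝ, F) (𝓘(ℝ, F).prod 𝓘(ℝ, F →L[ℝ] W)) ∞
    (fun x => (⟨x, η x⟩ : TotalSpace (F →L[ℝ] W)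
      (fun x : X => TangentSpace 𝓘(ℝ, F) x →L[ℝ] Bundle.Trivial X W x))) U

/-- The wedge product of two complex valued linear forms. -/
def wedge {T : Type*} (α β : T → ℂ) (v w : T) : ℂ := α v * β w - α w * β v

end Forms

/-! ## Coframes and the structure equations -/

/-- Values of a coframe `(τ, σ, ρ, ζ)` with `τ, σ, ρ` real and `ζ` complex; the fifth member of
the coframe is the conjugate of `ζ`. -/
abbrev CoframeValue : Type := ℝ × ℝ × ℝ × ℂ

/-- The five complex entries `(τ, σ, ρ, ζ, ζ̄)`. -/
def entry (v : CoframeValue) : Fin 5 → ℂ :=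
  ![(v.1 : ℂ), (v.2.1 : ℂ), (v.2.2.1 : ℂ), v.2.2.2, (starRingEnd ℂ) v.2.2.2]

section StructureEquations

variable {F : Type*} [NormedAddCommGroup F] [NormedSpace ℝ F]
  {X : Type*} [TopologicalSpace X] [ChartedSpace F X]

/-- The structure equations at the point `x` for the forms `θ = (τ, σ, ρ, ζ)` and the real
form `Λ`, with torsion coefficients `J₁, …, J₁₆` (`J₃` being purely imaginary) and with `dΛ` a
combination of the products of `τ, σ, ρ, ζ, ζ̄` only. -/
def StructureEquationsAt (θ : ∀ x : X, TangentSpace 𝓘(ℝ, F) x →L[ℝ] CoframeValue)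
    (Λ : ∀ x : X, TangentSpace 𝓘(ℝ, F) x →L[ℝ] ℝ) (x : X) : Prop :=
  let l : TangentSpace 𝓘(ℝ, F) x → ℂ := fun v => (Λ x v : ℂ)
  let τ : TangentSpace 𝓘(ℝ, F) x → ℂ := fun v => entry (θ x v) 0
  let σ : TangentSpace 𝓘(ℝ, F) x → ℂ := fun v => entry (θ x v) 1
  let ρ : TangentSpace 𝓘(ℝ, F) x → ℂ := fun v => entry (θ x v) 2
  let ζ : TangentSpace 𝓘(ℝ, F) x → ℂ := fun v => entry (θ x v) 3
  let ζb : TangentSpace 𝓘(ℝ, F) x → ℂ := fun v => entry (θ x v) 4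
  ∃ (J₁ J₂ J₃ J₄ J₅ J₆ J₇ J₈ J₉ J₁₀ J₁₁ J₁₂ J₁₃ J₁₄ J₁₅ J₁₆ : ℂ) (Y : Fin 5 → Fin 5 → ℂ),
    (starRingEnd ℂ) J₃ = -J₃ ∧
    ∀ v w : TangentSpace 𝓘(ℝ, F) x,
      entry (extD θ x v w) 0 =
        4 * wedge l τ v w + J₁ * wedge τ ζ v w - J₁ * wedge τ ζb v w
        + 3 * Complex.I * J₁ * wedge σ ρ v w + wedge σ ζ v w + wedge σ ζb v w ∧
      entry (extD θ x v w) 1 =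
        3 * wedge l σ v w + J₂ * wedge τ ρ v w + J₃ * wedge τ ζ v w
        + (starRingEnd ℂ) J₃ * wedge τ ζb v w + J₄ * wedge σ ρ v w
        - J₁ / 2 * wedge σ ζ v w + J₁ / 2 * wedge σ ζb v w
        + wedge ρ ζ v w + wedge ρ ζb v w ∧
      entry (extD θ x v w) 2 =
        2 * wedge l ρ v w + J₅ * wedge τ σ v w + J₆ * wedge τ ρ v w + J₇ * wedge τ ζ v w
        + (starRingEnd ℂ) J₇ * wedge τ ζb v w + J₈ * wedge σ ρ v w + J₉ * wedge σ ζ v w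
        + (starRingEnd ℂ) J₉ * wedge σ ζb v w - J₁ / 2 * wedge ρ ζ v w
        + J₁ / 2 * wedge ρ ζb v w + Complex.I * wedge ζ ζb v w ∧
      entry (extD θ x v w) 3 =
        wedge l ζ v w + J₁₀ * wedge τ σ v w + J₁₁ * wedge τ ρ v w + J₁₂ * wedge τ ζ v w
        + J₁₃ * wedge τ ζb v w + J₁₄ * wedge σ ρ v w + J₁₅ * wedge σ ζ v w
        + J₁₆ * wedge ρ ζ v w ∧
      ((extD Λ x v w : ℝ) : ℂ) =
        ∑ ν : Fin 5, ∑ μ : Fin 5, Y ν μ *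
          wedge (fun t => entry (θ x t) ν) (fun t => entry (θ x t) μ) v w

end StructureEquations

/-- The matrix group `G₁` of the initial `G`-structure. -/
def groupG1 : Set (Matrix (Fin 5) (Fin 5) ℂ) :=
  {g | ∃ a b c d e f h k m : ℂ, a ≠ 0 ∧
    g = !![a ^ 3 * (starRingEnd ℂ) a, 0, 0, 0, 0;
           f, a ^ 2 * (starRingEnd ℂ) a, 0, 0, 0;
           m, c, a * (starRingEnd ℂ) a, 0, 0;
           h, d, b, a, 0;
           k, e, (starRingEnd ℂ) b, 0, (starRingEnd ℂ) a]}

/-- The action of `G₅ = {diag(a⁴, a³, a², a, a) : a ∈ ℝ ∖ {0}} ≅ ℝˣ` on values of coframes. -/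
def scaleValue (a : ℝˣ) : CoframeValue →L[ℝ] CoframeValue :=
  ContinuousLinearMap.prodMap ((a : ℝ) ^ 4 • ContinuousLinearMap.id ℝ ℝ)
    (ContinuousLinearMap.prodMap ((a : ℝ) ^ 3 • ContinuousLinearMap.id ℝ ℝ)
      (ContinuousLinearMap.prodMap ((a : ℝ) ^ 2 • ContinuousLinearMap.id ℝ ℝ)
        ((a : ℝ) • ContinuousLinearMap.id ℝ ℂ)))

section Bundle

variable {E : Type*} [NormedAddCommGroup E] [NormedSpace ℝ E]
  {M : Type*} [TopologicalSpace M] [ChartedSpace E M] [IsManifold 𝓘(ℝ, E) ∞ M]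

/-- `u` belongs to the fibre over `x` of the initial `G₁`-structure `P¹`: it is `g · ω₀` with
`g ∈ G₁` and `ω₀` the coframe dual to `(ℛ, 𝒮, 𝒯, ℒ, ℒ̄)` for a local generator `ℒ` of `L`;
that is, `g` is the matrix of values of `u` on that frame. -/
def CRStructure.IsP1Coframe (C : CRStructure E M) (x : M)
    (u : TangentSpace 𝓘(ℝ, E) x →L[ℝ] CoframeValue) : Prop :=
  ∃ (U : Set M) (Z : ComplexField E M), x ∈ U ∧ IsLocalGenerator C.L U Z ∧
    ∃ g ∈ groupG1, ∀ i j : Fin 5,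
      g i j =
        entry (u ((![Z.fieldR, Z.fieldS, Z.fieldT, Z, Z.conj] j).re x)) i
        + Complex.I * entry (u ((![Z.fieldR, Z.fieldS, Z.fieldT, Z, Z.conj] j).im x)) i

/-- `s` is, over the open set `U`, a smooth section of `P¹` that is fully normalized: together
with some smooth real one-form it satisfies the structure equations. -/
structure CRStructure.IsNormalizedCoframe (C : CRStructure E M) (U : Set M)
    (s : ∀ x : M, TangentSpace 𝓘(ℝ, E) x →L[ℝ] CoframeValue) : Prop where
  isOpen : IsOpen U
  smooth : SmoothFormOn s U
  mem_P1 : ∀ x ∈ U, C.IsP1Coframe x (s x)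
  structure_eq : ∃ l : ∀ x : M, TangentSpace 𝓘(ℝ, E) x →L[ℝ] ℝ,
    SmoothFormOn l U ∧ ∀ x ∈ U, StructureEquationsAt s l x

variable (E M)

/-- The total space of the bundle of linear maps `T_x M → ℝ³ × ℂ`, which contains the bundle of
coframes of `M`. -/
abbrev CoframeSpace : Type _ :=
  TotalSpace (E →L[ℝ] CoframeValue)
    (fun x : M => TangentSpace 𝓘(ℝ, E) x →L[ℝ] Bundle.Trivial M CoframeValue x)

variable {E M}

/-- The action of `G₅` on coframes, `ω ↦ g · ω`. -/
def scaleCoframe (a : ℝˣ) (p : CoframeSpace E M) : CoframeSpace E M :=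
  ⟨p.1, ContinuousLinearMap.comp (scaleValue a) (p.2 : TangentSpace 𝓘(ℝ, E) p.1 →L[ℝ] CoframeValue)⟩

/-- The coframes at points of `M` that extend to normalized local coframes. -/
def CRStructure.P5Set (C : CRStructure E M) : Set (CoframeSpace E M) :=
  {p | ∃ (U : Set M) (s : ∀ x : M, TangentSpace 𝓘(ℝ, E) x →L[ℝ] CoframeValue),
    p.1 ∈ U ∧ C.IsNormalizedCoframe U s ∧ p.2 = s p.1}

/-- The reduced bundle `P⁵` as a space, with the topology induced from the coframe bundle. -/
def CRStructure.P5 (C : CRStructure E M) : Type _ := {p : CoframeSpace E M // p ∈ C.P5Set}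

instance (C : CRStructure E M) : TopologicalSpace C.P5 :=
  inferInstanceAs (TopologicalSpace {p : CoframeSpace E M // p ∈ C.P5Set})

/-- The inclusion of `P⁵` in the coframe bundle. -/
def CRStructure.incl (C : CRStructure E M) (p : C.P5) : CoframeSpace E M := p.1

/-- The projection `P⁵ → M`. -/
def CRStructure.proj (C : CRStructure E M) (p : C.P5) : M := (C.incl p).1

/-- The tautological forms `(τ, σ, ρ, ζ)` on `P⁵`. -/
def CRStructure.tautological (C : CRStructure E M) [ChartedSpace (E × ℝ) C.P5] (p : C.P5) :
    TangentSpace 𝓘(ℝ, E × ℝ) p →L[ℝ] CoframeValue :=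
  ContinuousLinearMap.comp ((C.incl p).2 : TangentSpace 𝓘(ℝ, E) (C.proj p) →L[ℝ] CoframeValue)
    (mfderiv 𝓘(ℝ, E × ℝ) 𝓘(ℝ, E) C.proj p)

end Bundle

/-! ## The model and its Lie algebra -/

/-- The model `N ⊂ ℂ⁴` as a graph over the coordinates `(z, u₁, u₂, u₃)`. -/
abbrev ModelN : Type := ℂ × ℝ × ℝ × ℝ

/-- The embedding of `N` in `ℂ⁴` with coordinates `(z, w₁, w₂, w₃)`. -/
def modelEmb (n : ModelN) : Fin 4 → ℂ :=
  let z := n.1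
  let zb := (starRingEnd ℂ) n.1
  ![z,
    (n.2.1 : ℂ) + Complex.I * (z * zb),
    (n.2.2.1 : ℂ) + Complex.I * (z * zb * (z + zb)),
    (n.2.2.2 : ℂ) + Complex.I * (z * zb * (z ^ 2 + 3 / 2 * (z * zb) + zb ^ 2))]

theorem range_modelEmb : Set.range modelEmb = {c : Fin 4 → ℂ |
    c 1 = (starRingEnd ℂ) (c 1) + 2 * Complex.I * (c 0 * (starRingEnd ℂ) (c 0)) ∧
    c 2 = (starRingEnd ℂ) (c 2) + 2 * Complex.I * (c 0 * (starRingEnd ℂ) (c 0))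
      * (c 0 + (starRingEnd ℂ) (c 0)) ∧
    c 3 = (starRingEnd ℂ) (c 3) + 2 * Complex.I * (c 0 * (starRingEnd ℂ) (c 0))
      * ((c 0) ^ 2 + 3 / 2 * (c 0 * (starRingEnd ℂ) (c 0)) + ((starRingEnd ℂ) (c 0)) ^ 2)} := by
  have aux : ∀ (w v : ℂ), (starRingEnd ℂ) v = v →
      w = (starRingEnd ℂ) w + 2 * Complex.I * v → (w.re : ℂ) + Complex.I * v = w := by
    intro w v hv hw
    have hvi : v.im = 0 := by
      have := congrArg Complex.im hv
      simp only [Complex.conj_im] at this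
      linarith
    have h2 := congrArg Complex.im hw
    simp [Complex.add_im, Complex.mul_im, Complex.mul_re] at h2
    apply Complex.ext <;> simp [hvi]
    linarith
  have h₂ : (starRingEnd ℂ) 2 = 2 := map_ofNat (starRingEnd ℂ) 2
  have h₃ : (starRingEnd ℂ) 3 = 3 := map_ofNat (starRingEnd ℂ) 3
  ext c
  constructor
  · rintro ⟨n, rfl⟩
    refine ⟨?_, ?_, ?_⟩ <;> simp [modelEmb, h₂, h₃] <;> ring
  · rintro ⟨h1, h2, h3⟩
    refine ⟨(c 0, (c 1).re, (c 2).re, (c 3).re), ?_⟩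
    funext j
    fin_cases j
    · simp [modelEmb]
    · exact aux _ _ (by simp; ring) h1
    · exact aux _ _ (by simp; ring) (by linear_combination h2)
    · exact aux _ _ (by simp [h₂, h₃]; ring) (by linear_combination h3)

/-- The CR-bundle `T^{1,0} N`: the complex tangent vectors killed by the differentials of the
conjugate coordinates `z̄, w̄₁, w̄₂, w̄₃`. -/
def modelL (n : ModelN) : Submodule ℂ (CTangent ModelN n) :=
  ⨅ j : Fin 4, LinearMap.ker (LinearMap.liftBaseChange ℂ
    (Complex.conjAe.toLinearMap ∘ₗ
      (fderiv ℝ (fun m : ModelN => modelEmb m j) n : ModelN →ₗ[ℝ] ℂ) :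
        TangentSpace 𝓘(ℝ, ModelN) n →ₗ[ℝ] ℂ))

/-- The real Lie algebra `𝔤`: the quintuple `(l, t, s, r, z)` stands for the real element
`l e_α + t e_τ + s e_σ + r e_ρ + z e_ζ + z̄ e_ζ̄`. -/
def ModelAlgebra : Type := ℝ × CoframeValue

instance : NormedAddCommGroup ModelAlgebra := inferInstanceAs (NormedAddCommGroup (ℝ × CoframeValue))
instance : NormedSpace ℝ ModelAlgebra := inferInstanceAs (NormedSpace ℝ (ℝ × CoframeValue))

namespace ModelAlgebra

/-- The element of `𝔤` with the given coordinates. -/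
def mk (l : ℝ) (v : CoframeValue) : ModelAlgebra := (l, v)

/-- The coordinate along `e_α`. -/
def cα (x : ModelAlgebra) : ℝ := x.1
/-- The coordinate along `e_τ`. -/
def cτ (x : ModelAlgebra) : ℝ := x.2.1
/-- The coordinate along `e_σ`. -/
def cσ (x : ModelAlgebra) : ℝ := x.2.2.1
/-- The coordinate along `e_ρ`. -/
def cρ (x : ModelAlgebra) : ℝ := x.2.2.2.1
/-- The coordinate along `e_ζ`; the one along `e_ζ̄` is its conjugate. -/
def cζ (x : ModelAlgebra) : ℂ := x.2.2.2.2

@[ext] theorem ext' {x y : ModelAlgebra} (h1 : x.cα = y.cα) (h2 : x.cτ = y.cτ)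
    (h3 : x.cσ = y.cσ) (h4 : x.cρ = y.cρ) (h5 : x.cζ = y.cζ) : x = y :=
  Prod.ext h1 (Prod.ext h2 (Prod.ext h3 (Prod.ext h4 h5)))

/-- The bracket with `[e_α, e_τ] = -4 e_τ`, `[e_α, e_σ] = -3 e_σ`, `[e_α, e_ρ] = -2 e_ρ`,
`[e_α, e_ζ] = -e_ζ`, `[e_α, e_ζ̄] = -e_ζ̄`, `[e_σ, e_ζ] = [e_σ, e_ζ̄] = -e_τ`,
`[e_ρ, e_ζ] = [e_ρ, e_ζ̄] = -e_σ`, `[e_ζ, e_ζ̄] = -i e_ρ`, the other brackets being zero,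
restricted to real elements. The `e_ρ` coefficient of `[z e_ζ + z̄ e_ζ̄, z' e_ζ + z̄' e_ζ̄]` is
`-i (z z̄' - z̄ z') = 2 Im (z z̄')`. -/
instance : Bracket ModelAlgebra ModelAlgebra where
  bracket x y := mk 0
    (-4 * (x.cα * y.cτ - y.cα * x.cτ) - 2 * (x.cσ * y.cζ.re - y.cσ * x.cζ.re),
     -3 * (x.cα * y.cσ - y.cα * x.cσ) - 2 * (x.cρ * y.cζ.re - y.cρ * x.cζ.re),
     -2 * (x.cα * y.cρ - y.cα * x.cρ) + 2 * (x.cζ * (starRingEnd ℂ) y.cζ).im,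
     -((x.cα : ℂ) * y.cζ - (y.cα : ℂ) * x.cζ))

section simps
variable (x y : ModelAlgebra) (c : ℝ) (l : ℝ) (v : CoframeValue)
@[simp] theorem add_cα : (x + y).cα = x.cα + y.cα := rfl
@[simp] theorem add_cτ : (x + y).cτ = x.cτ + y.cτ := rfl
@[simp] theorem add_cσ : (x + y).cσ = x.cσ + y.cσ := rfl
@[simp] theorem add_cρ : (x + y).cρ = x.cρ + y.cρ := rfl
@[simp] theorem add_cζ : (x + y).cζ = x.cζ + y.cζ := rfl
@[simp] theorem smul_cα : (c • x).cα = c * x.cα := rfl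
@[simp] theorem smul_cτ : (c • x).cτ = c * x.cτ := rfl
@[simp] theorem smul_cσ : (c • x).cσ = c * x.cσ := rfl
@[simp] theorem smul_cρ : (c • x).cρ = c * x.cρ := rfl
@[simp] theorem smul_cζ : (c • x).cζ = c • x.cζ := rfl
@[simp] theorem zero_cα : (0 : ModelAlgebra).cα = 0 := rfl
@[simp] theorem zero_cτ : (0 : ModelAlgebra).cτ = 0 := rfl
@[simp] theorem zero_cσ : (0 : ModelAlgebra).cσ = 0 := rfl
@[simp] theorem zero_cρ : (0 : ModelAlgebra).cρ = 0 := rfl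
@[simp] theorem zero_cζ : (0 : ModelAlgebra).cζ = 0 := rfl
@[simp] theorem mk_cα : (mk l v).cα = l := rfl
@[simp] theorem mk_cτ : (mk l v).cτ = v.1 := rfl
@[simp] theorem mk_cσ : (mk l v).cσ = v.2.1 := rfl
@[simp] theorem mk_cρ : (mk l v).cρ = v.2.2.1 := rfl
@[simp] theorem mk_cζ : (mk l v).cζ = v.2.2.2 := rfl
@[simp] theorem lie_cα : (⁅x, y⁆ : ModelAlgebra).cα = 0 := rfl
@[simp] theorem lie_cτ : (⁅x, y⁆ : ModelAlgebra).cτ =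
  -4 * (x.cα * y.cτ - y.cα * x.cτ) - 2 * (x.cσ * y.cζ.re - y.cσ * x.cζ.re) := rfl
@[simp] theorem lie_cσ : (⁅x, y⁆ : ModelAlgebra).cσ =
  -3 * (x.cα * y.cσ - y.cα * x.cσ) - 2 * (x.cρ * y.cζ.re - y.cρ * x.cζ.re) := rfl
@[simp] theorem lie_cρ : (⁅x, y⁆ : ModelAlgebra).cρ =
  -2 * (x.cα * y.cρ - y.cα * x.cρ) + 2 * (x.cζ * (starRingEnd ℂ) y.cζ).im := rfl
@[simp] theorem lie_cζ : (⁅x, y⁆ : ModelAlgebra).cζ =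
  -((x.cα : ℂ) * y.cζ - (y.cα : ℂ) * x.cζ) := rfl
end simps

instance : LieRing ModelAlgebra where
  add_lie x y z := by
    ext <;> simp <;> ring
  lie_add x y z := by
    ext <;> simp <;> ring
  lie_self x := by
    ext <;> simp <;> ring
  leibniz_lie x y z := by
    ext <;> simp <;> ring

instance : LieAlgebra ℝ ModelAlgebra where
  lie_smul c x y := by
    ext <;> simp <;> ring

/-- The element `e_α`. -/
def eα : ModelAlgebra := mk 1 0

/-- The adjoint action of `G₅ ≅ ℝˣ` on `𝔤`: it is by automorphisms of `𝔤`, and on the identity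
component (the one-parameter group generated by `e_α`) it is `Ad(exp(t e_α)) = exp(t ad e_α)`. -/
def Ad (a : ℝˣ) : ModelAlgebra →ₗ⁅ℝ⁆ ModelAlgebra where
  toFun x := mk x.cα
    (((a⁻¹ : ℝˣ) : ℝ) ^ 4 * x.cτ, ((a⁻¹ : ℝˣ) : ℝ) ^ 3 * x.cσ, ((a⁻¹ : ℝˣ) : ℝ) ^ 2 * x.cρ,
      (((a⁻¹ : ℝˣ) : ℝ) : ℂ) * x.cζ)
  map_add' x y := by
    ext <;> simp <;> ring
  map_smul' c x := by
    ext <;> simp <;> ring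
  map_lie' := by
    intro x y
    generalize ((a⁻¹ : ℝˣ) : ℝ) = b
    ext <;> simp <;> ring

@[simp] theorem Ad_cα (a : ℝˣ) (x : ModelAlgebra) : (Ad a x).cα = x.cα := rfl
@[simp] theorem Ad_cτ (a : ℝˣ) (x : ModelAlgebra) :
  (Ad a x).cτ = ((a⁻¹ : ℝˣ) : ℝ) ^ 4 * x.cτ := rfl
@[simp] theorem Ad_cσ (a : ℝˣ) (x : ModelAlgebra) :
  (Ad a x).cσ = ((a⁻¹ : ℝˣ) : ℝ) ^ 3 * x.cσ := rfl
@[simp] theorem Ad_cρ (a : ℝˣ) (x : ModelAlgebra) :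
  (Ad a x).cρ = ((a⁻¹ : ℝˣ) : ℝ) ^ 2 * x.cρ := rfl
@[simp] theorem Ad_cζ (a : ℝˣ) (x : ModelAlgebra) :
  (Ad a x).cζ = (((a⁻¹ : ℝˣ) : ℝ) : ℂ) * x.cζ := rfl

theorem Ad_mul (a b : ℝˣ) (x : ModelAlgebra) : Ad (a * b) x = Ad a (Ad b x) := by
  ext <;> simp <;> ring

end ModelAlgebra

/-! ## Principal bundles and Cartan connections -/

/-- The positive number `e^t` as an element of `G₅ ≅ ℝˣ`: the one-parameter subgroup generated
by `e_α`. -/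
def expUnit (t : ℝ) : ℝˣ := Units.mk0 (Real.exp t) (Real.exp_ne_zero t)

/-- `d/dt Ad(exp(t e_α)) x = [e_α, Ad(exp(t e_α)) x]`, so that `Ad` is the adjoint action. -/
theorem hasDerivAt_Ad_expUnit (x : ModelAlgebra) (t : ℝ) :
    HasDerivAt (fun t => ModelAlgebra.Ad (expUnit t) x)
      ⁅ModelAlgebra.eα, ModelAlgebra.Ad (expUnit t) x⁆ t := by
  have h : ∀ k : ℕ, HasDerivAt (fun t : ℝ => (((expUnit t)⁻¹ : ℝˣ) : ℝ) ^ k)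
      (-(k : ℝ) * (((expUnit t)⁻¹ : ℝˣ) : ℝ) ^ k) t := by
    intro k
    have e : ∀ t : ℝ, (((expUnit t)⁻¹ : ℝˣ) : ℝ) ^ k = Real.exp (-(k : ℝ) * t) := by
      intro t
      rw [Units.val_inv_eq_inv_val, show ((expUnit t : ℝˣ) : ℝ) = Real.exp t from rfl,
        ← Real.exp_neg, ← Real.exp_nat_mul]
      congr 1
      ring
    simp only [e]
    have := ((hasDerivAt_id t).const_mul (-(k : ℝ))).exp
    simpa [mul_comm] using this
  have h1 : HasDerivAt (fun t : ℝ => ((((expUnit t)⁻¹ : ℝˣ) : ℝ) : ℂ))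
      (((-(((expUnit t)⁻¹ : ℝˣ) : ℝ) : ℝ)) : ℂ) t := by
    have := (h 1).ofReal_comp
    simpa using this
  have key := (hasDerivAt_const t x.cα).prodMk (((h 4).mul_const x.cτ).prodMk
    (((h 3).mul_const x.cσ).prodMk (((h 2).mul_const x.cρ).prodMk (h1.mul_const x.cζ))))
  refine HasDerivAt.congr_deriv (f := fun t => ModelAlgebra.Ad (expUnit t) x) key ?_
  refine ModelAlgebra.ext' ?_ ?_ ?_ ?_ ?_
  · rfl
  · rw [ModelAlgebra.lie_cτ]
    change -((4 : ℕ) : ℝ) * _ * _ = _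
    simp [ModelAlgebra.eα]; ring
  · rw [ModelAlgebra.lie_cσ]
    change -((3 : ℕ) : ℝ) * _ * _ = _
    simp [ModelAlgebra.eα]; ring
  · rw [ModelAlgebra.lie_cρ]
    change -((2 : ℕ) : ℝ) * _ * _ = _
    simp [ModelAlgebra.eα]; ring
  · rw [ModelAlgebra.lie_cζ]
    change ((-(((expUnit t)⁻¹ : ℝˣ) : ℝ) : ℝ) : ℂ) * _ = _
    simp [ModelAlgebra.eα]

section Cartan

variable {E : Type*} [NormedAddCommGroup E] [NormedSpace ℝ E]
  {M : Type*} [TopologicalSpace M] [ChartedSpace E M]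
  {F : Type*} [NormedAddCommGroup F] [NormedSpace ℝ F]
  {P : Type*} [TopologicalSpace P] [ChartedSpace F P] [MulAction ℝˣ P]

/-- `pr : P → M` is a smooth principal bundle with structure group `G₅ ≅ ℝˣ` (the group being
commutative, left and right actions agree): the action is smooth, and `P` has smooth equivariant
local trivializations `(pr, κ)` with inverse `ψ`. -/
structure IsPrincipalBundle (pr : P → M) : Prop where
  smooth_proj : ContMDiff 𝓘(ℝ, F) 𝓘(ℝ, E) ∞ pr
  smooth_smul : ContMDiff (𝓘(ℝ, ℝ).prod 𝓘(ℝ, F)) 𝓘(ℝ, F) ∞ (fun q : ℝˣ × P => q.1 • q.2)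
  exists_trivialization : ∀ x : M, ∃ (U : Set M) (ψ : M × ℝˣ → P) (κ : P → ℝˣ),
    IsOpen U ∧ x ∈ U ∧
    ContMDiffOn (𝓘(ℝ, E).prod 𝓘(ℝ, ℝ)) 𝓘(ℝ, F) ∞ ψ (U ×ˢ Set.univ) ∧
    ContMDiffOn 𝓘(ℝ, F) 𝓘(ℝ, ℝ) ∞ κ (pr ⁻¹' U) ∧
    (∀ y ∈ U, ∀ a : ℝˣ, pr (ψ (y, a)) = y ∧ κ (ψ (y, a)) = a) ∧
    (∀ p ∈ pr ⁻¹' U, ψ (pr p, κ p) = p) ∧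
    (∀ y ∈ U, ∀ a b : ℝˣ, ψ (y, a * b) = a • ψ (y, b))

/-- The fundamental vector field `(c e_α)*` on `P`: the velocity at `t = 0` of
`t ↦ exp(t c e_α) · p`. -/
def fundamentalField (c : ℝ) (p : P) : TangentSpace 𝓘(ℝ, F) p :=
  mfderiv 𝓘(ℝ, ℝ) 𝓘(ℝ, F) (fun t : ℝ => expUnit (t * c) • p) 0 (1 : ℝ)

/-- `om` is a Cartan connection on the principal `G₅`-bundle `P` with values in `𝔤`. -/
structure IsCartanConnection [IsManifold 𝓘(ℝ, F) ∞ P]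
    (om : ∀ p : P, TangentSpace 𝓘(ℝ, F) p →L[ℝ] ModelAlgebra) : Prop where
  smooth : SmoothFormOn om Set.univ
  fundamental : ∀ (c : ℝ) (p : P), om p (fundamentalField c p) = c • ModelAlgebra.eα
  equivariant : ∀ (a : ℝˣ) (p : P) (v : TangentSpace 𝓘(ℝ, F) p),
    om (a • p) (mfderiv 𝓘(ℝ, F) 𝓘(ℝ, F) (fun q : P => a • q) p v) = ModelAlgebra.Ad a⁻¹ (om p v)
  bijective : ∀ p : P, Function.Bijective (om p)

end Cartan

section MainForm

variable {E : Type*} [NormedAddCommGroup E] [NormedSpace ℝ E]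
  {M : Type*} [TopologicalSpace M] [ChartedSpace E M] [IsManifold 𝓘(ℝ, E) ∞ M]
  (C : CRStructure E M) [ChartedSpace (E × ℝ) C.P5]

/-- The smooth real one-form `Λ` on `P⁵` completes the tautological forms to a system which
satisfies the structure equations. -/
def CRStructure.IsStructureForm [IsManifold 𝓘(ℝ, E × ℝ) ∞ C.P5]
    (Λ : ∀ p : C.P5, TangentSpace 𝓘(ℝ, E × ℝ) p →L[ℝ] ℝ) : Prop :=
  SmoothFormOn Λ Set.univ ∧ ∀ p : C.P5, StructureEquationsAt C.tautological Λ p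

/-- The `𝔤`-valued form `ω = Λ e_α + τ e_τ + σ e_σ + ρ e_ρ + ζ e_ζ + ζ̄ e_ζ̄`. -/
def CRStructure.cartanForm (Λ : ∀ p : C.P5, TangentSpace 𝓘(ℝ, E × ℝ) p →L[ℝ] ℝ) (p : C.P5) :
    TangentSpace 𝓘(ℝ, E × ℝ) p →L[ℝ] ModelAlgebra :=
  ((Λ p).prod (C.tautological p) : TangentSpace 𝓘(ℝ, E × ℝ) p →L[ℝ] ℝ × CoframeValue)

end MainForm

end

end CRThreeTwo

open CRThreeTwo

/-!
The statement is reduced to the algebra of real frames. A local generator of `L` is written as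
`A - i B` with real vector fields `A`, `B`, and a coframe `(τ, σ, ρ, ζ, ζ̄)` is written as
`(8 R*, 4 S*, 2 T*, A* ± i B*)` in terms of the dual of a real frame `(R, S, T, A, B)`
(`coframeOf`). The structure equations then become the bracket relations `IsNormalFrame`, which are
free of denominators and make sense in any Lie ring that is a module over a commutative ring of
functions acted on by derivations (`IsAnchor`). The existence and uniqueness of normalized coframes
are proved in this algebraic setting and applied to the vector fields over an open set of `M`
(`SmoothField`, `SmoothFun`).

*Normalized coframes.* Put `T = -[A, B]`. In class III₂ the brackets `[A, T]` and `[B, T]` span,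
modulo `T, A, B`, a single direction, so that multiplying `A - i B` by a suitable `1 + i α` makes
`[B, T] ≡ 0` (`exists_adapted`, `lie_rotated`); the remaining rank condition says that `A`, `B`,
`T`, `[A, T]`, `[A, [A, T]]` form a frame (`isInvertible_adapted`). Changing `T`, `[A, T]`,
`[A, [A, T]]` in a triangular way, the relations of a normal frame reduce to two linear equations
for the components `μ`, `ν` of `Λ` along `Re ζ`, `Im ζ`; they have exactly one solution, and the
Jacobi identity accounts for the rest (`exists_isNormalFrame`, `exists_normalFrame`,
`IsNormalFrame.unique`). The relation for `[B, T]` determines `A - i B` up to a real factor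
(`IsNormalFrame.rotation_eq_zero`). Hence normalized coframes exist near each point
(`exists_isNormalizedCoframe`), each of them comes from a normal frame
(`CRStructure.IsNormalizedCoframe.exists_frame`), and two of them differ by a function with values
in `G₅` (`CRStructure.IsNormalizedCoframe.exists_scale`).

*The bundle.* Accordingly `P⁵` consists over `U` of the coframes `a · s(x)`, `a ≠ 0`, for one
normalized coframe `s`, and `(x, a)` are its coordinates (`p5Chart`). The coordinate `a` is the
restriction of a smooth function `ratio s` on the bundle of coframes. This makes `P⁵` a submanifold
with the induced topology, into which a map is smooth if it is smooth into the bundle of coframes,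
and a principal bundle (`IsP5Charted.contMDiffAt_of_incl`, `IsP5Charted.isPrincipalBundle`).

*The connection.* If `l` is a form that belongs to `s` in the structure equations, then
`Λ = π^* l + da / a` satisfies them on `P⁵`: replacing `θ` by `a · θ` changes `Λ` by `da / a`
(`StructEqs.scale`, `localForm`). At each point `Λ` is determined by the equations, because the
coefficient of `σ ∧ ρ` in `dτ` gives `J₁`, the absence of `τ ∧ σ` in `dσ` gives the component of
`Λ` along `τ`, and the other components are then read off from `dτ` (`StructEqs.unique`). So the
local forms agree on overlaps (`IsP5Charted.existsUnique_structureForm`), and the properties of a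
Cartan connection follow from the local expression (`IsP5Charted.isCartanConnection`).

*The model.* The CR-bundle of the model has a polynomial generator `A - i B` for which the frame
`(R, S, T, A, B)` has constant structure coefficients (`IsModelFrame`). If `X` is an infinitesimal
CR-automorphism, `[X, A - i B]` is a multiple of `A - i B`, and the Jacobi identity forces the
factor to be a real constant (`IsModelFrame.symmetry_factor`). A symmetry with the factor zero
commutes with the whole frame and vanishes if it vanishes at the origin
(`IsModelFrame.coeff_const`). Therefore the six polynomial symmetries `modelSymm` exhaust the
algebra (`mem_range_modelSymm`).
-/


open scoped Manifold ContDiff TensorProduct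
open Bundle VectorField TopologicalSpace

/-! ### Normal frames in a Lie algebra over a ring of functions -/

namespace CRThreeTwo

section LieRinehart

variable {𝔽 𝔛 : Type*} [CommRing 𝔽] [LieRing 𝔛] [Module 𝔽 𝔛]

/-- `D` is the action of `𝔛` on the functions `𝔽` by derivations which enters the Leibniz rule of
the bracket. -/
structure IsAnchor (D : 𝔛 → 𝔽 → 𝔽) : Prop where
  lie_smul : ∀ (V : 𝔛) (f : 𝔽) (W : 𝔛), ⁅V, f • W⁆ = f • ⁅V, W⁆ + D V f • W
  map_add : ∀ (V : 𝔛) (f g : 𝔽), D V (f + g) = D V f + D V g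
  map_mul : ∀ (V : 𝔛) (f g : 𝔽), D V (f * g) = f * D V g + g * D V f
  add_left : ∀ (V W : 𝔛) (f : 𝔽), D (V + W) f = D V f + D W f
  smul_left : ∀ (V : 𝔛) (f g : 𝔽), D (f • V) g = f * D V g

variable {D : 𝔛 → 𝔽 → 𝔽}

theorem IsAnchor.smul_lie (hD : IsAnchor D) (V W : 𝔛) (f : 𝔽) :
    ⁅f • V, W⁆ = f • ⁅V, W⁆ - D W f • V := by
  rw [← lie_skew, hD.lie_smul, ← lie_skew W V]
  module

/-- A frame of `𝔛` over `𝔽`: five elements which span `𝔛` and are independent. -/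
structure IsFrame (𝔽 : Type*) {𝔛 : Type*} [CommRing 𝔽] [LieRing 𝔛] [Module 𝔽 𝔛]
    (R S T A B : 𝔛) : Prop where
  span : ∀ V : 𝔛, ∃ r s t a b : 𝔽, V = r • R + s • S + t • T + a • A + b • B
  indep : ∀ r s t a b : 𝔽, r • R + s • S + t • T + a • A + b • B = 0 →
    r = 0 ∧ s = 0 ∧ t = 0 ∧ a = 0 ∧ b = 0

/-- Comparison of coefficients with respect to a frame. -/
theorem IsFrame.coeff_eq {R S T A B : 𝔛} (h : IsFrame 𝔽 R S T A B) {r s t a b r' s' t' a' b' : 𝔽}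
    (e : r • R + s • S + t • T + a • A + b • B = r' • R + s' • S + t' • T + a' • A + b' • B) :
    r = r' ∧ s = s' ∧ t = t' ∧ a = a' ∧ b = b' := by
  obtain ⟨h1, h2, h3, h4, h5⟩ := h.indep (r - r') (s - s') (t - t') (a - a') (b - b')
    (by linear_combination (norm := module) (1 : 𝔽) • e)
  exact ⟨sub_eq_zero.1 h1, sub_eq_zero.1 h2, sub_eq_zero.1 h3, sub_eq_zero.1 h4,
    sub_eq_zero.1 h5⟩

/-- The bracket relations of the real frame `(8 e_τ, 4 e_σ, 2 e_ρ, A, B)`, where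
`(e_τ, e_σ, e_ρ, ½ (A - i B), ½ (A + i B))` is dual to a normalized coframe. The coefficients
`μ, ν` are the components of `Λ` along `Re ζ` and `Im ζ`, and `J₁ = i j`. The factors `8, 4, 2`
make all the coefficients integral. -/
structure IsNormalFrame (R S T A B : 𝔛) (μ ν j : 𝔽) : Prop where
  lie_AB : ⁅A, B⁆ = -T + ν • A - μ • B
  lie_T : ∃ w₁ w₂ : 𝔽, ⁅A, T⁆ = S - (2 * μ) • T + w₁ • A + w₂ • B ∧
    ⁅B, T⁆ = (j - 2 * ν) • T - w₂ • A + w₁ • B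
  lie_S : ∃ r₁ r₂ v₁ v₂ : 𝔽, ⁅A, S⁆ = R - (3 * μ) • S + r₁ • T + v₁ • A + v₂ • B ∧
    ⁅B, S⁆ = (j - 3 * ν) • S + r₂ • T - v₂ • A + v₁ • B
  lie_AR : ∃ t a b : 𝔽, ⁅A, R⁆ = (-4 * μ) • R + t • T + a • A + b • B
  lie_BR : ∃ s t a b : 𝔽, ⁅B, R⁆ = (-(4 * ν + 2 * j)) • R + s • S + t • T + a • A + b • B
  lie_ST : ∃ s t a b : 𝔽, ⁅S, T⁆ = (3 * j) • R + s • S + t • T + a • A + b • B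

/-- A lower triangular change of frame. -/
theorem IsFrame.triangular {R S T A B R' S' T' : 𝔛} (h : IsFrame 𝔽 R S T A B)
    {n m s₀ s₁ s₂ r₀ r₁ r₂ r₃ : 𝔽}
    (hT : T' = T + n • A + m • B) (hS : S' = S + s₀ • T + s₁ • A + s₂ • B)
    (hR : R' = R + r₀ • S + r₁ • T + r₂ • A + r₃ • B) : IsFrame 𝔽 R' S' T' A B where
  span V := by
    obtain ⟨r, s, t, a, b, rfl⟩ := h.span V
    subst hT hS hR
    refine ⟨r, s - r * r₀, t - r * r₁ - (s - r * r₀) * s₀, 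
      a - r * r₂ - (s - r * r₀) * s₁ - (t - r * r₁ - (s - r * r₀) * s₀) * n,
      b - r * r₃ - (s - r * r₀) * s₂ - (t - r * r₁ - (s - r * r₀) * s₀) * m, ?_⟩
    module
  indep r s t a b e := by
    subst hT hS hR
    obtain ⟨rfl, h2, h3, h4, h5⟩ := h.indep r (s + r * r₀) (t + s * s₀ + r * r₁)
      (a + t * n + s * s₁ + r * r₂) (b + t * m + s * s₂ + r * r₃)
      (by linear_combination (norm := module) (1 : 𝔽) • e)
    have hs : s = 0 := by linear_combination h2
    subst hs
    have ht : t = 0 := by linear_combination h3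
    subst ht
    exact ⟨rfl, rfl, rfl, by linear_combination h4, by linear_combination h5⟩

/-- Existence of a normal frame for a given pair `(A, B)`, for which the field `B` is
characteristic for the distribution spanned by `A`, `B` and `[A, B]`. The only coefficients which
have to be solved for are `μ` and `ν`: they are read off from the `R`-components of `[A, R]` and
`[B, R]`, and the Jacobi identity makes the remaining relations hold. -/
theorem exists_isNormalFrame (hD : IsAnchor D) {c : 𝔽} (hc : 10 * c = 1) {A B T₀ S₁ R₁ : 𝔛}
    (hT₀ : ⁅A, B⁆ = -T₀) (hS₁ : ⁅A, T₀⁆ = S₁) (hR₁ : ⁅A, S₁⁆ = R₁)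
    (hfr : IsFrame 𝔽 R₁ S₁ T₀ A B) {β y₁ y₂ : 𝔽} (hB : ⁅B, T₀⁆ = β • T₀ + y₁ • A + y₂ • B) :
    ∃ (R S T : 𝔛) (μ ν j : 𝔽), IsFrame 𝔽 R S T A B ∧ IsNormalFrame R S T A B μ ν j := by
  have hBA : ⁅B, A⁆ = T₀ := by rw [← lie_skew, hT₀, neg_neg]
  have hTA : ⁅T₀, A⁆ = -S₁ := by rw [← lie_skew, hS₁]
  have hSA : ⁅S₁, A⁆ = -R₁ := by rw [← lie_skew, hR₁]
  have hBS₁ : ⁅B, S₁⁆ = β • S₁ + (D A β - y₂) • T₀ + D A y₁ • A + D A y₂ • B := by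
    rw [← hS₁, leibniz_lie, hBA, hB]
    simp only [lie_add, hD.lie_smul A, lie_self, hS₁, hT₀]
    module
  -- the `R₁`-components `κ` of `[A, R₁]` and `o` of `[T₀, S₁]` determine `μ` and `ν`
  obtain ⟨κ, κ₂, κ₃, κ₄, κ₅, hκ⟩ := hfr.span ⁅A, R₁⁆
  obtain ⟨o, o₂, o₃, o₄, o₅, ho⟩ := hfr.span ⁅T₀, S₁⁆
  -- by the Jacobi identity the `R₁`-component of `[B, R₁]` is `o + β`
  have hBR₁ : ∃ s t a b : 𝔽, ⁅B, R₁⁆ = (o + β) • R₁ + s • S₁ + t • T₀ + a • A + b • B := by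
    refine ⟨o₂ + D A β + (D A β - y₂), o₃ + D A (D A β - y₂) - D A y₂,
      o₄ + D A (D A y₁), o₅ + D A (D A y₂), ?_⟩
    rw [← hR₁, leibniz_lie, hBA, ho, hBS₁]
    simp only [lie_add, hD.lie_smul A, lie_self, hR₁, hS₁, hT₀]
    module
  obtain ⟨b₂, b₃, b₄, b₅, hBR₁⟩ := hBR₁
  -- along `R`, `[A, R]` has the component `κ + 6 μ`, which has to be `-4 μ`; that of `[S, T]` is
  -- `-o - ν`, which has to be `3 j = 3 (β + 3 ν)`
  obtain ⟨μ, hμ⟩ : ∃ μ : 𝔽, 10 * μ = -κ := ⟨-κ * c, by linear_combination -κ * hc⟩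
  obtain ⟨ν, hν⟩ : ∃ ν : 𝔽, 10 * ν = -o - 3 * β :=
    ⟨(-o - 3 * β) * c, by linear_combination (-o - 3 * β) * hc⟩
  have hκ' : κ = -10 * μ := by linear_combination hμ
  have ho' : o = -10 * ν - 3 * β := by linear_combination hν
  subst hκ' ho'
  obtain ⟨T, hT⟩ : ∃ T, T = T₀ + ν • A - μ • B := ⟨_, rfl⟩
  have hAT : ⁅A, T⁆ = S₁ + μ • T₀ + D A ν • A - D A μ • B := by
    rw [hT]; simp only [lie_add, lie_sub, hD.lie_smul A, lie_self, hS₁, hT₀]; module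
  have hBT : ⁅B, T⁆ = (β + ν) • T + (y₁ - (β + ν) * ν + D B ν) • A
      + (y₂ + (β + ν) * μ - D B μ) • B := by
    rw [hT]; simp only [lie_add, lie_sub, hD.lie_smul B, lie_self, hB, hBA]; module
  obtain ⟨w₁, hw₁⟩ : ∃ w₁, w₁ = y₂ + (β + ν) * μ - D B μ := ⟨_, rfl⟩
  obtain ⟨w₂, hw₂⟩ : ∃ w₂, w₂ = -(y₁ - (β + ν) * ν + D B ν) := ⟨_, rfl⟩
  obtain ⟨s₁, hs₁⟩ : ∃ s₁, s₁ = D A ν + 2 * μ * ν - w₁ := ⟨_, rfl⟩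
  obtain ⟨s₂, hs₂⟩ : ∃ s₂, s₂ = -D A μ - 2 * μ * μ - w₂ := ⟨_, rfl⟩
  obtain ⟨S, hS⟩ : ∃ S, S = S₁ + (3 * μ) • T₀ + s₁ • A + s₂ • B := ⟨_, rfl⟩
  have hAS : ⁅A, S⁆ = R₁ + (3 * μ) • S₁ + (D A (3 * μ) - s₂) • T₀ + D A s₁ • A + D A s₂ • B := by
    rw [hS]; simp only [lie_add, hD.lie_smul A, lie_self, hR₁, hS₁, hT₀]; module
  have hBS : ∃ r₂ v₁ v₂ : 𝔽, ⁅B, S⁆ = β • S + r₂ • T - v₂ • A + v₁ • B := by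
    obtain ⟨r₂, hr₂⟩ : ∃ r₂, r₂ = D A β - y₂ + D B (3 * μ) + s₁ := ⟨_, rfl⟩
    refine ⟨r₂, D A y₂ + (3 * μ) * y₂ + D B s₂ - β * s₂ + r₂ * μ,
      -(D A y₁ + (3 * μ) * y₁ + D B s₁ - β * s₁ - r₂ * ν), ?_⟩
    rw [hS, hT]; simp only [lie_add, hD.lie_smul B, lie_self, hBS₁, hB, hBA]; subst hr₂; module
  obtain ⟨r₂, v₁, v₂, hBS⟩ := hBS
  obtain ⟨x, hx⟩ : ∃ x, x = D A (3 * μ) - s₂ + 9 * μ * μ := ⟨_, rfl⟩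
  -- the coefficient `r₁` is chosen so that `[A, R]` has no component along `S`
  obtain ⟨r₁, hr₁⟩ : ∃ r₁, r₁ = κ₂ + D A (6 * μ) + x + 24 * μ * μ := ⟨_, rfl⟩
  obtain ⟨R, hR⟩ : ∃ R, R = ⁅A, S⁆ + (3 * μ) • S - r₁ • T - v₁ • A - v₂ • B := ⟨_, rfl⟩
  obtain ⟨e₁, he₁⟩ : ∃ e₁, e₁ = D A s₁ + 3 * μ * s₁ - r₁ * ν - v₁ := ⟨_, rfl⟩
  obtain ⟨e₂, he₂⟩ : ∃ e₂, e₂ = D A s₂ + 3 * μ * s₂ + r₁ * μ - v₂ := ⟨_, rfl⟩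
  have hR' : R = R₁ + (6 * μ) • S₁ + (x - r₁) • T₀ + e₁ • A + e₂ • B := by
    rw [hR, hAS, hS, hT, he₁, he₂, hx]; module
  have hfr' : IsFrame 𝔽 R S T A B :=
    hfr.triangular (n := ν) (m := -μ) (by rw [hT]; module) hS hR'
  have hconv : ∀ r s t a b : 𝔽, ∃ s' t' a' b' : 𝔽,
      r • R₁ + s • S₁ + t • T₀ + a • A + b • B = r • R + s' • S + t' • T + a' • A + b' • B := by
    intro r s t a b
    obtain ⟨s', hs'⟩ : ∃ s', s' = s - 6 * μ * r := ⟨_, rfl⟩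
    obtain ⟨t', ht'⟩ : ∃ t', t' = t - (x - r₁) * r - 3 * μ * s' := ⟨_, rfl⟩
    refine ⟨s', t', a - r * e₁ - s' * s₁ - t' * ν, b - r * e₂ - s' * s₂ + t' * μ, ?_⟩
    rw [hR', hS, hT, ht', hs']; module
  refine ⟨R, S, T, μ, ν, β + 3 * ν, hfr', ⟨?_, ?_, ?_, ?_, ?_, ?_⟩⟩
  · rw [hT₀, hT]; module
  · refine ⟨w₁, w₂, ?_, ?_⟩
    · rw [hAT, hS, hT, hs₁, hs₂]; module
    · rw [hBT, hw₁, hw₂]; module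
  · refine ⟨r₁, r₂, v₁, v₂, ?_, ?_⟩
    · rw [hR]; module
    · rw [hBS]; module
  · have : ∃ t a b : 𝔽, ⁅A, R⁆ = (-4 * μ) • R₁ + (-24 * μ * μ) • S₁ + t • T₀ + a • A + b • B := by
      refine ⟨κ₃ + D A (x - r₁) - e₂, κ₄ + D A e₁, κ₅ + D A e₂, ?_⟩
      rw [hR']; simp only [lie_add, hD.lie_smul A, lie_self, hR₁, hS₁, hT₀, hκ]
      subst hr₁; module
    obtain ⟨t, a, b, h⟩ := this
    refine ⟨t + 4 * μ * (x - r₁), a - (t + 4 * μ * (x - r₁)) * ν + 4 * μ * e₁,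
      b + (t + 4 * μ * (x - r₁)) * μ + 4 * μ * e₂, ?_⟩
    rw [h, hR', hT]; module
  · obtain ⟨s, t, a, b, h⟩ := hconv (-10 * ν - 3 * β + β) (b₂ + D B (6 * μ) + 6 * μ * β)
      (b₃ + 6 * μ * (D A β - y₂) + D B (x - r₁) + (x - r₁) * β + e₁)
      (b₄ + 6 * μ * D A y₁ + (x - r₁) * y₁ + D B e₁)
      (b₅ + 6 * μ * D A y₂ + (x - r₁) * y₂ + D B e₂)
    refine ⟨s, t, a, b, ?_⟩
    rw [show -(4 * ν + 2 * (β + 3 * ν)) = -10 * ν - 3 * β + β by ring, ← h, hR']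
    simp only [lie_add, hD.lie_smul B, lie_self, hBR₁, hBS₁, hB, hBA]
    module
  · have hT₀B : ⁅T₀, B⁆ = -⁅B, T₀⁆ := (lie_skew _ _).symm
    have h1 : ⁅S, T₀⁆ = -⁅T₀, S⁆ := (lie_skew _ _).symm
    have h2 : ⁅S, A⁆ = -⁅A, S⁆ := (lie_skew _ _).symm
    have h3 : ⁅S, B⁆ = -⁅B, S⁆ := (lie_skew _ _).symm
    have h4 : ⁅T₀, S⁆ = (-10 * ν - 3 * β) • R₁ + (o₂ - s₁) • S₁
        + (o₃ + D T₀ (3 * μ) - s₂ * β) • T₀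
        + (o₄ + D T₀ s₁ - s₂ * y₁) • A + (o₅ + D T₀ s₂ - s₂ * y₂) • B := by
      rw [hS]; simp only [lie_add, hD.lie_smul T₀, lie_self, ho, hTA, hT₀B, hB]; module
    have h5 : ∃ s t a b : 𝔽, ⁅S, T⁆ = (3 * (β + 3 * ν)) • R₁ + s • S₁ + t • T₀ + a • A + b • B := by
      have h6 : ⁅S, T⁆ = -⁅T₀, S⁆ - ν • ⁅A, S⁆ + μ • ⁅B, S⁆ + D S ν • A - D S μ • B := by
        rw [hT, lie_sub, lie_add, hD.lie_smul S, hD.lie_smul S, h1, h2, h3]; module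
      obtain ⟨s, t, a, b, h⟩ : ∃ s t a b : 𝔽, ⁅B, S⁆ = (0 : 𝔽) • R₁ + s • S₁ + t • T₀ + a • A + b • B := by
        refine ⟨β, β * (3 * μ) + r₂, β * s₁ + r₂ * ν - v₂, β * s₂ - r₂ * μ + v₁, ?_⟩
        rw [hBS, hS, hT]; module
      refine ⟨-(o₂ - s₁) - ν * (3 * μ) + μ * s,
        -(o₃ + D T₀ (3 * μ) - s₂ * β) - ν * (D A (3 * μ) - s₂) + μ * t,
        -(o₄ + D T₀ s₁ - s₂ * y₁) - ν * D A s₁ + μ * a + D S ν,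
        -(o₅ + D T₀ s₂ - s₂ * y₂) - ν * D A s₂ + μ * b - D S μ, ?_⟩
      rw [h6, h4, hAS, h]; module
    obtain ⟨s, t, a, b, h5⟩ := h5
    obtain ⟨s', t', a', b', h⟩ := hconv (3 * (β + 3 * ν)) s t a b
    exact ⟨s', t', a', b', h5.trans h⟩

/-- For a given pair `(A, B)` the normal frame is unique. -/
theorem IsNormalFrame.unique (hD : IsAnchor D) {c : 𝔽} (hc : 10 * c = 1) {R S T A B R' S' T' : 𝔛}
    {μ ν j μ' ν' j' : 𝔽} (hfr : IsFrame 𝔽 R S T A B)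
    (h : IsNormalFrame R S T A B μ ν j) (h' : IsNormalFrame R' S' T' A B μ' ν' j') :
    R' = R ∧ S' = S ∧ T' = T := by
  obtain ⟨w₁, w₂, hAT, hBT⟩ := h.lie_T
  obtain ⟨w₁', w₂', hAT', hBT'⟩ := h'.lie_T
  obtain ⟨r₁, r₂, v₁, v₂, hAS, hBS⟩ := h.lie_S
  obtain ⟨r₁', r₂', v₁', v₂', hAS', hBS'⟩ := h'.lie_S
  obtain ⟨x₁, x₂, x₃, hAR⟩ := h.lie_AR
  obtain ⟨x₁', x₂', x₃', hAR'⟩ := h'.lie_AR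
  obtain ⟨z₁, z₂, z₃, z₄, hBR⟩ := h.lie_BR
  obtain ⟨z₁', z₂', z₃', z₄', hBR'⟩ := h'.lie_BR
  have hAB := h.lie_AB
  have hBA : ⁅B, A⁆ = T - ν • A + μ • B := by rw [← lie_skew, hAB]; module
  obtain ⟨m, rfl⟩ : ∃ m, μ' = μ + m := ⟨μ' - μ, by ring⟩
  obtain ⟨n, rfl⟩ : ∃ n, ν' = ν + n := ⟨ν' - ν, by ring⟩
  have hT : T' = T + n • A - m • B := by
    have := h'.lie_AB
    rw [hAB] at this
    linear_combination (norm := module) (1 : 𝔽) • this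
  have cancel : ∀ a : 𝔽, 10 * a = 0 → a = 0 := fun a ha => by
    linear_combination c * ha - a * hc
  have e1 : ∃ a b : 𝔽, S' = S + (3 * m) • T + a • A + b • B := by
    refine ⟨w₁ - w₁' + D A n - m * ν + 2 * (μ + m) * n, w₂ - w₂' - D A m + m * μ - 2 * (μ + m) * m, ?_⟩
    have : S' = ⁅A, T'⁆ + (2 * (μ + m)) • T' - w₁' • A - w₂' • B := by rw [hAT']; module
    rw [this, hT]; simp only [lie_add, lie_sub, hD.lie_smul A, lie_self, hAT, hAB]; module
  obtain ⟨a₁, b₁, hS⟩ := e1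
  have e2 : ∃ t a b : 𝔽, R' = R + (6 * m) • S + t • T + a • A + b • B := by
    have : R' = ⁅A, S'⁆ + (3 * (μ + m)) • S' - r₁' • T' - v₁' • A - v₂' • B := by rw [hAS']; module
    refine ⟨r₁ + D A (3 * m) - 3 * m * (2 * μ) - b₁ + 3 * (μ + m) * (3 * m) - r₁',
      v₁ + 3 * m * w₁ + D A a₁ + b₁ * ν + 3 * (μ + m) * a₁ - r₁' * n - v₁',
      v₂ + 3 * m * w₂ + D A b₁ - b₁ * μ + 3 * (μ + m) * b₁ + r₁' * m - v₂', ?_⟩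
    rw [this, hT, hS]; simp only [lie_add, hD.lie_smul A, lie_self, hAS, hAT, hAB]; module
  obtain ⟨t₂, a₂, b₂, hR⟩ := e2
  -- compare the components of `[A, R']` along `R`: the normalization leaves `10 m = 0`
  have hm : m = 0 := by
    rw [hR, hT] at hAR'
    simp only [lie_add, hD.lie_smul A, lie_self, hAR, hAS, hAT, hAB] at hAR'
    refine cancel m ?_
    have := (hfr.indep (10 * m)
      (6 * m * (-3 * μ) + D A (6 * m) + t₂ + 4 * (μ + m) * (6 * m))
      (x₁ + 6 * m * r₁ - t₂ * (2 * μ) + D A t₂ - b₂ + 4 * (μ + m) * t₂ - x₁')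
      (x₂ + 6 * m * v₁ + t₂ * w₁ + D A a₂ + b₂ * ν + 4 * (μ + m) * a₂ - x₁' * n - x₂')
      (x₃ + 6 * m * v₂ + t₂ * w₂ + D A b₂ - b₂ * μ + 4 * (μ + m) * b₂ + x₁' * m - x₃')
      (by linear_combination (norm := module) (1 : 𝔽) • hAR')).1
    exact this
  subst hm
  have D0 : ∀ V : 𝔛, D V 0 • V = 0 := fun V => by
    have := hD.lie_smul V 0 V
    simpa using this.symm
  have hT1 : T' = T + n • A := by rw [hT]; module
  have hj : j' = j + 3 * n := by
    rw [hT1] at hBT'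
    simp only [lie_add, hD.lie_smul B, hBA, hBT] at hBT'
    have := (hfr.coeff_eq (r := 0) (s := 0) (t := j - 2 * ν + n) (a := -w₂ - n * ν + D B n)
      (b := w₁ + n * μ) (r' := 0) (s' := 0) (t' := j' - 2 * (ν + n))
      (a' := (j' - 2 * (ν + n)) * n - w₂') (b' := w₁')
      (by linear_combination (norm := module) (1 : 𝔽) • hBT')).2.2.1
    linear_combination -this
  have hn : n = 0 := by
    rw [hR, hS, hT1] at hBR'
    simp only [lie_add, hD.lie_smul B, hBA, hBT, hBS, hBR, lie_self] at hBR'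
    refine cancel n ?_
    obtain ⟨s, t, a, b, e⟩ : ∃ s t a b : 𝔽, (10 * n) • R + s • S + t • T + a • A + b • B = 0 := by
      subst hj
      refine ⟨z₁ + 6 * 0 * (j - 3 * ν) + D B (6 * 0) + (4 * (ν + n) + 2 * (j + 3 * n)) * (6 * 0) - z₁',
        z₂ + 6 * 0 * r₂ + t₂ * (j - 2 * ν) + D B t₂ + a₂ +
          (4 * (ν + n) + 2 * (j + 3 * n)) * t₂ - z₁' * (3 * 0) - z₂',
        z₃ + 6 * 0 * (-v₂) - t₂ * w₂ - a₂ * ν + D B a₂ +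
          (4 * (ν + n) + 2 * (j + 3 * n)) * a₂ - z₁' * a₁ - z₂' * n - z₃',
        z₄ + 6 * 0 * v₁ + t₂ * w₁ + a₂ * μ + D B b₂ +
          (4 * (ν + n) + 2 * (j + 3 * n)) * b₂ - z₁' * b₁ - z₄', ?_⟩
      linear_combination (norm := module) (1 : 𝔽) • hBR'
    exact (hfr.indep _ _ _ _ _ e).1
  subst hn
  have hT2 : T' = T := by rw [hT1]; module
  rw [hT2] at hAT' hBT' hAS' hBS' hAR' 
  have hj' : j' = j := by rw [hj]; ring
  subst hj'
  simp only [add_zero] at hAT' hBT' hAS' hBS' hAR'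
  obtain ⟨-, -, -, hw₂, hw₁⟩ := hfr.coeff_eq (r := 0) (s := 0) (t := j' - 2 * ν) (a := -w₂) (b := w₁)
    (r' := 0) (s' := 0) (t' := j' - 2 * ν) (a' := -w₂') (b' := w₁')
    (by linear_combination (norm := module) (1 : 𝔽) • hBT' - (1 : 𝔽) • hBT)
  have hw₂ := neg_injective hw₂
  subst hw₁ hw₂
  have hS2 : S' = S := by linear_combination (norm := module) (1 : 𝔽) • hAT - (1 : 𝔽) • hAT'
  rw [hS2] at hAS' hBS'
  obtain ⟨-, -, -, hv₂, hv₁⟩ := hfr.coeff_eq (r := 0) (s := j' - 3 * ν) (t := r₂) (a := -v₂) (b := v₁)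
    (r' := 0) (s' := j' - 3 * ν) (t' := r₂') (a' := -v₂') (b' := v₁')
    (by linear_combination (norm := module) (1 : 𝔽) • hBS' - (1 : 𝔽) • hBS)
  have hv₂ := neg_injective hv₂
  subst hv₁ hv₂
  obtain ⟨d, rfl⟩ : ∃ d, r₁' = r₁ + d := ⟨r₁' - r₁, by ring⟩
  have hR2 : R' = R - d • T := by linear_combination (norm := module) (1 : 𝔽) • hAS - (1 : 𝔽) • hAS'
  have hd : d = 0 := by
    rw [hR2] at hAR'
    simp only [lie_sub, hD.lie_smul A, hAR, hAT] at hAR'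
    obtain ⟨t, a, b, e⟩ : ∃ t a b : 𝔽, (0 : 𝔽) • R + d • S + t • T + a • A + b • B = 0 := by
      refine ⟨-(x₁ + d * (2 * μ) - D A d) - 4 * μ * (-d) + x₁', -(x₂ - d * w₁) + x₂',
        -(x₃ - d * w₂) + x₃', ?_⟩
      linear_combination (norm := module) (-1 : 𝔽) • hAR'
    exact (hfr.indep _ _ _ _ _ e).2.1
  subst hd
  exact ⟨by rw [hR2]; module, hS2, hT2⟩

/-- The complex structure of the plane field spanned by `A` and `B` determines, for a normal frame,
the pair `(A, B)` up to a real factor: if `A - i B` is multiplied by `c + i d`, then `d = 0`. -/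
theorem IsNormalFrame.rotation_eq_zero (hD : IsAnchor D) {R S T A B R' S' T' A' B' : 𝔛}
    {μ ν j μ' ν' j' c d u : 𝔽} (hfr : IsFrame 𝔽 R S T A B)
    (h : IsNormalFrame R S T A B μ ν j) (h' : IsNormalFrame R' S' T' A' B' μ' ν' j')
    (hA : A' = c • A + d • B) (hB : B' = (-d) • A + c • B) (hu : u * (c * c + d * d) = 1) :
    d = 0 := by
  obtain ⟨w₁, w₂, hAT, hBT⟩ := h.lie_T
  obtain ⟨w₁', w₂', hAT', hBT'⟩ := h'.lie_T
  have hAB := h.lie_AB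
  have hBA : ⁅B, A⁆ = T - ν • A + μ • B := by rw [← lie_skew, hAB]; module
  have hAB' : ⁅A', B'⁆ = (-(c * c + d * d)) • T
      + (c * D A (-d) + d * D B (-d) - D B' c + (c * c + d * d) * ν) • A
      + (c * D A c + d * D B c - D B' d - (c * c + d * d) * μ) • B := by
    rw [hA, add_lie, hD.smul_lie, hD.smul_lie]
    simp only [hB, lie_add, hD.lie_smul A, hD.lie_smul B, hAB, hBA, lie_self]
    module
  obtain ⟨n, m, hT⟩ : ∃ n m : 𝔽, T' = (c * c + d * d) • T + n • A + m • B := by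
    refine ⟨ν' * c + μ' * d - (c * D A (-d) + d * D B (-d) - D B' c + (c * c + d * d) * ν),
      ν' * d - μ' * c - (c * D A c + d * D B c - D B' d - (c * c + d * d) * μ), ?_⟩
    have : T' = ν' • A' - μ' • B' - ⁅A', B'⁆ := by rw [h'.lie_AB]; module
    rw [this, hAB', hA, hB]; module
  have e : ⁅B', T'⁆ = (0 : 𝔽) • R + (-d * (c * c + d * d)) • S
      + (d * (c * c + d * d) * (2 * μ) + c * (c * c + d * d) * (j - 2 * ν) - d * D A (c * c + d * d)
        + c * D B (c * c + d * d) + d * m + c * n) • T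
      + (-d * (c * c + d * d) * w₁ - c * (c * c + d * d) * w₂ - d * D A n + c * D B n
        - d * m * ν - c * n * ν - D T' (-d)) • A
      + (-d * (c * c + d * d) * w₂ + c * (c * c + d * d) * w₁ - d * D A m + c * D B m
        + d * m * μ + c * n * μ - D T' c) • B := by
    rw [hB, add_lie, hD.smul_lie, hD.smul_lie]
    simp only [hT, lie_add, hD.lie_smul A, hD.lie_smul B, hAB, hBA, hAT, hBT, lie_self]
    module
  -- `[B', T']` has no component along `S`, which is `-d (c² + d²)` in the frame `(R, S, T, A, B)`
  rw [hBT', hT, hA, hB] at e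
  have e' := (hfr.coeff_eq (r := 0) (s := 0) (t := (j' - 2 * ν') * (c * c + d * d))
    (a := (j' - 2 * ν') * n - w₂' * c - w₁' * d) (b := (j' - 2 * ν') * m - w₂' * d + w₁' * c)
    (Eq.trans (by module) e)).2.1
  linear_combination u * e' - d * hu

/-- Rescaling a normal frame by a unit of the ring of functions. -/
theorem IsNormalFrame.scale (hD : IsAnchor D) {R S T A B : 𝔛} {μ ν j c u : 𝔽}
    (h : IsNormalFrame R S T A B μ ν j) (hu : u * c = 1) :
    IsNormalFrame ((c ^ 4) • R) ((c ^ 3) • S) ((c ^ 2) • T) (c • A) (c • B)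
      (c * μ - D A c) (c * ν - D B c) (c * j) := by
  obtain ⟨w₁, w₂, hAT, hBT⟩ := h.lie_T
  obtain ⟨r₁, r₂, v₁, v₂, hAS, hBS⟩ := h.lie_S
  obtain ⟨x₁, x₂, x₃, hAR⟩ := h.lie_AR
  obtain ⟨z₁, z₂, z₃, z₄, hBR⟩ := h.lie_BR
  obtain ⟨q₁, q₂, q₃, q₄, hST⟩ := h.lie_ST
  have hAB := h.lie_AB
  have D2 : ∀ V : 𝔛, D V (c ^ 2) = 2 * c * D V c := fun V => by
    rw [pow_two, hD.map_mul]; ring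
  have D3 : ∀ V : 𝔛, D V (c ^ 3) = 3 * c ^ 2 * D V c := fun V => by
    rw [pow_succ, hD.map_mul, D2]; ring
  have D4 : ∀ V : 𝔛, D V (c ^ 4) = 4 * c ^ 3 * D V c := fun V => by
    rw [pow_succ, hD.map_mul, D3]; ring
  have hX : ∀ (k : ℕ) (x : 𝔽) (V : 𝔛), x • V = (u ^ k * x) • (c ^ k) • V := fun k x V => by
    rw [smul_smul, mul_right_comm, ← mul_pow, hu, one_pow, one_mul]
  have h1 : ∀ V W : 𝔛, ⁅c • V, W⁆ = c • ⁅V, W⁆ - (u * D W c) • c • V := fun V W => by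
    rw [hD.smul_lie, hX 1 (D W c) V]; module
  refine ⟨?_, ⟨c ^ 2 * w₁ - u * D (c ^ 2 • T) c, c ^ 2 * w₂, ?_, ?_⟩,
    ⟨c ^ 2 * r₁, c ^ 2 * r₂, c ^ 3 * v₁ - u * D (c ^ 3 • S) c, c ^ 3 * v₂, ?_, ?_⟩,
    ⟨c ^ 3 * x₁, c ^ 4 * x₂ - u * D (c ^ 4 • R) c, c ^ 4 * x₃, ?_⟩,
    ⟨c ^ 2 * z₁, c ^ 3 * z₂, c ^ 4 * z₃, c ^ 4 * z₄ - u * D (c ^ 4 • R) c, ?_⟩,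
    ⟨c ^ 2 * q₁ - u ^ 3 * D (c ^ 2 • T) (c ^ 3), c ^ 3 * q₂ + c * D S (c ^ 2), c ^ 4 * q₃,
      c ^ 4 * q₄, ?_⟩⟩
  · rw [hD.smul_lie, hD.lie_smul A, hD.smul_left, hAB]; module
  · rw [h1, hD.lie_smul A, D2, hAT]; module
  · rw [h1, hD.lie_smul B, D2, hBT]; module
  · rw [h1, hD.lie_smul A, D3, hAS]; module
  · rw [h1, hD.lie_smul B, D3, hBS]; module
  · rw [h1, hD.lie_smul A, D4, hAR]; module
  · rw [h1, hD.lie_smul B, D4, hBR]; module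
  · rw [hD.smul_lie, hX 3 (D (c ^ 2 • T) (c ^ 3)) S, hD.lie_smul S, hST]; module

/-! ### The model frame -/

/-- The bracket relations of the left invariant frame of the model. -/
structure IsModelFrame (R S T A B : 𝔛) : Prop where
  lie_AB : ⁅A, B⁆ = -T
  lie_AT : ⁅A, T⁆ = S
  lie_AS : ⁅A, S⁆ = R
  lie_AR : ⁅A, R⁆ = 0
  lie_BT : ⁅B, T⁆ = 0
  lie_BS : ⁅B, S⁆ = 0
  lie_BR : ⁅B, R⁆ = 0
  lie_TS : ⁅T, S⁆ = 0
  lie_TR : ⁅T, R⁆ = 0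
  lie_SR : ⁅S, R⁆ = 0

/-- A field whose bracket with `A - i B` is the multiple of it by `c + i d` satisfies `d = 0`, and
`c` is annihilated by all fields. -/
theorem IsModelFrame.symmetry_factor (hD : IsAnchor D) {q : 𝔽} (hq : 30 * q = 1)
    {R S T A B X : 𝔛} {c d : 𝔽} (hfr : IsFrame 𝔽 R S T A B) (h : IsModelFrame R S T A B)
    (hA : ⁅X, A⁆ = c • A + d • B) (hB : ⁅X, B⁆ = (-d) • A + c • B) :
    d = 0 ∧ ∀ V : 𝔛, D V c = 0 := by
  have hBA : ⁅B, A⁆ = T := by rw [← lie_skew, h.lie_AB, neg_neg]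
  have hTA : ⁅T, A⁆ = -S := by rw [← lie_skew, h.lie_AT]
  have hTB : ⁅T, B⁆ = 0 := by rw [← lie_skew, h.lie_BT, neg_zero]
  have cancel : ∀ a : 𝔽, 30 * a = 0 → a = 0 := fun a ha => by
    linear_combination q * ha - a * hq
  have D0 : ∀ V : 𝔛, D V 0 = 0 := fun V => by
    have := hD.map_add V 0 0
    rw [add_zero] at this
    linear_combination -this
  have Dneg : ∀ (V : 𝔛) (f : 𝔽), D V (-f) = - D V f := fun V f => by
    have := hD.map_add V f (-f)
    rw [add_neg_cancel, D0] at this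
    linear_combination -this
  have D2 : ∀ (V : 𝔛) (f : 𝔽), D V (2 * f) = 2 * D V f := fun V f => by
    rw [two_mul, hD.map_add]; ring
  have D3 : ∀ (V : 𝔛) (f : 𝔽), D V (3 * f) = 3 * D V f := fun V f => by
    rw [show (3 : 𝔽) * f = 2 * f + f by ring, hD.map_add, D2]; ring
  have D4 : ∀ (V : 𝔛) (f : 𝔽), D V (4 * f) = 4 * D V f := fun V f => by
    rw [show (4 : 𝔽) * f = 2 * (2 * f) by ring, D2, D2]; ring
  have hXT : ⁅X, T⁆ = (2 * c) • T + (D B c + D A d) • A + (D B d - D A c) • B := by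
    have : T = -⁅A, B⁆ := by rw [h.lie_AB, neg_neg]
    conv_lhs => rw [this]
    rw [lie_neg, leibniz_lie, hA, hB]
    simp only [lie_add, add_lie, hD.smul_lie, hD.lie_smul, h.lie_AB, lie_self, Dneg]
    module
  -- `0 = [X, [B, T]]` gives `d = 0` along `S` and then `D B c = 0` along `T`
  have e1 : ⁅⁅X, B⁆, T⁆ + ⁅B, ⁅X, T⁆⁆ = 0 := by rw [← leibniz_lie, h.lie_BT, lie_zero]
  rw [hB, hXT] at e1
  simp only [lie_add, add_lie, hD.smul_lie, hD.lie_smul, hBA, lie_self, h.lie_AT, h.lie_BT, D2,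
    Dneg] at e1
  obtain ⟨-, i1, i2, -, i3⟩ := hfr.indep 0 (-d) (2 * D B c + (D B c + D A d))
    (D T d + D B (D B c + D A d)) (-D T c + D B (D B d - D A c))
    (by linear_combination (norm := module) (1 : 𝔽) • e1)
  obtain rfl : d = 0 := neg_eq_zero.1 i1
  refine ⟨rfl, ?_⟩
  simp only [D0] at i2 i3 hXT
  have hBc : D B c = 0 := cancel _ (by linear_combination 10 * i2)
  rw [hBc] at hXT
  have hXS : ⁅X, S⁆ = (3 * c) • S + (3 * D A c) • T + (-D T c) • A + (-D A (D A c)) • B := by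
    conv_lhs => rw [← h.lie_AT]
    rw [leibniz_lie, hA, hXT]
    simp only [lie_add, add_lie, hD.smul_lie, hD.lie_smul, h.lie_AB, lie_self, h.lie_AT, D0, D2,
      h.lie_BT, zero_sub, Dneg, zero_add]
    module
  have hXR : ⁅X, R⁆ = (4 * c) • R + (6 * D A c) • S + (4 * D A (D A c)) • T
      + (-D S c - D A (D T c)) • A + (-D A (D A (D A c))) • B := by
    conv_lhs => rw [← h.lie_AS]
    rw [leibniz_lie, hA, hXS]
    simp only [lie_add, add_lie, hD.smul_lie, hD.lie_smul, h.lie_AB, lie_self, h.lie_AT, h.lie_AS, 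
      D0, D3, h.lie_BS, Dneg]
    module
  -- `0 = [X, [A, R]]` gives `D A c = 0` along `R`
  have e2 : ⁅⁅X, A⁆, R⁆ + ⁅A, ⁅X, R⁆⁆ = 0 := by rw [← leibniz_lie, h.lie_AR, lie_zero]
  rw [hA, hXR] at e2
  simp only [lie_add, add_lie, hD.smul_lie, hD.lie_smul, lie_self, h.lie_AT, h.lie_AS, h.lie_AR,
    h.lie_BR, h.lie_AB, D4, D0] at e2
  have hAc : D A c = 0 := by
    refine cancel _ ?_
    have := (hfr.indep (10 * D A c) (D A (6 * D A c) + 4 * D A (D A c))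
      (4 * D A (D A (D A c)) + D A (D A (D A c)))
      (-D R c + D A (-D S c - D A (D T c))) (D A (-D A (D A (D A c))))
      (by linear_combination (norm := module) (1 : 𝔽) • e2)).1
    linear_combination 3 * this
  have hTc : D T c = 0 := by
    rw [hAc, sub_zero, D0] at i3
    linear_combination -i3
  simp only [hAc, hTc, D0, mul_zero, neg_zero, zero_smul, add_zero, sub_zero] at hXS hXR
  -- `0 = [X, [B, S]]` and `0 = [X, [B, R]]` give the two remaining derivatives
  have hSc : D S c = 0 := by
    have e : ⁅⁅X, B⁆, S⁆ + ⁅B, ⁅X, S⁆⁆ = 0 := by rw [← leibniz_lie, h.lie_BS, lie_zero]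
    rw [hB, hXS] at e
    simp only [add_lie, hD.smul_lie, hD.lie_smul, h.lie_BS, D3, hBc, h.lie_AS, neg_zero, D0] at e
    have := (hfr.indep 0 0 0 0 (-D S c)
      (by linear_combination (norm := module) (1 : 𝔽) • e)).2.2.2.2
    linear_combination -this
  have hRc : D R c = 0 := by
    have e : ⁅⁅X, B⁆, R⁆ + ⁅B, ⁅X, R⁆⁆ = 0 := by rw [← leibniz_lie, h.lie_BR, lie_zero]
    rw [hB, hXR] at e
    simp only [add_lie, hD.smul_lie, hD.lie_smul, h.lie_BR, D4, hBc, neg_zero, hSc, lie_add,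
      zero_smul, zero_lie, lie_zero] at e
    have := (hfr.indep 0 0 0 0 (-D R c)
      (by linear_combination (norm := module) (1 : 𝔽) • e)).2.2.2.2
    linear_combination -this
  intro V
  obtain ⟨r, s, t, a, b, rfl⟩ := hfr.span V
  simp only [hD.add_left, hD.smul_left, hAc, hBc, hTc, hSc, hRc, mul_zero, add_zero]

/-- The coefficients of a field commuting with `A` and `B` are constant, one after the other, as
soon as the preceding ones vanish. -/
theorem IsModelFrame.coeff_const (hD : IsAnchor D)
    {R S T A B : 𝔛} {r s t a b : 𝔽} (hfr : IsFrame 𝔽 R S T A B) (h : IsModelFrame R S T A B)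
    (hA : ⁅A, r • R + s • S + t • T + a • A + b • B⁆ = 0)
    (hB : ⁅B, r • R + s • S + t • T + a • A + b • B⁆ = 0) :
    (∀ V : 𝔛, D V a = 0 ∧ D V b = 0) ∧ (a = 0 → b = 0 → ∀ V : 𝔛, D V t = 0) ∧
    (a = 0 → b = 0 → t = 0 → ∀ V : 𝔛, D V s = 0) ∧
    (a = 0 → b = 0 → t = 0 → s = 0 → ∀ V : 𝔛, D V r = 0) := by
  obtain ⟨Y, hY⟩ : ∃ Y, Y = r • R + s • S + t • T + a • A + b • B := ⟨_, rfl⟩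
  rw [← hY] at hA hB
  -- the fields that commute with `Y` form a Lie algebra, so `Y` commutes with the whole frame
  have jac : ∀ V W : 𝔛, ⁅V, Y⁆ = 0 → ⁅W, Y⁆ = 0 → ⁅⁅V, W⁆, Y⁆ = 0 := fun V W hV hW => by
    rw [lie_lie, hV, hW, lie_zero, lie_zero, sub_zero]
  have hT : ⁅T, Y⁆ = 0 := by
    have := jac A B hA hB
    rw [h.lie_AB, neg_lie] at this
    exact neg_eq_zero.1 this
  have hS : ⁅S, Y⁆ = 0 := by rw [← h.lie_AT]; exact jac A T hA hT
  have hR : ⁅R, Y⁆ = 0 := by rw [← h.lie_AS]; exact jac A S hA hS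
  have hBA : ⁅B, A⁆ = T := by rw [← lie_skew, h.lie_AB, neg_neg]
  have hTA : ⁅T, A⁆ = -S := by rw [← lie_skew, h.lie_AT]
  have hTB : ⁅T, B⁆ = 0 := by rw [← lie_skew, h.lie_BT, neg_zero]
  have hSA : ⁅S, A⁆ = -R := by rw [← lie_skew, h.lie_AS]
  have hSB : ⁅S, B⁆ = 0 := by rw [← lie_skew, h.lie_BS, neg_zero]
  have hST : ⁅S, T⁆ = 0 := by rw [← lie_skew, h.lie_TS, neg_zero]
  have hRA : ⁅R, A⁆ = 0 := by rw [← lie_skew, h.lie_AR, neg_zero]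
  have hRB : ⁅R, B⁆ = 0 := by rw [← lie_skew, h.lie_BR, neg_zero]
  have hRT : ⁅R, T⁆ = 0 := by rw [← lie_skew, h.lie_TR, neg_zero]
  have hRS : ⁅R, S⁆ = 0 := by rw [← lie_skew, h.lie_SR, neg_zero]
  rw [hY] at hA hB hT hS hR
  simp only [lie_add, hD.lie_smul, lie_self, h.lie_AB, h.lie_AT, h.lie_AS, h.lie_AR, hBA, h.lie_BT,
    h.lie_BS, h.lie_BR, hTA, hTB, h.lie_TS, h.lie_TR, hSA, hSB, hST, h.lie_SR, hRA, hRB, hRT, hRS]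
    at hA hB hT hS hR
  obtain ⟨a1, a2, a3, a4, a5⟩ := hfr.indep (D A r + s) (D A s + t) (D A t - b) (D A a) (D A b)
    (by linear_combination (norm := module) (1 : 𝔽) • hA)
  obtain ⟨b1, b2, b3, b4, b5⟩ := hfr.indep (D B r) (D B s) (D B t + a) (D B a) (D B b)
    (by linear_combination (norm := module) (1 : 𝔽) • hB)
  obtain ⟨t1, t2, t3, t4, t5⟩ := hfr.indep (D T r) (D T s - a) (D T t) (D T a) (D T b)
    (by linear_combination (norm := module) (1 : 𝔽) • hT)
  obtain ⟨s1, s2, s3, s4, s5⟩ := hfr.indep (D S r - a) (D S s) (D S t) (D S a) (D S b)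
    (by linear_combination (norm := module) (1 : 𝔽) • hS)
  obtain ⟨r1, r2, r3, r4, r5⟩ := hfr.indep (D R r) (D R s) (D R t) (D R a) (D R b)
    (by linear_combination (norm := module) (1 : 𝔽) • hR)
  have key : ∀ f : 𝔽, D R f = 0 → D S f = 0 → D T f = 0 → D A f = 0 → D B f = 0 → ∀ V, D V f = 0 := by
    intro f h1 h2 h3 h4 h5 V
    obtain ⟨r, s, t, a, b, rfl⟩ := hfr.span V
    simp only [hD.add_left, hD.smul_left, h1, h2, h3, h4, h5, mul_zero, add_zero]
  refine ⟨fun V => ⟨key a r4 s4 t4 a4 b4 V, key b r5 s5 t5 a5 b5 V⟩, ?_, ?_, ?_⟩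
  · rintro rfl rfl
    exact key t r3 s3 t3 (by simpa using a3) (by simpa using b3)
  · rintro rfl rfl rfl
    exact key s r2 s2 (by simpa using t2) (by simpa using a2) b2
  · rintro rfl rfl rfl rfl
    exact key r r1 (by simpa using s1) t1 (by simpa using a1) b1

end LieRinehart

end CRThreeTwo

namespace CRThreeTwo

/-! ### One-forms and the exterior derivative -/

noncomputable section

section Forms
variable {F : Type*} [NormedAddCommGroup F] [NormedSpace ℝ F]
  {X : Type*} [TopologicalSpace X] [ChartedSpace F X] [IsManifold 𝓘(ℝ, F) ∞ X]
  {W : Type*} [NormedAddCommGroup W] [NormedSpace ℝ W]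

theorem two_le_infty : (2 : WithTop ℕ∞) ≤ ∞ :=
  show ((2 : ℕ∞) : WithTop ℕ∞) ≤ _ from WithTop.coe_le_coe.2 le_top

/-- Smoothness of a one-form at a point. -/
def SmoothFormAt (η : ∀ x : X, TangentSpace 𝓘(ℝ, F) x →L[ℝ] W) (x₀ : X) : Prop :=
  ContMDiffAt 𝓘(ℝ, F) (𝓘(ℝ, F).prod 𝓘(ℝ, F →L[ℝ] W)) ∞
    (fun x => (⟨x, η x⟩ : TotalSpace (F →L[ℝ] W)
      (fun x : X => TangentSpace 𝓘(ℝ, F) x →L[ℝ] Bundle.Trivial X W x))) x₀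

theorem smoothFormOn_iff {η : ∀ x : X, TangentSpace 𝓘(ℝ, F) x →L[ℝ] W} {U : Set X}
    (hU : IsOpen U) : SmoothFormOn η U ↔ ∀ x ∈ U, SmoothFormAt η x :=
  ⟨fun h x hx => (h x hx).contMDiffAt (hU.mem_nhds hx), fun h x hx => (h x hx).contMDiffWithinAt⟩

/-- The expression of the value of a form at `x` in the chart at `x₀`. -/
def coordForm (η : ∀ x : X, TangentSpace 𝓘(ℝ, F) x →L[ℝ] W) (x₀ x : X) : F →L[ℝ] W :=
  (η x).comp ((trivializationAt F (TangentSpace 𝓘(ℝ, F)) x₀).symmL ℝ x)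

/-- The coordinate expression of a linear map into a trivial bundle: only the source is changed. -/
theorem inCoordinates_trivial {x₀ x y₀ y : X}
    (f : TangentSpace 𝓘(ℝ, F) x →L[ℝ] Bundle.Trivial X W y) :
    ContinuousLinearMap.inCoordinates F (TangentSpace 𝓘(ℝ, F)) W (Bundle.Trivial X W) x₀ x y₀ y f =
      ContinuousLinearMap.comp (f : TangentSpace 𝓘(ℝ, F) x →L[ℝ] W)
        ((trivializationAt F (TangentSpace 𝓘(ℝ, F)) x₀).symmL ℝ x) := by
  ext v
  simp [ContinuousLinearMap.inCoordinates]

theorem smoothFormAt_iff {η : ∀ x : X, TangentSpace 𝓘(ℝ, F) x →L[ℝ] W} {x₀ : X} :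
    SmoothFormAt η x₀ ↔ ContMDiffAt 𝓘(ℝ, F) 𝓘(ℝ, F →L[ℝ] W) ∞ (coordForm η x₀) x₀ := by
  unfold SmoothFormAt
  rw [contMDiffAt_hom_bundle]
  simp only [inCoordinates_trivial]
  exact ⟨fun h => h.2, fun h => ⟨contMDiffAt_id, h⟩⟩

theorem formInChart_eq {η : ∀ x : X, TangentSpace 𝓘(ℝ, F) x →L[ℝ] W} {x₀ : X} {y : F}
    (hy : y ∈ (extChartAt 𝓘(ℝ, F) x₀).target) :
    formInChart η x₀ y = coordForm η x₀ ((extChartAt 𝓘(ℝ, F) x₀).symm y) := by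
  unfold formInChart coordForm
  have h := (extChartAt 𝓘(ℝ, F) x₀).map_target hy
  rw [extChartAt_source] at h
  rw [TangentBundle.symmL_trivializationAt h, (extChartAt 𝓘(ℝ, F) x₀).right_inv hy]
  simp only [modelWithCornersSelf_coe, Set.range_id, mfderivWithin_univ]

theorem SmoothFormAt.contDiffAt_formInChart {η : ∀ x : X, TangentSpace 𝓘(ℝ, F) x →L[ℝ] W} {x₀ : X}
    (h : SmoothFormAt η x₀) :
    ContDiffAt ℝ ∞ (formInChart η x₀) (extChartAt 𝓘(ℝ, F) x₀ x₀) := by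
  rw [smoothFormAt_iff] at h
  have h1 : ContMDiffAt 𝓘(ℝ, F) 𝓘(ℝ, F →L[ℝ] W) ∞
      (coordForm η x₀ ∘ (extChartAt 𝓘(ℝ, F) x₀).symm) (extChartAt 𝓘(ℝ, F) x₀ x₀) := by
    refine ContMDiffAt.comp (I' := 𝓘(ℝ, F)) _ ?_ ?_
    · rwa [(extChartAt 𝓘(ℝ, F) x₀).left_inv (mem_extChartAt_source x₀)]
    · have := contMDiffWithinAt_extChartAt_symm_range (I := 𝓘(ℝ, F)) (n := ∞) x₀
        (mem_extChartAt_target x₀)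
      rwa [modelWithCornersSelf_coe, Set.range_id, contMDiffWithinAt_univ] at this
  refine h1.contDiffAt.congr_of_eventuallyEq ?_
  filter_upwards [extChartAt_target_mem_nhds (I := 𝓘(ℝ, F)) x₀] with y hy
  exact formInChart_eq hy

theorem extD_apply (η : ∀ x : X, TangentSpace 𝓘(ℝ, F) x →L[ℝ] W) (x : X)
    (v w : TangentSpace 𝓘(ℝ, F) x) :
    extD η x v w = fderiv ℝ (formInChart η x) (extChartAt 𝓘(ℝ, F) x x) (v : F) (w : F) -
      fderiv ℝ (formInChart η x) (extChartAt 𝓘(ℝ, F) x x) (w : F) (v : F) := by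
  unfold extD
  rw [mfderiv_extChartAt_self]
  rfl

theorem formInChart_congr {η η' : ∀ x : X, TangentSpace 𝓘(ℝ, F) x →L[ℝ] W} {x : X}
    (h : ∀ᶠ y in nhds x, η y = η' y) :
    formInChart η x =ᶠ[nhds (extChartAt 𝓘(ℝ, F) x x)] formInChart η' x := by
  have h1 : Filter.Tendsto (extChartAt 𝓘(ℝ, F) x).symm (nhds (extChartAt 𝓘(ℝ, F) x x)) (nhds x) := by
    have := continuousAt_extChartAt_symm (I := 𝓘(ℝ, F)) x
    rwa [ContinuousAt, (extChartAt 𝓘(ℝ, F) x).left_inv (mem_extChartAt_source x)] at this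
  filter_upwards [h1 h] with y hy
  unfold formInChart
  rw [hy]

/-- The exterior derivative computed from any expression of the form near the base point of the chart. -/
theorem hasFDerivAt_extD {η : ∀ x : X, TangentSpace 𝓘(ℝ, F) x →L[ℝ] W} {x : X}
    {f : F → F →L[ℝ] W} {f' : F →L[ℝ] F →L[ℝ] W}
    (h : HasFDerivAt f f' (extChartAt 𝓘(ℝ, F) x x))
    (e : formInChart η x =ᶠ[nhds (extChartAt 𝓘(ℝ, F) x x)] f) (v w : TangentSpace 𝓘(ℝ, F) x) :
    extD η x v w = f' (show F from v) (show F from w) - f' (show F from w) (show F from v) := by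
  rw [extD_apply, e.fderiv_eq, h.fderiv]

theorem extD_congr {η η' : ∀ x : X, TangentSpace 𝓘(ℝ, F) x →L[ℝ] W} {x : X}
    (h : ∀ᶠ y in nhds x, η y = η' y) (v w : TangentSpace 𝓘(ℝ, F) x) :
    extD η x v w = extD η' x v w := by
  rw [extD_apply, extD_apply, (formInChart_congr h).fderiv_eq]

theorem SmoothFormAt.hasFDerivAt {η : ∀ x : X, TangentSpace 𝓘(ℝ, F) x →L[ℝ] W} {x : X}
    (h : SmoothFormAt η x) : HasFDerivAt (formInChart η x)
      (fderiv ℝ (formInChart η x) (extChartAt 𝓘(ℝ, F) x x)) (extChartAt 𝓘(ℝ, F) x x) :=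
  (h.contDiffAt_formInChart.differentiableAt (by simp)).hasFDerivAt

theorem extD_add {η η' : ∀ x : X, TangentSpace 𝓘(ℝ, F) x →L[ℝ] W} {x : X}
    (h : SmoothFormAt η x) (h' : SmoothFormAt η' x) (v w : TangentSpace 𝓘(ℝ, F) x) :
    extD (fun y => η y + η' y) x v w = extD η x v w + extD η' x v w := by
  rw [hasFDerivAt_extD (h.hasFDerivAt.add h'.hasFDerivAt) (Filter.Eventually.of_forall fun y => rfl),
    extD_apply, extD_apply]
  exact add_sub_add_comm _ _ _ _

theorem formInChart_self (η : ∀ x : X, TangentSpace 𝓘(ℝ, F) x →L[ℝ] W) (x : X) :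
    formInChart η x (extChartAt 𝓘(ℝ, F) x x) = (show F →L[ℝ] W from η x) := by
  unfold formInChart
  have := mfderivWithin_range_extChartAt_symm (I := 𝓘(ℝ, F)) (x := x)
  rw [modelWithCornersSelf_coe, Set.range_id, mfderivWithin_univ] at this
  rw [this]
  ext v
  change η _ v = η x v
  rw [extChartAt_to_inv]
  
theorem _root_.MDifferentiableAt.hasFDerivAt_chart {g : X → W} {x : X}
    (hg : MDifferentiableAt 𝓘(ℝ, F) 𝓘(ℝ, W) g x) :
    HasFDerivAt (g ∘ (extChartAt 𝓘(ℝ, F) x).symm)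
      (show F →L[ℝ] W from mvfderiv 𝓘(ℝ, F) g x) (extChartAt 𝓘(ℝ, F) x x) := by
  have := hg.hasMFDerivAt.2
  simp only [writtenInExtChartAt, extChartAt_model_space_eq_id, PartialEquiv.refl_coe,
    modelWithCornersSelf_coe, Set.range_id] at this
  exact hasFDerivWithinAt_univ.1 this

/-- Product rule for a form composed with a family of linear maps. -/
theorem extD_clm_comp {W' : Type*} [NormedAddCommGroup W'] [NormedSpace ℝ W']
    {η : ∀ x : X, TangentSpace 𝓘(ℝ, F) x →L[ℝ] W} {G : X → W →L[ℝ] W'} {x : X}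
    (h : SmoothFormAt η x) (hG : ContMDiffAt 𝓘(ℝ, F) 𝓘(ℝ, W →L[ℝ] W') ∞ G x)
    (v w : TangentSpace 𝓘(ℝ, F) x) :
    extD (fun y => (G y).comp (η y)) x v w = G x (extD η x v w)
      + mvfderiv 𝓘(ℝ, F) G x v (η x w) - mvfderiv 𝓘(ℝ, F) G x w (η x v) := by
  have hG' := hG.mdifferentiableAt (by simp) |>.hasFDerivAt_chart
  rw [hasFDerivAt_extD (hG'.clm_comp h.hasFDerivAt) (Filter.Eventually.of_forall fun y => rfl),
    formInChart_self, extD_apply, map_sub]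
  simp only [Function.comp_apply, extChartAt_to_inv]
  change G x _ + mvfderiv 𝓘(ℝ, F) G x v (η x w) - (G x _ + mvfderiv 𝓘(ℝ, F) G x w (η x v)) = _
  have key : ∀ a b c d : W', a + b - (c + d) = a - c + b - d := fun a b c d => by abel
  exact key _ _ _ _

theorem coordForm_mvfderiv (g : X → W) (x₀ x : X) :
    coordForm (mvfderiv 𝓘(ℝ, F) g) x₀ x =
      inTangentCoordinates 𝓘(ℝ, F) 𝓘(ℝ, W) id g (fun x => mfderiv 𝓘(ℝ, F) 𝓘(ℝ, W) g x) x₀ x := by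
  unfold coordForm inTangentCoordinates ContinuousLinearMap.inCoordinates
  rw [TangentBundle.continuousLinearMapAt_model_space]
  rfl

theorem smoothFormAt_mvfderiv {g : X → W} {x : X} (hg : ContMDiffAt 𝓘(ℝ, F) 𝓘(ℝ, W) ∞ g x) :
    SmoothFormAt (mvfderiv 𝓘(ℝ, F) g) x := by
  rw [smoothFormAt_iff]
  have := hg.mfderiv_const (m := ∞) (by simp)
  refine this.congr_of_eventuallyEq (Filter.Eventually.of_forall fun y => coordForm_mvfderiv g x y)

section Pullback

variable {F' : Type*} [NormedAddCommGroup F'] [NormedSpace ℝ F']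
  {Y : Type*} [TopologicalSpace Y] [ChartedSpace F' Y] [IsManifold 𝓘(ℝ, F') ∞ Y]

/-- The pullback of a one-form. -/
def pullbackForm (φ : X → Y) (η : ∀ y : Y, TangentSpace 𝓘(ℝ, F') y →L[ℝ] W) (x : X) :
    TangentSpace 𝓘(ℝ, F) x →L[ℝ] W :=
  (η (φ x)).comp (mfderiv 𝓘(ℝ, F) 𝓘(ℝ, F') φ x)

theorem smoothFormAt_pullbackForm {φ : X → Y} {η : ∀ y : Y, TangentSpace 𝓘(ℝ, F') y →L[ℝ] W}
    {x : X} (hφ : ContMDiffAt 𝓘(ℝ, F) 𝓘(ℝ, F') ∞ φ x) (hη : SmoothFormAt η (φ x)) :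
    SmoothFormAt (pullbackForm (F := F) (F' := F') φ η) x := by
  rw [smoothFormAt_iff] at hη ⊢
  have h1 := ContMDiffAt.mfderiv_const (I := 𝓘(ℝ, F)) (I' := 𝓘(ℝ, F')) (m := ∞) hφ (by simp)
  have hc : ContMDiffAt 𝓘(ℝ, F) 𝓘(ℝ, F' →L[ℝ] W) ∞ (coordForm η (φ x) ∘ φ) x := hη.comp x hφ
  have h2 := hc.clm_comp h1
  refine h2.congr_of_eventuallyEq ?_
  have h3 : ∀ᶠ y in nhds x, φ y ∈ (chartAt F' (φ x)).source :=
    hφ.continuousAt.eventually_mem ((chartAt F' (φ x)).open_source.mem_nhds (mem_chart_source _ _))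
  filter_upwards [h3] with y hy
  have hy' : φ y ∈ (trivializationAt F' (TangentSpace 𝓘(ℝ, F')) (φ x)).baseSet := by
    simpa using hy
  unfold coordForm inTangentCoordinates ContinuousLinearMap.inCoordinates pullbackForm
  ext v
  change η (φ y) (mfderiv 𝓘(ℝ, F) 𝓘(ℝ, F') φ y _) = η (φ y) (_ ) 
  congr 1
  exact ((trivializationAt F' (TangentSpace 𝓘(ℝ, F')) (φ x)).symmL_continuousLinearMapAt hy' _).symm

/-- The exterior derivative commutes with pullbacks: in charts the second derivatives of `φ` cancel by
their symmetry. This holds although `extD` is defined by the preferred chart at each point. -/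
theorem extD_pullbackForm {φ : X → Y} {η : ∀ y : Y, TangentSpace 𝓘(ℝ, F') y →L[ℝ] W}
    {x : X} (hφ : ContMDiffAt 𝓘(ℝ, F) 𝓘(ℝ, F') ∞ φ x) (hη : SmoothFormAt η (φ x))
    (v w : TangentSpace 𝓘(ℝ, F) x) :
    extD (pullbackForm (F := F) (F' := F') φ η) x v w =
      extD η (φ x) (mfderiv 𝓘(ℝ, F) 𝓘(ℝ, F') φ x v) (mfderiv 𝓘(ℝ, F) 𝓘(ℝ, F') φ x w) := by
  obtain ⟨f, hf⟩ : ∃ f : F → F', f = extChartAt 𝓘(ℝ, F') (φ x) ∘ φ ∘ (extChartAt 𝓘(ℝ, F) x).symm :=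
    ⟨_, rfl⟩
  have hfx : f (extChartAt 𝓘(ℝ, F) x x) = extChartAt 𝓘(ℝ, F') (φ x) (φ x) := by
    rw [hf]; simp only [Function.comp_apply, extChartAt_to_inv]
  have hsymm : ContMDiffAt 𝓘(ℝ, F) 𝓘(ℝ, F) ∞ (extChartAt 𝓘(ℝ, F) x).symm
      (extChartAt 𝓘(ℝ, F) x x) := by
    have := contMDiffWithinAt_extChartAt_symm_range (I := 𝓘(ℝ, F)) (n := ∞) x
        (mem_extChartAt_target x)
    rwa [modelWithCornersSelf_coe, Set.range_id, contMDiffWithinAt_univ] at this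
  have hf1 : ContDiffAt ℝ ∞ f (extChartAt 𝓘(ℝ, F) x x) := by
    rw [← contMDiffAt_iff_contDiffAt, hf]
    refine ContMDiffAt.comp (I' := 𝓘(ℝ, F')) _ ?_ (ContMDiffAt.comp (I' := 𝓘(ℝ, F)) _ ?_ hsymm)
    · simp only [Function.comp_apply, extChartAt_to_inv]
      exact contMDiffAt_extChartAt
    · rwa [extChartAt_to_inv]
  have hev : ∀ᶠ y in nhds (extChartAt 𝓘(ℝ, F) x x),
      φ ((extChartAt 𝓘(ℝ, F) x).symm y) ∈ (extChartAt 𝓘(ℝ, F') (φ x)).source := by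
    have h3 : ∀ᶠ y in nhds x, φ y ∈ (extChartAt 𝓘(ℝ, F') (φ x)).source :=
      hφ.continuousAt.eventually_mem (extChartAt_source_mem_nhds (I := 𝓘(ℝ, F')) _)
    have h4 : Filter.Tendsto (extChartAt 𝓘(ℝ, F) x).symm (nhds (extChartAt 𝓘(ℝ, F) x x)) (nhds x) := by
      have := hsymm.continuousAt
      rwa [ContinuousAt, extChartAt_to_inv] at this
    exact h4 h3
  have hφ' : ∀ᶠ y in nhds (extChartAt 𝓘(ℝ, F) x x), MDifferentiableAt 𝓘(ℝ, F) 𝓘(ℝ, F') φ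
      ((extChartAt 𝓘(ℝ, F) x).symm y) := by
    have h4 : Filter.Tendsto (extChartAt 𝓘(ℝ, F) x).symm (nhds (extChartAt 𝓘(ℝ, F) x x)) (nhds x) := by
      have := hsymm.continuousAt
      rwa [ContinuousAt, extChartAt_to_inv] at this
    have h5 := (contMDiffAt_iff_contMDiffAt_nhds (n := 1) (by simp)).1
      (hφ.of_le (m := 1) (by exact_mod_cast le_top))
    filter_upwards [h4 h5] with y hy using hy.mdifferentiableAt one_ne_zero
  have hf2 : ∀ᶠ y in nhds (extChartAt 𝓘(ℝ, F) x x), DifferentiableAt ℝ f y := by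
    have := (hf1.of_le (m := 1) (by exact_mod_cast le_top)).eventually (by simp)
    filter_upwards [this] with y hy using hy.differentiableAt one_ne_zero
  have key : formInChart (pullbackForm (F := F) (F' := F') φ η) x =ᶠ[nhds (extChartAt 𝓘(ℝ, F) x x)]
      fun y => (formInChart η (φ x) (f y)).comp (fderiv ℝ f y) := by
    filter_upwards [hev.eventually_nhds, hφ', hf2, extChartAt_target_mem_nhds (I := 𝓘(ℝ, F)) x]
      with y hy hφy hfy hyt
    have e1 : φ ∘ (extChartAt 𝓘(ℝ, F) x).symm =ᶠ[nhds y]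
        (extChartAt 𝓘(ℝ, F') (φ x)).symm ∘ f := by
      filter_upwards [hy] with z hz
      rw [hf]
      exact ((extChartAt 𝓘(ℝ, F') (φ x)).left_inv hz).symm
    have d1 : MDifferentiableAt 𝓘(ℝ, F) 𝓘(ℝ, F) (extChartAt 𝓘(ℝ, F) x).symm y := by
      have := mdifferentiableWithinAt_extChartAt_symm hyt
      rwa [modelWithCornersSelf_coe, Set.range_id, mdifferentiableWithinAt_univ] at this
    have hfy' : f y ∈ (extChartAt 𝓘(ℝ, F') (φ x)).target := by
      rw [hf]; exact (extChartAt 𝓘(ℝ, F') (φ x)).map_source hy.self_of_nhds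
    have d2 : MDifferentiableAt 𝓘(ℝ, F') 𝓘(ℝ, F') (extChartAt 𝓘(ℝ, F') (φ x)).symm (f y) := by
      have := mdifferentiableWithinAt_extChartAt_symm hfy'
      rwa [modelWithCornersSelf_coe, Set.range_id, mdifferentiableWithinAt_univ] at this
    have e2 := e1.mfderiv_eq (I := 𝓘(ℝ, F)) (I' := 𝓘(ℝ, F'))
    rw [mfderiv_comp (I' := 𝓘(ℝ, F)) y hφy d1,
      mfderiv_comp (I' := 𝓘(ℝ, F')) y d2 hfy.mdifferentiableAt, mfderiv_eq_fderiv] at e2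
    have e3 := e1.self_of_nhds
    simp only [Function.comp_apply] at e3
    unfold formInChart pullbackForm
    ext v
    have e4 := congrArg (fun A => (A : F →L[ℝ] F') v) e2
    have aux : ∀ (p q : Y) (a b : F'), p = q → a = b →
        (show F' →L[ℝ] W from η p) a = (show F' →L[ℝ] W from η q) b := by
      rintro p q a b rfl rfl; rfl
    exact aux _ _ _ _ e3 e4
  have hη' : HasFDerivAt (formInChart η (φ x))
      (fderiv ℝ (formInChart η (φ x)) (extChartAt 𝓘(ℝ, F') (φ x) (φ x)))
      (f (extChartAt 𝓘(ℝ, F) x x)) := by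
    rw [hfx]; exact hη.hasFDerivAt
  have hd := (hη'.comp _ (hf1.differentiableAt (by simp)).hasFDerivAt).clm_comp
      ((hf1.fderiv_right (m := 1) (by rw [one_add_one_eq_two]; exact two_le_infty)).differentiableAt one_ne_zero).hasFDerivAt
  have hsy : IsSymmSndFDerivAt ℝ f (extChartAt 𝓘(ℝ, F) x x) :=
    hf1.isSymmSndFDerivAt (by rw [minSmoothness_of_isRCLikeNormedField]; exact two_le_infty)
  have hm : fderiv ℝ f (extChartAt 𝓘(ℝ, F) x x) =
      (mfderiv 𝓘(ℝ, F) 𝓘(ℝ, F') φ x : F →L[ℝ] F') := by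
    have := (hφ.mdifferentiableAt (by simp)).hasMFDerivAt.2
    simp only [writtenInExtChartAt, modelWithCornersSelf_coe, Set.range_id] at this
    subst hf
    have h8 : HasFDerivAt (extChartAt 𝓘(ℝ, F') (φ x) ∘ φ ∘ (extChartAt 𝓘(ℝ, F) x).symm)
        (mfderiv 𝓘(ℝ, F) 𝓘(ℝ, F') φ x : F →L[ℝ] F') (extChartAt 𝓘(ℝ, F) x x) :=
      hasFDerivWithinAt_univ.1 this
    exact HasFDerivAt.fderiv (E := F) (F := F') h8
  rw [hasFDerivAt_extD hd key, extD_apply]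
  have aux : ∀ (a : F' →L[ℝ] W) (b : F →L[ℝ] F →L[ℝ] F') (c : F →L[ℝ] F')
      (d : F' →L[ℝ] F' →L[ℝ] W) (v w : F), b v w = b w v →
      ((ContinuousLinearMap.compL ℝ F F' W) a ∘SL b +
        (ContinuousLinearMap.compL ℝ F F' W).flip c ∘SL d ∘SL c) v w -
      ((ContinuousLinearMap.compL ℝ F F' W) a ∘SL b +
        (ContinuousLinearMap.compL ℝ F F' W).flip c ∘SL d ∘SL c) w v =
      d (c v) (c w) - d (c w) (c v) := by
    intro a b c d v w h
    simp only [_root_.add_apply, ContinuousLinearMap.comp_apply, ContinuousLinearMap.compL_apply,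
      ContinuousLinearMap.flip_apply, h, add_sub_add_left_eq_sub]
  have e : ∀ u : TangentSpace 𝓘(ℝ, F) x, mfderiv 𝓘(ℝ, F) 𝓘(ℝ, F') φ x u =
      fderiv ℝ f (extChartAt 𝓘(ℝ, F) x x) (u : F) := fun u => by rw [hm]; rfl
  rw [e, e]
  exact aux _ _ _ _ _ _ (hsy (v : F) (w : F))

end Pullback

/-- The second derivative of a function is symmetric, that is, `d d g = 0`. -/
theorem extD_mvfderiv {g : X → W} {x : X} (hg : ContMDiffAt 𝓘(ℝ, F) 𝓘(ℝ, W) ∞ g x)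
    (v w : TangentSpace 𝓘(ℝ, F) x) : extD (mvfderiv 𝓘(ℝ, F) g) x v w = 0 := by
  obtain ⟨η, hη⟩ : ∃ η : ∀ y : W, TangentSpace 𝓘(ℝ, W) y →L[ℝ] W,
      η = fun y => ContinuousLinearMap.id ℝ W := ⟨_, rfl⟩
  have h1 : formInChart η (g x) = fun _ => ContinuousLinearMap.id ℝ W := by
    funext y
    unfold formInChart
    rw [hη]
    change (ContinuousLinearMap.id ℝ W).comp (mfderiv 𝓘(ℝ, W) 𝓘(ℝ, W) id y) = _
    rw [mfderiv_id]; rfl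
  have h2 : SmoothFormAt η (g x) := by
    rw [smoothFormAt_iff]
    have : coordForm η (g x) = fun _ => ContinuousLinearMap.id ℝ W := by
      funext y
      unfold coordForm
      rw [hη, TangentBundle.symmL_model_space]; rfl
    rw [this]; exact contMDiffAt_const
  have h3 : mvfderiv 𝓘(ℝ, F) g = pullbackForm g η := by
    subst hη; rfl
  rw [h3, extD_pullbackForm hg h2, hasFDerivAt_extD (hasFDerivAt_const _ _) (by rw [h1])]
  exact sub_self (0 : W)

end Forms


/-! ### Vector fields -/

section Fields
variable {F : Type*} [NormedAddCommGroup F] [NormedSpace ℝ F]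
  {X : Type*} [TopologicalSpace X] [ChartedSpace F X] [IsManifold 𝓘(ℝ, F) ∞ X]
  {W : Type*} [NormedAddCommGroup W] [NormedSpace ℝ W]

theorem isManifold_minSmoothness_three : IsManifold 𝓘(ℝ, F) (minSmoothness ℝ 3) X := by
  rw [minSmoothness_of_isRCLikeNormedField]
  exact IsManifold.of_le (n := ∞)
    (show ((3 : ℕ∞) : WithTop ℕ∞) ≤ _ from WithTop.coe_le_coe.2 le_top)

/-- Smoothness of a vector field at a point. -/
def SmoothFieldAt (V : ∀ x : X, TangentSpace 𝓘(ℝ, F) x) (x₀ : X) : Prop :=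
  ContMDiffAt 𝓘(ℝ, F) 𝓘(ℝ, F).tangent ∞ (fun x => (⟨x, V x⟩ : TangentBundle 𝓘(ℝ, F) X)) x₀

/-- The expression of a vector field in the preferred chart at `x`. -/
def fieldInChart (V : ∀ x : X, TangentSpace 𝓘(ℝ, F) x) (x : X) (y : F) : F :=
  mpullback 𝓘(ℝ, F) 𝓘(ℝ, F) (extChartAt 𝓘(ℝ, F) x).symm V y

theorem SmoothFieldAt.contDiffAt_fieldInChart [CompleteSpace F]
    {V : ∀ x : X, TangentSpace 𝓘(ℝ, F) x} {x : X} (h : SmoothFieldAt V x) :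
    ContDiffAt ℝ ∞ (fieldInChart V x) (extChartAt 𝓘(ℝ, F) x x) := by
  have h1 := contMDiffWithinAt_mpullbackWithin_extChartAt_symm (n := ∞) (m := ∞)
    (contMDiffWithinAt_univ.2 h) uniqueMDiffOn_univ (Set.mem_univ x) (by simp)
  rw [modelWithCornersSelf_coe, Set.range_id, mpullbackWithin_univ, Set.preimage_univ,
    Set.inter_univ] at h1
  have h2 := h1.contMDiffAt (extChartAt_target_mem_nhds (I := 𝓘(ℝ, F)) x)
  exact (contMDiffAt_vectorSpace_iff_contDiffAt (V := fieldInChart V x)).1 h2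

theorem formInChart_fieldInChart {η : ∀ x : X, TangentSpace 𝓘(ℝ, F) x →L[ℝ] W}
    {V : ∀ x : X, TangentSpace 𝓘(ℝ, F) x} {x : X} {y : F}
    (hy : y ∈ (extChartAt 𝓘(ℝ, F) x).target) :
    formInChart η x y (fieldInChart V x y) =
      η ((extChartAt 𝓘(ℝ, F) x).symm y) (V ((extChartAt 𝓘(ℝ, F) x).symm y)) := by
  have h := isInvertible_mfderivWithin_extChartAt_symm (I := 𝓘(ℝ, F)) (x := x) hy
  rw [modelWithCornersSelf_coe, Set.range_id, mfderivWithin_univ] at h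
  unfold formInChart fieldInChart mpullback
  change η _ (mfderiv 𝓘(ℝ, F) 𝓘(ℝ, F) (extChartAt 𝓘(ℝ, F) x).symm y
    ((mfderiv 𝓘(ℝ, F) 𝓘(ℝ, F) (extChartAt 𝓘(ℝ, F) x).symm y).inverse _)) = _
  rw [h.self_apply_inverse]

theorem fieldInChart_self (V : ∀ x : X, TangentSpace 𝓘(ℝ, F) x) (x : X) :
    fieldInChart V x (extChartAt 𝓘(ℝ, F) x x) = (V x : F) := by
  have := mfderivWithin_range_extChartAt_symm (I := 𝓘(ℝ, F)) (x := x)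
  rw [modelWithCornersSelf_coe, Set.range_id, mfderivWithin_univ] at this
  unfold fieldInChart mpullback
  rw [this]
  have h2 : ∀ v : F, (ContinuousLinearMap.id ℝ F).inverse v = v := fun v => by
    rw [ContinuousLinearMap.inverse_id]; rfl
  have h3 := extChartAt_to_inv (I := 𝓘(ℝ, F)) x
  refine (h2 _).trans ?_
  rw [h3]

theorem mlieBracket_eq_inChart (V V' : ∀ x : X, TangentSpace 𝓘(ℝ, F) x) (x : X) :
    mlieBracket 𝓘(ℝ, F) V V' x =
      lieBracket ℝ (fieldInChart V x) (fieldInChart V' x) (extChartAt 𝓘(ℝ, F) x x) := by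
  rw [← mlieBracketWithin_univ, mlieBracketWithin_apply, mfderiv_extChartAt_self]
  simp only [modelWithCornersSelf_coe, Set.range_id, mpullbackWithin_univ, Set.preimage_univ,
    Set.inter_univ]
  have h2 : ∀ v : F, (ContinuousLinearMap.id ℝ F).inverse v = v := fun v => by
    rw [ContinuousLinearMap.inverse_id]; rfl
  refine (h2 _).trans ?_
  exact congrFun (lieBracketWithin_univ (V := fieldInChart V x) (W := fieldInChart V' x)) _

theorem SmoothFormAt.apply {η : ∀ x : X, TangentSpace 𝓘(ℝ, F) x →L[ℝ] W}
    {V : ∀ x : X, TangentSpace 𝓘(ℝ, F) x} {x : X} (hη : SmoothFormAt η x)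
    (hV : SmoothFieldAt V x) : ContMDiffAt 𝓘(ℝ, F) 𝓘(ℝ, W) ∞ (fun y => η y (V y)) x := by
  have := ContMDiffAt.clm_bundle_apply (F₁ := F) (F₂ := W) (E₁ := TangentSpace 𝓘(ℝ, F))
    (E₂ := Bundle.Trivial X W) (b := id) (ϕ := η) (v := V) hη hV
  rw [contMDiffAt_totalSpace] at this
  exact this.2

/-- Cartan's formula for the exterior derivative of a one-form. -/
theorem extD_cartan [CompleteSpace F] {η : ∀ x : X, TangentSpace 𝓘(ℝ, F) x →L[ℝ] W}
    {V V' : ∀ x : X, TangentSpace 𝓘(ℝ, F) x} {x : X} (hη : SmoothFormAt η x)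
    (hV : SmoothFieldAt V x) (hV' : SmoothFieldAt V' x) :
    extD η x (V x) (V' x) = mvfderiv 𝓘(ℝ, F) (fun y => η y (V' y)) x (V x)
      - mvfderiv 𝓘(ℝ, F) (fun y => η y (V y)) x (V' x)
      - η x (mlieBracket 𝓘(ℝ, F) V V' x) := by
  have key : ∀ {U : ∀ x : X, TangentSpace 𝓘(ℝ, F) x}, SmoothFieldAt U x → ∀ w : F,
      mvfderiv 𝓘(ℝ, F) (fun y => η y (U y)) x w =
      formInChart η x (extChartAt 𝓘(ℝ, F) x x)
        (fderiv ℝ (fieldInChart U x) (extChartAt 𝓘(ℝ, F) x x) w) +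
      fderiv ℝ (formInChart η x) (extChartAt 𝓘(ℝ, F) x x) w (U x : F) := by
    intro U hU w
    have h1 := ((hη.apply hU).mdifferentiableAt (by simp)).hasFDerivAt_chart
    have h2 := hη.hasFDerivAt.clm_apply
      (hU.contDiffAt_fieldInChart.differentiableAt (by simp)).hasFDerivAt
    have h3 := h1.unique (h2.congr_of_eventuallyEq ?_)
    · have h4 := congrArg (fun A : F →L[ℝ] W => A w) h3
      refine Eq.trans h4 ?_
      rw [fieldInChart_self]; rfl
    · filter_upwards [extChartAt_target_mem_nhds (I := 𝓘(ℝ, F)) x] with y hy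
      exact (formInChart_fieldInChart hy).symm
  have k1 : mvfderiv 𝓘(ℝ, F) (fun y => η y (V' y)) x (V x) = _ := key hV' _
  have k2 : mvfderiv 𝓘(ℝ, F) (fun y => η y (V y)) x (V' x) = _ := key hV _
  rw [mlieBracket_eq_inChart, extD_apply, k1, k2]
  simp only [lieBracket, fieldInChart_self, formInChart_self]
  have h5 : ∀ a b : F, η x (a - b) = η x a - η x b := fun a b => map_sub (η x) a b
  refine Eq.trans ?_ (congrArg _ (h5 _ _).symm)
  generalize fderiv ℝ (fieldInChart V' x) (extChartAt 𝓘(ℝ, F) x x) = p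
  generalize fderiv ℝ (fieldInChart V x) (extChartAt 𝓘(ℝ, F) x x) = q
  have h6 : ∀ a b c d : W, a - b = c + a - (d + b) - (c - d) := fun a b c d => by abel
  exact h6 _ _ _ _

theorem SmoothFormAt.clm_comp {W' : Type*} [NormedAddCommGroup W'] [NormedSpace ℝ W']
    {η : ∀ x : X, TangentSpace 𝓘(ℝ, F) x →L[ℝ] W} {G : X → W →L[ℝ] W'} {x : X}
    (hG : ContMDiffAt 𝓘(ℝ, F) 𝓘(ℝ, W →L[ℝ] W') ∞ G x) (h : SmoothFormAt η x) :
    SmoothFormAt (fun y => (G y).comp (η y)) x := by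
  rw [smoothFormAt_iff] at h ⊢
  exact hG.clm_comp h

theorem SmoothFormAt.add {η η' : ∀ x : X, TangentSpace 𝓘(ℝ, F) x →L[ℝ] W} {x : X}
    (h : SmoothFormAt η x) (h' : SmoothFormAt η' x) : SmoothFormAt (fun y => η y + η' y) x := by
  rw [smoothFormAt_iff] at h h' ⊢
  exact ContMDiffAt.add h h'

theorem SmoothFormAt.congr {η η' : ∀ x : X, TangentSpace 𝓘(ℝ, F) x →L[ℝ] W} {x : X}
    (h : SmoothFormAt η x) (e : ∀ᶠ y in nhds x, η' y = η y) : SmoothFormAt η' x := by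
  refine ContMDiffAt.congr_of_eventuallyEq h ?_
  filter_upwards [e] with y hy
  rw [hy]

theorem SmoothFieldAt.congr {V V' : ∀ x : X, TangentSpace 𝓘(ℝ, F) x} {x : X}
    (h : SmoothFieldAt V x) (e : ∀ᶠ y in nhds x, V' y = V y) : SmoothFieldAt V' x := by
  refine ContMDiffAt.congr_of_eventuallyEq h ?_
  filter_upwards [e] with y hy
  rw [hy]

theorem SmoothFieldAt.add {V V' : ∀ x : X, TangentSpace 𝓘(ℝ, F) x} {x : X}
    (h : SmoothFieldAt V x) (h' : SmoothFieldAt V' x) : SmoothFieldAt (fun y => V y + V' y) x :=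
  ContMDiffAt.add_section h h'

theorem SmoothFieldAt.smul {V : ∀ x : X, TangentSpace 𝓘(ℝ, F) x} {x : X} {f : X → ℝ}
    (hf : ContMDiffAt 𝓘(ℝ, F) 𝓘(ℝ, ℝ) ∞ f x) (h : SmoothFieldAt V x) :
    SmoothFieldAt (fun y => f y • V y) x :=
  ContMDiffAt.smul_section hf h

theorem SmoothFieldAt.mlieBracket [CompleteSpace F] {V V' : ∀ x : X, TangentSpace 𝓘(ℝ, F) x} {x : X}
    (h : SmoothFieldAt V x) (h' : SmoothFieldAt V' x) :
    SmoothFieldAt (mlieBracket 𝓘(ℝ, F) V V') x :=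
  haveI : IsManifold 𝓘(ℝ, F) (minSmoothness ℝ 3) X := isManifold_minSmoothness_three
  haveI : IsManifold 𝓘(ℝ, F) ((∞ : WithTop ℕ∞) + 1) X := by
    rw [show (∞ : WithTop ℕ∞) + 1 = ∞ from rfl]; infer_instance
  ContMDiffAt.mlieBracket_vectorField (n := ⊤) (m := ⊤) h h' (by simp)

theorem SmoothFieldAt.eventually {V : ∀ x : X, TangentSpace 𝓘(ℝ, F) x} {x : X}
    (h : SmoothFieldAt V x) :
    ContMDiffAt 𝓘(ℝ, F) 𝓘(ℝ, F) ∞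
      (fun y => (trivializationAt F (TangentSpace 𝓘(ℝ, F)) x ⟨y, V y⟩).2) x :=
  ((contMDiffAt_totalSpace).1 h).2

/-! ### Frames and dual coframes -/

section Frames
variable {ι : Type*} [Fintype ι]

/-- The linear map with the members of a family of vector fields at `y` as columns. -/
def frameMap (V : ι → ∀ x : X, TangentSpace 𝓘(ℝ, F) x) (y : X) :
    (ι → ℝ) →L[ℝ] TangentSpace 𝓘(ℝ, F) y :=
  ∑ i, (ContinuousLinearMap.proj (R := ℝ) (φ := fun _ : ι => ℝ) i).smulRight (V i y)

theorem frameMap_apply (V : ι → ∀ x : X, TangentSpace 𝓘(ℝ, F) x) (y : X) (c : ι → ℝ) :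
    frameMap V y c = ∑ i, c i • V i y := by
  simp [frameMap]

/-- The coframe dual to a family of vector fields; it is only meaningful where the family is a
frame. -/
def dualForm (V : ι → ∀ x : X, TangentSpace 𝓘(ℝ, F) x) (y : X) :
    TangentSpace 𝓘(ℝ, F) y →L[ℝ] (ι → ℝ) :=
  (frameMap V y).inverse

/-- A frame in the coordinates of the trivialization at `x`. -/
def coordFrame (V : ι → ∀ x : X, TangentSpace 𝓘(ℝ, F) x) (x y : X) : (ι → ℝ) →L[ℝ] F :=
  ((trivializationAt F (TangentSpace 𝓘(ℝ, F)) x).continuousLinearMapAt ℝ y).comp (frameMap V y)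

theorem contMDiffAt_coordFrame {V : ι → ∀ x : X, TangentSpace 𝓘(ℝ, F) x} {x : X}
    (h : ∀ i, SmoothFieldAt (V i) x) :
    ContMDiffAt 𝓘(ℝ, F) 𝓘(ℝ, (ι → ℝ) →L[ℝ] F) ∞ (coordFrame V x) x := by
  have h1 : ∀ i, ContMDiffAt 𝓘(ℝ, F) 𝓘(ℝ, (ι → ℝ) →L[ℝ] F) ∞
      (fun y => (ContinuousLinearMap.smulRightL ℝ (ι → ℝ) F
        (ContinuousLinearMap.proj (R := ℝ) (φ := fun _ : ι => ℝ) i))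
        (trivializationAt F (TangentSpace 𝓘(ℝ, F)) x ⟨y, V i y⟩).2) x := fun i =>
    contMDiffAt_const.clm_apply (h i).eventually
  have h2 := ContMDiffAt.sum (t := Finset.univ) (fun i _ => h1 i)
  refine h2.congr_of_eventuallyEq ?_
  have h3 : ∀ᶠ y in nhds x, y ∈ (trivializationAt F (TangentSpace 𝓘(ℝ, F)) x).baseSet :=
    (trivializationAt F (TangentSpace 𝓘(ℝ, F)) x).open_baseSet.mem_nhds
      (FiberBundle.mem_baseSet_trivializationAt' x)
  filter_upwards [h3] with y hy
  ext c
  simp only [coordFrame, ContinuousLinearMap.comp_apply, frameMap_apply, map_sum, map_smul]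
  simp only [sum_apply]
  refine Finset.sum_congr rfl fun i _ => ?_
  rw [Trivialization.continuousLinearMapAt_apply, Trivialization.linearMapAt_apply, if_pos hy]
  rfl

theorem coordFrame_eq {V : ι → ∀ x : X, TangentSpace 𝓘(ℝ, F) x} {x y : X}
    (hy : y ∈ (trivializationAt F (TangentSpace 𝓘(ℝ, F)) x).baseSet) :
    coordFrame V x y = (((trivializationAt F (TangentSpace 𝓘(ℝ, F)) x).continuousLinearEquivAt ℝ y
      hy : TangentSpace 𝓘(ℝ, F) y ≃L[ℝ] F) : TangentSpace 𝓘(ℝ, F) y →L[ℝ] F).comp (frameMap V y) := by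
  unfold coordFrame
  rw [Trivialization.coe_continuousLinearEquivAt_eq']

theorem isInvertible_coordFrame_iff {V : ι → ∀ x : X, TangentSpace 𝓘(ℝ, F) x} {x y : X}
    (hy : y ∈ (trivializationAt F (TangentSpace 𝓘(ℝ, F)) x).baseSet) :
    (coordFrame V x y).IsInvertible ↔ (frameMap V y).IsInvertible := by
  rw [coordFrame_eq hy, ContinuousLinearMap.isInvertible_equiv_comp]

theorem coordForm_dualForm {V : ι → ∀ x : X, TangentSpace 𝓘(ℝ, F) x} {x y : X}
    (hy : y ∈ (trivializationAt F (TangentSpace 𝓘(ℝ, F)) x).baseSet) :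
    coordForm (dualForm V) x y = (coordFrame V x y).inverse := by
  rw [coordFrame_eq hy, ContinuousLinearMap.inverse_equiv_comp,
    Trivialization.symm_continuousLinearEquivAt_eq']
  rfl

theorem eventually_isInvertible_frameMap [CompleteSpace F] {V : ι → ∀ x : X, TangentSpace 𝓘(ℝ, F) x} {x : X}
    (h : ∀ i, SmoothFieldAt (V i) x) (hx : (frameMap V x).IsInvertible) :
    ∀ᶠ y in nhds x, (frameMap V y).IsInvertible := by
  have h3 : ∀ᶠ y in nhds x, y ∈ (trivializationAt F (TangentSpace 𝓘(ℝ, F)) x).baseSet :=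
    (trivializationAt F (TangentSpace 𝓘(ℝ, F)) x).open_baseSet.mem_nhds
      (FiberBundle.mem_baseSet_trivializationAt' x)
  obtain ⟨e, he⟩ := (isInvertible_coordFrame_iff h3.self_of_nhds).2 hx
  have h4 := (contMDiffAt_coordFrame h).continuousAt (ContinuousLinearEquiv.nhds e |> fun h => he ▸ h)
  filter_upwards [h3, h4] with y hy hy'
  exact (isInvertible_coordFrame_iff hy).1 hy'

theorem smoothFormAt_dualForm [CompleteSpace F] {V : ι → ∀ x : X, TangentSpace 𝓘(ℝ, F) x} {x : X}
    (h : ∀ i, SmoothFieldAt (V i) x) (hx : (frameMap V x).IsInvertible) :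
    SmoothFormAt (dualForm V) x := by
  have h3 : ∀ᶠ y in nhds x, y ∈ (trivializationAt F (TangentSpace 𝓘(ℝ, F)) x).baseSet :=
    (trivializationAt F (TangentSpace 𝓘(ℝ, F)) x).open_baseSet.mem_nhds
      (FiberBundle.mem_baseSet_trivializationAt' x)
  obtain ⟨e, he⟩ := (isInvertible_coordFrame_iff h3.self_of_nhds).2 hx
  rw [smoothFormAt_iff]
  have h4 : ContDiffAt ℝ ∞ ContinuousLinearMap.inverse (coordFrame V x x) := by
    rw [← he]; exact contDiffAt_map_inverse e
  have h5 := h4.contMDiffAt.comp x (contMDiffAt_coordFrame h)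
  refine h5.congr_of_eventuallyEq ?_
  filter_upwards [h3] with y hy
  exact coordForm_dualForm hy

end Frames
end Fields

/-! ### The Lie ring of smooth vector fields over an open set -/

section LieRingOfFields
variable {F : Type*} [NormedAddCommGroup F] [NormedSpace ℝ F]
  {X : Type*} [TopologicalSpace X] [ChartedSpace F X]

open Classical in
/-- Extension by zero of a function on an open set. -/
def extF {U : Opens X} (f : U → ℝ) (x : X) : ℝ := if h : x ∈ U then f ⟨x, h⟩ else 0

open Classical in
/-- Extension by zero of a vector field on an open set. -/
def extV {U : Opens X} (V : ∀ x : U, TangentSpace 𝓘(ℝ, F) (x : X)) (x : X) :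
    TangentSpace 𝓘(ℝ, F) x := if h : x ∈ U then V ⟨x, h⟩ else 0

variable {U : Opens X}

@[simp] theorem extF_coe (f : U → ℝ) (x : U) : extF f x = f x := dif_pos x.2

@[simp] theorem extV_coe (V : ∀ x : U, TangentSpace 𝓘(ℝ, F) (x : X)) (x : U) :
    extV V x = V x := dif_pos x.2

theorem eventually_coe {p : X → Prop} (x : U) (h : ∀ y : U, p y) : ∀ᶠ y in nhds (x : X), p y :=
  Filter.mem_of_superset (U.isOpen.mem_nhds x.2) fun y hy => h ⟨y, hy⟩

variable [IsManifold 𝓘(ℝ, F) ∞ X]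

variable (U) in
/-- The ring of smooth functions on the open set `U`. -/
def SmoothFun : Subalgebra ℝ (U → ℝ) where
  carrier := {f | ∀ x : U, ContMDiffAt 𝓘(ℝ, F) 𝓘(ℝ, ℝ) ∞ (extF f) x}
  mul_mem' {f g} hf hg x := ((hf x).mul (hg x)).congr_of_eventuallyEq
    (eventually_coe x fun y => by simp)
  add_mem' {f g} hf hg x := ((hf x).add (hg x)).congr_of_eventuallyEq
    (eventually_coe x fun y => by simp)
  algebraMap_mem' r x := (contMDiffAt_const (c := r)).congr_of_eventuallyEq
    (eventually_coe x fun y => by simp)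

variable (U) in
/-- The module of smooth vector fields on the open set `U`. -/
def SmoothField : Submodule (SmoothFun (F := F) U) (∀ x : U, TangentSpace 𝓘(ℝ, F) (x : X)) where
  carrier := {V | ∀ x : U, SmoothFieldAt (extV V) (x : X)}
  add_mem' {V W} hV hW x := ((hV x).add (hW x)).congr (eventually_coe x fun y => by simp)
  zero_mem' x := by
    refine SmoothFieldAt.congr (V := fun _ => 0) ?_ (eventually_coe x fun y => by simp)
    exact contMDiff_zeroSection ℝ (TangentSpace 𝓘(ℝ, F)) (x : X)
  smul_mem' f V hV x := (SmoothFieldAt.smul (f.2 x) (hV x)).congr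
    (eventually_coe x fun y => by simp; rfl)

instance instCommRingSmoothFun : CommRing (SmoothFun (F := F) U) := Subalgebra.toCommRing _

instance instAddCommGroupSmoothField : AddCommGroup (SmoothField (F := F) U) :=
  Submodule.addCommGroup _

/-- The module structure over the commutative ring of smooth functions, stated with the instances
through which the lemmas on normal frames are applied. -/
instance instModuleSmoothField : @Module (SmoothFun (F := F) U) (SmoothField (F := F) U)
    instCommRingSmoothFun.toCommSemiring.toSemiring instAddCommGroupSmoothField.toAddCommMonoid :=
  Submodule.module _

instance : SMul (SmoothFun (F := F) U) (SmoothField (F := F) U) :=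
  instModuleSmoothField.toDistribMulAction.toMulAction.toSMul

instance : Neg (SmoothFun (F := F) U) := instCommRingSmoothFun.toRing.toNeg

instance : Neg (SmoothField (F := F) U) :=
  instAddCommGroupSmoothField.toAddGroup.toSubNegMonoid.toNeg

variable [CompleteSpace F]

theorem mlieBracket_congr {V V' W W' : ∀ x : X, TangentSpace 𝓘(ℝ, F) x} (x : U)
    (hV : ∀ y : U, V y = V' y) (hW : ∀ y : U, W y = W' y) :
    mlieBracket 𝓘(ℝ, F) V W x = mlieBracket 𝓘(ℝ, F) V' W' x :=
  Filter.EventuallyEq.mlieBracket_vectorField_eq (eventually_coe x hV) (eventually_coe x hW)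

theorem mvfderiv_congr {f g : X → ℝ} (x : U) (h : ∀ y : U, f y = g y) :
    mvfderiv 𝓘(ℝ, F) f x = mvfderiv 𝓘(ℝ, F) g (x : X) := by
  have h1 : f =ᶠ[nhds (x : X)] g := eventually_coe x h
  unfold mvfderiv
  rw [h1.mfderiv_eq]
  rfl

namespace SmoothField

instance : Bracket (SmoothField (F := F) U) (SmoothField (F := F) U) where
  bracket V W := ⟨fun x => mlieBracket 𝓘(ℝ, F) (extV V.1) (extV W.1) x, fun x =>
    ((V.2 x).mlieBracket (W.2 x)).congr (eventually_coe x fun y => by simp)⟩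

theorem bracket_apply (V W : SmoothField (F := F) U) (x : U) :
    ⁅V, W⁆.1 x = mlieBracket 𝓘(ℝ, F) (extV V.1) (extV W.1) x := rfl

theorem mdiff (V : SmoothField (F := F) U) (x : U) : MDifferentiableAt 𝓘(ℝ, F) 𝓘(ℝ, F).tangent
    (fun x => (⟨x, extV V.1 x⟩ : TangentBundle 𝓘(ℝ, F) X)) (x : X) :=
  (V.2 x).mdifferentiableAt (by simp)

instance : LieRing (SmoothField (F := F) U) where
  add_lie V V' W := by
    ext x
    have : IsManifold 𝓘(ℝ, F) (minSmoothness ℝ 3) X := isManifold_minSmoothness_three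
    refine (mlieBracket_congr (V' := extV V.1 + extV V'.1) (W' := extV W.1) x
      (fun y => by simp) fun y => rfl).trans ?_
    exact mlieBracket_add_left (mdiff V x) (mdiff V' x)
  lie_add V W W' := by
    ext x
    have : IsManifold 𝓘(ℝ, F) (minSmoothness ℝ 3) X := isManifold_minSmoothness_three
    refine (mlieBracket_congr (V' := extV V.1) (W' := extV W.1 + extV W'.1) x
      (fun y => rfl) fun y => by simp).trans ?_
    exact mlieBracket_add_right (mdiff W x) (mdiff W' x)
  lie_self V := by
    ext x
    rw [bracket_apply, mlieBracket_self]; rfl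
  leibniz_lie V W Y := by
    ext x
    have : IsManifold 𝓘(ℝ, F) (minSmoothness ℝ 3) X := isManifold_minSmoothness_three
    have hs : ∀ V : SmoothField (F := F) U, ContMDiffAt 𝓘(ℝ, F) 𝓘(ℝ, F).tangent (minSmoothness ℝ 2)
        (fun x => (⟨x, extV V.1 x⟩ : TangentBundle 𝓘(ℝ, F) X)) (x : X) := fun V => by
      rw [minSmoothness_of_isRCLikeNormedField]
      exact (V.2 x).of_le two_le_infty
    have h := leibniz_identity_mlieBracket_apply (hs V) (hs W) (hs Y)
    have e : ∀ P Q R : SmoothField (F := F) U, ⁅P, ⁅Q, R⁆⁆.1 x = mlieBracket 𝓘(ℝ, F) (extV P.1)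
        (mlieBracket 𝓘(ℝ, F) (extV Q.1) (extV R.1)) x := fun P Q R =>
      mlieBracket_congr x (fun y => rfl) fun y => by simp [bracket_apply]
    have e' : ∀ P Q R : SmoothField (F := F) U, ⁅⁅P, Q⁆, R⁆.1 x = mlieBracket 𝓘(ℝ, F)
        (mlieBracket 𝓘(ℝ, F) (extV P.1) (extV Q.1)) (extV R.1) x := fun P Q R =>
      mlieBracket_congr x (fun y => by simp [bracket_apply]) fun y => rfl
    change ⁅V, ⁅W, Y⁆⁆.1 x = ⁅⁅V, W⁆, Y⁆.1 x + ⁅W, ⁅V, Y⁆⁆.1 x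
    rw [e, e, e', h]

/-- The derivative of a smooth function along a smooth vector field. -/
def deriv (V : SmoothField (F := F) U) (f : SmoothFun (F := F) U) : SmoothFun (F := F) U :=
  ⟨fun x => mvfderiv 𝓘(ℝ, F) (extF f.1) x (V.1 x), fun x =>
    ((smoothFormAt_mvfderiv (f.2 x)).apply (V.2 x)).congr_of_eventuallyEq
      (eventually_coe x fun y => by simp)⟩

theorem deriv_apply (V : SmoothField (F := F) U) (f : SmoothFun (F := F) U) (x : U) :
    (deriv V f).1 x = mvfderiv 𝓘(ℝ, F) (extF f.1) x (V.1 x) := rfl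

theorem isAnchor_deriv : IsAnchor (deriv (F := F) (U := U)) where
  lie_smul V f W := by
    ext x
    have : IsManifold 𝓘(ℝ, F) (minSmoothness ℝ 3) X := isManifold_minSmoothness_three
    refine (mlieBracket_congr (V' := extV V.1) (W' := extF f.1 • extV W.1) x
      (fun y => rfl) fun y => by simp; rfl).trans ?_
    rw [mlieBracket_smul_right ((f.2 x).mdifferentiableAt (by simp)) (mdiff W x), add_comm,
      extF_coe, extV_coe, extV_coe]
    rfl
  map_add V f g := by
    ext x
    have hf := (f.2 x).mdifferentiableAt (I := 𝓘(ℝ, F)) (by simp)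
    have hg := (g.2 x).mdifferentiableAt (I := 𝓘(ℝ, F)) (by simp)
    rw [deriv_apply, mvfderiv_congr (g := extF f.1 + extF g.1) x fun y => by simp,
      mvfderiv_add hf hg]
    rfl
  map_mul V f g := by
    ext x
    have hf := (f.2 x).mdifferentiableAt (I := 𝓘(ℝ, F)) (by simp)
    have hg := (g.2 x).mdifferentiableAt (I := 𝓘(ℝ, F)) (by simp)
    rw [deriv_apply, mvfderiv_congr (g := extF f.1 * extF g.1) x fun y => by simp,
      mvfderiv_mul hf hg, extF_coe, extF_coe]
    rfl
  add_left V W f := by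
    ext x
    exact map_add (mvfderiv 𝓘(ℝ, F) (extF f.1) x) (V.1 x) (W.1 x)
  smul_left V f g := by
    ext x
    exact map_smul (mvfderiv 𝓘(ℝ, F) (extF g.1) x) (f.1 x) (V.1 x)

variable (U) in
/-- The restriction of a vector field which is smooth over `U`. -/
def res (V : ∀ x : X, TangentSpace 𝓘(ℝ, F) x) (hV : ∀ x ∈ U, SmoothFieldAt V x) :
    SmoothField (F := F) U :=
  ⟨fun x => V x, fun x => (hV x x.2).congr (eventually_coe x fun y => by simp)⟩

theorem res_lie (V W : ∀ x : X, TangentSpace 𝓘(ℝ, F) x) (hV : ∀ x ∈ U, SmoothFieldAt V x)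
    (hW : ∀ x ∈ U, SmoothFieldAt W x) :
    ⁅res U V hV, res U W hW⁆ = res U (mlieBracket 𝓘(ℝ, F) V W)
      (fun x hx => (hV x hx).mlieBracket (hW x hx)) := by
  ext x
  exact mlieBracket_congr x (fun y => by simp [res]) fun y => by simp [res]

end SmoothField

variable (U) in
/-- The restriction of a function which is smooth over `U`. -/
def SmoothFun.res (f : X → ℝ) (hf : ∀ x ∈ U, ContMDiffAt 𝓘(ℝ, F) 𝓘(ℝ, ℝ) ∞ f x) :
    SmoothFun (F := F) U :=
  ⟨fun x => f x, fun x => (hf x x.2).congr_of_eventuallyEq (eventually_coe x fun y => by simp)⟩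

end LieRingOfFields

/-! ### The algebra of the structure equations -/

/-- The structure equations for arbitrary functions in place of the forms `θ`, `Λ` and of their
exterior derivatives `dθ`, `dl`. -/
def StructEqs {T : Type*} (dθ : T → T → CoframeValue) (dl : T → T → ℝ) (θ : T → CoframeValue)
    (Λ : T → ℝ) : Prop :=
  let l : T → ℂ := fun v => (Λ v : ℂ)
  let τ : T → ℂ := fun v => entry (θ v) 0
  let σ : T → ℂ := fun v => entry (θ v) 1
  let ρ : T → ℂ := fun v => entry (θ v) 2
  let ζ : T → ℂ := fun v => entry (θ v) 3
  let ζb : T → ℂ := fun v => entry (θ v) 4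
  ∃ (J₁ J₂ J₃ J₄ J₅ J₆ J₇ J₈ J₉ J₁₀ J₁₁ J₁₂ J₁₃ J₁₄ J₁₅ J₁₆ : ℂ) (Y : Fin 5 → Fin 5 → ℂ),
    (starRingEnd ℂ) J₃ = -J₃ ∧
    ∀ v w : T,
      entry (dθ v w) 0 =
        4 * wedge l τ v w + J₁ * wedge τ ζ v w - J₁ * wedge τ ζb v w
        + 3 * Complex.I * J₁ * wedge σ ρ v w + wedge σ ζ v w + wedge σ ζb v w ∧
      entry (dθ v w) 1 =
        3 * wedge l σ v w + J₂ * wedge τ ρ v w + J₃ * wedge τ ζ v w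
        + (starRingEnd ℂ) J₃ * wedge τ ζb v w + J₄ * wedge σ ρ v w
        - J₁ / 2 * wedge σ ζ v w + J₁ / 2 * wedge σ ζb v w
        + wedge ρ ζ v w + wedge ρ ζb v w ∧
      entry (dθ v w) 2 =
        2 * wedge l ρ v w + J₅ * wedge τ σ v w + J₆ * wedge τ ρ v w + J₇ * wedge τ ζ v w
        + (starRingEnd ℂ) J₇ * wedge τ ζb v w + J₈ * wedge σ ρ v w + J₉ * wedge σ ζ v w
        + (starRingEnd ℂ) J₉ * wedge σ ζb v w - J₁ / 2 * wedge ρ ζ v w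
        + J₁ / 2 * wedge ρ ζb v w + Complex.I * wedge ζ ζb v w ∧
      entry (dθ v w) 3 =
        wedge l ζ v w + J₁₀ * wedge τ σ v w + J₁₁ * wedge τ ρ v w + J₁₂ * wedge τ ζ v w
        + J₁₃ * wedge τ ζb v w + J₁₄ * wedge σ ρ v w + J₁₅ * wedge σ ζ v w
        + J₁₆ * wedge ρ ζ v w ∧
      ((dl v w : ℝ) : ℂ) =
        ∑ ν : Fin 5, ∑ μ : Fin 5, Y ν μ *
          wedge (fun t => entry (θ t) ν) (fun t => entry (θ t) μ) v w

theorem structureEquationsAt_iff {F : Type*} [NormedAddCommGroup F] [NormedSpace ℝ F]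
    {X : Type*} [TopologicalSpace X] [ChartedSpace F X]
    (θ : ∀ x : X, TangentSpace 𝓘(ℝ, F) x →L[ℝ] CoframeValue)
    (Λ : ∀ x : X, TangentSpace 𝓘(ℝ, F) x →L[ℝ] ℝ) (x : X) :
    StructureEquationsAt θ Λ x ↔ StructEqs (extD θ x) (extD Λ x) (θ x) (Λ x) := Iff.rfl

theorem StructEqs.comp {T T' : Type*} {dθ : T → T → CoframeValue} {dl : T → T → ℝ}
    {θ : T → CoframeValue} {Λ : T → ℝ} (h : StructEqs dθ dl θ Λ) (f : T' → T) :
    StructEqs (fun v w => dθ (f v) (f w)) (fun v w => dl (f v) (f w)) (fun v => θ (f v))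
      (fun v => Λ (f v)) := by
  obtain ⟨J₁, J₂, J₃, J₄, J₅, J₆, J₇, J₈, J₉, J₁₀, J₁₁, J₁₂, J₁₃, J₁₄, J₁₅, J₁₆, Y, h3, h⟩ := h
  exact ⟨J₁, J₂, J₃, J₄, J₅, J₆, J₇, J₈, J₉, J₁₀, J₁₁, J₁₂, J₁₃, J₁₄, J₁₅, J₁₆, Y, h3,
    fun v w => h (f v) (f w)⟩

/-- The coordinates `(8 c₀, 4 c₁, 2 c₂, c₃ + i c₄)` on the values of coframes, in which the
bracket relations of a normalized frame have integral coefficients. -/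
def hat : (Fin 5 → ℝ) ≃L[ℝ] CoframeValue :=
  LinearEquiv.toContinuousLinearEquiv
  { toFun := fun c => (8 * c 0, 4 * c 1, 2 * c 2, ⟨c 3, c 4⟩)
    invFun := fun v => ![v.1 / 8, v.2.1 / 4, v.2.2.1 / 2, v.2.2.2.re, v.2.2.2.im]
    map_add' := fun c d => by
      refine Prod.ext ?_ (Prod.ext ?_ (Prod.ext ?_ (Complex.ext ?_ ?_))) <;> simp <;> ring
    map_smul' := fun r c => by
      refine Prod.ext ?_ (Prod.ext ?_ (Prod.ext ?_ (Complex.ext ?_ ?_))) <;> simp <;> ring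
    left_inv := fun c => by
      ext i; fin_cases i <;> simp
    right_inv := fun v => by
      refine Prod.ext ?_ (Prod.ext ?_ (Prod.ext ?_ (Complex.ext ?_ ?_))) <;> simp <;> ring }

theorem hat_apply (c : Fin 5 → ℝ) : hat c = (8 * c 0, 4 * c 1, 2 * c 2, ⟨c 3, c 4⟩) := rfl

theorem entry_hat (c : Fin 5 → ℝ) : entry (hat c) 0 = 8 * c 0 ∧ entry (hat c) 1 = 4 * c 1 ∧
    entry (hat c) 2 = 2 * c 2 ∧ entry (hat c) 3 = c 3 + c 4 * Complex.I ∧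
    entry (hat c) 4 = c 3 - c 4 * Complex.I := by
  refine ⟨?_, ?_, ?_, ?_, ?_⟩ <;> apply Complex.ext <;> simp [hat_apply, entry]

/-- Every alternating form is a combination of the products of the entries of the coframe. -/
theorem exists_wedge_coefficients (d : Fin 5 → Fin 5 → ℝ) :
    ∃ Y : Fin 5 → Fin 5 → ℂ, ∀ v w : Fin 5 → ℝ,
      ((∑ i, ∑ j, d i j * (v i * w j - v j * w i) : ℝ) : ℂ) = ∑ ν, ∑ μ, Y ν μ *
        wedge (fun t => entry (hat t) ν) (fun t => entry (hat t) μ) v w := by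
  -- the coordinates as combinations of the entries
  obtain ⟨m, hm⟩ : ∃ m : Fin 5 → Fin 5 → ℂ, ∀ (v : Fin 5 → ℝ) (i : Fin 5),
      (v i : ℂ) = ∑ ν, m i ν * entry (hat v) ν := by
    refine ⟨![![1 / 8, 0, 0, 0, 0], ![0, 1 / 4, 0, 0, 0], ![0, 0, 1 / 2, 0, 0],
      ![0, 0, 0, 1 / 2, 1 / 2], ![0, 0, 0, -Complex.I / 2, Complex.I / 2]], fun v i => ?_⟩
    obtain ⟨h0, h1, h2, h3, h4⟩ := entry_hat v
    simp only [Fin.sum_univ_five, h0, h1, h2, h3, h4]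
    fin_cases i <;> simp <;> first | ring1 | (linear_combination (v 4 : ℂ) * Complex.I_sq)
  refine ⟨fun ν μ => ∑ i, ∑ j, d i j * (m i ν * m j μ), fun v w => ?_⟩
  have h1 : ∀ i j, ((v i * w j - v j * w i : ℝ) : ℂ) = ∑ ν, ∑ μ, m i ν * m j μ *
      wedge (fun t => entry (hat t) ν) (fun t => entry (hat t) μ) v w := by
    intro i j
    push_cast
    rw [hm v i, hm w j, hm v j, hm w i, Finset.sum_mul_sum, Finset.sum_mul_sum]
    rw [Finset.sum_comm (f := fun a b => m j a * entry (hat v) a * (m i b * entry (hat w) b)),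
      ← Finset.sum_sub_distrib]
    refine Finset.sum_congr rfl fun ν _ => ?_
    rw [← Finset.sum_sub_distrib]
    refine Finset.sum_congr rfl fun μ _ => ?_
    unfold wedge
    ring
  calc _ = ∑ i, ∑ j, (d i j : ℂ) * ∑ ν, ∑ μ, m i ν * m j μ *
      wedge (fun t => entry (hat t) ν) (fun t => entry (hat t) μ) v w := by
        rw [Complex.ofReal_sum]
        refine Finset.sum_congr rfl fun i _ => ?_
        rw [Complex.ofReal_sum]
        refine Finset.sum_congr rfl fun j _ => ?_
        rw [Complex.ofReal_mul, h1]
    _ = _ := by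
      simp only [Finset.mul_sum, Finset.sum_mul]
      have e : ∀ f : Fin 5 → Fin 5 → Fin 5 → Fin 5 → ℂ,
          ∑ i, ∑ j, ∑ ν, ∑ μ, f i j ν μ = ∑ ν, ∑ μ, ∑ i, ∑ j, f i j ν μ := by
        intro f
        simp only [← Finset.sum_product', Finset.univ_product_univ]
        refine Fintype.sum_equiv
          ⟨fun p => (p.2.2.1, p.2.2.2, p.1, p.2.1), fun p => (p.2.2.1, p.2.2.2, p.1, p.2.1),
            fun p => rfl, fun p => rfl⟩ _ _ fun p => rfl
      rw [e]
      refine Finset.sum_congr rfl fun ν _ => Finset.sum_congr rfl fun μ _ =>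
        Finset.sum_congr rfl fun i _ => Finset.sum_congr rfl fun j _ => ?_
      ring

/-- The bracket relations of a normal frame imply the structure equations. -/
theorem structEqs_of_table {μ ν j w₁ w₂ r₁ r₂ v₁ v₂ t₃ a₃ b₃ s₄ t₄ a₄ b₄ s₅ t₅ a₅ b₅ : ℝ}
    (p q : Fin 5 → ℝ) (Ω : (Fin 5 → ℝ) → (Fin 5 → ℝ) → (Fin 5 → ℝ))
    (hΩ : ∀ v w k, Ω v w k = -((v 0 * w 1 - v 1 * w 0) * p k + (v 0 * w 2 - v 2 * w 0) * q k
      - (v 0 * w 3 - v 3 * w 0) * ![-4 * μ, 0, t₃, a₃, b₃] k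
      - (v 0 * w 4 - v 4 * w 0) * ![-(4 * ν + 2 * j), s₄, t₄, a₄, b₄] k
      + (v 1 * w 2 - v 2 * w 1) * ![3 * j, s₅, t₅, a₅, b₅] k
      - (v 1 * w 3 - v 3 * w 1) * ![1, -3 * μ, r₁, v₁, v₂] k
      - (v 1 * w 4 - v 4 * w 1) * ![0, j - 3 * ν, r₂, -v₂, v₁] k
      - (v 2 * w 3 - v 3 * w 2) * ![0, 1, -2 * μ, w₁, w₂] k
      - (v 2 * w 4 - v 4 * w 2) * ![0, 0, j - 2 * ν, -w₂, w₁] k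
      + (v 3 * w 4 - v 4 * w 3) * ![0, 0, -1, ν, -μ] k))
    (d : Fin 5 → Fin 5 → ℝ) :
    StructEqs (fun v w => hat (Ω v w)) (fun v w => ∑ i, ∑ j, d i j * (v i * w j - v j * w i))
      (fun v => hat v)
      (fun v => -(p 1 / 3) * v 0 + p 0 / 4 * v 1 + q 0 / 4 * v 2 + μ * v 3 + ν * v 4) := by
  obtain ⟨Y, hY⟩ := exists_wedge_coefficients d
  refine ⟨⟨0, j⟩, ⟨-(q 1 / 4), 0⟩, ⟨0, -(s₄ / 4)⟩, ⟨(-4 * s₅ + 3 * q 0) / 8, 0⟩,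
    ⟨-(p 2 / 16), 0⟩, ⟨(-2 * q 2 + 4 * p 1 / 3) / 16, 0⟩, ⟨t₃ / 8, -(t₄ / 8)⟩,
    ⟨(-2 * t₅ - p 0) / 8, 0⟩, ⟨r₁ / 4, -(r₂ / 4)⟩, ⟨-(p 3) / 32, -(p 4) / 32⟩,
    ⟨-(q 3) / 16, -(q 4) / 16⟩, ⟨(a₃ + b₄ + 2 * (p 1 / 3)) / 16, (b₃ - a₄) / 16⟩,
    ⟨(a₃ - b₄) / 16, (b₃ + a₄) / 16⟩, ⟨-a₅ / 8, -b₅ / 8⟩, ⟨(v₁ - p 0 / 4) / 4, v₂ / 4⟩,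
    ⟨(w₁ - q 0 / 4) / 2, w₂ / 2⟩, Y, ?_, fun v w => ⟨?_, ?_, ?_, ?_, hY v w⟩⟩
  · apply Complex.ext <;> simp
  all_goals
    obtain ⟨h0, h1, h2, h3, h4⟩ := entry_hat v
    obtain ⟨h0', h1', h2', h3', h4'⟩ := entry_hat w
    obtain ⟨k0, k1, k2, k3, k4⟩ := entry_hat (Ω v w)
    simp only [wedge, h0, h1, h2, h3, h4, h0', h1', h2', h3', h4', k0, k1, k2, k3, hΩ]
    apply Complex.ext <;> simp <;> ring

/-- The structure equations imply the bracket relations of a normal frame; the indices refer to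
the frame `(R, S, T, A, B)`. -/
theorem StructEqs.table {Ω : Fin 5 → Fin 5 → (Fin 5 → ℝ)} {dl : Fin 5 → Fin 5 → ℝ} {Λ : Fin 5 → ℝ}
    (h : StructEqs (fun i k => hat (Ω i k)) dl (fun i => hat (Pi.single i 1)) Λ) :
    ∃ j : ℝ, Ω 3 4 = ![0, 0, 1, -Λ 4, Λ 3] ∧
      (Ω 3 2 0 = 0 ∧ Ω 3 2 1 = -1 ∧ Ω 3 2 2 = 2 * Λ 3) ∧
      (Ω 4 2 0 = 0 ∧ Ω 4 2 1 = 0 ∧ Ω 4 2 2 = 2 * Λ 4 - j ∧ Ω 4 2 3 = -Ω 3 2 4 ∧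
        Ω 4 2 4 = Ω 3 2 3) ∧
      (Ω 3 1 0 = -1 ∧ Ω 3 1 1 = 3 * Λ 3) ∧
      (Ω 4 1 0 = 0 ∧ Ω 4 1 1 = 3 * Λ 4 - j ∧ Ω 4 1 3 = -Ω 3 1 4 ∧ Ω 4 1 4 = Ω 3 1 3) ∧
      (Ω 3 0 0 = 4 * Λ 3 ∧ Ω 3 0 1 = 0) ∧ Ω 4 0 0 = 4 * Λ 4 + 2 * j ∧ Ω 1 2 0 = -3 * j := by
  obtain ⟨J₁, J₂, J₃, J₄, J₅, J₆, J₇, J₈, J₉, J₁₀, J₁₁, J₁₂, J₁₃, J₁₄, J₁₅, J₁₆, Y, h3, h⟩ := h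
  have he : ∀ i, entry (hat (Pi.single i 1)) = ![8 * ((Pi.single i 1 : Fin 5 → ℝ) 0 : ℂ),
      4 * ((Pi.single i 1 : Fin 5 → ℝ) 1 : ℂ), 2 * ((Pi.single i 1 : Fin 5 → ℝ) 2 : ℂ),
      ((Pi.single i 1 : Fin 5 → ℝ) 3 : ℂ) + ((Pi.single i 1 : Fin 5 → ℝ) 4 : ℂ) * Complex.I,
      ((Pi.single i 1 : Fin 5 → ℝ) 3 : ℂ) - ((Pi.single i 1 : Fin 5 → ℝ) 4 : ℂ) * Complex.I] := by
    intro i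
    obtain ⟨h0, h1, h2, h3, h4⟩ := entry_hat (Pi.single i 1)
    ext k; fin_cases k <;> simp [h0, h1, h2, h3, h4]
  have hd : ∀ i k, entry (hat (Ω i k)) = ![8 * (Ω i k 0 : ℂ), 4 * (Ω i k 1 : ℂ), 2 * (Ω i k 2 : ℂ),
      (Ω i k 3 : ℂ) + (Ω i k 4 : ℂ) * Complex.I, (Ω i k 3 : ℂ) - (Ω i k 4 : ℂ) * Complex.I] := by
    intro i k
    obtain ⟨h0, h1, h2, h3, h4⟩ := entry_hat (Ω i k)
    ext k; fin_cases k <;> simp [h0, h1, h2, h3, h4]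
  simp only [hd, he, wedge] at h
  have hJ : J₃.re = 0 := by
    have := congrArg Complex.re h3
    simp at this; linarith
  have e : ∀ i k : Fin 5, _ := fun i k => 
    And.intro (congrArg Complex.re (h i k).1) <| And.intro (congrArg Complex.im (h i k).1) <|
    And.intro (congrArg Complex.re (h i k).2.1) <| 
    And.intro (congrArg Complex.re (h i k).2.2.1) <| 
    And.intro (congrArg Complex.re (h i k).2.2.2.1) (congrArg Complex.im (h i k).2.2.2.1) 
  clear h h3
  have e34 := e 3 4
  have e32 := e 3 2
  have e42 := e 4 2
  have e31 := e 3 1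
  have e41 := e 4 1
  have e30 := e 3 0
  have e40 := e 4 0
  have e12 := e 1 2
  clear e he hd
  simp [hJ] at e34 e32 e42 e31 e41 e30 e40 e12
  obtain ⟨a0, a1, a2, a3, a4⟩ := e34
  obtain ⟨b0, b1, b2, b3, b4⟩ := e32
  obtain ⟨c0, c1, c2, c3, c4⟩ := e42
  obtain ⟨d0, d1, d2, d3, d4⟩ := e31
  obtain ⟨f0, f1, f2, f3, f4⟩ := e41
  refine ⟨J₁.im, ?_, ⟨b0, by linarith, by linarith⟩, ⟨c0, c1, by linarith, by linarith, by linarith⟩,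
    ⟨by linarith, by linarith⟩, ⟨f0, by linarith, by linarith, by linarith⟩,
    ⟨by linarith [e30.1], e30.2.1⟩, by linarith [e40.1], by linarith [e12.1]⟩
  ext k
  fin_cases k <;> simp <;> linarith

/-- The effect on the structure equations of the change `θ ↦ a · θ`, `Λ ↦ Λ + α`, where `α` stands
for `da / a`. -/
theorem StructEqs.scale {T : Type*} {dθ dθ' : T → T → CoframeValue} {dl : T → T → ℝ}
    {θ : T → CoframeValue} {Λ : T → ℝ} (h : StructEqs dθ dl θ Λ) (a : ℝˣ) (α : T → ℝ)
    (hd : ∀ v w, dθ' v w = scaleValue a (dθ v w +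
      (4 * (α v * (θ w).1 - α w * (θ v).1), 3 * (α v * (θ w).2.1 - α w * (θ v).2.1),
        2 * (α v * (θ w).2.2.1 - α w * (θ v).2.2.1),
        (α v : ℂ) * (θ w).2.2.2 - (α w : ℂ) * (θ v).2.2.2))) :
    StructEqs dθ' dl (fun v => scaleValue a (θ v)) (fun v => Λ v + α v) := by
  obtain ⟨J₁, J₂, J₃, J₄, J₅, J₆, J₇, J₈, J₉, J₁₀, J₁₁, J₁₂, J₁₃, J₁₄, J₁₅, J₁₆, Y, h3, h⟩ := h
  obtain ⟨c, hc⟩ : ∃ c : ℂ, c = ((a : ℝ) : ℂ) := ⟨_, rfl⟩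
  have hc0 : c ≠ 0 := by rw [hc]; exact_mod_cast a.ne_zero
  have hcc : (starRingEnd ℂ) c = c := by rw [hc, Complex.conj_ofReal]
  have he : ∀ u, entry (scaleValue a u) = ![c ^ 4 * entry u 0, c ^ 3 * entry u 1,
      c ^ 2 * entry u 2, c * entry u 3, c * entry u 4] := by
    intro u
    ext k
    fin_cases k <;> simp [scaleValue, entry, hc]
  have hadd : ∀ (u : CoframeValue) (x y z : ℝ) (t : ℂ), entry (u + (x, y, z, t)) = ![entry u 0 + x,
      entry u 1 + y, entry u 2 + z, entry u 3 + t, entry u 4 + (starRingEnd ℂ) t] := by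
    intro u x y z t
    ext k
    fin_cases k <;> simp [entry]
  refine ⟨J₁ / c, J₂ / c ^ 3, J₃ / c ^ 2, J₄ / c ^ 2, J₅ / c ^ 5, J₆ / c ^ 4, J₇ / c ^ 3, J₈ / c ^ 3,
    J₉ / c ^ 2, J₁₀ / c ^ 6, J₁₁ / c ^ 5, J₁₂ / c ^ 4, J₁₃ / c ^ 4, J₁₄ / c ^ 4, J₁₅ / c ^ 3,
    J₁₆ / c ^ 2, fun ν μ => Y ν μ / (![c ^ 4, c ^ 3, c ^ 2, c, c] ν * ![c ^ 4, c ^ 3, c ^ 2, c, c] μ),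
    ?_, fun v w => ?_⟩
  · simp only [map_div₀, map_pow, hcc, h3]; ring
  obtain ⟨h0, h1, h2, h4, h5⟩ := h v w
  have hr : ∀ u : CoframeValue, (u.1 : ℂ) = entry u 0 ∧ (u.2.1 : ℂ) = entry u 1 ∧
      (u.2.2.1 : ℂ) = entry u 2 ∧ u.2.2.2 = entry u 3 := fun u => ⟨rfl, rfl, rfl, rfl⟩
  rw [hd, he, hadd]
  simp only [wedge] at h0 h1 h2 h4
  refine ⟨?_, ?_, ?_, ?_, ?_⟩
  · simp only [wedge, he, Matrix.cons_val, h0]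
    push_cast
    rw [(hr (θ v)).1, (hr (θ w)).1]
    field_simp
    ring
  · simp only [wedge, he, Matrix.cons_val, h1, map_div₀, map_pow, hcc]
    push_cast
    rw [(hr (θ v)).2.1, (hr (θ w)).2.1]
    field_simp
    ring
  · simp only [wedge, he, Matrix.cons_val, h2, map_div₀, map_pow, hcc]
    push_cast
    rw [(hr (θ v)).2.2.1, (hr (θ w)).2.2.1]
    field_simp
    ring
  · simp only [wedge, he, Matrix.cons_val, h4]
    push_cast
    rw [(hr (θ v)).2.2.2, (hr (θ w)).2.2.2]
    field_simp
    ring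
  · rw [h5]
    refine Finset.sum_congr rfl fun ν _ => Finset.sum_congr rfl fun μ _ => ?_
    have hs : ∀ (u : CoframeValue) (k : Fin 5), entry (scaleValue a u) k =
        ![c ^ 4, c ^ 3, c ^ 2, c, c] k * entry u k := by
      intro u k
      rw [he]; fin_cases k <;> rfl
    have hn : ∀ k : Fin 5, ![c ^ 4, c ^ 3, c ^ 2, c, c] k ≠ 0 := by
      intro k; fin_cases k <;> simp [hc0]
    have n1 := hn ν
    have n2 := hn μ
    simp only [wedge, hs]
    field_simp

/-- The form `Λ` of the structure equations is determined by the coframe. -/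
theorem StructEqs.unique {T : Type*} {dθ : T → T → CoframeValue} {dl dl' : T → T → ℝ}
    {θ : T → CoframeValue} {Λ Λ' : T → ℝ} (h : StructEqs dθ dl θ Λ) (h' : StructEqs dθ dl' θ Λ')
    (hθ : Function.Surjective θ) : Λ = Λ' := by
  obtain ⟨J₁, J₂, J₃, J₄, _, _, _, _, _, _, _, _, _, _, _, _, _, _, h⟩ := h
  obtain ⟨J₁', J₂', J₃', J₄', _, _, _, _, _, _, _, _, _, _, _, _, _, _, h'⟩ := h'
  choose E hE using fun i : Fin 5 => hθ (hat (Pi.single i 1))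
  have he : ∀ i, entry (hat (Pi.single i 1)) = ![8 * ((Pi.single i 1 : Fin 5 → ℝ) 0 : ℂ),
      4 * ((Pi.single i 1 : Fin 5 → ℝ) 1 : ℂ), 2 * ((Pi.single i 1 : Fin 5 → ℝ) 2 : ℂ),
      ((Pi.single i 1 : Fin 5 → ℝ) 3 : ℂ) + ((Pi.single i 1 : Fin 5 → ℝ) 4 : ℂ) * Complex.I,
      ((Pi.single i 1 : Fin 5 → ℝ) 3 : ℂ) - ((Pi.single i 1 : Fin 5 → ℝ) 4 : ℂ) * Complex.I] := by
    intro i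
    obtain ⟨h0, h1, h2, h3, h4⟩ := entry_hat (Pi.single i 1)
    ext k; fin_cases k <;> simp [h0, h1, h2, h3, h4]
  -- the coefficient of `σ ∧ ρ` in `dτ` determines `J₁`
  have e1 := (h (E 1) (E 2)).1.symm.trans (h' (E 1) (E 2)).1
  simp [wedge, hE, he] at e1
  -- the coefficient of `τ ∧ σ` in `dσ` determines the component of `Λ` along `τ`
  have e2 := (h (E 0) (E 1)).2.1.symm.trans (h' (E 0) (E 1)).2.1
  simp [wedge, hE, he] at e2
  funext v
  have e3 := (h v (E 0)).1.symm.trans (h' v (E 0)).1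
  simp [wedge, hE, he, e1, e2] at e3
  exact e3


/-! ### Real and complex ranks -/

section Rank
variable {T : Type*} [AddCommGroup T] [Module ℝ T]

/-- The complex span of vectors with real and imaginary parts in `K` lies in `ℂ ⊗ K`. -/
theorem finrank_span_complex_le [FiniteDimensional ℝ T] (K : Submodule ℝ T) (s : Set (ℂ ⊗[ℝ] T))
    (hs : ∀ z ∈ s, ∃ a ∈ K, ∃ b ∈ K, z = (1 : ℂ) ⊗ₜ[ℝ] a + Complex.I ⊗ₜ[ℝ] b) :
    Module.finrank ℂ (Submodule.span ℂ s) ≤ Module.finrank ℝ K := by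
  have h1 : Submodule.span ℂ s ≤ LinearMap.range (K.subtype.baseChange ℂ) := by
    refine Submodule.span_le.2 fun z hz => ?_
    obtain ⟨a, ha, b, hb, rfl⟩ := hs z hz
    exact ⟨(1 : ℂ) ⊗ₜ[ℝ] ⟨a, ha⟩ + Complex.I ⊗ₜ[ℝ] ⟨b, hb⟩, by simp⟩
  calc _ ≤ Module.finrank ℂ (LinearMap.range (K.subtype.baseChange ℂ)) := Submodule.finrank_mono h1
    _ ≤ Module.finrank ℂ (ℂ ⊗[ℝ] K) := LinearMap.finrank_range_le _
    _ = _ := Module.finrank_baseChange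

/-- A complex subspace that contains the real vectors of `K` contains `ℂ ⊗ K`. -/
theorem finrank_le_of_complex [FiniteDimensional ℝ T] (K : Submodule ℝ T)
    (C : Submodule ℂ (ℂ ⊗[ℝ] T)) (h : ∀ a ∈ K, (1 : ℂ) ⊗ₜ[ℝ] a ∈ C) :
    Module.finrank ℝ K ≤ Module.finrank ℂ C := by
  have hi : Function.Injective (K.subtype.baseChange ℂ) :=
    Module.Flat.lTensor_preserves_injective_linearMap (M := ℂ) K.subtype K.injective_subtype
  have h1 : LinearMap.range (K.subtype.baseChange ℂ) ≤ C := by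
    rintro _ ⟨z, rfl⟩
    induction z with
    | zero => simp
    | add a b ha hb => rw [map_add]; exact C.add_mem ha hb
    | tmul c a =>
      rw [LinearMap.baseChange_tmul, ← mul_one c, ← smul_eq_mul, ← TensorProduct.smul_tmul']
      exact C.smul_mem _ (h _ a.2)
  calc _ = Module.finrank ℂ (ℂ ⊗[ℝ] K) := Module.finrank_baseChange.symm
    _ = Module.finrank ℂ (LinearMap.range (K.subtype.baseChange ℂ)) :=
      (LinearMap.finrank_range_of_inj hi).symm
    _ ≤ _ := Submodule.finrank_mono h1

end Rank

section CR
variable {E : Type*} [NormedAddCommGroup E] [NormedSpace ℝ E]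
  {M : Type*} [TopologicalSpace M] [ChartedSpace E M] [IsManifold 𝓘(ℝ, E) ∞ M] {U : Opens M}

/-! ### Complex fields in terms of the Lie ring of real fields -/

/-- Over `U` the complex field `Z` is `a + i b`. -/
def ComplexField.On (Z : ComplexField E M) (a b : SmoothField (F := E) U) : Prop :=
  ∀ x : U, Z.re x = a.1 x ∧ Z.im x = b.1 x

variable [CompleteSpace E]

theorem mlieBracket_eq_lie {V W : ∀ x : M, TangentSpace 𝓘(ℝ, E) x} {a b : SmoothField (F := E) U}
    (hV : ∀ x : U, V x = a.1 x) (hW : ∀ x : U, W x = b.1 x) (x : U) :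
    mlieBracket 𝓘(ℝ, E) V W x = ⁅a, b⁆.1 x := 
  mlieBracket_congr x (fun y => by simp [hV]) fun y => by simp [hW]

namespace ComplexField.On
variable {Z W : ComplexField E M} {a b c d : SmoothField (F := E) U}

theorem bracket (h : Z.On a b) (h' : W.On c d) :
    (Z.bracket W).On (⁅a, c⁆ - ⁅b, d⁆) (⁅a, d⁆ + ⁅b, c⁆) := fun x => by
  constructor
  · change _ - _ = ⁅a, c⁆.1 x - ⁅b, d⁆.1 x
    rw [mlieBracket_eq_lie (fun y => (h y).1) (fun y => (h' y).1),
      mlieBracket_eq_lie (fun y => (h y).2) (fun y => (h' y).2)]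
  · change _ + _ = ⁅a, d⁆.1 x + ⁅b, c⁆.1 x
    rw [mlieBracket_eq_lie (fun y => (h y).1) (fun y => (h' y).2),
      mlieBracket_eq_lie (fun y => (h y).2) (fun y => (h' y).1)]

theorem conj (h : Z.On a b) : Z.conj.On a (-b) := fun x =>
  ⟨(h x).1, congrArg Neg.neg (h x).2⟩

theorem mulI (h : Z.On a b) : Z.mulI.On (-b) a := fun x =>
  ⟨congrArg Neg.neg (h x).2, (h x).1⟩

variable {A B T P Q : SmoothField (F := E) U}

/-- For `ℒ = A - i B` one has `𝒯 = -2 [A, B] = 2 T`. -/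
theorem fieldT (h : Z.On A (-B)) (hT : T = -⁅A, B⁆) : Z.fieldT.On (T + T) 0 := by
  have := (h.bracket h.conj).mulI
  have e1 : -(⁅A, -(-B)⁆ + ⁅-B, A⁆) = T + T := by
    rw [hT, neg_neg, neg_lie, ← lie_skew B A]; abel
  have e2 : ⁅A, A⁆ - ⁅-B, -(-B)⁆ = 0 := by simp
  rwa [e1, e2] at this

/-- For `ℒ = A - i B` one has `𝒮 = 2 [A, T] - 2 i [B, T]`. -/
theorem fieldS (h : Z.On A (-B)) (hT : T = -⁅A, B⁆) (hP : P = ⁅A, T⁆) (hQ : Q = ⁅B, T⁆) :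
    Z.fieldS.On (P + P) (-(Q + Q)) := by
  have := h.bracket (h.fieldT hT)
  have e1 : ⁅A, T + T⁆ - ⁅-B, 0⁆ = P + P := by simp [hP]
  have e2 : ⁅A, 0⁆ + ⁅-B, T + T⁆ = -(Q + Q) := by simp [hQ]
  rwa [e1, e2] at this

/-- For `ℒ = A - i B`, `ℛ` in terms of the iterated brackets of `A` and `B`. -/
theorem fieldR (h : Z.On A (-B)) (hT : T = -⁅A, B⁆) (hP : P = ⁅A, T⁆) (hQ : Q = ⁅B, T⁆) :
    Z.fieldR.On (⁅A, P⁆ + ⁅A, P⁆ - (⁅B, Q⁆ + ⁅B, Q⁆)) (-(⁅A, Q⁆ + ⁅A, Q⁆) - (⁅B, P⁆ + ⁅B, P⁆)) := by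
  have := h.bracket (h.fieldS hT hP hQ)
  have e1 : ⁅A, P + P⁆ - ⁅-B, -(Q + Q)⁆ = ⁅A, P⁆ + ⁅A, P⁆ - (⁅B, Q⁆ + ⁅B, Q⁆) := by simp
  have e2 : ⁅A, -(Q + Q)⁆ + ⁅-B, P + P⁆ = -(⁅A, Q⁆ + ⁅A, Q⁆) - (⁅B, P⁆ + ⁅B, P⁆) := by
    simp only [lie_add, lie_neg, neg_lie]; abel
  rwa [e1, e2] at this

end ComplexField.On

variable {Z : ComplexField E M} {A B T P Q : SmoothField (F := E) U} {x : U}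

/-! ### The rank conditions in real terms -/

section Class
variable {C : CRStructure E M} [FiniteDimensional ℝ E]

/-- Rank three of `(ℒ, ℒ̄, 𝒯)`, as a bound for the real subspaces that contain the real and imaginary
parts of these fields. -/
theorem class_T (hC : C.IsClassIII2) (hZ : IsLocalGenerator C.L U Z) (h : Z.On A (-B))
    (hT : T = -⁅A, B⁆) (K : Submodule ℝ (TangentSpace 𝓘(ℝ, E) (x : M)))
    (hA : A.1 x ∈ K) (hB : B.1 x ∈ K) (hTK : T.1 x ∈ K) : 3 ≤ Module.finrank ℝ K := by
  have : FiniteDimensional ℝ (TangentSpace 𝓘(ℝ, E) (x : M)) := ‹FiniteDimensional ℝ E›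
  rw [← (hC U Z hZ x x.2).1]
  refine finrank_span_complex_le K _ ?_
  rintro z (rfl | rfl | rfl)
  · exact ⟨_, by rw [(h x).1]; exact hA, _, by rw [(h x).2]; exact K.neg_mem hB, rfl⟩
  · exact ⟨_, by rw [(h.conj x).1]; exact hA, _, by rw [(h.conj x).2, neg_neg]; exact hB, rfl⟩
  · exact ⟨_, by rw [(h.fieldT hT x).1]; exact K.add_mem hTK hTK, _,
      by rw [(h.fieldT hT x).2]; exact K.zero_mem, rfl⟩

/-- Rank four of `(ℒ, ℒ̄, 𝒯, 𝒮)`, as a bound for real subspaces. -/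
theorem class_S (hC : C.IsClassIII2) (hZ : IsLocalGenerator C.L U Z) (h : Z.On A (-B))
    (hT : T = -⁅A, B⁆) (hP : P = ⁅A, T⁆) (hQ : Q = ⁅B, T⁆)
    (K : Submodule ℝ (TangentSpace 𝓘(ℝ, E) (x : M)))
    (hA : A.1 x ∈ K) (hB : B.1 x ∈ K) (hTK : T.1 x ∈ K) (hPK : P.1 x ∈ K) (hQK : Q.1 x ∈ K) :
    4 ≤ Module.finrank ℝ K := by
  have : FiniteDimensional ℝ (TangentSpace 𝓘(ℝ, E) (x : M)) := ‹FiniteDimensional ℝ E›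
  rw [← (hC U Z hZ x x.2).2.1]
  refine finrank_span_complex_le K _ ?_
  rintro z (rfl | rfl | rfl | rfl)
  · exact ⟨_, by rw [(h x).1]; exact hA, _, by rw [(h x).2]; exact K.neg_mem hB, rfl⟩
  · exact ⟨_, by rw [(h.conj x).1]; exact hA, _, by rw [(h.conj x).2, neg_neg]; exact hB, rfl⟩
  · exact ⟨_, by rw [(h.fieldT hT x).1]; exact K.add_mem hTK hTK, _,
      by rw [(h.fieldT hT x).2]; exact K.zero_mem, rfl⟩
  · exact ⟨_, by rw [(h.fieldS hT hP hQ x).1]; exact K.add_mem hPK hPK, _,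
      by rw [(h.fieldS hT hP hQ x).2]; exact K.neg_mem (K.add_mem hQK hQK), rfl⟩

/-- Rank five of `(ℒ, ℒ̄, 𝒯, 𝒮, ℛ)`, as a bound for real subspaces. -/
theorem class_R (hC : C.IsClassIII2) (hZ : IsLocalGenerator C.L U Z) (h : Z.On A (-B))
    (hT : T = -⁅A, B⁆) (hP : P = ⁅A, T⁆) (hQ : Q = ⁅B, T⁆)
    (K : Submodule ℝ (TangentSpace 𝓘(ℝ, E) (x : M)))
    (hA : A.1 x ∈ K) (hB : B.1 x ∈ K) (hTK : T.1 x ∈ K) (hPK : P.1 x ∈ K) (hQK : Q.1 x ∈ K)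
    (hAP : ⁅A, P⁆.1 x ∈ K) (hAQ : ⁅A, Q⁆.1 x ∈ K) (hBP : ⁅B, P⁆.1 x ∈ K) (hBQ : ⁅B, Q⁆.1 x ∈ K) :
    5 ≤ Module.finrank ℝ K := by
  have : FiniteDimensional ℝ (TangentSpace 𝓘(ℝ, E) (x : M)) := ‹FiniteDimensional ℝ E›
  rw [← (hC U Z hZ x x.2).2.2.2]
  refine finrank_span_complex_le K _ ?_
  rintro z (rfl | rfl | rfl | rfl | rfl)
  · exact ⟨_, by rw [(h x).1]; exact hA, _, by rw [(h x).2]; exact K.neg_mem hB, rfl⟩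
  · exact ⟨_, by rw [(h.conj x).1]; exact hA, _, by rw [(h.conj x).2, neg_neg]; exact hB, rfl⟩
  · exact ⟨_, by rw [(h.fieldT hT x).1]; exact K.add_mem hTK hTK, _,
      by rw [(h.fieldT hT x).2]; exact K.zero_mem, rfl⟩
  · exact ⟨_, by rw [(h.fieldS hT hP hQ x).1]; exact K.add_mem hPK hPK, _,
      by rw [(h.fieldS hT hP hQ x).2]; exact K.neg_mem (K.add_mem hQK hQK), rfl⟩
  · have m1 := K.sub_mem (K.add_mem hAP hAP) (K.add_mem hBQ hBQ)
    have m2 := K.sub_mem (K.neg_mem (K.add_mem hAQ hAQ)) (K.add_mem hBP hBP)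
    exact ⟨_, by rw [(h.fieldR hT hP hQ x).1]; exact m1, _,
      by rw [(h.fieldR hT hP hQ x).2]; exact m2, rfl⟩

/-- Rank four of `(ℒ, ℒ̄, 𝒯, 𝒮, 𝒮̄)`. The complex span of these five fields is stable under
conjugation, so that it is the complexification of a real subspace. -/
theorem class_conj (hC : C.IsClassIII2) (hZ : IsLocalGenerator C.L U Z) (h : Z.On A (-B))
    (hT : T = -⁅A, B⁆) (hP : P = ⁅A, T⁆) (hQ : Q = ⁅B, T⁆) :
    Module.finrank ℝ (Submodule.span ℝ
      ({A.1 x, B.1 x, T.1 x, P.1 x, Q.1 x} : Set (TangentSpace 𝓘(ℝ, E) (x : M)))) ≤ 4 := by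
  have : FiniteDimensional ℝ (TangentSpace 𝓘(ℝ, E) (x : M)) := ‹FiniteDimensional ℝ E›
  rw [← (hC U Z hZ x x.2).2.2.1]
  obtain ⟨D, hD⟩ : ∃ D, D = Submodule.span ℂ ({Z.val x, Z.conj.val x, Z.fieldT.val x, Z.fieldS.val x,
    Z.fieldS.conj.val x} : Set (CTangent E (x : M))) := ⟨_, rfl⟩
  rw [← hD]
  have h1 : ∀ z ∈ ({Z.val x, Z.conj.val x, Z.fieldT.val x, Z.fieldS.val x,
    Z.fieldS.conj.val x} : Set (CTangent E (x : M))), z ∈ D := fun z hz => by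
      rw [hD]; exact Submodule.subset_span hz
  simp only [Set.mem_insert_iff, Set.mem_singleton_iff, forall_eq_or_imp, forall_eq] at h1
  obtain ⟨z1, z2, z3, z4, z5⟩ := h1
  simp only [ComplexField.val, (h x).1, (h x).2] at z1
  simp only [ComplexField.val, (h.conj x).1, (h.conj x).2] at z2
  simp only [ComplexField.val, (h.fieldT hT x).1, (h.fieldT hT x).2] at z3
  simp only [ComplexField.val, (h.fieldS hT hP hQ x).1, (h.fieldS hT hP hQ x).2] at z4
  simp only [ComplexField.val, ((h.fieldS hT hP hQ).conj x).1, ((h.fieldS hT hP hQ).conj x).2] at z5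
  have half : ∀ v : TangentSpace 𝓘(ℝ, E) (x : M), (1 : ℂ) ⊗ₜ[ℝ] (v + v) ∈ D →
      (1 : ℂ) ⊗ₜ[ℝ] v ∈ D := fun v hv => by
    have := D.smul_mem (2⁻¹ : ℂ) hv
    rwa [TensorProduct.tmul_add, ← two_smul ℂ, smul_smul, inv_mul_cancel₀ two_ne_zero, one_smul] at this
  have half' : ∀ a b : TangentSpace 𝓘(ℝ, E) (x : M),
      (1 : ℂ) ⊗ₜ[ℝ] a + Complex.I ⊗ₜ[ℝ] b ∈ D → (1 : ℂ) ⊗ₜ[ℝ] a + Complex.I ⊗ₜ[ℝ] (-b) ∈ D →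
      (1 : ℂ) ⊗ₜ[ℝ] a ∈ D ∧ (1 : ℂ) ⊗ₜ[ℝ] b ∈ D := fun a b h1 h2 => by
    constructor
    · refine half _ ?_
      have := D.add_mem h1 h2
      rw [TensorProduct.tmul_neg] at this
      rw [TensorProduct.tmul_add]
      convert this using 1
      abel
    · refine half _ ?_
      have := D.smul_mem (-Complex.I) (D.sub_mem h1 h2)
      rw [TensorProduct.tmul_neg, add_sub_add_left_eq_sub, sub_neg_eq_add, ← TensorProduct.tmul_add,
        TensorProduct.smul_tmul'] at this
      simpa using this
  obtain ⟨hA, hB⟩ := half' _ _ z1 z2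
  obtain ⟨hP', hQ'⟩ := half' _ _ z4 z5
  have hT' : (1 : ℂ) ⊗ₜ[ℝ] T.1 x ∈ D := by
    refine half _ ?_
    have e : Complex.I ⊗ₜ[ℝ] ((0 : SmoothField (F := E) U).1 x) = 0 := TensorProduct.tmul_zero _ _
    rw [e, add_zero] at z3
    exact z3
  have neg : ∀ v : TangentSpace 𝓘(ℝ, E) (x : M), (1 : ℂ) ⊗ₜ[ℝ] (-v) ∈ D → (1 : ℂ) ⊗ₜ[ℝ] v ∈ D :=
    fun v hv => by
      rw [TensorProduct.tmul_neg] at hv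
      exact neg_mem_iff.1 hv
  have hB' : (1 : ℂ) ⊗ₜ[ℝ] B.1 x ∈ D := neg _ hB
  have hQ'' : (1 : ℂ) ⊗ₜ[ℝ] Q.1 x ∈ D := half _ (neg _ hQ')
  refine finrank_le_of_complex _ D fun a ha => ?_
  have h2 : Submodule.span ℝ ({A.1 x, B.1 x, T.1 x, P.1 x, Q.1 x} :
      Set (TangentSpace 𝓘(ℝ, E) (x : M))) ≤
      (D.restrictScalars ℝ).comap (TensorProduct.mk ℝ ℂ (TangentSpace 𝓘(ℝ, E) (x : M)) 1) := by
    refine Submodule.span_le.2 ?_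
    rintro z (rfl | rfl | rfl | rfl | rfl)
    exacts [hA, hB', hT', half _ hP', hQ'']
  exact h2 ha

end Class

end CR

section LocalFrames
variable {F : Type*} [NormedAddCommGroup F] [NormedSpace ℝ F]
  {X : Type*} [TopologicalSpace X] [ChartedSpace F X] [IsManifold 𝓘(ℝ, F) ∞ X]
  {W : Type*} [NormedAddCommGroup W] [NormedSpace ℝ W]

/-! ### Local frames -/

/-- Every tangent vector is the value of a vector field which is smooth near its base point. -/
theorem exists_smoothFieldAt (x₀ : X) (v : TangentSpace 𝓘(ℝ, F) x₀) :
    ∃ V : ∀ x : X, TangentSpace 𝓘(ℝ, F) x, (∀ᶠ x in nhds x₀, SmoothFieldAt V x) ∧ V x₀ = v := by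
  obtain ⟨e, he⟩ : ∃ e, e = trivializationAt F (TangentSpace 𝓘(ℝ, F)) x₀ := ⟨_, rfl⟩
  have hx₀ : x₀ ∈ e.baseSet := he ▸ FiberBundle.mem_baseSet_trivializationAt' x₀
  have : MemTrivializationAtlas e := he ▸ inferInstance
  refine ⟨fun x => e.symmL ℝ x (e ⟨x₀, v⟩).2, ?_, ?_⟩
  · filter_upwards [e.open_baseSet.mem_nhds hx₀] with x hx
    have h : ContMDiffOn 𝓘(ℝ, F) (𝓘(ℝ, F).prod 𝓘(ℝ, F)) ∞
        (fun x => TotalSpace.mk' F x (e.symmL ℝ x (e ⟨x₀, v⟩).2)) e.baseSet := by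
      rw [e.contMDiffOn_section_baseSet_iff]
      refine (contMDiffOn_const (c := (e ⟨x₀, v⟩).2)).congr fun y hy => ?_
      have h1 := congrArg Prod.snd (e.apply_mk_symm hy (e ⟨x₀, v⟩).2)
      rwa [← e.symmL_apply (R := ℝ) hy] at h1
    exact (h x hx).contMDiffAt (e.open_baseSet.mem_nhds hx)
  · exact (e.symmL_apply (R := ℝ) hx₀ _).trans (e.symm_apply_apply_mk hx₀ v)

theorem smoothFieldAt_iff_coord {V : ∀ x : X, TangentSpace 𝓘(ℝ, F) x} {x : X} :
    SmoothFieldAt V x ↔ ContMDiffAt 𝓘(ℝ, F) 𝓘(ℝ, F) ∞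
      (fun y => (trivializationAt F (TangentSpace 𝓘(ℝ, F)) x ⟨y, V y⟩).2) x :=
  contMDiffAt_section x

/-- The fields which are dual to an invertible smooth form are smooth. -/
theorem SmoothFormAt.inverse_apply [CompleteSpace F] {η : ∀ x : X, TangentSpace 𝓘(ℝ, F) x →L[ℝ] W}
    {x : X} (h : SmoothFormAt η x) (hx : (η x).IsInvertible) (c : W) :
    SmoothFieldAt (fun y => (η y).inverse c) x := by
  have h3 : ∀ᶠ y in nhds x, y ∈ (trivializationAt F (TangentSpace 𝓘(ℝ, F)) x).baseSet :=
    (trivializationAt F (TangentSpace 𝓘(ℝ, F)) x).open_baseSet.mem_nhds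
      (FiberBundle.mem_baseSet_trivializationAt' x)
  have h4 : ∀ y ∈ (trivializationAt F (TangentSpace 𝓘(ℝ, F)) x).baseSet, ∀ e :
      TangentSpace 𝓘(ℝ, F) y ≃L[ℝ] F,
      (e : TangentSpace 𝓘(ℝ, F) y →L[ℝ] F) =
        (trivializationAt F (TangentSpace 𝓘(ℝ, F)) x).continuousLinearMapAt ℝ y →
      coordForm η x y = (η y).comp (e.symm : F →L[ℝ] TangentSpace 𝓘(ℝ, F) y) := by
    intro y hy e he
    ext v
    unfold coordForm
    simp only [ContinuousLinearMap.comp_apply]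
    congr 1
    apply e.injective
    have := congrArg (fun A => A ((trivializationAt F (TangentSpace 𝓘(ℝ, F)) x).symmL ℝ y v)) he
    refine this.trans ?_
    rw [Trivialization.continuousLinearMapAt_symmL _ hy]
    simp
  rw [smoothFieldAt_iff_coord]
  rw [smoothFormAt_iff] at h
  obtain ⟨e', he'⟩ : (coordForm η x x).IsInvertible := by
    have hx' := h3.self_of_nhds
    rw [h4 x hx' _ (Trivialization.coe_continuousLinearEquivAt_eq' _ hx')]
    rwa [ContinuousLinearMap.isInvertible_comp_equiv]
  have h5 : ContDiffAt ℝ ∞ ContinuousLinearMap.inverse (coordForm η x x) := by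
    rw [← he']
    exact contDiffAt_map_inverse e'
  have h6 := (h5.contMDiffAt.comp x h).clm_apply (contMDiffAt_const (c := c))
  refine h6.congr_of_eventuallyEq ?_
  filter_upwards [h3] with y hy
  have hc := Trivialization.coe_continuousLinearEquivAt_eq' (R := ℝ)
    (trivializationAt F (TangentSpace 𝓘(ℝ, F)) x) hy
  simp only [Function.comp_apply]
  rw [h4 y hy _ hc, ContinuousLinearMap.inverse_comp_equiv]
  rfl

variable {ι : Type*} [Fintype ι]

theorem isInvertible_frameMap_iff [FiniteDimensional ℝ F]
    (hι : Fintype.card ι = Module.finrank ℝ F) (V : ι → ∀ x : X, TangentSpace 𝓘(ℝ, F) x) (x : X) :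
    (frameMap V x).IsInvertible ↔ LinearIndependent ℝ (fun i => V i x) := by
  have hinj : Function.Injective (frameMap V x) ↔ LinearIndependent ℝ (fun i => V i x) := by
    rw [Fintype.linearIndependent_iff, injective_iff_map_eq_zero]
    simp only [frameMap_apply]
    exact ⟨fun h c hc i => congrFun (h c hc) i, fun h c hc => funext (h c hc)⟩
  rw [← hinj]
  refine ⟨fun h => h.injective, fun h => ?_⟩
  have : FiniteDimensional ℝ (TangentSpace 𝓘(ℝ, F) x) := ‹FiniteDimensional ℝ F›
  have hd : Module.finrank ℝ (ι → ℝ) = Module.finrank ℝ (TangentSpace 𝓘(ℝ, F) x) := by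
    rw [Module.finrank_fintype_fun_eq_card, hι]; rfl
  have : T2Space (TangentSpace 𝓘(ℝ, F) x) := inferInstanceAs (T2Space F)
  refine ⟨(LinearEquiv.ofBijective (frameMap V x).toLinearMap ⟨h, ?_⟩).toContinuousLinearEquiv, ?_⟩
  · exact (LinearMap.injective_iff_surjective_of_finrank_eq_finrank hd).1 h
  · rfl

variable [CompleteSpace F] {U : Opens X}

/-- The five given fields as a family. -/
def five (R S T A B : SmoothField (F := F) U) (i : Fin 5) : ∀ x : X, TangentSpace 𝓘(ℝ, F) x :=
  extV ((![R, S, T, A, B] i).1)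

theorem smooth_five (R S T A B : SmoothField (F := F) U) (i : Fin 5) (x : U) :
    SmoothFieldAt (five R S T A B i) (x : X) := (![R, S, T, A, B] i).2 x

theorem frameMap_five (R S T A B : SmoothField (F := F) U) (x : U) (c : Fin 5 → ℝ) :
    frameMap (five R S T A B) x c =
      c 0 • R.1 x + c 1 • S.1 x + c 2 • T.1 x + c 3 • A.1 x + c 4 • B.1 x := by
  rw [frameMap_apply, Fin.sum_univ_five]
  simp [five]

theorem isFrame_of_isInvertible {R S T A B : SmoothField (F := F) U}
    (h : ∀ x : U, (frameMap (five R S T A B) (x : X)).IsInvertible) :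
    IsFrame (SmoothFun (F := F) U) R S T A B where
  span V := by
    have hs : ∀ (i : Fin 5), ∀ x ∈ U, ContMDiffAt 𝓘(ℝ, F) 𝓘(ℝ, ℝ) ∞
        (fun y => dualForm (five R S T A B) y (extV V.1 y) i) x := fun i x hx =>
      contMDiffAt_pi_space.1 ((smoothFormAt_dualForm (fun i => smooth_five R S T A B i ⟨x, hx⟩)
        (h ⟨x, hx⟩)).apply (V.2 ⟨x, hx⟩)) i
    refine ⟨SmoothFun.res U _ (hs 0), SmoothFun.res U _ (hs 1), SmoothFun.res U _ (hs 2),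
      SmoothFun.res U _ (hs 3), SmoothFun.res U _ (hs 4), ?_⟩
    ext x
    have := (h x).self_apply_inverse (V.1 x)
    rw [frameMap_five] at this
    refine this.symm.trans ?_
    simp only [← extV_coe V.1 x]
    rfl
  indep r s t a b e := by
    have h0 : ∀ x : U, ![r.1 x, s.1 x, t.1 x, a.1 x, b.1 x] = 0 := fun x => by
      apply (h x).injective
      rw [frameMap_five, map_zero]
      exact congrFun (congrArg Subtype.val e) x
    refine ⟨?_, ?_, ?_, ?_, ?_⟩ <;> ext x
    exacts [congrFun (h0 x) 0, congrFun (h0 x) 1, congrFun (h0 x) 2, congrFun (h0 x) 3,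
      congrFun (h0 x) 4]

/-- If one frame consists of pointwise independent fields, then all frames do. -/
theorem IsFrame.isInvertible [FiniteDimensional ℝ F] (h5 : Module.finrank ℝ F = 5)
    {R S T A B R' S' T' A' B' : SmoothField (F := F) U}
    (h : IsFrame (SmoothFun (F := F) U) R S T A B) (x : U)
    (h' : (frameMap (five R' S' T' A' B') (x : X)).IsInvertible) :
    (frameMap (five R S T A B) (x : X)).IsInvertible := by
  have : FiniteDimensional ℝ (TangentSpace 𝓘(ℝ, F) (x : X)) := ‹FiniteDimensional ℝ F›
  rw [isInvertible_frameMap_iff (by simp [h5])]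
  refine linearIndependent_of_top_le_span_of_card_eq_finrank ?_ (by rw [Fintype.card_fin, ← h5]; rfl)
  intro v _
  have key : ∀ V : SmoothField (F := F) U,
      V.1 x ∈ Submodule.span ℝ (Set.range fun i => five R S T A B i x) := by
    intro V
    obtain ⟨r, s, t, a, b, rfl⟩ := h.span V
    have m : ∀ i : Fin 5, (![R, S, T, A, B] i).1 x ∈
        Submodule.span ℝ (Set.range fun i => five R S T A B i x) := fun i =>
      Submodule.subset_span ⟨i, by simp [five]⟩
    exact Submodule.add_mem _ (Submodule.add_mem _ (Submodule.add_mem _ (Submodule.add_mem _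
      (Submodule.smul_mem _ (r.1 x) (m 0)) (Submodule.smul_mem _ (s.1 x) (m 1)))
      (Submodule.smul_mem _ (t.1 x) (m 2))) (Submodule.smul_mem _ (a.1 x) (m 3)))
      (Submodule.smul_mem _ (b.1 x) (m 4))
  obtain ⟨c, rfl⟩ := h'.surjective v
  rw [frameMap_five]
  exact Submodule.add_mem _ (Submodule.add_mem _ (Submodule.add_mem _ (Submodule.add_mem _
      (Submodule.smul_mem _ _ (key R')) (Submodule.smul_mem _ _ (key S')))
      (Submodule.smul_mem _ _ (key T'))) (Submodule.smul_mem _ _ (key A')))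
      (Submodule.smul_mem _ _ (key B'))

end LocalFrames

section Adapted
variable {E : Type*} [NormedAddCommGroup E] [NormedSpace ℝ E]
  {M : Type*} [TopologicalSpace M] [ChartedSpace E M] [IsManifold 𝓘(ℝ, E) ∞ M] {U V : Opens M}

/-! ### Adapted generators -/

theorem IsLocalGenerator.of_smul {L : ∀ x : M, Submodule ℂ (CTangent E x)} {U₀ U : Set M}
    {Z Z' : ComplexField E M} (h : IsLocalGenerator L U₀ Z) (hU : IsOpen U) (hs : U ⊆ U₀)
    (hZ' : Z'.SmoothOn U) (c : M → ℂ) (hc : ∀ x ∈ U, c x ≠ 0 ∧ Z'.val x = c x • Z.val x) :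
    IsLocalGenerator L U Z' where
  isOpen := hU
  smooth := hZ'
  ne_zero x hx := by
    rw [(hc x hx).2]; exact smul_ne_zero (hc x hx).1 (h.ne_zero x (hs hx))
  span_eq x hx := by
    rw [h.span_eq x (hs hx), (hc x hx).2,
      Submodule.span_singleton_smul_eq (IsUnit.mk0 _ (hc x hx).1)]

/-- The complex field `A - i B`. -/
def gen (A B : SmoothField (F := E) U) : ComplexField E M := ⟨extV A.1, fun x => -extV B.1 x⟩

theorem gen_on (A B : SmoothField (F := E) U) : (gen A B).On A (-B) := fun x =>
  ⟨extV_coe _ x, congrArg Neg.neg (extV_coe B.1 x)⟩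

theorem gen_val (A B : SmoothField (F := E) U) (x : U) :
    (gen A B).val (x : M) = (1 : ℂ) ⊗ₜ[ℝ] A.1 x - Complex.I ⊗ₜ[ℝ] B.1 x := by
  unfold ComplexField.val
  rw [(gen_on A B x).1, (gen_on A B x).2, sub_eq_add_neg, ← TensorProduct.tmul_neg]
  rfl

theorem gen_smoothOn (A B : SmoothField (F := E) U) : (gen A B).SmoothOn U :=
  ⟨fun x hx => ContMDiffAt.contMDiffWithinAt (A.2 ⟨x, hx⟩), fun x hx =>
    ContMDiffAt.contMDiffWithinAt (SmoothFieldAt.congr ((-B).2 ⟨x, hx⟩)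
      (eventually_coe (⟨x, hx⟩ : U) fun y => by
        rw [extV_coe]; exact congrArg Neg.neg (extV_coe B.1 y)))⟩

/-- Every local generator has the form `A - i B` with smooth real fields `A`, `B`. -/
theorem exists_gen {L : ∀ x : M, Submodule ℂ (CTangent E x)} {U₀ : Set M} {Z : ComplexField E M}
    (h : IsLocalGenerator L U₀ Z) :
    ∃ A B : SmoothField (F := E) (⟨U₀, h.isOpen⟩ : Opens M), IsLocalGenerator L U₀ (gen A B) ∧
      Z.On A (-B) := by
  have h1 : ∀ x ∈ (⟨U₀, h.isOpen⟩ : Opens M), SmoothFieldAt Z.re x := fun x hx =>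
    (h.smooth.1 x hx).contMDiffAt (h.isOpen.mem_nhds hx)
  have h2 : ∀ x ∈ (⟨U₀, h.isOpen⟩ : Opens M), SmoothFieldAt Z.im x := fun x hx =>
    (h.smooth.2 x hx).contMDiffAt (h.isOpen.mem_nhds hx)
  have h3 : Z.On (SmoothField.res _ Z.re h1) (- -SmoothField.res _ Z.im h2) := fun x =>
    ⟨rfl, (neg_neg (Z.im (x : M))).symm⟩
  refine ⟨_, _, h.of_smul h.isOpen subset_rfl (gen_smoothOn _ _) (fun _ => 1) fun x hx =>
    ⟨one_ne_zero, ?_⟩, h3⟩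
  have h4 := gen_on (SmoothField.res _ Z.re h1) (-SmoothField.res _ Z.im h2) ⟨x, hx⟩
  unfold ComplexField.val
  rw [h4.1, h4.2, ← (h3 ⟨x, hx⟩).1, ← (h3 ⟨x, hx⟩).2, one_smul]

/-- Multiplication of `a - i b` by `p + i q`. -/
theorem tmul_rotate {T : Type*} [AddCommGroup T] [Module ℝ T] (a b : T) (p q : ℝ) :
    (1 : ℂ) ⊗ₜ[ℝ] (p • a + q • b) - Complex.I ⊗ₜ[ℝ] (-q • a + p • b) =
      (⟨p, q⟩ : ℂ) • ((1 : ℂ) ⊗ₜ[ℝ] a - Complex.I ⊗ₜ[ℝ] b) := by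
  have e1 : (⟨p, q⟩ : ℂ) = p • (1 : ℂ) + q • Complex.I := by apply Complex.ext <;> simp
  have e2 : (⟨p, q⟩ : ℂ) * Complex.I = p • Complex.I - q • (1 : ℂ) := by apply Complex.ext <;> simp
  rw [smul_sub, TensorProduct.smul_tmul', TensorProduct.smul_tmul', smul_eq_mul, smul_eq_mul,
    mul_one, e2, e1, TensorProduct.add_tmul, TensorProduct.sub_tmul, TensorProduct.tmul_add,
    TensorProduct.tmul_add, ← TensorProduct.smul_tmul', ← TensorProduct.smul_tmul',
    ← TensorProduct.smul_tmul', ← TensorProduct.smul_tmul', TensorProduct.tmul_smul,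
    TensorProduct.tmul_smul, TensorProduct.tmul_smul, TensorProduct.tmul_smul]
  module

theorem gen_val_rotate (A B A' B' : SmoothField (F := E) U) (p q : ℝ) (x : U)
    (hA : A'.1 x = p • A.1 x + q • B.1 x) (hB : B'.1 x = -q • A.1 x + p • B.1 x) :
    (gen A' B').val (x : M) = (⟨p, q⟩ : ℂ) • (gen A B).val (x : M) := by
  rw [gen_val, gen_val, hA, hB, tmul_rotate]

/-- Multiplication of a local generator by a function `p + i q` without zeros. -/
theorem IsLocalGenerator.gen_rotate {L : ∀ x : M, Submodule ℂ (CTangent E x)}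
    {A B : SmoothField (F := E) U} (h : IsLocalGenerator L U (gen A B))
    (p q : SmoothFun (F := E) U) (hpq : ∀ x : U, p.1 x ≠ 0 ∨ q.1 x ≠ 0) :
    IsLocalGenerator L U (gen (p • A + q • B) (-q • A + p • B)) := by
  refine h.of_smul U.isOpen subset_rfl (gen_smoothOn _ _) (fun x => ⟨extF p.1 x, extF q.1 x⟩)
    fun x hx => ⟨fun h0 => ?_, ?_⟩
  · have h1 := congrArg Complex.re h0
    have h2 := congrArg Complex.im h0
    simp only [Complex.zero_re, Complex.zero_im] at h1 h2
    have h3 := hpq ⟨x, hx⟩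
    rw [← extF_coe p.1 ⟨x, hx⟩, ← extF_coe q.1 ⟨x, hx⟩] at h3
    tauto
  · have := gen_val_rotate A B (p • A + q • B) (-q • A + p • B) (p.1 ⟨x, hx⟩) (q.1 ⟨x, hx⟩) ⟨x, hx⟩
      rfl rfl
    rwa [← extF_coe p.1 ⟨x, hx⟩, ← extF_coe q.1 ⟨x, hx⟩] at this

/-- Restriction of vector fields to a smaller open set. -/
def SmoothField.restr (h : V ≤ U) (W : SmoothField (F := E) U) : SmoothField (F := E) V :=
  ⟨fun x => W.1 ⟨x, h x.2⟩, fun x => (W.2 ⟨x, h x.2⟩).congr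
    (eventually_coe x fun y => by rw [extV_coe, ← extV_coe W.1 ⟨y, h y.2⟩])⟩

theorem SmoothField.extV_restr (h : V ≤ U) (W : SmoothField (F := E) U) (y : V) :
    extV (SmoothField.restr h W).1 (y : M) = extV W.1 y := by
  rw [extV_coe, extV_coe W.1 ⟨y, h y.2⟩]; rfl

theorem IsLocalGenerator.gen_restr {L : ∀ x : M, Submodule ℂ (CTangent E x)} (hVU : V ≤ U)
    {A B : SmoothField (F := E) U} (h : IsLocalGenerator L U (gen A B)) :
    IsLocalGenerator L V (gen (SmoothField.restr hVU A) (SmoothField.restr hVU B)) := by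
  refine h.of_smul V.isOpen hVU (gen_smoothOn _ _) (fun _ => 1) fun x hx => ⟨one_ne_zero, ?_⟩
  rw [one_smul, gen_val _ _ ⟨x, hx⟩]
  exact (gen_val A B ⟨x, hVU hx⟩).symm

variable [CompleteSpace E]

theorem SmoothField.restr_lie (hVU : V ≤ U) (A B : SmoothField (F := E) U) :
    SmoothField.restr hVU ⁅A, B⁆ = ⁅SmoothField.restr hVU A, SmoothField.restr hVU B⁆ := by
  ext x
  exact (mlieBracket_congr (U := V) x (fun y => SmoothField.extV_restr hVU A y)
    fun y => SmoothField.extV_restr hVU B y).symm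

end Adapted

/-! ### Existence of normal frames -/

section Rotation
variable {𝔽 𝔛 : Type*} [CommRing 𝔽] [LieRing 𝔛] [Module 𝔽 𝔛] {D : 𝔛 → 𝔽 → 𝔽}

/-- If `[B, T] ≡ α [A, T]` modulo `T, A, B`, then the rotated pair `(A + α B, -α A + B)` satisfies
`[B', T'] ≡ 0` modulo `T', A', B'`. -/
theorem lie_rotated (hD : IsAnchor D) {A B T P A' B' T' : 𝔛} {α t a b w : 𝔽} (hAB : ⁅A, B⁆ = -T)
    (hAT : ⁅A, T⁆ = P) (hBT : ⁅B, T⁆ = α • P + t • T + a • A + b • B) (hA : A' = A + α • B)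
    (hB : B' = -α • A + B) (hT : T' = -⁅A', B'⁆) (hw : w * (1 + α * α) = 1) :
    ∃ β y₁ y₂ : 𝔽, ⁅B', T'⁆ = β • T' + y₁ • A' + y₂ • B' := by
  have hBA : ⁅B, A⁆ = T := by rw [← lie_skew, hAB, neg_neg]
  have hBA' : ⁅B', A'⁆ = T' := by rw [hT, lie_skew]
  have hA'A : ⁅A', A⁆ = α • T - D A α • B := by
    rw [hA, add_lie, lie_self, hD.smul_lie, hBA, zero_add]
  have hA'B : ⁅A', B⁆ = -T - D B α • B := by
    rw [hA, add_lie, hD.smul_lie, lie_self, hAB]; module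
  obtain ⟨m, n, hT'⟩ : ∃ m n : 𝔽, T' = (1 + α * α) • T + m • A + n • B := by
    refine ⟨-D A' (-α), D B α - α * D A α, ?_⟩
    rw [hT, hB, lie_add, hD.lie_smul, hA'A, hA'B]; module
  have hB'T : ⁅B', T⁆ = t • T + (a - D T (-α)) • A + b • B := by
    rw [hB, add_lie, hD.smul_lie, hAT, hBT]; module
  have hB'A : ⁅B', A⁆ = T - D A (-α) • A := by
    rw [hB, add_lie, hD.smul_lie, lie_self, hBA]; module
  have hB'B : ⁅B', B⁆ = α • T - D B (-α) • A := by
    rw [hB, add_lie, hD.smul_lie, lie_self, hAB]; module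
  have hw' := hw
  obtain ⟨u, hu⟩ : ∃ u, u = 1 + α * α := ⟨_, rfl⟩
  rw [← hu] at hT' hw
  obtain ⟨c, d, e, h1⟩ : ∃ c d e : 𝔽, ⁅B', T'⁆ = c • T + d • A + e • B := by
    refine ⟨u * t + D B' u + m + n * α, u * (a - D T (-α)) - m * D A (-α) + D B' m - n * D B (-α),
      u * b + D B' n, ?_⟩
    rw [hT']
    simp only [lie_add, hD.lie_smul, hB'T, hB'A, hB'B]
    module
  have eT : T = w • (T' - m • A - n • B) := by
    rw [hT']; linear_combination (norm := module) (-hw) • T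
  have eA : A = w • (A' - α • B') := by
    rw [hA, hB]; linear_combination (norm := module) (-hw') • A
  have eB : B = w • (α • A' + B') := by
    rw [hA, hB]; linear_combination (norm := module) (-hw') • B
  obtain ⟨f, g, h2⟩ : ∃ f g : 𝔽, c • T + d • A + e • B = (c * w) • T' + f • A + g • B :=
    ⟨d - c * w * m, e - c * w * n, by linear_combination (norm := module) c • eT⟩
  refine ⟨c * w, w * (f + g * α), w * (g - f * α), ?_⟩
  rw [h1, h2]
  linear_combination (norm := module) f • eA + g • eB

/-- The brackets which enter the rank conditions, in terms of a relation
`[B, T] = β T + y₁ A + y₂ B`. -/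
theorem lie_adapted (hD : IsAnchor D) {A B T S : 𝔛} {β y₁ y₂ : 𝔽} (hAB : ⁅A, B⁆ = -T)
    (hAT : ⁅A, T⁆ = S) (hBT : ⁅B, T⁆ = β • T + y₁ • A + y₂ • B) :
    ⁅B, S⁆ = β • S + (D A β - y₂) • T + D A y₁ • A + D A y₂ • B ∧
    ⁅A, β • T + y₁ • A + y₂ • B⁆ = β • S + (D A β - y₂) • T + D A y₁ • A + D A y₂ • B ∧
    ⁅B, β • T + y₁ • A + y₂ • B⁆ = (0 : 𝔽) • S + (β * β + D B β + y₁) • T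
      + (β * y₁ + D B y₁) • A + (β * y₂ + D B y₂) • B := by
  have hBA : ⁅B, A⁆ = T := by rw [← lie_skew, hAB, neg_neg]
  refine ⟨?_, ?_, ?_⟩
  · rw [← hAT, leibniz_lie, hBA, hBT]
    simp only [lie_add, hD.lie_smul A, lie_self, hAT, hAB]
    module
  · simp only [lie_add, hD.lie_smul A, lie_self, hAT, hAB]
    module
  · simp only [lie_add, hD.lie_smul B, lie_self, hBT, hBA]
    module
end Rotation

section Adapted
variable {E : Type*} [NormedAddCommGroup E] [NormedSpace ℝ E] [FiniteDimensional ℝ E]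
  [CompleteSpace E]
  {M : Type*} [TopologicalSpace M] [ChartedSpace E M] [IsManifold 𝓘(ℝ, E) ∞ M]
  {C : CRStructure E M}

/-- Near each point there is a local generator `A - i B` for which `A, B, T, [A, T]` are independent
there, where `T = -[A, B]`. For any generator `[A, T]` or `[B, T]` is independent of `A, B, T`; in the
second case the generator is replaced by `i (A - i B) = B + i A`. -/
theorem exists_gen_indep (hC : C.IsClassIII2) (x₀ : M) :
    ∃ (U : Opens M) (hx : x₀ ∈ U) (A B : SmoothField (F := E) U),
      IsLocalGenerator C.L U (gen A B) ∧
      LinearIndependent ℝ ![⁅A, -⁅A, B⁆⁆.1 ⟨x₀, hx⟩, (-⁅A, B⁆).1 ⟨x₀, hx⟩, A.1 ⟨x₀, hx⟩,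
        B.1 ⟨x₀, hx⟩] := by
  have : FiniteDimensional ℝ (TangentSpace 𝓘(ℝ, E) x₀) := ‹FiniteDimensional ℝ E›
  obtain ⟨U₀, Z, hx, hZ⟩ := C.exists_generator x₀
  obtain ⟨A, B, hg, -⟩ := exists_gen hZ
  obtain ⟨U, hU⟩ : ∃ U : Opens M, U = ⟨U₀, hZ.isOpen⟩ := ⟨_, rfl⟩
  have hx' : x₀ ∈ U := hU ▸ hx
  have key : ∀ A B : SmoothField (F := E) U, IsLocalGenerator C.L U (gen A B) →
      ⁅A, -⁅A, B⁆⁆.1 ⟨x₀, hx'⟩ ∉ Submodule.span ℝ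
        (Set.range ![(-⁅A, B⁆).1 ⟨x₀, hx'⟩, A.1 ⟨x₀, hx'⟩, B.1 ⟨x₀, hx'⟩]) →
      LinearIndependent ℝ ![⁅A, -⁅A, B⁆⁆.1 ⟨x₀, hx'⟩, (-⁅A, B⁆).1 ⟨x₀, hx'⟩, A.1 ⟨x₀, hx'⟩,
        B.1 ⟨x₀, hx'⟩] := by
    intro A B h hn
    refine linearIndependent_finCons.2 ⟨?_, hn⟩
    rw [linearIndependent_iff_card_le_finrank_span, Fintype.card_fin]
    have m : ∀ i, ![(-⁅A, B⁆).1 ⟨x₀, hx'⟩, A.1 ⟨x₀, hx'⟩, B.1 ⟨x₀, hx'⟩] i ∈ Submodule.span ℝ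
        (Set.range ![(-⁅A, B⁆).1 ⟨x₀, hx'⟩, A.1 ⟨x₀, hx'⟩, B.1 ⟨x₀, hx'⟩]) := fun i =>
      Submodule.subset_span ⟨i, rfl⟩
    exact class_T (x := ⟨x₀, hx'⟩) hC h (gen_on A B) rfl _ (m 1) (m 2) (m 0)
  subst hU
  have hg' : IsLocalGenerator C.L ((⟨U₀, hZ.isOpen⟩ : Opens M) : Set M) (gen A B) := hg
  -- if `[A, T]` is a combination of `T, A, B`, then `[B, T]` is not, since these fields span four
  -- dimensions; the pair `(B, -A)` then has the required property
  by_cases hn : ⁅A, -⁅A, B⁆⁆.1 ⟨x₀, hx'⟩ ∈ Submodule.span ℝ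
        (Set.range ![(-⁅A, B⁆).1 ⟨x₀, hx'⟩, A.1 ⟨x₀, hx'⟩, B.1 ⟨x₀, hx'⟩])
  · refine ⟨_, hx', B, -A, ?_, key B (-A) ?_ ?_⟩
    · have := hg'.gen_rotate 0 1 (fun x => Or.inr one_ne_zero)
      rwa [zero_smul, one_smul, zero_add, neg_smul, one_smul, zero_smul, add_zero] at this
    · have := hg'.gen_rotate 0 1 (fun x => Or.inr one_ne_zero)
      rwa [zero_smul, one_smul, zero_add, neg_smul, one_smul, zero_smul, add_zero] at this
    · intro hn'
      have e : -⁅B, -A⁆ = -⁅A, B⁆ := by rw [lie_neg, neg_neg, lie_skew]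
      rw [e] at hn'
      obtain ⟨K, hK⟩ : ∃ K, K = Submodule.span ℝ
        (Set.range ![(-⁅A, B⁆).1 ⟨x₀, hx'⟩, A.1 ⟨x₀, hx'⟩, B.1 ⟨x₀, hx'⟩]) := ⟨_, rfl⟩
      have hK' : Submodule.span ℝ (Set.range ![(-⁅A, B⁆).1 ⟨x₀, hx'⟩, B.1 ⟨x₀, hx'⟩,
          (-A).1 ⟨x₀, hx'⟩]) ≤ K := by
        rw [Submodule.span_le, hK]
        rintro _ ⟨i, rfl⟩
        fin_cases i
        · exact Submodule.subset_span ⟨0, rfl⟩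
        · exact Submodule.subset_span ⟨2, rfl⟩
        · exact Submodule.neg_mem _ (Submodule.subset_span ⟨1, rfl⟩)
      have hQ := hK' hn'
      rw [← hK] at hn
      have m : ∀ i, ![(-⁅A, B⁆).1 ⟨x₀, hx'⟩, A.1 ⟨x₀, hx'⟩, B.1 ⟨x₀, hx'⟩] i ∈ K := fun i =>
        hK ▸ Submodule.subset_span ⟨i, rfl⟩
      have h4 := class_S (x := ⟨x₀, hx'⟩) hC hg (gen_on A B) rfl rfl rfl K (m 1) (m 2) (m 0) hn hQ
      have h3 : Module.finrank ℝ K ≤ 3 := by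
        rw [hK]; exact finrank_range_le_card (R := ℝ)
          ![(-⁅A, B⁆).1 ⟨x₀, hx'⟩, A.1 ⟨x₀, hx'⟩, B.1 ⟨x₀, hx'⟩]
      omega
  · exact ⟨_, hx', A, B, hg, key A B hg hn⟩

theorem coeff_mem {U : Opens M} {x : U} (K : Submodule ℝ (TangentSpace 𝓘(ℝ, E) (x : M)))
    {V S T A B : SmoothField (F := E) U} {s t a b : SmoothFun (F := E) U}
    (h : V = s • S + t • T + a • A + b • B) (hS : S.1 x ∈ K) (hT : T.1 x ∈ K) (hA : A.1 x ∈ K)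
    (hB : B.1 x ∈ K) : V.1 x ∈ K := by
  rw [h]
  exact K.add_mem (K.add_mem (K.add_mem (K.smul_mem (s.1 x) hS) (K.smul_mem (t.1 x) hT))
    (K.smul_mem (a.1 x) hA)) (K.smul_mem (b.1 x) hB)

theorem isInvertible_five_iff (hE : Module.finrank ℝ E = 5) {U : Opens M}
    (R S T A B : SmoothField (F := E) U) (x : U) :
    (frameMap (five R S T A B) (x : M)).IsInvertible ↔
      LinearIndependent ℝ ![R.1 x, S.1 x, T.1 x, A.1 x, B.1 x] := by
  rw [isInvertible_frameMap_iff (by simp [hE])]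
  have : (fun i => five R S T A B i (x : M)) = ![R.1 x, S.1 x, T.1 x, A.1 x, B.1 x] := by
    funext i; fin_cases i <;> simp [five]
  rw [this]

theorem SmoothFun.exists_inverse {U : Opens M} (f : SmoothFun (F := E) U) (hf : ∀ x, f.1 x ≠ 0) :
    ∃ w : SmoothFun (F := E) U, w * f = 1 := by
  refine ⟨⟨fun x => (f.1 x)⁻¹, fun x => ?_⟩, ?_⟩
  · refine (ContMDiffAt.inv₀ (f.2 x) (by rw [extF_coe]; exact hf x)).congr_of_eventuallyEq
      (eventually_coe x fun y => by simp)
  · ext x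
    exact inv_mul_cancel₀ (hf x)

/-- A local generator `A - i B` of `L` such that `[B, [A, B]]` is a combination of `[A, [A, B]]`,
`[A, B]`, `A` and `B`: the rank of `(ℒ, ℒ̄, 𝒯, 𝒮, 𝒮̄)` is four. -/
theorem exists_adapted (hE : Module.finrank ℝ E = 5) (hC : C.IsClassIII2) (x₀ : M) :
    ∃ (U : Opens M) (_ : x₀ ∈ U) (A B : SmoothField (F := E) U) (α t a b : SmoothFun (F := E) U),
      IsLocalGenerator C.L U (gen A B) ∧
      ⁅B, -⁅A, B⁆⁆ = α • ⁅A, -⁅A, B⁆⁆ + t • -⁅A, B⁆ + a • A + b • B := by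
  have : FiniteDimensional ℝ (TangentSpace 𝓘(ℝ, E) x₀) := ‹FiniteDimensional ℝ E›
  obtain ⟨U, hx, A, B, hg, hi⟩ := exists_gen_indep hC x₀
  -- an auxiliary field `Y₀` completes `A, B, T, [A, T]` to a frame near `x₀`; the component of `[B, T]`
  -- along it vanishes, as otherwise the five fields `A, B, T, [A, T], [B, T]` would have rank five
  obtain ⟨v, hv⟩ : ∃ v : TangentSpace 𝓘(ℝ, E) x₀, v ∉ Submodule.span ℝ (Set.range
      ![⁅A, -⁅A, B⁆⁆.1 ⟨x₀, hx⟩, (-⁅A, B⁆).1 ⟨x₀, hx⟩, A.1 ⟨x₀, hx⟩, B.1 ⟨x₀, hx⟩]) := by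
    by_contra! h
    have h4 : Module.finrank ℝ (Submodule.span ℝ (Set.range
      ![⁅A, -⁅A, B⁆⁆.1 ⟨x₀, hx⟩, (-⁅A, B⁆).1 ⟨x₀, hx⟩, A.1 ⟨x₀, hx⟩, B.1 ⟨x₀, hx⟩])) ≤ 4 :=
      finrank_range_le_card (R := ℝ) _
    rw [Submodule.eq_top_iff'.2 h, finrank_top] at h4
    exact absurd (hE.ge.trans h4) (by norm_num)
  obtain ⟨Y₀, hY₀, rfl⟩ := exists_smoothFieldAt x₀ v
  obtain ⟨P, hP⟩ : ∃ P, P = ⁅A, -⁅A, B⁆⁆ := ⟨_, rfl⟩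
  obtain ⟨Y₁, hY₁⟩ : ∃ Y₁ : Fin 5 → ∀ x : M, TangentSpace 𝓘(ℝ, E) x,
    Y₁ = ![Y₀, extV P.1, extV (-⁅A, B⁆).1, extV A.1, extV B.1] := ⟨_, rfl⟩
  have hsm : ∀ᶠ x in nhds x₀, (∀ i, SmoothFieldAt (Y₁ i) x) ∧ x ∈ U := by
    filter_upwards [hY₀, U.isOpen.mem_nhds hx] with x hx1 hx2
    refine ⟨fun i => ?_, hx2⟩
    rw [hY₁]
    fin_cases i
    exacts [hx1, P.2 ⟨x, hx2⟩, (-⁅A, B⁆).2 ⟨x, hx2⟩, A.2 ⟨x, hx2⟩, B.2 ⟨x, hx2⟩]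
  have hinv : (frameMap Y₁ x₀).IsInvertible := by
    rw [isInvertible_frameMap_iff (by simp [hE])]
    have e : (fun i => Y₁ i x₀) = ![Y₀ x₀, ⁅A, -⁅A, B⁆⁆.1 ⟨x₀, hx⟩, (-⁅A, B⁆).1 ⟨x₀, hx⟩,
        A.1 ⟨x₀, hx⟩, B.1 ⟨x₀, hx⟩] := by
      funext i
      rw [hY₁, hP]
      fin_cases i
      exacts [rfl, extV_coe _ ⟨x₀, hx⟩, extV_coe _ ⟨x₀, hx⟩, extV_coe _ ⟨x₀, hx⟩,
        extV_coe _ ⟨x₀, hx⟩]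
    rw [e]
    exact linearIndependent_finCons.2 ⟨hi, hv⟩
  have hev := hsm.and (eventually_isInvertible_frameMap hsm.self_of_nhds.1 hinv)
  obtain ⟨V₀, hV₀, hVo, hxV⟩ := mem_nhds_iff.1 hev
  obtain ⟨V, rfl⟩ : ∃ V : Opens M, (V : Set M) = V₀ := ⟨⟨V₀, hVo⟩, rfl⟩
  have hVU : V ≤ U := fun x hx => (hV₀ hx).1.2
  have hY : ∀ x ∈ V, SmoothFieldAt Y₀ x := fun x hx => by
    have := (hV₀ hx).1.1 0
    rwa [hY₁] at this
  obtain ⟨A', hA'⟩ : ∃ A', A' = SmoothField.restr hVU A := ⟨_, rfl⟩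
  obtain ⟨B', hB'⟩ : ∃ B', B' = SmoothField.restr hVU B := ⟨_, rfl⟩
  have hT' : -⁅A', B'⁆ = SmoothField.restr hVU (-⁅A, B⁆) := by
    rw [hA', hB', ← SmoothField.restr_lie]; rfl
  have hP' : ⁅A', -⁅A', B'⁆⁆ = SmoothField.restr hVU P := by
    rw [hT', hA', hP, SmoothField.restr_lie]
  have hg' : IsLocalGenerator C.L V (gen A' B') := by rw [hA', hB']; exact hg.gen_restr hVU
  have hfi : ∀ x : V, (frameMap (five (SmoothField.res V Y₀ hY) ⁅A', -⁅A', B'⁆⁆ (-⁅A', B'⁆) A' B')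
      (x : M)).IsInvertible := fun x => by
    have h := (hV₀ x.2).2
    have e : frameMap (five (SmoothField.res V Y₀ hY) ⁅A', -⁅A', B'⁆⁆ (-⁅A', B'⁆) A' B') (x : M)
        = frameMap Y₁ (x : M) := by
      ext c
      rw [frameMap_five, frameMap_apply, Fin.sum_univ_five, hP', hT', hA', hB', hY₁]
      have e : ∀ W : SmoothField (F := E) U, (SmoothField.restr hVU W).1 x = extV W.1 x := fun W => by
        rw [← SmoothField.extV_restr hVU, extV_coe]
      rw [e, e, e, e]
      rfl
    rw [e]; exact h
  obtain ⟨y, α, t, a, b, hQ⟩ := (isFrame_of_isInvertible hfi).span ⁅B', -⁅A', B'⁆⁆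
  have hy : y = 0 := by
    ext x
    by_contra hne
    have hne : y.1 x ≠ 0 := hne
    have h4 := class_conj (x := x) hC hg' (gen_on A' B') rfl rfl rfl
    have : FiniteDimensional ℝ (TangentSpace 𝓘(ℝ, E) (x : M)) := ‹FiniteDimensional ℝ E›
    obtain ⟨K, hK⟩ : ∃ K, K = Submodule.span ℝ ({A'.1 x, B'.1 x, (-⁅A', B'⁆).1 x,
      ⁅A', -⁅A', B'⁆⁆.1 x, ⁅B', -⁅A', B'⁆⁆.1 x} : Set (TangentSpace 𝓘(ℝ, E) (x : M))) := ⟨_, rfl⟩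
    rw [← hK] at h4
    have hAK : A'.1 x ∈ K := hK ▸ Submodule.subset_span (by simp)
    have hBK : B'.1 x ∈ K := hK ▸ Submodule.subset_span (by simp)
    have hTK : (-⁅A', B'⁆).1 x ∈ K := hK ▸ Submodule.subset_span (by simp)
    have hPK : ⁅A', -⁅A', B'⁆⁆.1 x ∈ K := hK ▸ Submodule.subset_span (by simp)
    have hQK : ⁅B', -⁅A', B'⁆⁆.1 x ∈ K := hK ▸ Submodule.subset_span (by simp)
    have hR : (α • ⁅A', -⁅A', B'⁆⁆ + t • -⁅A', B'⁆ + a • A' + b • B').1 x ∈ K :=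
      coeff_mem K rfl hPK hTK hAK hBK
    have hyY : y.1 x • Y₀ x ∈ K := by
      have h6 : (⁅B', -⁅A', B'⁆⁆ - (α • ⁅A', -⁅A', B'⁆⁆ + t • -⁅A', B'⁆ + a • A' + b • B')).1 x
          ∈ K := K.sub_mem hQK hR
      have h7 : ⁅B', -⁅A', B'⁆⁆ - (α • ⁅A', -⁅A', B'⁆⁆ + t • -⁅A', B'⁆ + a • A' + b • B')
          = y • SmoothField.res V Y₀ hY := by
        rw [hQ]; module
      rw [h7] at h6
      exact h6
    have hYK : Y₀ x ∈ K := (K.smul_mem_iff hne).1 hyY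
    have htop : K = ⊤ := by
      rw [Submodule.eq_top_iff']
      intro v
      obtain ⟨c, rfl⟩ := (hfi x).surjective v
      rw [frameMap_five]
      exact K.add_mem (K.add_mem (K.add_mem (K.add_mem (K.smul_mem _ hYK) (K.smul_mem _ hPK))
        (K.smul_mem _ hTK)) (K.smul_mem _ hAK)) (K.smul_mem _ hBK)
    rw [htop, finrank_top] at h4
    have : Module.finrank ℝ (TangentSpace 𝓘(ℝ, E) (x : M)) = 5 := hE
    omega
  rw [hy, zero_smul, zero_add] at hQ
  exact ⟨V, hxV, A', B', α, t, a, b, hg', hQ⟩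

/-- If `[B, T] ≡ 0` modulo `T, A, B`, then `A`, `B`, `T`, `[A, T]` and `[A, [A, T]]` are independent:
they span all fields that enter the rank condition on `ℛ`. -/
theorem isInvertible_adapted (hE : Module.finrank ℝ E = 5) (hC : C.IsClassIII2) {U : Opens M}
    {R S T A B : SmoothField (F := E) U} {β y₁ y₂ : SmoothFun (F := E) U}
    (hg : IsLocalGenerator C.L U (gen A B)) (hT : T = -⁅A, B⁆) (hS : ⁅A, T⁆ = S) (hR : ⁅A, S⁆ = R)
    (hBT : ⁅B, T⁆ = β • T + y₁ • A + y₂ • B) (x : U) :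
    (frameMap (five R S T A B) (x : M)).IsInvertible := by
  have hAB : ⁅A, B⁆ = -T := by rw [hT, neg_neg]
  obtain ⟨h1, h2, h3⟩ := lie_adapted SmoothField.isAnchor_deriv hAB hS hBT
  have : FiniteDimensional ℝ (TangentSpace 𝓘(ℝ, E) (x : M)) := ‹FiniteDimensional ℝ E›
  rw [isInvertible_five_iff hE, linearIndependent_iff_card_le_finrank_span, Fintype.card_fin]
  obtain ⟨K, hK⟩ : ∃ K, K = Submodule.span ℝ (Set.range ![R.1 x, S.1 x, T.1 x, A.1 x, B.1 x]) :=
    ⟨_, rfl⟩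
  change 5 ≤ Module.finrank ℝ (Submodule.span ℝ (Set.range ![R.1 x, S.1 x, T.1 x, A.1 x, B.1 x]))
  rw [← hK]
  have m : ∀ i, ![R.1 x, S.1 x, T.1 x, A.1 x, B.1 x] i ∈ K := fun i =>
    hK ▸ Submodule.subset_span ⟨i, rfl⟩
  have mR : R.1 x ∈ K := m 0
  have mS : S.1 x ∈ K := m 1
  have mT : T.1 x ∈ K := m 2
  have mA : A.1 x ∈ K := m 3
  have mB : B.1 x ∈ K := m 4
  have hBT' : ⁅B, T⁆ = (0 : SmoothFun (F := E) U) • S + β • T + y₁ • A + y₂ • B := by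
    rw [hBT, zero_smul, zero_add]
  rw [← hBT] at h2 h3
  exact class_R (x := x) hC hg (gen_on A B) hT hS.symm rfl K mA mB mT mS
    (coeff_mem K hBT' mS mT mA mB) (hR ▸ mR) (coeff_mem K h2 mS mT mA mB)
    (coeff_mem K h1 mS mT mA mB) (coeff_mem K h3 mS mT mA mB)

/-- Near each point there is a normal frame whose fields `A, B` give a generator of `L`. -/
theorem exists_normalFrame (hE : Module.finrank ℝ E = 5) (hC : C.IsClassIII2) (x₀ : M) :
    ∃ (U : Opens M) (_ : x₀ ∈ U) (R S T A B : SmoothField (F := E) U)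
      (μ ν j : SmoothFun (F := E) U), IsLocalGenerator C.L U (gen A B) ∧
      (∀ x : U, (frameMap (five R S T A B) (x : M)).IsInvertible) ∧
      IsNormalFrame R S T A B μ ν j := by
  obtain ⟨U, hx, A₀, B₀, α, t, a, b, hg₀, hQ₀⟩ := exists_adapted hE hC x₀
  obtain ⟨w, hw⟩ := SmoothFun.exists_inverse (1 + α * α) (fun x => by
    have : (0 : ℝ) < 1 + α.1 x * α.1 x := by nlinarith [mul_self_nonneg (α.1 x)]
    exact this.ne')
  -- the generator `(1 + i α) (A₀ - i B₀)`
  have hg := hg₀.gen_rotate 1 α (fun x => Or.inl one_ne_zero)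
  rw [one_smul, one_smul] at hg
  obtain ⟨A, hA⟩ : ∃ A, A = A₀ + α • B₀ := ⟨_, rfl⟩
  obtain ⟨B, hB⟩ : ∃ B, B = -α • A₀ + B₀ := ⟨_, rfl⟩
  rw [← hA, ← hB] at hg
  have hAB₀ : ⁅A₀, B₀⁆ = - -⁅A₀, B₀⁆ := by rw [neg_neg]
  obtain ⟨β, y₁, y₂, hBT⟩ := lie_rotated (SmoothField.isAnchor_deriv (F := E) (U := U)) hAB₀ rfl hQ₀
    hA hB rfl hw
  obtain ⟨T, hT⟩ : ∃ T, T = -⁅A, B⁆ := ⟨_, rfl⟩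
  obtain ⟨S, hS⟩ : ∃ S, ⁅A, T⁆ = S := ⟨_, rfl⟩
  obtain ⟨R, hR⟩ : ∃ R, ⁅A, S⁆ = R := ⟨_, rfl⟩
  have hAB : ⁅A, B⁆ = -T := by rw [hT, neg_neg]
  rw [← hT] at hBT
  have hinv := isInvertible_adapted hE hC hg hT hS hR hBT
  have hc : 10 * algebraMap ℝ (SmoothFun (F := E) U) (1 / 10) = 1 := by
    rw [← map_ofNat (algebraMap ℝ (SmoothFun (F := E) U)) 10, ← map_mul]; norm_num
  obtain ⟨R', S', T', μ, ν, j, hF, hN⟩ := exists_isNormalFrame SmoothField.isAnchor_deriv hc hAB hS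
    hR (isFrame_of_isInvertible hinv) hBT
  exact ⟨U, hx, R', S', T', A, B, μ, ν, j, hg, fun x => hF.isInvertible hE x (hinv x), hN⟩

end Adapted

section Expansion
variable {F : Type*} [NormedAddCommGroup F] [NormedSpace ℝ F]
  {X : Type*} [TopologicalSpace X] [ChartedSpace F X] [IsManifold 𝓘(ℝ, F) ∞ X]
  {W : Type*} [NormedAddCommGroup W] [NormedSpace ℝ W]
  {ι : Type*} [Fintype ι]

/-! ### Normal frames and normalized coframes -/

theorem extD_sum_smul (η : ∀ x : X, TangentSpace 𝓘(ℝ, F) x →L[ℝ] W) (x : X)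
    (V : ι → TangentSpace 𝓘(ℝ, F) x) (a b : ι → ℝ) :
    extD η x (∑ i, a i • V i) (∑ i, b i • V i) =
      ∑ i, ∑ j, (a i * b j) • extD η x (V i) (V j) := by
  simp only [extD_apply]
  have h : ∀ (D : F →L[ℝ] F →L[ℝ] W) (V : ι → F) (a b : ι → ℝ),
      D (∑ i, a i • V i) (∑ i, b i • V i) = ∑ i, ∑ j, (a i * b j) • D (V i) (V j) := by
    intro D V a b
    rw [map_sum D, sum_apply]
    refine Finset.sum_congr rfl fun i _ => ?_
    rw [map_smul D, smul_apply, map_sum, Finset.smul_sum]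
    refine Finset.sum_congr rfl fun j _ => ?_
    rw [map_smul, smul_smul]
  have h' : ∀ (D : F →L[ℝ] F →L[ℝ] W) (V : ι → F) (a b : ι → ℝ),
      D (∑ i, a i • V i) (∑ i, b i • V i) - D (∑ i, b i • V i) (∑ i, a i • V i) =
        ∑ i, ∑ j, (a i * b j) • (D (V i) (V j) - D (V j) (V i)) := by
    intro D V a b
    rw [h, h, Finset.sum_comm (f := fun i j => (b i * a j) • D (V i) (V j)),
      ← Finset.sum_sub_distrib]
    refine Finset.sum_congr rfl fun i _ => ?_
    rw [← Finset.sum_sub_distrib]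
    refine Finset.sum_congr rfl fun j _ => ?_
    rw [smul_sub, mul_comm (b j)]
  exact h' _ V a b

theorem extD_skew (η : ∀ x : X, TangentSpace 𝓘(ℝ, F) x →L[ℝ] W) (x : X)
    (v w : TangentSpace 𝓘(ℝ, F) x) : extD η x v w = -extD η x w v := by
  rw [extD_apply, extD_apply, neg_sub]

variable [CompleteSpace F]

/-- The exterior derivative of a form on fields on which it is constant. -/
theorem extD_of_const {η : ∀ x : X, TangentSpace 𝓘(ℝ, F) x →L[ℝ] W}
    {V V' : ∀ x : X, TangentSpace 𝓘(ℝ, F) x} {x : X} (hη : SmoothFormAt η x)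
    (hV : SmoothFieldAt V x) (hV' : SmoothFieldAt V' x) {c c' : W}
    (h : ∀ᶠ y in nhds x, η y (V y) = c) (h' : ∀ᶠ y in nhds x, η y (V' y) = c') :
    extD η x (V x) (V' x) = -η x (mlieBracket 𝓘(ℝ, F) V V' x) := by
  have key : ∀ {f : X → W} {c : W}, (∀ᶠ y in nhds x, f y = c) → mvfderiv 𝓘(ℝ, F) f x = 0 := by
    intro f c hf
    have h1 : f =ᶠ[nhds x] fun _ => c := hf
    unfold mvfderiv
    rw [h1.mfderiv_eq, mfderiv_const]
    rfl
  rw [extD_cartan hη hV hV', key h, key h']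
  simp

/-- The exterior derivative commutes with constant linear maps. -/
theorem extD_const_comp {W' : Type*} [NormedAddCommGroup W'] [NormedSpace ℝ W']
    {η : ∀ x : X, TangentSpace 𝓘(ℝ, F) x →L[ℝ] W} (G : W →L[ℝ] W') {x : X} (h : SmoothFormAt η x)
    (v w : TangentSpace 𝓘(ℝ, F) x) :
    extD (fun y => G.comp (η y)) x v w = G (extD η x v w) := by
  have h0 : mvfderiv 𝓘(ℝ, F) (fun _ : X => G) x = 0 := by
    unfold mvfderiv
    rw [mfderiv_const]; rfl
  rw [extD_clm_comp (G := fun _ => G) h contMDiffAt_const, h0]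
  simp

end Expansion

section Dictionary
variable {E : Type*} [NormedAddCommGroup E] [NormedSpace ℝ E] [CompleteSpace E]
  {M : Type*} [TopologicalSpace M] [ChartedSpace E M] [IsManifold 𝓘(ℝ, E) ∞ M]
  {C : CRStructure E M} {U : Opens M} {R S T A B : SmoothField (F := E) U}
  {μ ν j : SmoothFun (F := E) U}

theorem five_coe (i : Fin 5) (x : U) : five R S T A B i (x : M) = (![R, S, T, A, B] i).1 x :=
  extV_coe _ x

theorem dualForm_five {x : U} (h : (frameMap (five R S T A B) (x : M)).IsInvertible)
    {W : SmoothField (F := E) U} {r s t a b : SmoothFun (F := E) U}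
    (hW : W = r • R + s • S + t • T + a • A + b • B) :
    dualForm (five R S T A B) (x : M) (W.1 x) = ![r.1 x, s.1 x, t.1 x, a.1 x, b.1 x] := by
  have : frameMap (five R S T A B) (x : M) ![r.1 x, s.1 x, t.1 x, a.1 x, b.1 x] = W.1 x := by
    rw [frameMap_five, hW]
    rfl
  rw [← this]
  exact h.inverse_apply_self _

theorem dualForm_single {x : U} (h : (frameMap (five R S T A B) (x : M)).IsInvertible) (i : Fin 5) :
    dualForm (five R S T A B) (x : M) ((![R, S, T, A, B] i).1 x) = Pi.single i 1 := by
  have : frameMap (five R S T A B) (x : M) (Pi.single i 1) = (![R, S, T, A, B] i).1 x := by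
    rw [frameMap_apply]
    simp [Pi.single_apply, five_coe]
  rw [← this]
  exact h.inverse_apply_self _

theorem smoothFormAt_dual (hinv : ∀ x : U, (frameMap (five R S T A B) (x : M)).IsInvertible)
    (x : U) : SmoothFormAt (dualForm (five R S T A B)) (x : M) :=
  smoothFormAt_dualForm (fun i => smooth_five R S T A B i x) (hinv x)

/-- The exterior derivative of the dual coframe on a pair of fields of the frame is minus their bracket. -/
theorem extD_dualForm_basis (hinv : ∀ x : U, (frameMap (five R S T A B) (x : M)).IsInvertible)
    (x : U) (i k : Fin 5) :
    extD (dualForm (five R S T A B)) (x : M) ((![R, S, T, A, B] i).1 x) ((![R, S, T, A, B] k).1 x) =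
      -dualForm (five R S T A B) (x : M) (⁅![R, S, T, A, B] i, ![R, S, T, A, B] k⁆.1 x) := by
  have := extD_of_const (smoothFormAt_dual hinv x) (smooth_five R S T A B i x)
    (smooth_five R S T A B k x)
    (eventually_coe x fun y => by rw [five_coe]; exact dualForm_single (hinv y) i)
    (eventually_coe x fun y => by rw [five_coe]; exact dualForm_single (hinv y) k)
  rw [five_coe, five_coe] at this
  exact this

/-- The exterior derivative of a form is determined by its values on a frame. -/
theorem extD_expand (hinv : ∀ x : U, (frameMap (five R S T A B) (x : M)).IsInvertible)
    {W : Type*} [NormedAddCommGroup W] [NormedSpace ℝ W]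
    (η : ∀ x : M, TangentSpace 𝓘(ℝ, E) x →L[ℝ] W) (x : U) (v w : TangentSpace 𝓘(ℝ, E) (x : M)) :
    extD η (x : M) v w = ∑ i, ∑ k, (dualForm (five R S T A B) (x : M) v i *
      dualForm (five R S T A B) (x : M) w k) •
      extD η (x : M) ((![R, S, T, A, B] i).1 x) ((![R, S, T, A, B] k).1 x) := by
  rw [← extD_sum_smul]
  have h : ∀ v : TangentSpace 𝓘(ℝ, E) (x : M), ∑ i, dualForm (five R S T A B) (x : M) v i •
      (![R, S, T, A, B] i).1 x = v := fun v => by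
    have := (hinv x).self_apply_inverse v
    rw [frameMap_apply] at this
    simp only [five_coe] at this
    exact this
  rw [h, h]

/-- The exterior derivative of the dual coframe in terms of the structure functions of the frame. -/
theorem extD_dualForm_apply (hinv : ∀ x : U, (frameMap (five R S T A B) (x : M)).IsInvertible)
    (x : U) (v w : TangentSpace 𝓘(ℝ, E) (x : M)) (n : Fin 5)
    (c : Fin 5 → Fin 5 → Fin 5 → ℝ) (hc : ∀ i k, c i k =
      dualForm (five R S T A B) (x : M) (⁅![R, S, T, A, B] i, ![R, S, T, A, B] k⁆.1 x))
    (v' w' : Fin 5 → ℝ) (hv : v' = dualForm (five R S T A B) (x : M) v)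
    (hw : w' = dualForm (five R S T A B) (x : M) w) :
    extD (dualForm (five R S T A B)) (x : M) v w n =
      -((v' 0 * w' 1 - v' 1 * w' 0) * c 0 1 n + (v' 0 * w' 2 - v' 2 * w' 0) * c 0 2 n
      - (v' 0 * w' 3 - v' 3 * w' 0) * c 3 0 n - (v' 0 * w' 4 - v' 4 * w' 0) * c 4 0 n
      + (v' 1 * w' 2 - v' 2 * w' 1) * c 1 2 n - (v' 1 * w' 3 - v' 3 * w' 1) * c 3 1 n
      - (v' 1 * w' 4 - v' 4 * w' 1) * c 4 1 n - (v' 2 * w' 3 - v' 3 * w' 2) * c 3 2 n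
      - (v' 2 * w' 4 - v' 4 * w' 2) * c 4 2 n + (v' 3 * w' 4 - v' 4 * w' 3) * c 3 4 n) := by
  have hs : ∀ i k, c i k n = -c k i n := fun i k => by
    have e : ⁅![R, S, T, A, B] i, ![R, S, T, A, B] k⁆.1 x =
        -(⁅![R, S, T, A, B] k, ![R, S, T, A, B] i⁆.1 x) := by
      rw [← lie_skew]; rfl
    rw [hc i k, hc k i, e, map_neg]; rfl
  have h0 : ∀ i, c i i n = 0 := fun i => by have := hs i i; linarith
  rw [extD_expand hinv, ← hv, ← hw]
  have e : ∀ i k, extD (dualForm (five R S T A B)) (x : M) ((![R, S, T, A, B] i).1 x)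
      ((![R, S, T, A, B] k).1 x) = -c i k := fun i k => by rw [extD_dualForm_basis hinv, hc]
  simp only [e, Finset.sum_apply, Pi.smul_apply, Pi.neg_apply, smul_eq_mul]
  simp only [Fin.sum_univ_five, h0]
  rw [hs 1 0, hs 2 0, hs 0 3, hs 0 4, hs 2 1, hs 1 3, hs 1 4, hs 2 3, hs 2 4, hs 4 3]
  ring

/-- The form with the given components on a frame. -/
def formOf (V : Fin 5 → ∀ x : M, TangentSpace 𝓘(ℝ, E) x) (f : Fin 5 → M → ℝ) (x : M) :
    TangentSpace 𝓘(ℝ, E) x →L[ℝ] ℝ :=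
  (∑ i, f i x • ContinuousLinearMap.proj (R := ℝ) (φ := fun _ : Fin 5 => ℝ) i).comp (dualForm V x)

theorem formOf_apply (V : Fin 5 → ∀ x : M, TangentSpace 𝓘(ℝ, E) x) (f : Fin 5 → M → ℝ) (x : M)
    (v : TangentSpace 𝓘(ℝ, E) x) : formOf V f x v = ∑ i, f i x * dualForm V x v i := by
  change (∑ i, f i x • ContinuousLinearMap.proj (R := ℝ) (φ := fun _ : Fin 5 => ℝ) i)
    (dualForm V x v) = _
  rw [sum_apply]
  rfl

theorem smoothFormAt_formOf (hinv : ∀ x : U, (frameMap (five R S T A B) (x : M)).IsInvertible)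
    (f : Fin 5 → SmoothFun (F := E) U) (x : U) :
    SmoothFormAt (formOf (five R S T A B) fun i => extF (f i).1) (x : M) := by
  refine SmoothFormAt.clm_comp ?_ (smoothFormAt_dual hinv x)
  exact ContMDiffAt.sum (t := Finset.univ) fun i _ => ((f i).2 x).smul contMDiffAt_const

/-- The coframe `(8 R*, 4 S*, 2 T*, A* + i B*)`, where `R*, …, B*` is dual to the frame
`(R, S, T, A, B)`. -/
def coframeOf (V : Fin 5 → ∀ x : M, TangentSpace 𝓘(ℝ, E) x) (x : M) :
    TangentSpace 𝓘(ℝ, E) x →L[ℝ] CoframeValue :=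
  (hat : (Fin 5 → ℝ) →L[ℝ] CoframeValue).comp (dualForm V x)

/-- The coframe of a normal frame satisfies the structure equations. -/
theorem structureEquationsAt_coframeOf
    (hinv : ∀ x : U, (frameMap (five R S T A B) (x : M)).IsInvertible)
    (hN : IsNormalFrame R S T A B μ ν j) :
    ∃ l : ∀ x : M, TangentSpace 𝓘(ℝ, E) x →L[ℝ] ℝ, SmoothFormOn l U ∧
      ∀ x ∈ U, StructureEquationsAt (coframeOf (five R S T A B)) l x := by
  have hF := isFrame_of_isInvertible hinv
  obtain ⟨p₀, p₁, p₂, p₃, p₄, hp⟩ := hF.span ⁅R, S⁆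
  obtain ⟨q₀, q₁, q₂, q₃, q₄, hq⟩ := hF.span ⁅R, T⁆
  obtain ⟨third, hthird⟩ : ∃ f : SmoothFun (F := E) U, f = algebraMap ℝ _ (-(1 / 3)) := ⟨_, rfl⟩
  obtain ⟨quarter, hquarter⟩ : ∃ f : SmoothFun (F := E) U, f = algebraMap ℝ _ (1 / 4) := ⟨_, rfl⟩
  -- the components of `Λ` along `R, S, T` are chosen so as to remove the terms `τ ∧ σ` from `dσ`
  -- and `τ ∧ σ`, `τ ∧ ρ` from `dτ`, which the structure equations do not contain
  refine ⟨formOf (five R S T A B) fun i => extF (![third * p₁, quarter * p₀, quarter * q₀, μ, ν] i).1,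
    (smoothFormOn_iff U.isOpen).2 fun x hx => smoothFormAt_formOf hinv _ ⟨x, hx⟩, fun x hx => ?_⟩
  rw [structureEquationsAt_iff]
  obtain ⟨x, rfl⟩ : ∃ y : U, (y : M) = x := ⟨⟨x, hx⟩, rfl⟩
  obtain ⟨w₁, w₂, hAT, hBT⟩ := hN.lie_T
  obtain ⟨r₁, r₂, v₁, v₂, hAS, hBS⟩ := hN.lie_S
  obtain ⟨t₃, a₃, b₃, hAR⟩ := hN.lie_AR
  obtain ⟨s₄, t₄, a₄, b₄, hBR⟩ := hN.lie_BR
  obtain ⟨s₅, t₅, a₅, b₅, hST⟩ := hN.lie_ST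
  have hAB := hN.lie_AB
  obtain ⟨c, hc⟩ : ∃ c : Fin 5 → Fin 5 → Fin 5 → ℝ, ∀ i k, c i k =
      dualForm (five R S T A B) (x : M) (⁅![R, S, T, A, B] i, ![R, S, T, A, B] k⁆.1 x) :=
    ⟨_, fun _ _ => rfl⟩
  have c01 : c 0 1 = ![p₀.1 x, p₁.1 x, p₂.1 x, p₃.1 x, p₄.1 x] :=
    (hc 0 1).trans (dualForm_five (hinv x) hp)
  have c02 : c 0 2 = ![q₀.1 x, q₁.1 x, q₂.1 x, q₃.1 x, q₄.1 x] :=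
    (hc 0 2).trans (dualForm_five (hinv x) hq)
  have c30 : c 3 0 = ![-4 * μ.1 x, 0, t₃.1 x, a₃.1 x, b₃.1 x] :=
    (hc 3 0).trans (dualForm_five (hinv x) (r := -4 * μ) (s := 0) (hAR.trans (by module)))
  have c40 : c 4 0 = ![-(4 * ν.1 x + 2 * j.1 x), s₄.1 x, t₄.1 x, a₄.1 x, b₄.1 x] :=
    (hc 4 0).trans (dualForm_five (hinv x) hBR)
  have c12 : c 1 2 = ![3 * j.1 x, s₅.1 x, t₅.1 x, a₅.1 x, b₅.1 x] :=
    (hc 1 2).trans (dualForm_five (hinv x) hST)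
  have c31 : c 3 1 = ![1, -3 * μ.1 x, r₁.1 x, v₁.1 x, v₂.1 x] :=
    (hc 3 1).trans (dualForm_five (hinv x) (r := 1) (s := -3 * μ) (hAS.trans (by module)))
  have c41 : c 4 1 = ![0, j.1 x - 3 * ν.1 x, r₂.1 x, -v₂.1 x, v₁.1 x] :=
    (hc 4 1).trans (dualForm_five (hinv x) (r := 0) (a := -v₂) (s := j - 3 * ν)
      (hBS.trans (by module)))
  have c32 : c 3 2 = ![0, 1, -2 * μ.1 x, w₁.1 x, w₂.1 x] :=
    (hc 3 2).trans (dualForm_five (hinv x) (r := 0) (s := 1) (t := -2 * μ) (hAT.trans (by module)))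
  have c42 : c 4 2 = ![0, 0, j.1 x - 2 * ν.1 x, -w₂.1 x, w₁.1 x] :=
    (hc 4 2).trans (dualForm_five (hinv x) (r := 0) (s := 0) (a := -w₂) (t := j - 2 * ν)
      (hBT.trans (by module)))
  have c34 : c 3 4 = ![0, 0, -1, ν.1 x, -μ.1 x] :=
    (hc 3 4).trans (dualForm_five (hinv x) (r := 0) (s := 0) (t := -1) (b := -μ)
      (hAB.trans (by module)))
  obtain ⟨Ω, hΩ⟩ : ∃ Ω : (Fin 5 → ℝ) → (Fin 5 → ℝ) → (Fin 5 → ℝ), ∀ v w k, Ω v w k =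
      -((v 0 * w 1 - v 1 * w 0) * c 0 1 k + (v 0 * w 2 - v 2 * w 0) * c 0 2 k
      - (v 0 * w 3 - v 3 * w 0) * c 3 0 k - (v 0 * w 4 - v 4 * w 0) * c 4 0 k
      + (v 1 * w 2 - v 2 * w 1) * c 1 2 k - (v 1 * w 3 - v 3 * w 1) * c 3 1 k
      - (v 1 * w 4 - v 4 * w 1) * c 4 1 k - (v 2 * w 3 - v 3 * w 2) * c 3 2 k
      - (v 2 * w 4 - v 4 * w 2) * c 4 2 k + (v 3 * w 4 - v 4 * w 3) * c 3 4 k) :=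
    ⟨_, fun _ _ _ => rfl⟩
  obtain ⟨l, hl⟩ : ∃ l, l = formOf (five R S T A B) fun i =>
    extF (![third * p₁, quarter * p₀, quarter * q₀, μ, ν] i).1 := ⟨_, rfl⟩
  rw [← hl]
  have hd : ∀ v w : TangentSpace 𝓘(ℝ, E) (x : M), extD l (x : M) v w =
      ∑ i, ∑ k, (1 / 2 * extD l (x : M) ((![R, S, T, A, B] i).1 x) ((![R, S, T, A, B] k).1 x)) *
      (dualForm (five R S T A B) (x : M) v i * dualForm (five R S T A B) (x : M) w k -
        dualForm (five R S T A B) (x : M) v k * dualForm (five R S T A B) (x : M) w i) := by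
    intro v w
    have h1 := extD_expand hinv l x v w
    have h2 : extD l (x : M) v w = (1 / 2) * (extD l (x : M) v w - extD l (x : M) w v) := by
      rw [extD_skew l x w v]; ring
    rw [h2, extD_expand hinv l x v w, extD_expand hinv l x w v, ← Finset.sum_sub_distrib,
      Finset.mul_sum]
    refine Finset.sum_congr rfl fun i _ => ?_
    rw [← Finset.sum_sub_distrib, Finset.mul_sum]
    refine Finset.sum_congr rfl fun k _ => ?_
    simp only [smul_eq_mul]
    ring
  have key := (structEqs_of_table (c 0 1) (c 0 2) Ω
    (by intro v w k; rw [hΩ, c30, c40, c12, c31, c41, c32, c42, c34])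
    (fun i k => 1 / 2 * extD l (x : M) ((![R, S, T, A, B] i).1 x) ((![R, S, T, A, B] k).1 x))).comp
    (fun v : TangentSpace 𝓘(ℝ, E) (x : M) => dualForm (five R S T A B) (x : M) v)
  have e1 : extD (coframeOf (five R S T A B)) (x : M) = fun v w =>
      hat (Ω (dualForm (five R S T A B) (x : M) v) (dualForm (five R S T A B) (x : M) w)) := by
    funext v w
    refine (extD_const_comp _ (smoothFormAt_dual hinv x) v w).trans ?_
    refine congrArg hat (funext fun n => ?_)
    rw [extD_dualForm_apply hinv x v w n c hc _ _ rfl rfl, hΩ]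
  have e2 : extD l (x : M) = _ := funext fun v => funext fun w => hd v w
  have e3 : ⇑(l (x : M)) = fun v => -(c 0 1 1 / 3) * dualForm (five R S T A B) (x : M) v 0
      + c 0 1 0 / 4 * dualForm (five R S T A B) (x : M) v 1
      + c 0 2 0 / 4 * dualForm (five R S T A B) (x : M) v 2
      + μ.1 x * dualForm (five R S T A B) (x : M) v 3
      + ν.1 x * dualForm (five R S T A B) (x : M) v 4 := by
    funext v
    rw [hl, c01, c02]
    have m1 : (third * p₁).1 x = -(1 / 3) * p₁.1 x := by rw [hthird]; rfl
    have m2 : (quarter * p₀).1 x = 1 / 4 * p₀.1 x := by rw [hquarter]; rfl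
    have m3 : (quarter * q₀).1 x = 1 / 4 * q₀.1 x := by rw [hquarter]; rfl
    rw [formOf_apply, Fin.sum_univ_five]
    simp only [extF_coe, Matrix.cons_val, m1, m2, m3]
    ring
  rw [e1, e2, e3]
  exact key

end Dictionary

/-! ### Existence of normalized coframes -/

section Brackets
variable {𝔽 𝔛 : Type*} [CommRing 𝔽] [LieRing 𝔛] [Module 𝔽 𝔛] {D : 𝔛 → 𝔽 → 𝔽}

/-- The fields which make up `𝒯, 𝒮, ℛ` for the generator `A - i B`, in a normal frame. -/
theorem IsNormalFrame.iterated (hD : IsAnchor D) {R S T A B T₁ P Q : 𝔛} {μ ν j : 𝔽}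
    (h : IsNormalFrame R S T A B μ ν j) (hT₁ : T₁ = -⁅A, B⁆) (hP : P = ⁅A, T₁⁆) (hQ : Q = ⁅B, T₁⁆) :
    T₁ = (0 : 𝔽) • R + (0 : 𝔽) • S + (1 : 𝔽) • T + (-ν) • A + μ • B ∧
    (∃ t a b : 𝔽, P = (0 : 𝔽) • R + (1 : 𝔽) • S + t • T + a • A + b • B) ∧
    (∃ t a b : 𝔽, Q = (0 : 𝔽) • R + (0 : 𝔽) • S + t • T + a • A + b • B) ∧
    (∃ s t a b : 𝔽, ⁅A, P⁆ = (1 : 𝔽) • R + s • S + t • T + a • A + b • B) ∧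
    (∃ s t a b : 𝔽, ⁅B, P⁆ = (0 : 𝔽) • R + s • S + t • T + a • A + b • B) ∧
    (∃ s t a b : 𝔽, ⁅A, Q⁆ = (0 : 𝔽) • R + s • S + t • T + a • A + b • B) ∧
    (∃ s t a b : 𝔽, ⁅B, Q⁆ = (0 : 𝔽) • R + s • S + t • T + a • A + b • B) := by
  obtain ⟨w₁, w₂, hAT, hBT⟩ := h.lie_T
  obtain ⟨r₁, r₂, v₁, v₂, hAS, hBS⟩ := h.lie_S
  have hAB := h.lie_AB
  have hBA : ⁅B, A⁆ = T - ν • A + μ • B := by rw [← lie_skew, hAB]; module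
  have eT : T₁ = T + (-ν) • A + μ • B := by rw [hT₁, hAB]; module
  obtain ⟨p₂, p₃, p₄, hP'⟩ : ∃ t a b : 𝔽, P = S + t • T + a • A + b • B := by
    refine ⟨-(2 * μ) - μ, w₁ + D A (-ν) + μ * ν, w₂ + D A μ - μ * μ, ?_⟩
    rw [hP, eT]
    simp only [lie_add, hD.lie_smul A, lie_self, hAT, hAB]
    module
  obtain ⟨q₂, q₃, q₄, hQ'⟩ : ∃ t a b : 𝔽, Q = t • T + a • A + b • B := by
    refine ⟨j - 2 * ν - ν, ν * ν - w₂ + D B (-ν), w₁ + D B μ - ν * μ, ?_⟩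
    rw [hQ, eT]
    simp only [lie_add, hD.lie_smul B, lie_self, hBT, hBA]
    module
  refine ⟨by rw [eT]; module, ⟨p₂, p₃, p₄, by rw [hP']; module⟩, ⟨q₂, q₃, q₄, by rw [hQ']; module⟩,
    ?_, ?_, ?_, ?_⟩
  · refine ⟨-(3 * μ) + p₂, r₁ + p₂ * (-(2 * μ)) + D A p₂ - p₄,
      v₁ + p₂ * w₁ + D A p₃ + p₄ * ν, v₂ + p₂ * w₂ + D A p₄ - p₄ * μ, ?_⟩
    rw [hP']
    simp only [lie_add, hD.lie_smul A, lie_self, hAS, hAT, hAB]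
    module
  · refine ⟨j - 3 * ν, r₂ + p₂ * (j - 2 * ν) + D B p₂ + p₃,
      -v₂ - p₂ * w₂ + D B p₃ - p₃ * ν, v₁ + p₂ * w₁ + D B p₄ + p₃ * μ, ?_⟩
    rw [hP']
    simp only [lie_add, hD.lie_smul B, lie_self, hBS, hBT, hBA]
    module
  · refine ⟨q₂, q₂ * (-(2 * μ)) + D A q₂ - q₄,
      q₂ * w₁ + D A q₃ + q₄ * ν, q₂ * w₂ + D A q₄ - q₄ * μ, ?_⟩
    rw [hQ']
    simp only [lie_add, hD.lie_smul A, lie_self, hAT, hAB]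
    module
  · refine ⟨0, q₂ * (j - 2 * ν) + D B q₂ + q₃,
      - q₂ * w₂ + D B q₃ - q₃ * ν, q₂ * w₁ + D B q₄ + q₃ * μ, ?_⟩
    rw [hQ']
    simp only [lie_add, hD.lie_smul B, lie_self, hBT, hBA]
    module

end Brackets

section Dictionary
variable {E : Type*} [NormedAddCommGroup E] [NormedSpace ℝ E] [CompleteSpace E]
  {M : Type*} [TopologicalSpace M] [ChartedSpace E M] [IsManifold 𝓘(ℝ, E) ∞ M]
  {C : CRStructure E M} {U : Opens M} {R S T A B : SmoothField (F := E) U}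
  {μ ν j : SmoothFun (F := E) U}

theorem smoothFormAt_coframeOf
    (hinv : ∀ x : U, (frameMap (five R S T A B) (x : M)).IsInvertible) (x : U) :
    SmoothFormAt (coframeOf (five R S T A B)) (x : M) :=
  SmoothFormAt.clm_comp (G := fun _ => (hat : (Fin 5 → ℝ) →L[ℝ] CoframeValue)) contMDiffAt_const
    (smoothFormAt_dual hinv x)

/-- The entries of a coframe on a complex vector. -/
theorem entry_complex (c d : Fin 5 → ℝ) :
    (fun i => entry (hat c) i + Complex.I * entry (hat d) i) =
      ![8 * (c 0 + Complex.I * d 0), 4 * (c 1 + Complex.I * d 1), 2 * (c 2 + Complex.I * d 2),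
        (c 3 + c 4 * Complex.I) + Complex.I * (d 3 + d 4 * Complex.I),
        (c 3 - c 4 * Complex.I) + Complex.I * (d 3 - d 4 * Complex.I)] := by
  obtain ⟨h0, h1, h2, h3, h4⟩ := entry_hat c
  obtain ⟨k0, k1, k2, k3, k4⟩ := entry_hat d
  funext i
  fin_cases i
  · simp [h0, k0]; ring
  · simp [h1, k1]; ring
  · simp [h2, k2]; ring
  · simp [h3, k3]
  · simp [h4, k4]

/-- The coframe of a normal frame belongs to the initial `G₁`-structure, the generator being `A - i B`.
The diagonal entry `a` of the element of `G₁` is `2`, because `A* + i B*` takes the value `2` on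
`A - i B`. -/
theorem isP1Coframe_coframeOf (hg : IsLocalGenerator C.L U (gen A B))
    (hinv : ∀ x : U, (frameMap (five R S T A B) (x : M)).IsInvertible)
    (hN : IsNormalFrame R S T A B μ ν j) (x : U) :
    C.IsP1Coframe (x : M) (coframeOf (five R S T A B) (x : M)) := by
  obtain ⟨T₁, hT₁⟩ : ∃ T₁, T₁ = -⁅A, B⁆ := ⟨_, rfl⟩
  obtain ⟨P, hP⟩ : ∃ P, P = ⁅A, T₁⁆ := ⟨_, rfl⟩
  obtain ⟨Q, hQ⟩ : ∃ Q, Q = ⁅B, T₁⁆ := ⟨_, rfl⟩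
  obtain ⟨e0, ⟨p₂, p₃, p₄, e1⟩, ⟨q₂, q₃, q₄, e2⟩, ⟨a₁, a₂, a₃, a₄, e3⟩, ⟨b₁, b₂, b₃, b₄, e4⟩,
    ⟨c₁, c₂, c₃, c₄, e5⟩, ⟨d₁, d₂, d₃, d₄, e6⟩⟩ :=
    hN.iterated (SmoothField.isAnchor_deriv (F := E) (U := U)) hT₁ hP hQ
  have hZ := gen_on A B
  have key : ∀ {Z : ComplexField E M} {X Y : SmoothField (F := E) U} {c d : Fin 5 → ℝ}, Z.On X Y →
      dualForm (five R S T A B) (x : M) (X.1 x) = c →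
      dualForm (five R S T A B) (x : M) (Y.1 x) = d → ∀ i,
      entry (coframeOf (five R S T A B) (x : M) (Z.re x)) i +
        Complex.I * entry (coframeOf (five R S T A B) (x : M) (Z.im x)) i =
      entry (hat c) i + Complex.I * entry (hat d) i := by
    intro Z X Y c d h hc hd i
    rw [(h x).1, (h x).2, ← hc, ← hd]
    rfl
  obtain ⟨δ, hδ⟩ : ∃ δ : SmoothField (F := E) U → (Fin 5 → ℝ), ∀ X : SmoothField (F := E) U,
      dualForm (five R S T A B) (x : M) (X.1 x) = δ X := ⟨_, fun _ => rfl⟩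
  have δadd : ∀ X Y, δ (X + Y) = δ X + δ Y := fun X Y => by
    rw [← hδ, ← hδ, ← hδ]; exact map_add (dualForm (five R S T A B) (x : M)) (X.1 x) (Y.1 x)
  have δneg : ∀ X, δ (-X) = -δ X := fun X => by
    rw [← hδ, ← hδ]; exact map_neg (dualForm (five R S T A B) (x : M)) (X.1 x)
  have δsub : ∀ X Y, δ (X - Y) = δ X - δ Y := fun X Y => by
    rw [← hδ, ← hδ, ← hδ]; exact map_sub (dualForm (five R S T A B) (x : M)) (X.1 x) (Y.1 x)
  have δzero : δ 0 = 0 := by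
    rw [← hδ]; exact map_zero (dualForm (five R S T A B) (x : M))
  have δA : δ A = ![0, 0, 0, 1, 0] := by
    rw [← hδ]; refine (dualForm_single (hinv x) 3).trans ?_; ext i; fin_cases i <;> rfl
  have δB : δ B = ![0, 0, 0, 0, 1] := by
    rw [← hδ]; refine (dualForm_single (hinv x) 4).trans ?_; ext i; fin_cases i <;> rfl
  have f0 := (hδ T₁).symm.trans (dualForm_five (hinv x) e0)
  have f1 := (hδ P).symm.trans (dualForm_five (hinv x) e1)
  have f2 := (hδ Q).symm.trans (dualForm_five (hinv x) e2)
  have f3 := (hδ ⁅A, P⁆).symm.trans (dualForm_five (hinv x) e3)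
  have f4 := (hδ ⁅B, P⁆).symm.trans (dualForm_five (hinv x) e4)
  have f5 := (hδ ⁅A, Q⁆).symm.trans (dualForm_five (hinv x) e5)
  have f6 := (hδ ⁅B, Q⁆).symm.trans (dualForm_five (hinv x) e6)
  have zz : (0 : SmoothFun (F := E) U).1 x = 0 := rfl
  have oo : (1 : SmoothFun (F := E) U).1 x = 1 := rfl
  have nn : (-ν).1 x = -ν.1 x := rfl
  rw [zz, oo, nn] at f0
  rw [zz, oo] at f1
  rw [oo] at f3
  rw [zz] at f2 f4 f5 f6
  obtain ⟨g, hgd⟩ : ∃ g : Matrix (Fin 5) (Fin 5) ℂ, ∀ i k, g i k =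
      entry (coframeOf (five R S T A B) (x : M) ((![(gen A B).fieldR, (gen A B).fieldS,
        (gen A B).fieldT, gen A B, (gen A B).conj] k).re x)) i + Complex.I *
      entry (coframeOf (five R S T A B) (x : M) ((![(gen A B).fieldR, (gen A B).fieldS,
        (gen A B).fieldT, gen A B, (gen A B).conj] k).im x)) i := ⟨_, fun _ _ => rfl⟩
  have k0 := fun i => (hgd i 0).trans ((key (hZ.fieldR hT₁ hP hQ) (hδ _) (hδ _) i).trans
    (congrFun (entry_complex _ _) i))
  have k1 := fun i => (hgd i 1).trans ((key (hZ.fieldS hT₁ hP hQ) (hδ _) (hδ _) i).trans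
    (congrFun (entry_complex _ _) i))
  have k2 := fun i => (hgd i 2).trans ((key (hZ.fieldT hT₁) (hδ _) (hδ _) i).trans
    (congrFun (entry_complex _ _) i))
  have k3 := fun i => (hgd i 3).trans ((key hZ (hδ _) (hδ _) i).trans
    (congrFun (entry_complex _ _) i))
  have k4 := fun i => (hgd i 4).trans ((key hZ.conj (hδ _) (hδ _) i).trans
    (congrFun (entry_complex _ _) i))
  simp only [δadd, δneg, δsub, δzero, δA, δB, f0, f1, f2, f3, f4, f5, f6, Pi.add_apply, Pi.sub_apply,
    Pi.neg_apply, Pi.zero_apply, Matrix.cons_val] at k0 k1 k2 k3 k4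
  have c2 : (starRingEnd ℂ) 2 = 2 := Complex.conj_ofNat 2
  have hI := Complex.I_mul_I
  refine ⟨U, gen A B, x.2, hg, g, ⟨2, g 3 2, g 2 1, g 3 1, g 4 1, g 1 0, g 3 0, g 4 0, g 2 0,
    two_ne_zero, ?_⟩, hgd⟩
  have t0 : g 0 0 = 2 ^ 3 * (starRingEnd ℂ) 2 := by rw [k0, c2]; simp; norm_num
  have t1 : g 1 1 = 2 ^ 2 * (starRingEnd ℂ) 2 := by rw [k1, c2]; simp; norm_num
  have t2 : g 2 2 = 2 * (starRingEnd ℂ) 2 := by rw [k2, c2]; simp; norm_num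
  have t3 : g 3 3 = 2 := by rw [k3]; simp [hI]; norm_num
  have t4 : g 4 4 = (starRingEnd ℂ) 2 := by rw [k4, c2]; simp [hI]; norm_num
  have t5 : g 4 2 = (starRingEnd ℂ) (g 3 2) := by rw [k2, k2]; simp; ring
  have z1 : g 0 1 = 0 := by rw [k1]; simp
  have z2 : g 0 2 = 0 := by rw [k2]; simp
  have z3 : g 0 3 = 0 := by rw [k3]; simp
  have z4 : g 0 4 = 0 := by rw [k4]; simp
  have z5 : g 1 2 = 0 := by rw [k2]; simp
  have z6 : g 1 3 = 0 := by rw [k3]; simp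
  have z7 : g 1 4 = 0 := by rw [k4]; simp
  have z8 : g 2 3 = 0 := by rw [k3]; simp
  have z9 : g 2 4 = 0 := by rw [k4]; simp
  have z10 : g 3 4 = 0 := by rw [k4]; simp [hI]
  have z11 : g 4 3 = 0 := by rw [k3]; simp [hI]
  ext i k
  fin_cases i <;> fin_cases k
  exacts [t0, z1, z2, z3, z4, rfl, t1, z5, z6, z7, rfl, rfl, t2, z8, z9, rfl, rfl, rfl, t3, z10,
    rfl, rfl, t5, z11, t4]

theorem isNormalizedCoframe_coframeOf (hg : IsLocalGenerator C.L U (gen A B))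
    (hinv : ∀ x : U, (frameMap (five R S T A B) (x : M)).IsInvertible)
    (hN : IsNormalFrame R S T A B μ ν j) :
    C.IsNormalizedCoframe U (coframeOf (five R S T A B)) where
  isOpen := U.isOpen
  smooth := (smoothFormOn_iff U.isOpen).2 fun x hx => smoothFormAt_coframeOf hinv ⟨x, hx⟩
  mem_P1 x hx := isP1Coframe_coframeOf hg hinv hN ⟨x, hx⟩
  structure_eq := structureEquationsAt_coframeOf hinv hN

/-- Near each point there is a normalized coframe. -/
theorem exists_isNormalizedCoframe [FiniteDimensional ℝ E] (hE : Module.finrank ℝ E = 5)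
    (hC : C.IsClassIII2) (x₀ : M) : ∃ (U : Opens M)
      (s : ∀ x : M, TangentSpace 𝓘(ℝ, E) x →L[ℝ] CoframeValue), x₀ ∈ U ∧
      C.IsNormalizedCoframe U s := by
  obtain ⟨U, hx, R, S, T, A, B, μ, ν, j, hg, hinv, hN⟩ := exists_normalFrame hE hC x₀
  exact ⟨U, _, hx, isNormalizedCoframe_coframeOf hg hinv hN⟩

end Dictionary

/-! ### The normal frame of a normalized coframe -/

section Converse
variable {E : Type*} [NormedAddCommGroup E] [NormedSpace ℝ E]
  {M : Type*} [TopologicalSpace M] [ChartedSpace E M] [IsManifold 𝓘(ℝ, E) ∞ M]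
  {C : CRStructure E M}

/-- A real subspace of the space of values is everything if it contains the complex line of `ζ` and,
for each of `ρ`, `σ`, `τ` in turn, a vector on which this entry does not vanish and the preceding
ones do. -/
theorem coframeValue_eq_top (K : Submodule ℝ CoframeValue) {a : ℂ} (ha : a ≠ 0)
    (h1 : ((0, 0, 0, a) : CoframeValue) ∈ K) (h2 : ((0, 0, 0, -(Complex.I * a)) : CoframeValue) ∈ K)
    (h3 : ∃ v ∈ K, v.1 = 0 ∧ v.2.1 = 0 ∧ v.2.2.1 ≠ 0) (h4 : ∃ v ∈ K, v.1 = 0 ∧ v.2.1 ≠ 0)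
    (h5 : ∃ v ∈ K, v.1 ≠ 0) : K = ⊤ := by
  have m1 : ∀ w : ℂ, ((0, 0, 0, w) : CoframeValue) ∈ K := fun w => by
    have h := K.add_mem (K.smul_mem (w / a).re h1) (K.smul_mem (-(w / a).im) h2)
    have e : ((0, 0, 0, w) : CoframeValue) =
        (w / a).re • (0, 0, 0, a) + (-(w / a).im) • (0, 0, 0, -(Complex.I * a)) := by
      refine Prod.ext (by simp) (Prod.ext (by simp) (Prod.ext (by simp) ?_))
      have hw : w = (w / a) * a := (div_mul_cancel₀ w ha).symm
      generalize w / a = z at hw ⊢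
      rw [hw]
      simp
      linear_combination (-a) * Complex.re_add_im z
    rw [e]; exact h
  have m2 : ∀ (r : ℝ) (w : ℂ), ((0, 0, r, w) : CoframeValue) ∈ K := fun r w => by
    obtain ⟨v, hv, e1, e2, e3⟩ := h3
    have h := K.add_mem (K.smul_mem (r / v.2.2.1) hv) (m1 (w - (r / v.2.2.1) • v.2.2.2))
    have e : ((0, 0, r, w) : CoframeValue) =
        (r / v.2.2.1) • v + (0, 0, 0, w - (r / v.2.2.1) • v.2.2.2) := by
      refine Prod.ext (by simp [e1]) (Prod.ext (by simp [e2]) (Prod.ext ?_ ?_))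
      · simp; field_simp
      · simp
    rw [e]; exact h
  have m3 : ∀ (s r : ℝ) (w : ℂ), ((0, s, r, w) : CoframeValue) ∈ K := fun s r w => by
    obtain ⟨v, hv, e1, e2⟩ := h4
    have h := K.add_mem (K.smul_mem (s / v.2.1) hv)
      (m2 (r - (s / v.2.1) • v.2.2.1) (w - (s / v.2.1) • v.2.2.2))
    have e : ((0, s, r, w) : CoframeValue) =
        (s / v.2.1) • v + (0, 0, r - (s / v.2.1) • v.2.2.1, w - (s / v.2.1) • v.2.2.2) := by
      refine Prod.ext (by simp [e1]) (Prod.ext ?_ (Prod.ext ?_ ?_))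
      · simp; field_simp
      · simp
      · simp
    rw [e]; exact h
  rw [Submodule.eq_top_iff']
  rintro ⟨t, s, r, w⟩
  obtain ⟨v, hv, e1⟩ := h5
  have h := K.add_mem (K.smul_mem (t / v.1) hv)
    (m3 (s - (t / v.1) • v.2.1) (r - (t / v.1) • v.2.2.1) (w - (t / v.1) • v.2.2.2))
  have e : ((t, s, r, w) : CoframeValue) = (t / v.1) • v + (0, s - (t / v.1) • v.2.1,
      r - (t / v.1) • v.2.2.1, w - (t / v.1) • v.2.2.2) := by
    refine Prod.ext ?_ (Prod.ext ?_ (Prod.ext ?_ ?_))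
    · simp; field_simp
    · simp
    · simp
    · simp
  rw [e]; exact h

theorem isInvertible_of_surjective [FiniteDimensional ℝ E] (hE : Module.finrank ℝ E = 5) {x : M}
    {u : TangentSpace 𝓘(ℝ, E) x →L[ℝ] CoframeValue} (h : Function.Surjective u) :
    u.IsInvertible := by
  have : FiniteDimensional ℝ (TangentSpace 𝓘(ℝ, E) x) := ‹FiniteDimensional ℝ E›
  have hd : Module.finrank ℝ (TangentSpace 𝓘(ℝ, E) x) = Module.finrank ℝ CoframeValue := by
    rw [← hat.toLinearEquiv.finrank_eq, Module.finrank_fin_fun]; exact hE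
  have : T2Space (TangentSpace 𝓘(ℝ, E) x) := inferInstanceAs (T2Space E)
  refine ⟨(LinearEquiv.ofBijective u.toLinearMap ⟨?_, h⟩).toContinuousLinearEquiv, ?_⟩
  · exact (LinearMap.injective_iff_surjective_of_finrank_eq_finrank hd).2 h
  · rfl

/-- Real numbers `p, q` are determined by `p + i q`. -/
theorem ofReal_add_I_mul {p q : ℝ} {c : ℂ} (h : c = p + Complex.I * q) : p = c.re ∧ q = c.im := by
  rw [h]; simp

/-- The properties of the coframes in the initial `G₁`-structure that are used: they are invertible,
and on some local generator all the entries except `ζ` and `ζ̄` vanish. -/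
theorem CRStructure.IsP1Coframe.spec [FiniteDimensional ℝ E] (hE : Module.finrank ℝ E = 5) {x : M}
    {u : TangentSpace 𝓘(ℝ, E) x →L[ℝ] CoframeValue} (h : C.IsP1Coframe x u) :
    u.IsInvertible ∧ ∃ (U : Set M) (Z : ComplexField E M), x ∈ U ∧ IsLocalGenerator C.L U Z ∧
      ∃ a : ℂ, a ≠ 0 ∧ u (Z.re x) = (0, 0, 0, a) ∧ u (Z.im x) = (0, 0, 0, -(Complex.I * a)) := by
  obtain ⟨U, Z, hx, hZ, g, ⟨a, b, c, d, e, f, h, k, m, ha, hg⟩, H⟩ := h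
  have hr : ∀ u : CoframeValue, entry u 0 = (u.1 : ℂ) ∧ entry u 1 = (u.2.1 : ℂ) ∧
      entry u 2 = (u.2.2.1 : ℂ) ∧ entry u 3 = u.2.2.2 ∧ entry u 4 = (starRingEnd ℂ) u.2.2.2 :=
    fun u => ⟨rfl, rfl, rfl, rfl, rfl⟩
  have a0 : ∀ {p q : ℝ}, (0 : ℂ) = p + Complex.I * q → p = 0 ∧ q = 0 := fun h => by
    simpa using ofReal_add_I_mul h
  have l0 := H 0 3
  have l1 := H 1 3
  have l2 := H 2 3
  have l3 := H 3 3
  have l4 := H 4 3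
  rw [(hr _).1, (hr _).1, hg] at l0
  rw [(hr _).2.1, (hr _).2.1, hg] at l1
  rw [(hr _).2.2.1, (hr _).2.2.1, hg] at l2
  rw [(hr _).2.2.2.1, (hr _).2.2.2.1, hg] at l3
  rw [(hr _).2.2.2.2, (hr _).2.2.2.2, hg] at l4
  simp only [Matrix.of_apply, Matrix.cons_val] at l0 l1 l2 l3 l4
  obtain ⟨p0, q0⟩ := a0 l0
  obtain ⟨p1, q1⟩ := a0 l1
  obtain ⟨p2, q2⟩ := a0 l2
  have l5 := congrArg (starRingEnd ℂ) l4
  rw [map_add, map_mul, Complex.conj_conj, Complex.conj_conj, Complex.conj_I, map_zero] at l5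
  have hre : u (Z.re x) = (0, 0, 0, a / 2) := by
    refine Prod.ext p0 (Prod.ext p1 (Prod.ext p2 ?_))
    change (u (Z.re x)).2.2.2 = a / 2
    linear_combination (-1 / 2) * l3 - (1 / 2) * l5
  have him : u (Z.im x) = (0, 0, 0, -(Complex.I * (a / 2))) := by
    refine Prod.ext q0 (Prod.ext q1 (Prod.ext q2 ?_))
    change (u (Z.im x)).2.2.2 = -(Complex.I * (a / 2))
    linear_combination (1 / 2) * Complex.I * (l3 - l5) + (u (Z.im x)).2.2.2 * Complex.I_mul_I
  refine ⟨isInvertible_of_surjective hE ?_, U, Z, hx, hZ, a / 2, div_ne_zero ha two_ne_zero, hre, him⟩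
  refine LinearMap.range_eq_top.1 (coframeValue_eq_top (LinearMap.range u.toLinearMap)
    (div_ne_zero ha two_ne_zero) ⟨_, hre⟩ ⟨_, him⟩ ?_ ?_ ?_)
  · have n0 := H 0 2
    have n1 := H 1 2
    have n2 := H 2 2
    rw [(hr _).1, (hr _).1, hg] at n0
    rw [(hr _).2.1, (hr _).2.1, hg] at n1
    rw [(hr _).2.2.1, (hr _).2.2.1, hg] at n2
    simp only [Matrix.of_apply, Matrix.cons_val] at n0 n1 n2
    refine ⟨_, ⟨_, rfl⟩, (a0 n0).1, (a0 n1).1, ?_⟩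
    change (u (Z.fieldT.re x)).2.2.1 ≠ 0
    rw [(ofReal_add_I_mul n2).1, Complex.mul_conj, Complex.ofReal_re]
    exact (Complex.normSq_pos.2 ha).ne'
  · have n0 := H 0 1
    have n1 := H 1 1
    rw [(hr _).1, (hr _).1, hg] at n0
    rw [(hr _).2.1, (hr _).2.1, hg] at n1
    simp only [Matrix.of_apply, Matrix.cons_val] at n0 n1
    by_cases hz : (u (Z.fieldS.re x)).2.1 = 0
    · refine ⟨u (Z.fieldS.im x), ⟨_, rfl⟩, (a0 n0).2, fun hz' => ?_⟩
      refine mul_ne_zero (pow_ne_zero 2 ha) ((map_ne_zero (starRingEnd ℂ)).2 ha) (n1.trans ?_)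
      change ((u (Z.fieldS.re x)).2.1 : ℂ) + Complex.I * ((u (Z.fieldS.im x)).2.1 : ℂ) = 0
      rw [hz, show (u (Z.fieldS.im x)).2.1 = 0 from hz']; simp
    · exact ⟨_, ⟨_, rfl⟩, (a0 n0).1, hz⟩
  · have n0 := H 0 0
    rw [(hr _).1, (hr _).1, hg] at n0
    simp only [Matrix.of_apply, Matrix.cons_val] at n0
    by_cases hz : (u (Z.fieldR.re x)).1 = 0
    · refine ⟨u (Z.fieldR.im x), ⟨_, rfl⟩, fun hz' => ?_⟩
      refine mul_ne_zero (pow_ne_zero 3 ha) ((map_ne_zero (starRingEnd ℂ)).2 ha) (n0.trans ?_)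
      change ((u (Z.fieldR.re x)).1 : ℂ) + Complex.I * ((u (Z.fieldR.im x)).1 : ℂ) = 0
      rw [hz, show (u (Z.fieldR.im x)).1 = 0 from hz']; simp
    · exact ⟨u (Z.fieldR.re x), ⟨_, rfl⟩, hz⟩

/-- A normalized coframe is the coframe of a normal frame. -/
theorem CRStructure.IsNormalizedCoframe.exists_frame [FiniteDimensional ℝ E] [CompleteSpace E]
    (hE : Module.finrank ℝ E = 5)
    {U : Opens M} {s : ∀ x : M, TangentSpace 𝓘(ℝ, E) x →L[ℝ] CoframeValue}
    (hs : C.IsNormalizedCoframe U s) :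
    ∃ (R S T A B : SmoothField (F := E) U) (μ ν j : SmoothFun (F := E) U),
      IsLocalGenerator C.L U (gen A B) ∧
      (∀ x : U, (frameMap (five R S T A B) (x : M)).IsInvertible) ∧
      IsNormalFrame R S T A B μ ν j ∧ ∀ x : U, s x = coframeOf (five R S T A B) (x : M) := by
  have hsm : ∀ x ∈ U, SmoothFormAt s x := (smoothFormOn_iff U.isOpen).1 hs.smooth
  have hsi : ∀ x ∈ U, (s x).IsInvertible := fun x hx => ((hs.mem_P1 x hx).spec hE).1
  -- the frame `(R, S, T, A, B)` on which `s` takes the values `8, 4, 2` in `τ, σ, ρ` and `1, i` in `ζ`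
  obtain ⟨V, hV⟩ : ∃ V : Fin 5 → SmoothField (F := E) U, ∀ i (x : U),
      s x ((V i).1 x) = hat (Pi.single i 1) :=
    ⟨fun i => SmoothField.res U (fun y => (s y).inverse (hat (Pi.single i 1)))
      (fun x hx => (hsm x hx).inverse_apply (hsi x hx) _),
      fun i x => (hsi x x.2).self_apply_inverse _⟩
  have h5 : ∀ i, ![V 0, V 1, V 2, V 3, V 4] i = V i := fun i => by fin_cases i <;> rfl
  have hframe : ∀ (x : U) (c : Fin 5 → ℝ),
      s x (frameMap (five (V 0) (V 1) (V 2) (V 3) (V 4)) (x : M) c) = hat c := fun x c => by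
    rw [frameMap_apply, map_sum]
    simp only [map_smul, five_coe, h5, hV]
    rw [← Finset.univ_sum_single c, map_sum]
    refine Finset.sum_congr rfl fun i _ => ?_
    rw [← map_smul, ← Pi.single_smul, smul_eq_mul, mul_one]
    simp
  have hinv : ∀ x : U, (frameMap (five (V 0) (V 1) (V 2) (V 3) (V 4)) (x : M)).IsInvertible := by
    intro x
    obtain ⟨e, he⟩ := hsi x x.2
    refine ⟨hat.trans e.symm, ?_⟩
    ext c : 1
    apply e.injective
    have := hframe x c
    rw [← he] at this
    refine Eq.trans ?_ this.symm
    exact e.apply_symm_apply _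
  have hco : ∀ x : U, s x = coframeOf (five (V 0) (V 1) (V 2) (V 3) (V 4)) (x : M) := by
    intro x
    ext v : 1
    obtain ⟨c, rfl⟩ := (hinv x).surjective v
    rw [hframe]
    exact congrArg hat ((hinv x).inverse_apply_self c).symm
  have hinj : ∀ (x : U) (v w : TangentSpace 𝓘(ℝ, E) (x : M)), s x v = s x w → v = w := fun x v w h =>
    (hsi x x.2).injective h
  have hF := isFrame_of_isInvertible hinv
  obtain ⟨l, -, hl⟩ := hs.structure_eq
  have hd : ∀ (x : U) {W : SmoothField (F := E) U} {r s t a b : SmoothFun (F := E) U},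
      W = r • V 0 + s • V 1 + t • V 2 + a • V 3 + b • V 4 →
      dualForm (five (V 0) (V 1) (V 2) (V 3) (V 4)) (x : M) (W.1 x) =
        ![r.1 x, s.1 x, t.1 x, a.1 x, b.1 x] := fun x {W r s t a b} hW => dualForm_five (hinv x) hW
  have table : ∀ x : U, _ := fun x => by
    have h := ((structureEquationsAt_iff s l (x : M)).1 (hl x x.2)).comp (fun i => (V i).1 x)
    have e1 : (fun i => s x ((V i).1 x)) = fun i => hat (Pi.single i 1) := funext fun i => hV i x
    have e2 : (fun i k => extD s (x : M) ((V i).1 x) ((V k).1 x)) = fun i k =>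
        hat (-dualForm (five (V 0) (V 1) (V 2) (V 3) (V 4)) (x : M) (⁅V i, V k⁆.1 x)) := by
      funext i k
      have := extD_of_const (hsm x x.2) ((V i).2 x) ((V k).2 x)
        (eventually_coe x fun y => by rw [extV_coe]; exact hV i y)
        (eventually_coe x fun y => by rw [extV_coe]; exact hV k y)
      rw [extV_coe, extV_coe] at this
      rw [this, map_neg, hco]
      rfl
    rw [e1, e2] at h
    exact h.table
  obtain ⟨r₁, s₁, t₁, a₁, b₁, hAB⟩ := hF.span ⁅V 3, V 4⁆
  obtain ⟨r₂, s₂, t₂, a₂, b₂, hAT⟩ := hF.span ⁅V 3, V 2⁆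
  obtain ⟨r₃, s₃, t₃, a₃, b₃, hBT⟩ := hF.span ⁅V 4, V 2⁆
  obtain ⟨r₄, s₄, t₄, a₄, b₄, hAS⟩ := hF.span ⁅V 3, V 1⁆
  obtain ⟨r₅, s₅, t₅, a₅, b₅, hBS⟩ := hF.span ⁅V 4, V 1⁆
  obtain ⟨r₆, s₆, t₆, a₆, b₆, hAR⟩ := hF.span ⁅V 3, V 0⁆
  obtain ⟨r₇, s₇, t₇, a₇, b₇, hBR⟩ := hF.span ⁅V 4, V 0⁆
  obtain ⟨r₈, s₈, t₈, a₈, b₈, hST⟩ := hF.span ⁅V 1, V 2⁆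
  obtain ⟨j, hj⟩ : ∃ j : SmoothFun (F := E) U, ∀ x : U, j.1 x = (1 / 3) * r₈.1 x :=
    ⟨algebraMap ℝ _ (1 / 3) * r₈, fun x => rfl⟩
  have key : ∀ x : U, (r₁.1 x = 0 ∧ s₁.1 x = 0 ∧ t₁.1 x = -1) ∧
      (r₂.1 x = 0 ∧ s₂.1 x = 1 ∧ t₂.1 x = -(2 * -b₁.1 x)) ∧
      (r₃.1 x = 0 ∧ s₃.1 x = 0 ∧ t₃.1 x = j.1 x - 2 * a₁.1 x ∧ a₃.1 x = -b₂.1 x ∧ b₃.1 x = a₂.1 x) ∧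
      (r₄.1 x = 1 ∧ s₄.1 x = -(3 * -b₁.1 x)) ∧
      (r₅.1 x = 0 ∧ s₅.1 x = j.1 x - 3 * a₁.1 x ∧ a₅.1 x = -b₄.1 x ∧ b₅.1 x = a₄.1 x) ∧
      (r₆.1 x = -4 * -b₁.1 x ∧ s₆.1 x = 0) ∧ r₇.1 x = -(4 * a₁.1 x + 2 * j.1 x) ∧
      r₈.1 x = 3 * j.1 x := by
    intro x
    obtain ⟨j', h1, ⟨h2, h3, h4⟩, ⟨h5, h6, h7, h8, h9⟩, ⟨h10, h11⟩, ⟨h12, h13, h14, h15⟩,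
      ⟨h16, h17⟩, h18, h19⟩ := table x
    rw [hd x hAB] at h1
    rw [hd x hAT] at h2 h3 h4 h8 h9
    rw [hd x hBT] at h5 h6 h7 h8 h9
    rw [hd x hAS] at h10 h11 h14 h15
    rw [hd x hBS] at h12 h13 h14 h15
    rw [hd x hAR] at h16 h17
    rw [hd x hBR] at h18
    rw [hd x hST] at h19
    have g0 := congrFun h1 0
    have g1 := congrFun h1 1
    have g2 := congrFun h1 2
    have g3 := congrFun h1 3
    have g4 := congrFun h1 4
    simp only [Pi.neg_apply, Matrix.cons_val] at g0 g1 g2 g3 g4 h2 h3 h4 h5 h6 h7 h8 h9 h10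
    simp only [Pi.neg_apply, Matrix.cons_val] at h11 h12 h13 h14 h15 h16 h17 h18 h19
    have hjx := hj x
    refine ⟨⟨?_, ?_, ?_⟩, ⟨?_, ?_, ?_⟩, ⟨?_, ?_, ?_, ?_, ?_⟩, ⟨?_, ?_⟩, ⟨?_, ?_, ?_, ?_⟩, ⟨?_, ?_⟩,
      ?_, ?_⟩ <;> linarith
  have ext : ∀ {f g : SmoothFun (F := E) U}, (∀ x : U, f.1 x = g.1 x) → f = g := fun h =>
    Subtype.ext (funext h)
  have q1 : r₁ = 0 := ext fun x => (key x).1.1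
  have q2 : s₁ = 0 := ext fun x => (key x).1.2.1
  have q3 : t₁ = -1 := ext fun x => (key x).1.2.2
  have q4 : r₂ = 0 := ext fun x => (key x).2.1.1
  have q5 : s₂ = 1 := ext fun x => (key x).2.1.2.1
  have q6 : t₂ = -(2 * -b₁) := ext fun x => (key x).2.1.2.2
  have q7 : r₃ = 0 := ext fun x => (key x).2.2.1.1
  have q8 : s₃ = 0 := ext fun x => (key x).2.2.1.2.1
  have q9 : t₃ = j - 2 * a₁ := ext fun x => (key x).2.2.1.2.2.1
  have q10 : a₃ = -b₂ := ext fun x => (key x).2.2.1.2.2.2.1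
  have q11 : b₃ = a₂ := ext fun x => (key x).2.2.1.2.2.2.2
  have q12 : r₄ = 1 := ext fun x => (key x).2.2.2.1.1
  have q13 : s₄ = -(3 * -b₁) := ext fun x => (key x).2.2.2.1.2
  have q14 : r₅ = 0 := ext fun x => (key x).2.2.2.2.1.1
  have q15 : s₅ = j - 3 * a₁ := ext fun x => (key x).2.2.2.2.1.2.1
  have q16 : a₅ = -b₄ := ext fun x => (key x).2.2.2.2.1.2.2.1
  have q17 : b₅ = a₄ := ext fun x => (key x).2.2.2.2.1.2.2.2
  have q18 : r₆ = -4 * -b₁ := ext fun x => (key x).2.2.2.2.2.1.1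
  have q19 : s₆ = 0 := ext fun x => (key x).2.2.2.2.2.1.2
  have q20 : r₇ = -(4 * a₁ + 2 * j) := ext fun x => (key x).2.2.2.2.2.2.1
  have q21 : r₈ = 3 * j := ext fun x => (key x).2.2.2.2.2.2.2
  have hgen : ∀ x : U, (gen (V 3) (V 4)).val (x : M) ≠ 0 ∧
      C.L x = Submodule.span ℂ {(gen (V 3) (V 4)).val (x : M)} := by
    intro x
    obtain ⟨-, U', Z, hx, hZ, a, ha, hre, him⟩ := (hs.mem_P1 x x.2).spec hE
    have s3 : s x ((V 3).1 x) = (0, 0, 0, 1) := by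
      rw [hV, hat_apply]
      exact Prod.ext (by simp) (Prod.ext (by simp) (Prod.ext (by simp)
        (Complex.ext (by simp) (by simp))))
    have s4 : s x ((V 4).1 x) = (0, 0, 0, Complex.I) := by
      rw [hV, hat_apply]
      exact Prod.ext (by simp) (Prod.ext (by simp) (Prod.ext (by simp)
        (Complex.ext (by simp) (by simp))))
    have f1 : Z.re (x : M) = a.re • (V 3).1 x + a.im • (V 4).1 x := by
      apply hinj
      rw [hre, map_add, map_smul, map_smul, s3, s4]
      refine Prod.ext (by simp) (Prod.ext (by simp) (Prod.ext (by simp) ?_))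
      apply Complex.ext <;> simp
    have f2 : Z.im (x : M) = -(-a.im • (V 3).1 x + a.re • (V 4).1 x) := by
      apply hinj
      rw [him, map_neg, map_add, map_smul, map_smul, s3, s4]
      refine Prod.ext (by simp) (Prod.ext (by simp) (Prod.ext (by simp) ?_))
      apply Complex.ext <;> simp
    have f3 : Z.val (x : M) = a • (gen (V 3) (V 4)).val (x : M) := by
      unfold ComplexField.val
      rw [f1, f2]
      refine Eq.trans ?_ ((tmul_rotate ((V 3).1 x) ((V 4).1 x) a.re a.im).trans ?_)
      · rw [TensorProduct.tmul_neg, sub_eq_add_neg]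
      · rw [← gen_val]; rfl
    refine ⟨fun h0 => hZ.ne_zero x hx (by rw [f3, h0, smul_zero]), ?_⟩
    rw [hZ.span_eq x hx, f3, Submodule.span_singleton_smul_eq (IsUnit.mk0 _ ha)]
  refine ⟨V 0, V 1, V 2, V 3, V 4, -b₁, a₁, j, ⟨U.isOpen, gen_smoothOn _ _, ?_, ?_⟩, hinv, ⟨?_,
    ⟨a₂, b₂, ?_, ?_⟩, ⟨t₄, t₅, a₄, b₄, ?_, ?_⟩, ⟨t₆, a₆, b₆, ?_⟩, ⟨s₇, t₇, a₇, b₇, ?_⟩,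
    ⟨s₈, t₈, a₈, b₈, ?_⟩⟩, hco⟩
  · exact fun x hx => (hgen ⟨x, hx⟩).1
  · exact fun x hx => (hgen ⟨x, hx⟩).2
  · rw [hAB, q1, q2, q3]; module
  · rw [hAT, q4, q5, q6]; module
  · rw [hBT, q7, q8, q9, q10, q11]; module
  · rw [hAS, q12, q13]; module
  · rw [hBS, q14, q15, q16, q17]; module
  · rw [hAR, q18, q19]; module
  · rw [hBR, q20]
  · rw [hST, q21]

end Converse

/-! ### Uniqueness of normalized coframes -/

section Scaling

variable {E : Type*} [NormedAddCommGroup E] [NormedSpace ℝ E]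
  {M : Type*} [TopologicalSpace M] [ChartedSpace E M] [IsManifold 𝓘(ℝ, E) ∞ M]
  {C : CRStructure E M}

theorem scaleValue_apply (a : ℝˣ) (v : CoframeValue) : scaleValue a v =
    ((a : ℝ) ^ 4 * v.1, (a : ℝ) ^ 3 * v.2.1, (a : ℝ) ^ 2 * v.2.2.1, (a : ℂ) * v.2.2.2) := by
  rw [← Complex.real_smul]; rfl

theorem scaleValue_mul (a b : ℝˣ) :
    scaleValue (a * b) = (scaleValue a).comp (scaleValue b) := by
  refine ContinuousLinearMap.ext fun v => ?_
  rw [ContinuousLinearMap.comp_apply, scaleValue_apply, scaleValue_apply, scaleValue_apply]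
  simp only [Units.val_mul, Complex.ofReal_mul, mul_pow, mul_assoc]

theorem scaleValue_one : scaleValue 1 = ContinuousLinearMap.id ℝ CoframeValue := by
  refine ContinuousLinearMap.ext fun v => ?_
  rw [scaleValue_apply]
  simp

theorem CRStructure.IsNormalizedCoframe.mono {U V : Set M}
    {s : ∀ x : M, TangentSpace 𝓘(ℝ, E) x →L[ℝ] CoframeValue} (hs : C.IsNormalizedCoframe U s)
    (hV : IsOpen V) (h : V ⊆ U) : C.IsNormalizedCoframe V s := by
  obtain ⟨l, hl, he⟩ := hs.structure_eq
  exact ⟨hV, (smoothFormOn_iff hV).2 fun x hx => (smoothFormOn_iff hs.isOpen).1 hs.smooth x (h hx),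
    fun x hx => hs.mem_P1 x (h hx), l,
    (smoothFormOn_iff hV).2 fun x hx => (smoothFormOn_iff hs.isOpen).1 hl x (h hx),
    fun x hx => he x (h hx)⟩

/-- The action of `G₅` on the space of values, entry by entry, as a diagonal matrix. -/
theorem entry_scaleValue (a : ℝˣ) (v w : CoframeValue) (i : Fin 5) :
    entry (scaleValue a v) i + Complex.I * entry (scaleValue a w) i =
      (![(a : ℂ) ^ 4, (a : ℂ) ^ 3, (a : ℂ) ^ 2, (a : ℂ), (a : ℂ)] i) *
        (entry v i + Complex.I * entry w i) := by
  rw [scaleValue_apply, scaleValue_apply]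
  fin_cases i <;> simp [entry] <;> ring

/-- The group `G₅` acts on the initial `G₁`-structure. -/
theorem CRStructure.IsP1Coframe.scale {x : M} {u : TangentSpace 𝓘(ℝ, E) x →L[ℝ] CoframeValue}
    (h : C.IsP1Coframe x u) (a : ℝˣ) : C.IsP1Coframe x ((scaleValue a).comp u) := by
  obtain ⟨U, Z, hx, hZ, g, ⟨a₀, b, c, d, e, f, h, k, m, ha₀, hg⟩, H⟩ := h
  refine ⟨U, Z, hx, hZ, Matrix.of fun i j =>
    (![(a : ℂ) ^ 4, (a : ℂ) ^ 3, (a : ℂ) ^ 2, (a : ℂ), (a : ℂ)] i) * g i j,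
    ⟨a * a₀, a * b, a ^ 2 * c, a * d, a * e, a ^ 3 * f, a * h, a * k, a ^ 2 * m,
      mul_ne_zero (Complex.ofReal_ne_zero.2 a.ne_zero) ha₀, ?_⟩, fun i j => ?_⟩
  · rw [hg]
    ext i j
    fin_cases i <;> fin_cases j <;> simp <;> ring
  · rw [Matrix.of_apply, H]
    exact (entry_scaleValue a _ _ i).symm

/-- The group `G₅` acts on normalized coframes. -/
theorem CRStructure.IsNormalizedCoframe.scale [FiniteDimensional ℝ E] {U : Set M}
    {s : ∀ x : M, TangentSpace 𝓘(ℝ, E) x →L[ℝ] CoframeValue} (hs : C.IsNormalizedCoframe U s)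
    (a : ℝˣ) : C.IsNormalizedCoframe U fun x => (scaleValue a).comp (s x) := by
  have hsm := (smoothFormOn_iff hs.isOpen).1 hs.smooth
  obtain ⟨l, hl, he⟩ := hs.structure_eq
  refine ⟨hs.isOpen, (smoothFormOn_iff hs.isOpen).2 fun x hx =>
    SmoothFormAt.clm_comp (G := fun _ => scaleValue a) contMDiffAt_const (hsm x hx),
    fun x hx => (hs.mem_P1 x hx).scale a, l, hl, fun x hx => ?_⟩
  rw [structureEquationsAt_iff]
  have := StructEqs.scale ((structureEquationsAt_iff _ _ _).1 (he x hx)) a (fun _ => 0)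
    (dθ' := extD (fun x => (scaleValue a).comp (s x)) x) (fun v w => by
      rw [extD_const_comp _ (hsm x hx)]
      congr 1
      simp only [zero_mul, mul_zero, sub_zero, Complex.ofReal_zero]
      exact (add_zero _).symm)
  simp only [add_zero] at this
  exact this

theorem tmul_sub_injective {T : Type*} [AddCommGroup T] [Module ℝ T] {a b a' b' : T}
    (h : (1 : ℂ) ⊗ₜ[ℝ] a - Complex.I ⊗ₜ[ℝ] b = (1 : ℂ) ⊗ₜ[ℝ] a' - Complex.I ⊗ₜ[ℝ] b') :
    a = a' ∧ b = b' := by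
  have h1 := congrArg (fun t => TensorProduct.lid ℝ T (LinearMap.rTensor T Complex.reLm t)) h
  have h2 := congrArg (fun t => TensorProduct.lid ℝ T (LinearMap.rTensor T Complex.imLm t)) h
  simp at h1 h2
  exact ⟨h1, h2⟩

/-- Normalized coframes are unique up to the action of `G₅`. -/
theorem CRStructure.IsNormalizedCoframe.exists_scale [FiniteDimensional ℝ E]
    (hE : Module.finrank ℝ E = 5) {U : Opens M}
    {s s' : ∀ x : M, TangentSpace 𝓘(ℝ, E) x →L[ℝ] CoframeValue}
    (hs : C.IsNormalizedCoframe U s) (hs' : C.IsNormalizedCoframe U s') (x : U) :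
    ∃ a : ℝˣ, s' x = (scaleValue a).comp (s x) := by
  have : CompleteSpace E := FiniteDimensional.complete ℝ E
  obtain ⟨R, S, T, A, B, μ, ν, j, hg, hi, hN, hc⟩ := hs.exists_frame hE
  obtain ⟨R', S', T', A', B', μ', ν', j', hg', hi', hN', hc'⟩ := hs'.exists_frame hE
  have hF := isFrame_of_isInvertible hi
  have hF' := isFrame_of_isInvertible hi'
  have ext : ∀ {f g : SmoothFun (F := E) U}, (∀ x : U, f.1 x = g.1 x) → f = g := fun h =>
    Subtype.ext (funext h)
  -- both `A - i B` and `A' - i B'` generate `L`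
  have rot : ∀ x : U, ∃ c : ℂ, c ≠ 0 ∧ A'.1 x = c.re • A.1 x + c.im • B.1 x ∧
      B'.1 x = -c.im • A.1 x + c.re • B.1 x := by
    intro x
    have h1 : (gen A' B').val (x : M) ∈ C.L (x : M) := by
      rw [hg'.span_eq x x.2]; exact Submodule.mem_span_singleton_self _
    rw [hg.span_eq x x.2, Submodule.mem_span_singleton] at h1
    obtain ⟨c, h1⟩ := h1
    refine ⟨c, ?_, ?_⟩
    · rintro rfl
      exact hg'.ne_zero x x.2 (by rw [← h1, zero_smul])
    · rw [gen_val, gen_val, ← Complex.eta c, ← tmul_rotate] at h1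
      exact tmul_sub_injective h1.symm
  obtain ⟨r₁, s₁, t₁, p, q, hA⟩ := hF.span A'
  obtain ⟨r₂, s₂, t₂, p', q', hB⟩ := hF.span B'
  have key : ∀ x : U, (r₁.1 x = 0 ∧ s₁.1 x = 0 ∧ t₁.1 x = 0) ∧
      (r₂.1 x = 0 ∧ s₂.1 x = 0 ∧ t₂.1 x = 0 ∧ p'.1 x = -q.1 x ∧ q'.1 x = p.1 x) ∧
      (p.1 x * p.1 x + q.1 x * q.1 x ≠ 0) := by
    intro x
    obtain ⟨c, c0, h1, h2⟩ := rot x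
    have e3 := dualForm_single (hi x) 3
    have e4 := dualForm_single (hi x) 4
    have k1 := dualForm_five (hi x) hA
    have k2 := dualForm_five (hi x) hB
    rw [h1, map_add, map_smul, map_smul] at k1
    rw [h2, map_add, map_smul, map_smul] at k2
    change c.re • dualForm (five R S T A B) (x : M) (![R, S, T, A, B] 3 |>.1 x) +
      c.im • dualForm (five R S T A B) (x : M) (![R, S, T, A, B] 4 |>.1 x) = _ at k1
    change -c.im • dualForm (five R S T A B) (x : M) (![R, S, T, A, B] 3 |>.1 x) +
      c.re • dualForm (five R S T A B) (x : M) (![R, S, T, A, B] 4 |>.1 x) = _ at k2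
    rw [e3, e4] at k1 k2
    have l := fun i => congrFun k1 i
    have m := fun i => congrFun k2 i
    have l0 := l 0; have l1 := l 1; have l2 := l 2; have l3 := l 3; have l4 := l 4
    have m0 := m 0; have m1 := m 1; have m2 := m 2; have m3 := m 3; have m4 := m 4
    simp at l0 l1 l2 l3 l4 m0 m1 m2 m3 m4
    refine ⟨⟨l0.symm, l1.symm, l2.symm⟩, ⟨m0.symm, m1.symm, m2.symm, by linarith, by linarith⟩, ?_⟩
    rw [← l3, ← l4]
    exact fun h => c0 (Complex.normSq_eq_zero.1 h)
  have hA' : A' = p • A + q • B := by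
    rw [hA, show r₁ = 0 from ext fun x => (key x).1.1, show s₁ = 0 from ext fun x => (key x).1.2.1,
      show t₁ = 0 from ext fun x => (key x).1.2.2]
    module
  have hB' : B' = (-q) • A + p • B := by
    rw [hB, show r₂ = 0 from ext fun x => (key x).2.1.1, show s₂ = 0 from ext fun x => (key x).2.1.2.1,
      show t₂ = 0 from ext fun x => (key x).2.1.2.2.1,
      show p' = -q from ext fun x => (key x).2.1.2.2.2.1,
      show q' = p from ext fun x => (key x).2.1.2.2.2.2]
    module
  obtain ⟨w, hw⟩ := SmoothFun.exists_inverse (p * p + q * q) fun x => (key x).2.2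
  -- the factor is real, and after rescaling the two normal frames have the same `A` and `B`
  have hq : q = 0 := IsNormalFrame.rotation_eq_zero (SmoothField.isAnchor_deriv (F := E) (U := U))
    hF hN hN' hA' hB' hw
  subst hq
  have hA'' : p • A = A' := by rw [hA']; module
  have hB'' : p • B = B' := by rw [hB']; module
  have hp : (w * p) * p = 1 := by rw [← hw]; ring
  have hN'' := hN.scale (SmoothField.isAnchor_deriv (F := E) (U := U)) hp
  rw [hA'', hB''] at hN''
  obtain ⟨c, hc10⟩ : ∃ c : SmoothFun (F := E) U, 10 * c = 1 :=
    ⟨algebraMap ℝ _ (1 / 10), by rw [← map_ofNat (algebraMap ℝ _) 10, ← map_mul]; norm_num⟩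
  obtain ⟨hR, hS, hT⟩ := hN'.unique (SmoothField.isAnchor_deriv (F := E) (U := U)) hc10 hF' hN''
  have hpx : p.1 x ≠ 0 := fun h => by
    have := congrArg (fun f : SmoothFun (F := E) U => f.1 x) hp
    change w.1 x * p.1 x * p.1 x = 1 at this
    rw [h, mul_zero] at this
    exact zero_ne_one this
  refine ⟨(Units.mk0 _ hpx)⁻¹, ?_⟩
  rw [hc, hc']
  ext v : 1
  obtain ⟨v, rfl⟩ := (hi' x).surjective v
  have e1 : frameMap (five R' S' T' A' B') (x : M) v = frameMap (five R S T A B) (x : M)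
      ![p.1 x ^ 4 * v 0, p.1 x ^ 3 * v 1, p.1 x ^ 2 * v 2, p.1 x * v 3, p.1 x * v 4] := by
    rw [frameMap_five, frameMap_five, ← hR, ← hS, ← hT, ← hA'', ← hB'']
    have aux : ∀ a b c d e : E, v 0 • (p.1 x ^ 4 • a) + v 1 • (p.1 x ^ 3 • b) +
        v 2 • (p.1 x ^ 2 • c) + v 3 • (p.1 x • d) + v 4 • (p.1 x • e) =
        (p.1 x ^ 4 * v 0) • a + (p.1 x ^ 3 * v 1) • b + (p.1 x ^ 2 * v 2) • c + (p.1 x * v 3) • d +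
        (p.1 x * v 4) • e := fun a b c d e => by module
    exact aux _ _ _ _ _
  have e2 : ∀ {V : Fin 5 → ∀ x : M, TangentSpace 𝓘(ℝ, E) x}, (frameMap V (x : M)).IsInvertible →
      ∀ c, coframeOf V (x : M) (frameMap V (x : M) c) = hat c := fun hV c =>
    congrArg hat (hV.inverse_apply_self c)
  rw [e2 (hi' x), ContinuousLinearMap.comp_apply, e1, e2 (hi x), scaleValue_apply, hat_apply,
    hat_apply]
  simp only [Units.val_inv_eq_inv_val, Units.val_mk0, Matrix.cons_val]
  refine Prod.ext ?_ (Prod.ext ?_ (Prod.ext ?_ (Complex.ext ?_ ?_)))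
  · simp; field_simp
  · simp; field_simp
  · simp; field_simp
  · simp [hpx]
  · simp [hpx]

end Scaling

/-! ### Smooth maps into the bundle of coframes -/

section CoframeBundle

variable {E : Type*} [NormedAddCommGroup E] [NormedSpace ℝ E]
  {M : Type*} [TopologicalSpace M] [ChartedSpace E M] [IsManifold 𝓘(ℝ, E) ∞ M]
  {F : Type*} [NormedAddCommGroup F] [NormedSpace ℝ F]
  {Y : Type*} [TopologicalSpace Y] [ChartedSpace F Y]

/-- The expression of a coframe at a point of `M` in the chart at `x₀`. -/
def coframeCoord (x₀ : M) (q : CoframeSpace E M) : E →L[ℝ] CoframeValue :=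
  ContinuousLinearMap.comp (q.2 : TangentSpace 𝓘(ℝ, E) q.1 →L[ℝ] CoframeValue)
    ((trivializationAt E (TangentSpace 𝓘(ℝ, E)) x₀).symmL ℝ q.1)

theorem trivializationAt_snd (x₀ : M) (q : CoframeSpace E M) :
    ((trivializationAt (E →L[ℝ] CoframeValue)
      (fun x : M => TangentSpace 𝓘(ℝ, E) x →L[ℝ] Bundle.Trivial M CoframeValue x) x₀) q).2 =
      coframeCoord x₀ q := by
  rw [hom_trivializationAt_apply]
  refine ContinuousLinearMap.ext fun v => ?_
  unfold ContinuousLinearMap.inCoordinates coframeCoord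
  rw [ContinuousLinearMap.comp_apply, ContinuousLinearMap.comp_apply]
  rw [Trivialization.continuousLinearMapAt_apply, Trivialization.linearMapAt_apply]
  rw [if_pos]
  · rfl
  · exact ⟨trivial, trivial, trivial, trivial⟩

theorem contMDiffAt_coframeSpace {I : Type*} [TopologicalSpace I] {J : ModelWithCorners ℝ F I}
    {Y : Type*} [TopologicalSpace Y] [ChartedSpace I Y] {f : Y → CoframeSpace E M} {y : Y} :
    ContMDiffAt J (𝓘(ℝ, E).prod 𝓘(ℝ, E →L[ℝ] CoframeValue)) ∞ f y ↔
      ContMDiffAt J 𝓘(ℝ, E) ∞ (fun y => (f y).1) y ∧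
      ContMDiffAt J 𝓘(ℝ, E →L[ℝ] CoframeValue) ∞
        (fun z => coframeCoord (f y).1 (f z)) y := by
  rw [contMDiffAt_totalSpace]
  simp only [trivializationAt_snd]

/-- The map `diag(a⁴, a³, a², a, a)` for a real number `a`. -/
def scaleReal (a : ℝ) : CoframeValue →L[ℝ] CoframeValue :=
  ContinuousLinearMap.prodMap (a ^ 4 • ContinuousLinearMap.id ℝ ℝ)
    (ContinuousLinearMap.prodMap (a ^ 3 • ContinuousLinearMap.id ℝ ℝ)
      (ContinuousLinearMap.prodMap (a ^ 2 • ContinuousLinearMap.id ℝ ℝ)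
        (a • ContinuousLinearMap.id ℝ ℂ)))

theorem contDiff_scaleReal : ContDiff ℝ ∞ scaleReal := by
  rw [contDiff_clm_apply_iff]
  intro v
  have : (fun a => scaleReal a v) = fun a : ℝ => (a ^ 4 * v.1, a ^ 3 * v.2.1, a ^ 2 * v.2.2.1,
      a • v.2.2.2) := rfl
  rw [this]
  fun_prop

theorem contMDiffAt_scaleReal (a : ℝ) :
    ContMDiffAt 𝓘(ℝ, ℝ) 𝓘(ℝ, CoframeValue →L[ℝ] CoframeValue) ∞ scaleReal a :=
  contDiff_scaleReal.contDiffAt.contMDiffAt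

/-- The multiple `diag(a⁴, a³, a², a, a) ω` of a coframe. -/
def scaleBy (a : ℝ) (p : CoframeSpace E M) : CoframeSpace E M :=
  ⟨p.1, ContinuousLinearMap.comp (scaleReal a) (p.2 : TangentSpace 𝓘(ℝ, E) p.1 →L[ℝ] CoframeValue)⟩

theorem scaleBy_coe (a : ℝˣ) (p : CoframeSpace E M) : scaleBy (a : ℝ) p = scaleCoframe a p := rfl

theorem contMDiffAt_scaleBy {I : Type*} [TopologicalSpace I] {J : ModelWithCorners ℝ F I}
    {Y : Type*} [TopologicalSpace Y] [ChartedSpace I Y] {a : Y → ℝ} {f : Y → CoframeSpace E M} {y : Y}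
    (ha : ContMDiffAt J 𝓘(ℝ, ℝ) ∞ a y)
    (hf : ContMDiffAt J (𝓘(ℝ, E).prod 𝓘(ℝ, E →L[ℝ] CoframeValue)) ∞ f y) :
    ContMDiffAt J (𝓘(ℝ, E).prod 𝓘(ℝ, E →L[ℝ] CoframeValue)) ∞
      (fun y => scaleBy (a y) (f y)) y := by
  rw [contMDiffAt_coframeSpace] at hf ⊢
  exact ⟨hf.1, ((contMDiffAt_scaleReal (a y)).comp y ha).clm_comp hf.2⟩

/-- A local coframe as a map into the bundle of coframes. -/
def sectionMap (s : ∀ x : M, TangentSpace 𝓘(ℝ, E) x →L[ℝ] CoframeValue) (x : M) :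
    CoframeSpace E M := ⟨x, s x⟩

theorem contMDiffAt_sectionMap {I : Type*} [TopologicalSpace I] {J : ModelWithCorners ℝ F I}
    {Y : Type*} [TopologicalSpace Y] [ChartedSpace I Y]
    {s : ∀ x : M, TangentSpace 𝓘(ℝ, E) x →L[ℝ] CoframeValue} {f : Y → M} {y : Y}
    (hs : SmoothFormAt s (f y)) (hf : ContMDiffAt J 𝓘(ℝ, E) ∞ f y) :
    ContMDiffAt J (𝓘(ℝ, E).prod 𝓘(ℝ, E →L[ℝ] CoframeValue)) ∞ (fun y => sectionMap s (f y)) y := by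
  rw [contMDiffAt_coframeSpace]
  exact ⟨hf, (smoothFormAt_iff.1 hs).comp y hf⟩

/-- The ratio of a coframe to a coframe `s`: if `q = diag(a⁴, a³, a², a, a) s`, it is `a`. -/
def ratio (s : ∀ x : M, TangentSpace 𝓘(ℝ, E) x →L[ℝ] CoframeValue) (q : CoframeSpace E M) : ℝ :=
  ((q.2 : TangentSpace 𝓘(ℝ, E) q.1 →L[ℝ] CoframeValue) ((s q.1).inverse (0, 0, 0, 1))).2.2.2.re

theorem ratio_scaleBy {s : ∀ x : M, TangentSpace 𝓘(ℝ, E) x →L[ℝ] CoframeValue} (a : ℝ)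
    (q : CoframeSpace E M) : ratio s (scaleBy a q) = a * ratio s q := by
  unfold ratio scaleBy
  rw [ContinuousLinearMap.comp_apply]
  exact Complex.re_ofReal_mul _ _ |>.symm ▸ (by simp [scaleReal])

theorem ratio_sectionMap {s : ∀ x : M, TangentSpace 𝓘(ℝ, E) x →L[ℝ] CoframeValue} {x : M}
    (h : (s x).IsInvertible) : ratio s (sectionMap s x) = 1 := by
  unfold ratio sectionMap
  rw [h.self_apply_inverse]
  simp

theorem contMDiffAt_ratio [CompleteSpace E]
    {s : ∀ x : M, TangentSpace 𝓘(ℝ, E) x →L[ℝ] CoframeValue} {q : CoframeSpace E M}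
    (hs : SmoothFormAt s q.1) (hi : (s q.1).IsInvertible) :
    ContMDiffAt (𝓘(ℝ, E).prod 𝓘(ℝ, E →L[ℝ] CoframeValue)) 𝓘(ℝ, ℝ) ∞ (ratio s) q := by
  have h0 := contMDiffAt_coframeSpace.1 (contMDiffAt_id (I := 𝓘(ℝ, E).prod 𝓘(ℝ, E →L[ℝ] CoframeValue))
    (x := q))
  have h1 := ContMDiffAt.comp q (hs.inverse_apply hi (0, 0, 0, 1)).eventually h0.1
  have h2 := h0.2.clm_apply h1
  have h3 : ContMDiffAt 𝓘(ℝ, CoframeValue) 𝓘(ℝ, ℝ) ∞ (fun v : CoframeValue => v.2.2.2.re)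
      (coframeCoord q.1 q ((trivializationAt E (TangentSpace 𝓘(ℝ, E)) q.1
        ⟨q.1, (s q.1).inverse (0, 0, 0, 1)⟩).2)) := by
    refine ContDiffAt.contMDiffAt ?_
    have : (fun v : CoframeValue => v.2.2.2.re) = fun v : CoframeValue => Complex.reCLM v.2.2.2 := rfl
    rw [this]
    fun_prop
  refine (h3.comp q h2).congr_of_eventuallyEq ?_
  have h4 : ∀ᶠ q' in nhds q, q'.1 ∈ (trivializationAt E (TangentSpace 𝓘(ℝ, E)) q.1).baseSet :=
    h0.1.continuousAt.eventually_mem ((trivializationAt E (TangentSpace 𝓘(ℝ, E)) q.1).open_baseSet.mem_nhds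
      (mem_baseSet_trivializationAt E (TangentSpace 𝓘(ℝ, E)) q.1))
  filter_upwards [h4] with q' hq'
  unfold ratio coframeCoord
  simp only [Function.comp_apply, ContinuousLinearMap.comp_apply, id]
  rw [Trivialization.symmL_apply _ hq', Trivialization.symm_apply_apply_mk _ hq']

end CoframeBundle

/-! ### The fibres of the bundle of normalized coframes -/

section Fibre

variable {E : Type*} [NormedAddCommGroup E] [NormedSpace ℝ E]
  {M : Type*} [TopologicalSpace M] [ChartedSpace E M] [IsManifold 𝓘(ℝ, E) ∞ M]
  {C : CRStructure E M} {s : ∀ x : M, TangentSpace 𝓘(ℝ, E) x →L[ℝ] CoframeValue}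
  {U : Opens M}

theorem CRStructure.IsNormalizedCoframe.smoothAt (hs : C.IsNormalizedCoframe U s) {x : M}
    (hx : x ∈ U) : SmoothFormAt s x := (smoothFormOn_iff hs.isOpen).1 hs.smooth x hx

theorem CRStructure.IsNormalizedCoframe.isInvertible [FiniteDimensional ℝ E]
    (hs : C.IsNormalizedCoframe U s) (hE : Module.finrank ℝ E = 5) {x : M} (hx : x ∈ U) :
    (s x).IsInvertible := ((hs.mem_P1 x hx).spec hE).1

theorem CRStructure.IsNormalizedCoframe.scaleCoframe_mem [FiniteDimensional ℝ E]
    (hs : C.IsNormalizedCoframe U s) {x : M} (hx : x ∈ U) (a : ℝˣ) :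
    scaleCoframe a (sectionMap s x) ∈ C.P5Set :=
  ⟨U, _, hx, hs.scale a, rfl⟩

theorem scaleCoframe_mem_P5Set [FiniteDimensional ℝ E] {q : CoframeSpace E M} (hq : q ∈ C.P5Set)
    (a : ℝˣ) : scaleCoframe a q ∈ C.P5Set := by
  obtain ⟨U, s, hx, hs, e⟩ := hq
  refine ⟨U, _, hx, hs.scale a, ?_⟩
  change ContinuousLinearMap.comp _ _ = _
  rw [e]; rfl

/-- The fibre of `P⁵` over a point is an orbit of `G₅`. -/
theorem CRStructure.IsNormalizedCoframe.eq_scaleBy [FiniteDimensional ℝ E]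
    (hs : C.IsNormalizedCoframe U s) (hE : Module.finrank ℝ E = 5) {q : CoframeSpace E M}
    (hq : q ∈ C.P5Set) (hx : q.1 ∈ U) :
    ratio s q ≠ 0 ∧ q = scaleBy (ratio s q) (sectionMap s q.1) := by
  obtain ⟨x, q⟩ := q
  obtain ⟨U', s', hx', hs', e⟩ := hq
  have e : q = s' x := e
  subst e
  have hV : IsOpen ((U : Set M) ∩ U') := U.isOpen.inter hs'.isOpen
  obtain ⟨a, ha⟩ := CRStructure.IsNormalizedCoframe.exists_scale hE
    (U := ⟨(U : Set M) ∩ U', hV⟩) (hs.mono hV Set.inter_subset_left)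
    (hs'.mono hV Set.inter_subset_right) ⟨x, hx, hx'⟩
  have e1 : (⟨x, s' x⟩ : CoframeSpace E M) = scaleBy (a : ℝ) (sectionMap s x) := by
    rw [ha]; rfl
  rw [e1, ratio_scaleBy, ratio_sectionMap (hs.isInvertible hE hx), mul_one]
  exact ⟨a.ne_zero, rfl⟩

end Fibre


/-! ### The smooth structure of `P⁵` -/

section Tangent

variable {F : Type*} [NormedAddCommGroup F] [NormedSpace ℝ F]
  {X : Type*} [TopologicalSpace X] [ChartedSpace F X] [IsManifold 𝓘(ℝ, F) ∞ X]
  {W : Type*} [NormedAddCommGroup W] [NormedSpace ℝ W]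

/-- In the preferred chart at `p` the derivative at `p` of a linear function of the coordinates is this
linear function. -/
theorem mfderiv_clm_comp_extChartAt (p : X) (v : TangentSpace 𝓘(ℝ, F) p) (A : F →L[ℝ] W) :
    mfderiv 𝓘(ℝ, F) 𝓘(ℝ, W) (A ∘ extChartAt 𝓘(ℝ, F) p) p v = A (show F from v) := by
  have h8 := mfderiv_comp p (g := A) (f := extChartAt 𝓘(ℝ, F) p) (I := 𝓘(ℝ, F))
    (I' := 𝓘(ℝ, F)) (I'' := 𝓘(ℝ, W)) A.mdifferentiableAt
    ((contMDiffAt_extChartAt (n := ∞)).mdifferentiableAt (by simp))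
  rw [mfderiv_extChartAt_self, A.mfderiv_eq] at h8
  exact congrArg (fun B => B v) h8

theorem comp_apply_eq_zero {A B D : Type*} [NormedAddCommGroup A] [NormedAddCommGroup B]
    [NormedAddCommGroup D] [NormedSpace ℝ A] [NormedSpace ℝ B] [NormedSpace ℝ D] (g : B →L[ℝ] D)
    (f : A →L[ℝ] B) {v : A} (h : f v = 0) : g.comp f v = 0 := by
  rw [ContinuousLinearMap.comp_apply, h, map_zero]

end Tangent

section Charts

variable {E : Type*} [NormedAddCommGroup E] [NormedSpace ℝ E]
  {M : Type*} [TopologicalSpace M] [ChartedSpace E M] [IsManifold 𝓘(ℝ, E) ∞ M]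
  {C : CRStructure E M}

/-- The point of `P⁵` given by a member of the set `P5Set`. -/
def CRStructure.toP5 (C : CRStructure E M) (q : CoframeSpace E M) (h : q ∈ C.P5Set) : C.P5 := ⟨q, h⟩

theorem isInducing_incl : Topology.IsInducing C.incl := Topology.IsInducing.subtypeVal

theorem incl_injective : Function.Injective C.incl := Subtype.val_injective

theorem continuous_incl : Continuous C.incl := isInducing_incl.continuous

theorem continuous_coframeSpace_proj : Continuous fun q : CoframeSpace E M => q.1 :=
  continuous_iff_continuousAt.2 fun _ => (contMDiffAt_coframeSpace.1
    (contMDiffAt_id (I := 𝓘(ℝ, E).prod 𝓘(ℝ, E →L[ℝ] CoframeValue)))).1.continuousAt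

theorem continuous_proj : Continuous C.proj := continuous_coframeSpace_proj.comp continuous_incl

variable {U : Opens M} {s : ∀ x : M, TangentSpace 𝓘(ℝ, E) x →L[ℝ] CoframeValue}

/-- The domain of the coordinates `(x, a)` of the coframe `diag(a⁴, a³, a², a, a) s(x)`. -/
def chartTarget (U : Opens M) (x₀ : M) : Set (E × ℝ) :=
  {z | z.1 ∈ (chartAt E x₀).target ∧ (chartAt E x₀).symm z.1 ∈ U ∧ z.2 ≠ 0}

theorem isOpen_chartTarget (x₀ : M) : IsOpen (chartTarget (E := E) U x₀) := by
  have h1 := (chartAt E x₀).isOpen_inter_preimage_symm U.isOpen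
  have : chartTarget (E := E) U x₀ =
      (((chartAt E x₀).target ∩ (chartAt E x₀).symm ⁻¹' U) ×ˢ ({0}ᶜ : Set ℝ)) := by
    ext z
    simp only [chartTarget, Set.mem_ofPred_eq, Set.mem_prod, Set.mem_inter_iff, Set.mem_preimage,
      Set.mem_compl_iff, Set.mem_singleton_iff, and_assoc]
    rfl
  rw [this]
  exact h1.prod isClosed_singleton.isOpen_compl

/-- The coframe with coordinates `(x, a)`. -/
def chartSymm (s : ∀ x : M, TangentSpace 𝓘(ℝ, E) x →L[ℝ] CoframeValue) (x₀ : M) (z : E × ℝ) :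
    CoframeSpace E M := scaleBy z.2 (sectionMap s ((chartAt E x₀).symm z.1))

theorem chartSymm_mem [FiniteDimensional ℝ E] (hs : C.IsNormalizedCoframe U s) {x₀ : M} {z : E × ℝ}
    (hz : z ∈ chartTarget U x₀) : chartSymm s x₀ z ∈ C.P5Set :=
  hs.scaleCoframe_mem hz.2.1 (Units.mk0 z.2 hz.2.2)

theorem contMDiffAt_chartSymm (hs : C.IsNormalizedCoframe U s) {x₀ : M} {z : E × ℝ}
    (hz : z ∈ chartTarget U x₀) : ContMDiffAt 𝓘(ℝ, E × ℝ)
      (𝓘(ℝ, E).prod 𝓘(ℝ, E →L[ℝ] CoframeValue)) ∞ (chartSymm s x₀) z := by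
  have h1 : ContMDiffAt 𝓘(ℝ, E × ℝ) 𝓘(ℝ, E) ∞ (fun z : E × ℝ => z.1) z :=
    contDiff_fst.contMDiff.contMDiffAt
  have h2 : ContMDiffAt 𝓘(ℝ, E × ℝ) 𝓘(ℝ, ℝ) ∞ (fun z : E × ℝ => z.2) z :=
    contDiff_snd.contMDiff.contMDiffAt
  have h3 : ContMDiffAt 𝓘(ℝ, E) 𝓘(ℝ, E) ∞ (chartAt E x₀).symm z.1 :=
    (contMDiffOn_chart_symm (I := 𝓘(ℝ, E)) (x := x₀)).contMDiffAt
      ((chartAt E x₀).open_target.mem_nhds hz.1)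
  exact contMDiffAt_scaleBy h2 (contMDiffAt_sectionMap (hs.smoothAt hz.2.1) (h3.comp z h1))

open Classical in
/-- The chart of `P⁵` given by a chart of `M` and a normalized local coframe; outside of its target
the inverse takes the arbitrary value `p₀`. -/
def p5Chart [FiniteDimensional ℝ E] (hE : Module.finrank ℝ E = 5) (hs : C.IsNormalizedCoframe U s)
    (x₀ : M) (p₀ : C.P5) : OpenPartialHomeomorph C.P5 (E × ℝ) where
  toFun p := (chartAt E x₀ (C.proj p), ratio s (C.incl p))
  invFun z := if h : z ∈ chartTarget U x₀ then C.toP5 (chartSymm s x₀ z) (chartSymm_mem hs h) else p₀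
  source := C.proj ⁻¹' ((chartAt E x₀).source ∩ U)
  target := chartTarget U x₀
  map_source' p hp := ⟨(chartAt E x₀).map_source hp.1, by
    rw [(chartAt E x₀).left_inv hp.1]; exact hp.2, (hs.eq_scaleBy hE p.2 hp.2).1⟩
  map_target' z hz := by
    rw [dif_pos hz]
    exact ⟨(chartAt E x₀).map_target hz.1, hz.2.1⟩
  left_inv' p hp := by
    have h : (chartAt E x₀ (C.proj p), ratio s (C.incl p)) ∈ chartTarget (E := E) U x₀ :=
      ⟨(chartAt E x₀).map_source hp.1, by
        rw [(chartAt E x₀).left_inv hp.1]; exact hp.2, (hs.eq_scaleBy hE p.2 hp.2).1⟩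
    rw [dif_pos h]
    apply incl_injective
    refine Eq.trans ?_ (hs.eq_scaleBy hE p.2 hp.2).2.symm
    change scaleBy _ (sectionMap s ((chartAt E x₀).symm (chartAt E x₀ (C.proj p)))) = _
    rw [(chartAt E x₀).left_inv hp.1]; rfl
  right_inv' z hz := by
    rw [dif_pos hz]
    refine Prod.ext ((chartAt E x₀).right_inv hz.1) ?_
    change ratio s (scaleBy z.2 (sectionMap s _)) = z.2
    rw [ratio_scaleBy, ratio_sectionMap (hs.isInvertible hE hz.2.1), mul_one]
  open_source := ((chartAt E x₀).open_source.inter U.isOpen).preimage continuous_proj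
  open_target := isOpen_chartTarget x₀
  continuousOn_toFun := by
    have : CompleteSpace E := FiniteDimensional.complete ℝ E
    intro p hp
    refine ContinuousAt.continuousWithinAt (ContinuousAt.prodMk ?_ ?_)
    · exact ((chartAt E x₀).continuousAt hp.1).comp continuous_proj.continuousAt
    · exact (contMDiffAt_ratio (hs.smoothAt hp.2) (hs.isInvertible hE hp.2)).continuousAt.comp
        continuous_incl.continuousAt
  continuousOn_invFun := by
    intro z hz
    refine isInducing_incl.continuousWithinAt_iff.2 ?_
    refine ((contMDiffAt_chartSymm hs hz).continuousAt.continuousWithinAt).congr (fun y hy => ?_) ?_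
    · exact congrArg C.incl (dif_pos hy)
    · exact congrArg C.incl (dif_pos hz)

theorem incl_p5Chart_symm [FiniteDimensional ℝ E] (hE : Module.finrank ℝ E = 5)
    (hs : C.IsNormalizedCoframe U s) (x₀ : M) (p₀ : C.P5) {z : E × ℝ} (hz : z ∈ chartTarget U x₀) :
    C.incl ((p5Chart hE hs x₀ p₀).symm z) = chartSymm s x₀ z :=
  congrArg C.incl (dif_pos hz)

/-- The charts of `P⁵` given by a family of normalized local coframes. -/
@[reducible] def p5ChartedSpace [FiniteDimensional ℝ E] (hE : Module.finrank ℝ E = 5) (U : M → Opens M)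
    (s : M → ∀ x : M, TangentSpace 𝓘(ℝ, E) x →L[ℝ] CoframeValue) (hU : ∀ x, x ∈ U x)
    (hs : ∀ x, C.IsNormalizedCoframe (U x) (s x)) : ChartedSpace (E × ℝ) C.P5 where
  atlas := Set.range fun p => p5Chart hE (hs (C.proj p)) (C.proj p) p
  chartAt p := p5Chart hE (hs (C.proj p)) (C.proj p) p
  mem_chart_source p := ⟨mem_chart_source E (C.proj p), hU (C.proj p)⟩
  chart_mem_atlas p := ⟨p, rfl⟩

theorem isManifold_p5 [FiniteDimensional ℝ E] (hE : Module.finrank ℝ E = 5) (U : M → Opens M)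
    (s : M → ∀ x : M, TangentSpace 𝓘(ℝ, E) x →L[ℝ] CoframeValue) (hU : ∀ x, x ∈ U x)
    (hs : ∀ x, C.IsNormalizedCoframe (U x) (s x)) :
    @IsManifold ℝ _ (E × ℝ) _ _ (E × ℝ) _ 𝓘(ℝ, E × ℝ) ∞ C.P5 _ (p5ChartedSpace hE U s hU hs) := by
  have : CompleteSpace E := FiniteDimensional.complete ℝ E
  let _ := p5ChartedSpace hE U s hU hs
  refine isManifold_of_contDiffOn _ _ _ ?_
  rintro _ _ ⟨p, rfl⟩ ⟨p', rfl⟩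
  intro z hz
  obtain ⟨⟨hz, hz'⟩, -⟩ := hz
  have hz : z ∈ chartTarget (U (C.proj p)) (C.proj p) := hz
  have hz' : (chartAt E (C.proj p)).symm z.1 ∈ (chartAt E (C.proj p')).source ∩ U (C.proj p') := by
    have : (C.incl ((p5Chart hE (hs (C.proj p)) (C.proj p) p).symm z)).1 ∈
      (chartAt E (C.proj p')).source ∩ (U (C.proj p') : Set M) := hz'
    rwa [incl_p5Chart_symm _ _ _ _ hz] at this
  have h1 := contMDiffAt_chartSymm (hs (C.proj p)) hz
  have h2 := (contMDiffAt_ratio ((hs (C.proj p')).smoothAt hz'.2)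
    ((hs (C.proj p')).isInvertible hE hz'.2)).comp z (f := chartSymm (s (C.proj p)) (C.proj p)) h1
  have h3 : ContMDiffAt 𝓘(ℝ, E) 𝓘(ℝ, E) ∞ (chartAt E (C.proj p')) ((chartAt E (C.proj p)).symm z.1) :=
    (contMDiffOn_chart (I := 𝓘(ℝ, E)) (x := C.proj p')).contMDiffAt
      ((chartAt E (C.proj p')).open_source.mem_nhds hz'.1)
  have h4 := h3.comp z (f := fun z => (chartSymm (s (C.proj p)) (C.proj p) z).1)
    (contMDiffAt_coframeSpace.1 h1).1
  refine ContDiffAt.contDiffWithinAt (contMDiffAt_iff_contDiffAt.1 ?_)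
  refine (h4.prodMk_space h2).congr_of_eventuallyEq ?_
  filter_upwards [(isOpen_chartTarget (C.proj p)).mem_nhds hz] with y hy
  change (chartAt E (C.proj p') (C.incl ((p5Chart hE (hs (C.proj p)) (C.proj p) p).symm y)).1,
    ratio (s (C.proj p')) (C.incl ((p5Chart hE (hs (C.proj p)) (C.proj p) p).symm y))) = _
  rw [incl_p5Chart_symm _ _ _ _ hy]
  rfl

variable [FiniteDimensional ℝ E]

/-- The charted space structure of `P⁵` is the one induced from the bundle of coframes: its charts
are of the form `p5Chart`. -/
structure IsP5Charted (C : CRStructure E M) [ChartedSpace (E × ℝ) C.P5] : Prop where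
  finrank_eq : Module.finrank ℝ E = 5
  exists_chart : ∀ p : C.P5, ∃ (U : Opens M) (s : ∀ x : M, TangentSpace 𝓘(ℝ, E) x →L[ℝ] CoframeValue)
    (hs : C.IsNormalizedCoframe U s), C.proj p ∈ U ∧
    chartAt (E × ℝ) p = p5Chart finrank_eq hs (C.proj p) p

variable [ChartedSpace (E × ℝ) C.P5]

/-- A map into `P⁵` is smooth if it is smooth as a map into the bundle of coframes. -/
theorem IsP5Charted.contMDiffAt_of_incl (h : IsP5Charted C) {F I : Type*} [NormedAddCommGroup F]
    [NormedSpace ℝ F] [TopologicalSpace I] {J : ModelWithCorners ℝ F I}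
    {Y : Type*} [TopologicalSpace Y] [ChartedSpace I Y] {g : Y → C.P5} {y : Y}
    (hg : ContMDiffAt J (𝓘(ℝ, E).prod 𝓘(ℝ, E →L[ℝ] CoframeValue)) ∞ (fun y => C.incl (g y)) y) :
    ContMDiffAt J 𝓘(ℝ, E × ℝ) ∞ g y := by
  have : CompleteSpace E := FiniteDimensional.complete ℝ E
  obtain ⟨U, s, hs, hx, hc⟩ := h.exists_chart (g y)
  refine contMDiffAt_iff_target.2 ⟨isInducing_incl.continuousAt_iff.2 hg.continuousAt, ?_⟩
  have e : (extChartAt 𝓘(ℝ, E × ℝ) (g y) ∘ g) =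
      fun y' => (chartAt E (C.proj (g y)) (C.incl (g y')).1, ratio s (C.incl (g y'))) := by
    rw [extChartAt, hc]; rfl
  rw [e]
  have h1 : ContMDiffAt 𝓘(ℝ, E) 𝓘(ℝ, E) ∞ (chartAt E (C.proj (g y))) (C.incl (g y)).1 :=
    (contMDiffOn_chart (I := 𝓘(ℝ, E)) (x := C.proj (g y))).contMDiffAt
      ((chartAt E (C.proj (g y))).open_source.mem_nhds (mem_chart_source E (C.proj (g y))))
  exact (h1.comp y (f := fun y' => (C.incl (g y')).1) (contMDiffAt_coframeSpace.1 hg).1).prodMk_space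
    ((contMDiffAt_ratio (q := C.incl (g y)) (hs.smoothAt hx) (hs.isInvertible h.finrank_eq hx)).comp y
      (f := fun y => C.incl (g y)) hg)

variable [IsManifold 𝓘(ℝ, E × ℝ) ∞ C.P5]

theorem IsP5Charted.contMDiff_incl (h : IsP5Charted C) :
    ContMDiff 𝓘(ℝ, E × ℝ) (𝓘(ℝ, E).prod 𝓘(ℝ, E →L[ℝ] CoframeValue)) ∞ C.incl := by
  intro p
  obtain ⟨U, s, hs, hx, hc⟩ := h.exists_chart p
  have hp := mem_chart_source (E × ℝ) p
  have h1 : ContMDiffAt 𝓘(ℝ, E × ℝ) 𝓘(ℝ, E × ℝ) ∞ (chartAt (E × ℝ) p) p :=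
    (contMDiffOn_chart (I := 𝓘(ℝ, E × ℝ)) (x := p)).contMDiffAt
      ((chartAt (E × ℝ) p).open_source.mem_nhds hp)
  have h2 : chartAt (E × ℝ) p p ∈ chartTarget U (C.proj p) := by
    have := (chartAt (E × ℝ) p).map_source hp
    have e : (chartAt (E × ℝ) p).target = chartTarget U (C.proj p) := by rw [hc]; rfl
    rwa [e] at this
  refine ((contMDiffAt_chartSymm hs h2).comp p h1).congr_of_eventuallyEq ?_
  filter_upwards [(chartAt (E × ℝ) p).open_source.mem_nhds hp] with p' hp'
  have h3 : chartAt (E × ℝ) p p' ∈ chartTarget U (C.proj p) := by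
    have := (chartAt (E × ℝ) p).map_source hp'
    have e : (chartAt (E × ℝ) p).target = chartTarget U (C.proj p) := by rw [hc]; rfl
    rwa [e] at this
  rw [Function.comp_apply, ← incl_p5Chart_symm h.finrank_eq hs (C.proj p) p h3, ← hc,
    (chartAt (E × ℝ) p).left_inv hp']

theorem IsP5Charted.contMDiff_proj (h : IsP5Charted C) :
    ContMDiff 𝓘(ℝ, E × ℝ) 𝓘(ℝ, E) ∞ C.proj := fun p =>
  (contMDiffAt_coframeSpace.1 (h.contMDiff_incl p)).1

variable {U : Opens M} {s : ∀ x : M, TangentSpace 𝓘(ℝ, E) x →L[ℝ] CoframeValue}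

theorem IsP5Charted.contMDiffAt_ratio (h : IsP5Charted C) (hs : C.IsNormalizedCoframe U s) {p : C.P5}
    (hx : C.proj p ∈ U) : ContMDiffAt 𝓘(ℝ, E × ℝ) 𝓘(ℝ, ℝ) ∞ (fun p => ratio s (C.incl p)) p := by
  have : CompleteSpace E := FiniteDimensional.complete ℝ E
  exact (CRThreeTwo.contMDiffAt_ratio (q := C.incl p) (hs.smoothAt hx)
    (hs.isInvertible h.finrank_eq hx)).comp p (h.contMDiff_incl p)

/-- A tangent vector of `P⁵` is determined by its projection to `M` and by the derivative of the
ratio to some normalized local coframe. -/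
theorem IsP5Charted.eq_zero_of_mfderiv (h : IsP5Charted C) (p : C.P5) :
    ∃ (U : Opens M) (s : ∀ x : M, TangentSpace 𝓘(ℝ, E) x →L[ℝ] CoframeValue),
      C.IsNormalizedCoframe U s ∧ C.proj p ∈ U ∧ ∀ v : TangentSpace 𝓘(ℝ, E × ℝ) p,
      mfderiv 𝓘(ℝ, E × ℝ) 𝓘(ℝ, E) C.proj p v = 0 →
      mfderiv 𝓘(ℝ, E × ℝ) 𝓘(ℝ, ℝ) (fun p => ratio s (C.incl p)) p v = 0 → v = 0 := by
  obtain ⟨U, s, hs, hx, hc⟩ := h.exists_chart p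
  refine ⟨U, s, hs, hx, fun v h1 h2 => ?_⟩
  have e : (extChartAt 𝓘(ℝ, E × ℝ) p : C.P5 → E × ℝ) =
      fun y' => (chartAt E (C.proj p) (C.proj y'), ratio s (C.incl y')) := by
    rw [extChartAt, hc]; rfl
  have h4 : MDifferentiableAt 𝓘(ℝ, E) 𝓘(ℝ, E) (chartAt E (C.proj p)) (C.proj p) :=
    ((contMDiffOn_chart (I := 𝓘(ℝ, E)) (x := C.proj p)).contMDiffAt
      ((chartAt E (C.proj p)).open_source.mem_nhds (mem_chart_source E (C.proj p)))).mdifferentiableAt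
      (n := ∞) (by simp)
  have h5 := (h.contMDiff_proj p).mdifferentiableAt (by simp)
  have h6 := (h.contMDiffAt_ratio hs hx).mdifferentiableAt (by simp)
  refine Prod.ext ?_ ?_
  · refine (mfderiv_clm_comp_extChartAt p v (ContinuousLinearMap.fst ℝ E ℝ)).symm.trans ?_
    rw [e]
    refine (congrArg (fun B => B v) (mfderiv_comp p h4 h5)).trans ?_
    exact comp_apply_eq_zero (A := E × ℝ) (B := E) (D := E) _ _ h1
  · refine (mfderiv_clm_comp_extChartAt p v (ContinuousLinearMap.snd ℝ E ℝ)).symm.trans ?_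
    rw [e]
    exact h2

/-- The inclusion of `P⁵` is an immersion, since the two components of a chart of `P⁵` are restrictions
of smooth functions on the bundle of coframes. -/
theorem IsP5Charted.injective_mfderiv_incl (h : IsP5Charted C) (p : C.P5) :
    Function.Injective
      (mfderiv 𝓘(ℝ, E × ℝ) (𝓘(ℝ, E).prod 𝓘(ℝ, E →L[ℝ] CoframeValue)) C.incl p) := by
  have : CompleteSpace E := FiniteDimensional.complete ℝ E
  obtain ⟨U, s, hs, hx, hinj⟩ := h.eq_zero_of_mfderiv p
  have aux : ∀ {A B : Type _} [NormedAddCommGroup A] [NormedAddCommGroup B] [NormedSpace ℝ A]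
      [NormedSpace ℝ B] (f : A →L[ℝ] B), (∀ v, f v = 0 → v = 0) → Function.Injective f :=
    fun f => (injective_iff_map_eq_zero f).2
  refine aux (A := E × ℝ) (B := E × (E →L[ℝ] CoframeValue)) _ fun v hv => hinj v ?_ ?_
  · have h0 := (contMDiffAt_coframeSpace.1 (contMDiffAt_id
      (I := 𝓘(ℝ, E).prod 𝓘(ℝ, E →L[ℝ] CoframeValue)) (x := C.incl p))).1
    have := mfderiv_comp p (g := fun q : CoframeSpace E M => q.1) (f := C.incl)
      (h0.mdifferentiableAt (by simp)) ((h.contMDiff_incl p).mdifferentiableAt (by simp))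
    refine (congrArg (fun A => A v) this).trans ?_
    exact comp_apply_eq_zero (A := E × ℝ) (B := E × (E →L[ℝ] CoframeValue)) (D := E) _ _ hv
  · have h0 := CRThreeTwo.contMDiffAt_ratio (q := C.incl p) (hs.smoothAt hx)
      (hs.isInvertible h.finrank_eq hx)
    have := mfderiv_comp p (g := ratio s) (f := C.incl)
      (h0.mdifferentiableAt (by simp)) ((h.contMDiff_incl p).mdifferentiableAt (by simp))
    refine (congrArg (fun A => A v) this).trans ?_
    exact comp_apply_eq_zero (A := E × ℝ) (B := E × (E →L[ℝ] CoframeValue)) (D := ℝ) _ _ hv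

end Charts


/-! ### `P⁵` as a principal bundle -/

section Principal

variable {E : Type*} [NormedAddCommGroup E] [NormedSpace ℝ E] [FiniteDimensional ℝ E]
  {M : Type*} [TopologicalSpace M] [ChartedSpace E M] [IsManifold 𝓘(ℝ, E) ∞ M]

/-- The action `ω ↦ g · ω` of `G₅` on `P⁵`. -/
@[reducible] def p5MulAction (C : CRStructure E M) : MulAction ℝˣ C.P5 where
  smul a p := C.toP5 (scaleCoframe a (C.incl p)) (scaleCoframe_mem_P5Set p.2 a)
  one_smul p := by
    apply incl_injective
    change scaleCoframe 1 (C.incl p) = C.incl p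
    unfold scaleCoframe
    rw [scaleValue_one]; rfl
  mul_smul a b p := by
    apply incl_injective
    change scaleCoframe (a * b) (C.incl p) = scaleCoframe a (scaleCoframe b (C.incl p))
    unfold scaleCoframe
    rw [scaleValue_mul]; rfl

variable {C : CRStructure E M} [ChartedSpace (E × ℝ) C.P5] [IsManifold 𝓘(ℝ, E × ℝ) ∞ C.P5]

/-- Each point of `P⁵` over `U` is the multiple of `s` by its ratio to `s`. -/
theorem CRStructure.IsNormalizedCoframe.incl_eq {C : CRStructure E M} {U : Opens M}
    {s : ∀ x : M, TangentSpace 𝓘(ℝ, E) x →L[ℝ] CoframeValue} (hs : C.IsNormalizedCoframe U s)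
    (hE : Module.finrank ℝ E = 5) {p : C.P5} (hp : C.proj p ∈ U) : ratio s (C.incl p) ≠ 0 ∧
      C.incl p = scaleBy (ratio s (C.incl p)) (sectionMap s (C.proj p)) :=
  hs.eq_scaleBy hE p.2 hp

open Classical in
/-- The local trivializations are `(x, a) ↦ a · s(x)` for normalized local coframes `s` of `M`. -/
theorem IsP5Charted.isPrincipalBundle [MulAction ℝˣ C.P5] (h : IsP5Charted C)
    (hs : ∀ (a : ℝˣ) (p : C.P5), C.incl (a • p) = scaleCoframe a (C.incl p))
    (hloc : ∀ x₀ : M, ∃ (U : Opens M) (s : ∀ x : M, TangentSpace 𝓘(ℝ, E) x →L[ℝ] CoframeValue),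
      x₀ ∈ U ∧ C.IsNormalizedCoframe U s) :
    IsPrincipalBundle (E := E) (F := E × ℝ) C.proj where
  smooth_proj := h.contMDiff_proj
  smooth_smul := by
    intro q
    refine h.contMDiffAt_of_incl ?_
    have e : (fun q : ℝˣ × C.P5 => C.incl (q.1 • q.2)) =
        fun q => scaleBy (q.1 : ℝ) (C.incl q.2) := funext fun q => hs q.1 q.2
    rw [e]
    exact contMDiffAt_scaleBy
      (ContMDiffAt.comp q (Units.contMDiff_val (𝕜 := ℝ) (R := ℝ)).contMDiffAt contMDiffAt_fst)
      (ContMDiffAt.comp q (h.contMDiff_incl q.2) contMDiffAt_snd)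
  exists_trivialization := by
    intro x₀
    obtain ⟨U, s, hx₀, hU⟩ := hloc x₀
    obtain ⟨ψ, hψ⟩ : ∃ ψ : M × ℝˣ → C.P5, ∀ z, z.1 ∈ U →
        C.incl (ψ z) = scaleCoframe z.2 (sectionMap s z.1) :=
      ⟨fun z => if hz : z.1 ∈ U then C.toP5 (scaleCoframe z.2 (sectionMap s z.1))
        (hU.scaleCoframe_mem hz z.2) else C.toP5 (scaleCoframe 1 (sectionMap s x₀))
        (hU.scaleCoframe_mem hx₀ 1), fun z hz => congrArg C.incl (dif_pos hz)⟩
    obtain ⟨κ, hκ⟩ : ∃ κ : C.P5 → ℝˣ, ∀ p, C.proj p ∈ U → (κ p : ℝ) = ratio s (C.incl p) :=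
      ⟨fun p => if hp : ratio s (C.incl p) ≠ 0 then Units.mk0 _ hp else 1, fun p hp =>
        congrArg Units.val (dif_pos (hU.incl_eq h.finrank_eq hp).1)⟩
    have hπ : ∀ z, z.1 ∈ U → C.proj (ψ z) = z.1 := fun z hz => by
      unfold CRStructure.proj; rw [hψ z hz]; rfl
    refine ⟨U, ψ, κ, U.isOpen, hx₀, ?_, ?_, fun y hy a => ⟨hπ (y, a) hy, ?_⟩, ?_, ?_⟩
    · rintro ⟨y, a⟩ ⟨hy, -⟩
      refine ContMDiffAt.contMDiffWithinAt (h.contMDiffAt_of_incl ?_)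
      refine ContMDiffAt.congr_of_eventuallyEq (f := fun z : M × ℝˣ =>
        scaleBy (z.2 : ℝ) (sectionMap s z.1)) ?_ ?_
      · exact contMDiffAt_scaleBy
          (ContMDiffAt.comp _ (Units.contMDiff_val (𝕜 := ℝ) (R := ℝ)).contMDiffAt contMDiffAt_snd)
          (contMDiffAt_sectionMap (hU.smoothAt hy) contMDiffAt_fst)
      · filter_upwards [(U.isOpen.preimage continuous_fst).mem_nhds hy] with z hz using hψ z hz
    · intro p hp
      have h2 : ContMDiffAt 𝓘(ℝ, E × ℝ) 𝓘(ℝ, ℝ) ∞ (fun p => (κ p : ℝ)) p := by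
        refine (h.contMDiffAt_ratio hU hp).congr_of_eventuallyEq ?_
        filter_upwards [(U.isOpen.preimage continuous_proj).mem_nhds hp] with p hp using hκ p hp
      refine ContMDiffAt.contMDiffWithinAt (contMDiffAt_iff_target.2 ⟨?_, h2⟩)
      exact (Units.isOpenEmbedding_val (R := ℝ)).isInducing.continuousAt_iff.2 h2.continuousAt
    · refine Units.ext ?_
      have hy' : C.proj (ψ (y, a)) ∈ U := by rw [hπ (y, a) hy]; exact hy
      rw [hκ _ hy', hψ (y, a) hy]
      change ratio s (scaleBy (a : ℝ) (sectionMap s y)) = a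
      rw [ratio_scaleBy, ratio_sectionMap (hU.isInvertible h.finrank_eq hy), mul_one]
    · intro p hp
      apply incl_injective
      rw [hψ (C.proj p, κ p) hp, ← scaleBy_coe, hκ p hp]
      exact (hU.incl_eq h.finrank_eq hp).2.symm
    · intro y hy a b
      apply incl_injective
      rw [hs, hψ _ hy, hψ _ hy]
      unfold scaleCoframe
      rw [scaleValue_mul]; rfl

end Principal


/-! ### The structure form and the Cartan connection -/

section StructureForm

variable {E : Type*} [NormedAddCommGroup E] [NormedSpace ℝ E] [FiniteDimensional ℝ E]
  {M : Type*} [TopologicalSpace M] [ChartedSpace E M] [IsManifold 𝓘(ℝ, E) ∞ M]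
  {C : CRStructure E M} [ChartedSpace (E × ℝ) C.P5] [IsManifold 𝓘(ℝ, E × ℝ) ∞ C.P5]
  {U : Opens M} {s : ∀ x : M, TangentSpace 𝓘(ℝ, E) x →L[ℝ] CoframeValue}

/-- Over the domain of a normalized coframe `s` the tautological forms are `κ · π^* s`, where `κ` is
the ratio to `s`. -/
theorem tautological_eq (hs : C.IsNormalizedCoframe U s) (hE : Module.finrank ℝ E = 5) {p : C.P5}
    (hp : C.proj p ∈ U) : C.tautological p = (scaleReal (ratio s (C.incl p))).comp
      (pullbackForm (F := E × ℝ) (F' := E) C.proj s p) := by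
  have h2 := (hs.incl_eq hE hp).2
  have h3 : ∀ (q : CoframeSpace E M) (a : ℝ), q = scaleBy a (sectionMap s q.1) →
    (q.2 : TangentSpace 𝓘(ℝ, E) q.1 →L[ℝ] CoframeValue) = (scaleReal a).comp (s q.1) := by
    rintro ⟨x, q⟩ a h
    have h := (TotalSpace.mk.inj h).2
    exact eq_of_heq h
  unfold CRStructure.tautological pullbackForm
  rw [h3 (C.incl p) _ h2]
  rfl

/-- The derivative of `diag(κ⁴, κ³, κ², κ, κ)` for a function `κ`. -/
theorem mvfderiv_scaleReal {F : Type*} [NormedAddCommGroup F] [NormedSpace ℝ F]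
    {X : Type*} [TopologicalSpace X] [ChartedSpace F X] {κ : X → ℝ} {x : X}
    (hκ : MDifferentiableAt 𝓘(ℝ, F) 𝓘(ℝ, ℝ) κ x) (v : TangentSpace 𝓘(ℝ, F) x) (c : CoframeValue) :
    mvfderiv 𝓘(ℝ, F) (fun x => scaleReal (κ x)) x v c =
      (4 * κ x ^ 3 * mvfderiv 𝓘(ℝ, F) κ x v * c.1, 3 * κ x ^ 2 * mvfderiv 𝓘(ℝ, F) κ x v * c.2.1,
        2 * κ x * mvfderiv 𝓘(ℝ, F) κ x v * c.2.2.1, ((mvfderiv 𝓘(ℝ, F) κ x v : ℝ) : ℂ) * c.2.2.2) := by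
  have h1 : HasFDerivAt (fun a : ℝ => scaleReal a) (fderiv ℝ scaleReal (κ x)) (κ x) :=
    (contDiff_scaleReal.differentiable (by simp)).differentiableAt.hasFDerivAt
  have h2 : HasFDerivAt (fun a : ℝ => scaleReal a c) ((fderiv ℝ scaleReal (κ x)).flip c) (κ x) := by
    have := h1.clm_apply (hasFDerivAt_const c (κ x))
    simpa using this
  have h3 : HasDerivAt (fun a : ℝ => scaleReal a c)
      (4 * κ x ^ 3 * c.1, 3 * κ x ^ 2 * c.2.1, 2 * κ x * c.2.2.1, c.2.2.2) (κ x) := by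
    have e : (fun a => scaleReal a c) = fun a : ℝ => (a ^ 4 * c.1, a ^ 3 * c.2.1, a ^ 2 * c.2.2.1,
      a • c.2.2.2) := rfl
    rw [e]
    refine HasDerivAt.prodMk ?_ (HasDerivAt.prodMk ?_ (HasDerivAt.prodMk ?_ ?_))
    · simpa using (hasDerivAt_pow 4 (κ x)).mul_const c.1
    · simpa using (hasDerivAt_pow 3 (κ x)).mul_const c.2.1
    · simpa using (hasDerivAt_pow 2 (κ x)).mul_const c.2.2.1
    · simpa using (hasDerivAt_id (κ x)).smul_const c.2.2.2
  have h4 := h2.unique h3.hasFDerivAt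
  have h5 : mvfderiv 𝓘(ℝ, F) (fun x => scaleReal (κ x)) x v =
      fderiv ℝ scaleReal (κ x) (mvfderiv 𝓘(ℝ, F) κ x v) := by
    have := mfderiv_comp x (g := scaleReal) (f := κ) (I := 𝓘(ℝ, F)) (I' := 𝓘(ℝ, ℝ))
      (I'' := 𝓘(ℝ, CoframeValue →L[ℝ] CoframeValue)) h1.differentiableAt.mdifferentiableAt hκ
    rw [mfderiv_eq_fderiv] at this
    exact congrArg (fun A => A v) this
  rw [h5]
  have h6 := congrArg (fun A : ℝ →L[ℝ] CoframeValue => A (mvfderiv 𝓘(ℝ, F) κ x v)) h4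
  refine h6.trans ?_
  simp only [ContinuousLinearMap.toSpanSingleton_apply, Prod.smul_mk, smul_eq_mul]
  rw [Complex.real_smul]
  refine Prod.ext ?_ (Prod.ext ?_ (Prod.ext ?_ rfl)) <;> simp only [] <;> ring

/-- The product rule for `κ · θ` in the form in which it enters `StructEqs.scale`, with `dκ / κ`. -/
theorem scale_derivative {κ : ℝ} (h0 : κ ≠ 0) (D c c' : CoframeValue) (a a' : ℝ) :
    scaleReal κ D + (4 * κ ^ 3 * a * c'.1, 3 * κ ^ 2 * a * c'.2.1, 2 * κ * a * c'.2.2.1,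
        (a : ℂ) * c'.2.2.2) -
      (4 * κ ^ 3 * a' * c.1, 3 * κ ^ 2 * a' * c.2.1, 2 * κ * a' * c.2.2.1, (a' : ℂ) * c.2.2.2) =
    scaleValue (Units.mk0 κ h0) (D + (4 * (κ⁻¹ * a * c'.1 - κ⁻¹ * a' * c.1),
      3 * (κ⁻¹ * a * c'.2.1 - κ⁻¹ * a' * c.2.1), 2 * (κ⁻¹ * a * c'.2.2.1 - κ⁻¹ * a' * c.2.2.1),
      ((κ⁻¹ * a : ℝ) : ℂ) * c'.2.2.2 - ((κ⁻¹ * a' : ℝ) : ℂ) * c.2.2.2)) := by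
  have h0' : (κ : ℂ) ≠ 0 := Complex.ofReal_ne_zero.2 h0
  have e : scaleReal κ D = scaleValue (Units.mk0 κ h0) D := rfl
  rw [e, scaleValue_apply, scaleValue_apply]
  refine Prod.ext ?_ (Prod.ext ?_ (Prod.ext ?_ ?_)) <;>
    simp only [Units.val_mk0, Prod.fst_add, Prod.snd_add, Prod.fst_sub, Prod.snd_sub,
      Complex.ofReal_mul, Complex.ofReal_inv] <;> field_simp <;> ring

/-- The form `Λ` over the domain of a normalized coframe `s` of `M` with real form `l`: it is
`π^* l + dκ / κ`, where `κ` is the coordinate of `P⁵` along the fibres. -/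
def localForm (C : CRStructure E M) [ChartedSpace (E × ℝ) C.P5]
    (s : ∀ x : M, TangentSpace 𝓘(ℝ, E) x →L[ℝ] CoframeValue)
    (l : ∀ x : M, TangentSpace 𝓘(ℝ, E) x →L[ℝ] ℝ) (p : C.P5) :
    TangentSpace 𝓘(ℝ, E × ℝ) p →L[ℝ] ℝ :=
  pullbackForm (F := E × ℝ) (F' := E) C.proj l p +
    mvfderiv 𝓘(ℝ, E × ℝ) (fun q => Real.log (ratio s (C.incl q))) p

theorem mvfderiv_log {F : Type*} [NormedAddCommGroup F] [NormedSpace ℝ F]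
    {X : Type*} [TopologicalSpace X] [ChartedSpace F X] {κ : X → ℝ} {x : X}
    (hκ : MDifferentiableAt 𝓘(ℝ, F) 𝓘(ℝ, ℝ) κ x) (h0 : κ x ≠ 0) (v : TangentSpace 𝓘(ℝ, F) x) :
    mvfderiv 𝓘(ℝ, F) (fun x => Real.log (κ x)) x v = (κ x)⁻¹ * mvfderiv 𝓘(ℝ, F) κ x v := by
  have h1 := (Real.hasDerivAt_log h0).hasFDerivAt
  have := mfderiv_comp x (g := Real.log) (f := κ) (I := 𝓘(ℝ, F)) (I' := 𝓘(ℝ, ℝ))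
      (I'' := 𝓘(ℝ, ℝ)) h1.differentiableAt.mdifferentiableAt hκ
  rw [mfderiv_eq_fderiv, h1.fderiv] at this
  refine (congrArg (fun A => A v) this).trans ?_
  change mvfderiv 𝓘(ℝ, F) κ x v • (κ x)⁻¹ = _
  rw [smul_eq_mul, mul_comm]

variable {l : ∀ x : M, TangentSpace 𝓘(ℝ, E) x →L[ℝ] ℝ}

theorem IsP5Charted.localForm_apply (h : IsP5Charted C) (hs : C.IsNormalizedCoframe U s) {p : C.P5}
    (hp : C.proj p ∈ U) (v : TangentSpace 𝓘(ℝ, E × ℝ) p) : localForm C s l p v =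
      l (C.proj p) (mfderiv 𝓘(ℝ, E × ℝ) 𝓘(ℝ, E) C.proj p v) +
      (ratio s (C.incl p))⁻¹ * mvfderiv 𝓘(ℝ, E × ℝ) (fun q => ratio s (C.incl q)) p v := by
  rw [← mvfderiv_log ((h.contMDiffAt_ratio hs hp).mdifferentiableAt (by simp))
    (hs.incl_eq h.finrank_eq hp).1]
  rfl

theorem IsP5Charted.smoothFormAt_localForm (h : IsP5Charted C) (hs : C.IsNormalizedCoframe U s)
    (hl : SmoothFormOn l U) {p : C.P5} (hp : C.proj p ∈ U) : SmoothFormAt (localForm C s l) p := by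
  have h1 : ContMDiffAt 𝓘(ℝ, E × ℝ) 𝓘(ℝ, ℝ) ∞ (fun q => Real.log (ratio s (C.incl q))) p :=
    ContMDiffAt.comp p (Real.contDiffAt_log.2 (hs.incl_eq h.finrank_eq hp).1).contMDiffAt
      (h.contMDiffAt_ratio hs hp)
  exact (smoothFormAt_pullbackForm (F := E × ℝ) (F' := E) (h.contMDiff_proj p)
    ((smoothFormOn_iff hs.isOpen).1 hl _ hp)).add (smoothFormAt_mvfderiv h1)

theorem IsP5Charted.smoothFormAt_tautological (h : IsP5Charted C) (hs : C.IsNormalizedCoframe U s)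
    {p : C.P5} (hp : C.proj p ∈ U) : SmoothFormAt C.tautological p := by
  refine SmoothFormAt.congr (SmoothFormAt.clm_comp (G := fun p => scaleReal (ratio s (C.incl p)))
    ((contMDiffAt_scaleReal _).comp p (h.contMDiffAt_ratio hs hp))
    (smoothFormAt_pullbackForm (F := E × ℝ) (F' := E) (h.contMDiff_proj p) (hs.smoothAt hp))) ?_
  filter_upwards [(U.isOpen.preimage continuous_proj).mem_nhds hp] with q hq
  exact tautological_eq hs h.finrank_eq hq

theorem IsP5Charted.structureEquationsAt_localForm (h : IsP5Charted C)
    (hs : C.IsNormalizedCoframe U s) (hl : SmoothFormOn l U)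
    (he : ∀ x ∈ U, StructureEquationsAt s l x) {p : C.P5} (hp : C.proj p ∈ U) :
    StructureEquationsAt C.tautological (localForm C s l) p := by
  have h0 := (hs.incl_eq h.finrank_eq hp).1
  have hκ := h.contMDiffAt_ratio hs hp
  have hl' := (smoothFormOn_iff hs.isOpen).1 hl _ hp
  have hπ := h.contMDiff_proj p
  have h1 : ContMDiffAt 𝓘(ℝ, E × ℝ) 𝓘(ℝ, ℝ) ∞ (fun q => Real.log (ratio s (C.incl q))) p :=
    ContMDiffAt.comp p (Real.contDiffAt_log.2 h0).contMDiffAt hκ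
  have hG : ContMDiffAt 𝓘(ℝ, E × ℝ) 𝓘(ℝ, CoframeValue →L[ℝ] CoframeValue) ∞
      (fun p => scaleReal (ratio s (C.incl p))) p := (contMDiffAt_scaleReal _).comp p hκ
  have hπs := smoothFormAt_pullbackForm (F := E × ℝ) (F' := E) hπ (hs.smoothAt hp)
  have eθ : ∀ᶠ q in nhds p, C.tautological q = (scaleReal (ratio s (C.incl q))).comp
      (pullbackForm (F := E × ℝ) (F' := E) C.proj s q) := by
    filter_upwards [(U.isOpen.preimage continuous_proj).mem_nhds hp] with q hq
    exact tautological_eq hs h.finrank_eq hq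
  rw [structureEquationsAt_iff]
  have key := StructEqs.scale (((structureEquationsAt_iff _ _ _).1 (he _ hp)).comp
    (mfderiv 𝓘(ℝ, E × ℝ) 𝓘(ℝ, E) C.proj p)) (Units.mk0 _ h0)
    (mvfderiv 𝓘(ℝ, E × ℝ) (fun q => Real.log (ratio s (C.incl q))) p)
    (dθ' := extD C.tautological p) (fun v w => by
      rw [extD_congr eθ, extD_clm_comp hπs hG, extD_pullbackForm hπ (hs.smoothAt hp),
        mvfderiv_scaleReal (hκ.mdifferentiableAt (by simp)),
        mvfderiv_scaleReal (hκ.mdifferentiableAt (by simp)),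
        mvfderiv_log (hκ.mdifferentiableAt (by simp)) h0,
        mvfderiv_log (hκ.mdifferentiableAt (by simp)) h0]
      exact scale_derivative h0 _ _ _ _ _)
  have e1 : (fun v w => extD l (C.proj p) (mfderiv 𝓘(ℝ, E × ℝ) 𝓘(ℝ, E) C.proj p v)
      (mfderiv 𝓘(ℝ, E × ℝ) 𝓘(ℝ, E) C.proj p w)) = extD (localForm C s l) p := by
    funext v w
    unfold localForm
    rw [extD_add (smoothFormAt_pullbackForm (F := E × ℝ) (F' := E) hπ hl') (smoothFormAt_mvfderiv h1),
      extD_pullbackForm hπ hl', extD_mvfderiv h1, add_zero]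
  rw [e1] at key
  have e2 : (fun v => scaleValue (Units.mk0 _ h0) (s (C.proj p)
      (mfderiv 𝓘(ℝ, E × ℝ) 𝓘(ℝ, E) C.proj p v))) = C.tautological p := by
    rw [tautological_eq hs h.finrank_eq hp]; rfl
  rw [e2] at key
  exact key

theorem injective_of_ker {A B : Type*} [NormedAddCommGroup A] [NormedSpace ℝ A]
    [NormedAddCommGroup B] [NormedSpace ℝ B] (f : A →L[ℝ] B) (hf : ∀ v, f v = 0 → v = 0) :
    Function.Injective f := (injective_iff_map_eq_zero f).2 hf

/-- The tautological forms are independent at each point: they are so on `M`, and the projection is a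
submersion. -/
theorem IsP5Charted.surjective_tautological (h : IsP5Charted C) (p : C.P5) :
    Function.Surjective (C.tautological p) := by
  obtain ⟨U, s, hs, hp, hinj⟩ := h.eq_zero_of_mfderiv p
  obtain ⟨D, hD⟩ : ∃ D : E × ℝ →L[ℝ] E × ℝ, ∀ v : TangentSpace 𝓘(ℝ, E × ℝ) p, D v =
      (mfderiv 𝓘(ℝ, E × ℝ) 𝓘(ℝ, E) C.proj p v,
        mfderiv 𝓘(ℝ, E × ℝ) 𝓘(ℝ, ℝ) (fun p => ratio s (C.incl p)) p v) :=
    ⟨ContinuousLinearMap.prod (M₁ := E × ℝ) (M₂ := E) (M₃ := ℝ)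
      (mfderiv 𝓘(ℝ, E × ℝ) 𝓘(ℝ, E) C.proj p)
      (mfderiv 𝓘(ℝ, E × ℝ) 𝓘(ℝ, ℝ) (fun p => ratio s (C.incl p)) p), fun v => rfl⟩
  have h1 : Function.Injective D := injective_of_ker _ fun v hv =>
    hinj v (congrArg Prod.fst ((hD v).symm.trans hv)) (congrArg Prod.snd ((hD v).symm.trans hv))
  have h2 := (LinearMap.injective_iff_surjective (f := (D : E × ℝ →ₗ[ℝ] E × ℝ))).1 h1
  intro c
  have h0 := (hs.incl_eq h.finrank_eq hp).1
  obtain ⟨w, hw⟩ := (hs.isInvertible h.finrank_eq hp).surjective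
    (scaleValue (Units.mk0 _ h0)⁻¹ c)
  obtain ⟨v, hv⟩ := h2 (w, 0)
  refine ⟨v, ?_⟩
  rw [tautological_eq hs h.finrank_eq hp]
  have h3 : mfderiv 𝓘(ℝ, E × ℝ) 𝓘(ℝ, E) C.proj p v = w := congrArg Prod.fst ((hD v).symm.trans hv)
  change scaleValue (Units.mk0 _ h0) (s (C.proj p) (mfderiv 𝓘(ℝ, E × ℝ) 𝓘(ℝ, E) C.proj p v)) = c
  rw [h3, hw, ← ContinuousLinearMap.comp_apply, ← scaleValue_mul, mul_inv_cancel, scaleValue_one]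
  rfl

/-- The structure form is unique pointwise, so that local solutions agree on overlaps. -/
theorem IsP5Charted.structureEquationsAt_unique (h : IsP5Charted C)
    {Λ Λ' : ∀ p : C.P5, TangentSpace 𝓘(ℝ, E × ℝ) p →L[ℝ] ℝ} {p : C.P5}
    (hΛ : StructureEquationsAt C.tautological Λ p) (hΛ' : StructureEquationsAt C.tautological Λ' p) :
    Λ p = Λ' p :=
  DFunLike.coe_injective (StructEqs.unique ((structureEquationsAt_iff _ _ _).1 hΛ)
    ((structureEquationsAt_iff _ _ _).1 hΛ') (h.surjective_tautological p))

/-- There is exactly one structure form. -/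
theorem IsP5Charted.existsUnique_structureForm (h : IsP5Charted C)
    (hloc : ∀ x₀ : M, ∃ (U : Opens M) (s : ∀ x : M, TangentSpace 𝓘(ℝ, E) x →L[ℝ] CoframeValue),
      x₀ ∈ U ∧ C.IsNormalizedCoframe U s) :
    ∃! Λ : ∀ p : C.P5, TangentSpace 𝓘(ℝ, E × ℝ) p →L[ℝ] ℝ, C.IsStructureForm Λ := by
  choose U s hU hs using hloc
  choose l hl he using fun x => (hs x).structure_eq
  have key : ∀ p : C.P5, ∀ᶠ q in nhds p, localForm C (s (C.proj q)) (l (C.proj q)) q =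
      localForm C (s (C.proj p)) (l (C.proj p)) q := by
    intro p
    filter_upwards [((U (C.proj p)).isOpen.preimage continuous_proj).mem_nhds (hU (C.proj p))] with q hq
    exact h.structureEquationsAt_unique
      (h.structureEquationsAt_localForm (hs _) (hl _) (he _) (hU (C.proj q)))
      (h.structureEquationsAt_localForm (hs _) (hl _) (he _) hq)
  refine ⟨fun p => localForm C (s (C.proj p)) (l (C.proj p)) p, ⟨?_, fun p => ?_⟩, fun Λ hΛ => ?_⟩
  · refine (smoothFormOn_iff isOpen_univ).2 fun p _ => ?_
    exact (h.smoothFormAt_localForm (hs (C.proj p)) (hl _) (hU (C.proj p))).congr (key p)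
  · have h1 := h.structureEquationsAt_localForm (hs (C.proj p)) (hl _) (he _) (hU (C.proj p))
    rw [structureEquationsAt_iff] at h1 ⊢
    have e : extD (fun p => localForm C (s (C.proj p)) (l (C.proj p)) p) p =
        extD (localForm C (s (C.proj p)) (l (C.proj p))) p := by
      funext v w; exact extD_congr (key p) v w
    rw [e]
    exact h1
  · funext p
    exact h.structureEquationsAt_unique (hΛ.2 p)
      (h.structureEquationsAt_localForm (hs _) (hl _) (he _) (hU (C.proj p)))

/-- The connection form is given by the local form of any normalized coframe. -/
theorem IsP5Charted.structureForm_apply (h : IsP5Charted C)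
    {Λ : ∀ p : C.P5, TangentSpace 𝓘(ℝ, E × ℝ) p →L[ℝ] ℝ} (hΛ : C.IsStructureForm Λ)
    (hs : C.IsNormalizedCoframe U s) : ∃ l : ∀ x : M, TangentSpace 𝓘(ℝ, E) x →L[ℝ] ℝ,
      ∀ p : C.P5, C.proj p ∈ U → ∀ v : TangentSpace 𝓘(ℝ, E × ℝ) p,
      Λ p v = l (C.proj p) (mfderiv 𝓘(ℝ, E × ℝ) 𝓘(ℝ, E) C.proj p v) +
        (ratio s (C.incl p))⁻¹ * mvfderiv 𝓘(ℝ, E × ℝ) (fun q => ratio s (C.incl q)) p v := by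
  obtain ⟨l, hl, he⟩ := hs.structure_eq
  refine ⟨l, fun p hp v => ?_⟩
  rw [h.structureEquationsAt_unique (hΛ.2 p) (h.structureEquationsAt_localForm hs hl he hp),
    h.localForm_apply hs hp]

/-- The tautological forms vanish on vertical vectors. -/
theorem tautological_eq_zero {p : C.P5} {v : TangentSpace 𝓘(ℝ, E × ℝ) p}
    (hv : mfderiv 𝓘(ℝ, E × ℝ) 𝓘(ℝ, E) C.proj p v = 0) : C.tautological p v = 0 :=
  comp_apply_eq_zero (A := E × ℝ) (B := E) (D := CoframeValue) _ _ hv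

section Chain

variable {F F' F'' W : Type*} [NormedAddCommGroup F] [NormedSpace ℝ F] [NormedAddCommGroup F']
  [NormedSpace ℝ F'] [NormedAddCommGroup F''] [NormedSpace ℝ F''] [NormedAddCommGroup W]
  [NormedSpace ℝ W] {X Y Y' : Type*} [TopologicalSpace X] [ChartedSpace F X] [TopologicalSpace Y]
  [ChartedSpace F' Y] [TopologicalSpace Y'] [ChartedSpace F'' Y']
  [IsManifold 𝓘(ℝ, F) ∞ X] [IsManifold 𝓘(ℝ, F') ∞ Y] [IsManifold 𝓘(ℝ, F'') ∞ Y']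

theorem pullbackForm_comp {f : X → Y} {g : Y → Y'} {x : X}
    (η : ∀ y : Y', TangentSpace 𝓘(ℝ, F'') y →L[ℝ] W)
    (hg : MDifferentiableAt 𝓘(ℝ, F') 𝓘(ℝ, F'') g (f x))
    (hf : MDifferentiableAt 𝓘(ℝ, F) 𝓘(ℝ, F') f x) (v : TangentSpace 𝓘(ℝ, F) x) :
    pullbackForm (F := F') (F' := F'') g η (f x) (mfderiv 𝓘(ℝ, F) 𝓘(ℝ, F') f x v) =
      pullbackForm (F := F) (F' := F'') (g ∘ f) η x v := by
  unfold pullbackForm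
  rw [mfderiv_comp x hg hf]
  rfl

/-- The chain rule along a curve. -/
theorem mfderiv_curve {γ : ℝ → X} {g : X → Y} {p : X} (hγ : γ 0 = p)
    (hg : MDifferentiableAt 𝓘(ℝ, F) 𝓘(ℝ, F') g p) (hf : MDifferentiableAt 𝓘(ℝ, ℝ) 𝓘(ℝ, F) γ 0) :
    (mfderiv 𝓘(ℝ, F) 𝓘(ℝ, F') g p (show TangentSpace 𝓘(ℝ, F) p from
      mfderiv 𝓘(ℝ, ℝ) 𝓘(ℝ, F) γ 0 (1 : ℝ)) : F') =
      (mfderiv 𝓘(ℝ, ℝ) 𝓘(ℝ, F') (g ∘ γ) 0 (1 : ℝ) : F') := by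
  subst hγ
  rw [mfderiv_comp 0 hg hf]
  rfl

end Chain

/-- In the local form `π^* l + dκ / κ` of `Λ` the fundamental field of `c e_α` has the projection `0` and
`dκ / κ = c`, while `π` and `dκ / κ` are invariant under the action of `G₅`. -/
theorem IsP5Charted.isCartanConnection [MulAction ℝˣ C.P5] (h : IsP5Charted C)
    (hsmul : ∀ (a : ℝˣ) (p : C.P5), C.incl (a • p) = scaleCoframe a (C.incl p))
    (hloc : ∀ x₀ : M, ∃ (U : Opens M) (s : ∀ x : M, TangentSpace 𝓘(ℝ, E) x →L[ℝ] CoframeValue),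
      x₀ ∈ U ∧ C.IsNormalizedCoframe U s)
    {Λ : ∀ p : C.P5, TangentSpace 𝓘(ℝ, E × ℝ) p →L[ℝ] ℝ} (hΛ : C.IsStructureForm Λ) :
    IsCartanConnection (C.cartanForm Λ) where
  smooth := by
    refine (smoothFormOn_iff isOpen_univ).2 fun p _ => ?_
    obtain ⟨U, s, hp, hs⟩ := hloc (C.proj p)
    have h1 := (smoothFormOn_iff isOpen_univ).1 hΛ.1 p trivial
    have h2 := h.smoothFormAt_tautological hs hp
    have h3 : SmoothFormAt (W := ModelAlgebra) (fun p =>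
        (ContinuousLinearMap.comp (ContinuousLinearMap.inl ℝ ℝ CoframeValue : ℝ →L[ℝ] ModelAlgebra) (Λ p) +
        ContinuousLinearMap.comp (ContinuousLinearMap.inr ℝ ℝ CoframeValue : CoframeValue →L[ℝ] ModelAlgebra)
          (C.tautological p))) p :=
      (SmoothFormAt.clm_comp (G := fun _ => (ContinuousLinearMap.inl ℝ ℝ CoframeValue : ℝ →L[ℝ] ModelAlgebra))
        contMDiffAt_const h1).add (SmoothFormAt.clm_comp
        (G := fun _ => (ContinuousLinearMap.inr ℝ ℝ CoframeValue : CoframeValue →L[ℝ] ModelAlgebra))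
        contMDiffAt_const h2)
    refine h3.congr (Filter.Eventually.of_forall fun q => ContinuousLinearMap.ext fun v => ?_)
    exact Prod.ext (add_zero (Λ q v)).symm (zero_add (C.tautological q v)).symm
  fundamental c p := by
    obtain ⟨U, s, hp, hs⟩ := hloc (C.proj p)
    obtain ⟨l, hl⟩ := h.structureForm_apply hΛ hs
    have h0 := (hs.incl_eq h.finrank_eq hp).1
    have e0 : expUnit (0 * c) • p = p := by
      apply incl_injective
      rw [hsmul, zero_mul, show expUnit 0 = 1 from Units.ext Real.exp_zero]
      unfold scaleCoframe
      rw [scaleValue_one]; rfl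
    have hcurve : MDifferentiableAt 𝓘(ℝ, ℝ) 𝓘(ℝ, E × ℝ) (fun t : ℝ => expUnit (t * c) • p) 0 := by
      refine ContMDiffAt.mdifferentiableAt (n := ∞) (h.contMDiffAt_of_incl ?_) (by simp)
      have e : (fun t : ℝ => C.incl (expUnit (t * c) • p)) =
          fun t => scaleBy (Real.exp (t * c)) (C.incl p) := funext fun t => hsmul _ p
      rw [e]
      refine contMDiffAt_scaleBy ?_ contMDiffAt_const
      exact ContDiffAt.contMDiffAt (by fun_prop)
    have hπ : mfderiv 𝓘(ℝ, E × ℝ) 𝓘(ℝ, E) C.proj p (fundamentalField c p) = 0 := by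
      have h1 := mfderiv_curve e0 (h.contMDiff_proj p |>.mdifferentiableAt (by simp)) hcurve
      have h2 : (C.proj ∘ fun t : ℝ => expUnit (t * c) • p) = fun _ => C.proj p := funext fun t => by
        change (C.incl _).1 = _
        rw [hsmul]; rfl
      rw [h2, mfderiv_const] at h1
      exact h1
    have hκ : mvfderiv 𝓘(ℝ, E × ℝ) (fun q => ratio s (C.incl q)) p (fundamentalField c p) =
        c * ratio s (C.incl p) := by
      have h1 := mfderiv_curve e0 ((h.contMDiffAt_ratio hs hp).mdifferentiableAt (by simp)) hcurve
      have h2 : ((fun q => ratio s (C.incl q)) ∘ fun t : ℝ => expUnit (t * c) • p) =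
          fun t => Real.exp (t * c) * ratio s (C.incl p) := funext fun t => by
        change ratio s (C.incl _) = _
        rw [hsmul, ← scaleBy_coe, ratio_scaleBy]; rfl
      have h3 : HasDerivAt (fun t => Real.exp (t * c) * ratio s (C.incl p))
          (c * ratio s (C.incl p)) 0 := by
        have := (((hasDerivAt_id (0 : ℝ)).mul_const c).exp).mul_const (ratio s (C.incl p))
        simpa using this
      rw [h2, mfderiv_eq_fderiv] at h1
      exact h1.trans (fderiv_apply_one_eq_deriv.trans h3.deriv)
    refine Prod.ext ?_ ?_
    · change Λ p (fundamentalField c p) = c * 1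
      rw [hl p hp, hπ, hκ, map_zero]
      field_simp
      ring
    · change C.tautological p (fundamentalField c p) = c • 0
      rw [tautological_eq_zero hπ, smul_zero]
  equivariant a p v := by
    obtain ⟨U, s, hp, hs⟩ := hloc (C.proj p)
    obtain ⟨l, hl⟩ := h.structureForm_apply hΛ hs
    have h0 := (hs.incl_eq h.finrank_eq hp).1
    have hR : MDifferentiableAt 𝓘(ℝ, E × ℝ) 𝓘(ℝ, E × ℝ) (fun q : C.P5 => a • q) p := by
      refine ContMDiffAt.mdifferentiableAt (n := ∞) (h.contMDiffAt_of_incl ?_) (by simp)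
      have e : (fun q : C.P5 => C.incl (a • q)) = fun q => scaleBy (a : ℝ) (C.incl q) :=
        funext fun q => hsmul a q
      rw [e]
      exact contMDiffAt_scaleBy contMDiffAt_const (h.contMDiff_incl p)
    have eπ : ∀ q : C.P5, C.proj (a • q) = C.proj q := fun q => by
      unfold CRStructure.proj; rw [hsmul]; rfl
    have hp' : C.proj (a • p) ∈ U := by rw [eπ]; exact hp
    have hπ : MDifferentiableAt 𝓘(ℝ, E × ℝ) 𝓘(ℝ, E) C.proj (a • p) :=
      (h.contMDiff_proj (a • p)).mdifferentiableAt (by simp)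
    have eR : (C.proj ∘ fun q : C.P5 => a • q) = C.proj := funext eπ
    have hκ : ∀ q : C.P5, ratio s (C.incl (a • q)) = a * ratio s (C.incl q) := fun q => by
      rw [hsmul, ← scaleBy_coe, ratio_scaleBy]
    have pull : ∀ {W : Type} [NormedAddCommGroup W] [NormedSpace ℝ W]
        (η : ∀ x : M, TangentSpace 𝓘(ℝ, E) x →L[ℝ] W),
        pullbackForm (F := E × ℝ) (F' := E) C.proj η (a • p)
          (mfderiv 𝓘(ℝ, E × ℝ) 𝓘(ℝ, E × ℝ) (fun q : C.P5 => a • q) p v) =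
        pullbackForm (F := E × ℝ) (F' := E) C.proj η p v := fun η => by
      have := pullbackForm_comp (f := fun q : C.P5 => a • q) η hπ hR v
      rwa [eR] at this
    refine Prod.ext ?_ ?_
    · change Λ (a • p) _ = Λ p v
      have h1 : mvfderiv 𝓘(ℝ, E × ℝ) (fun q => ratio s (C.incl q)) (a • p)
          (mfderiv 𝓘(ℝ, E × ℝ) 𝓘(ℝ, E × ℝ) (fun q : C.P5 => a • q) p v) =
          a * mvfderiv 𝓘(ℝ, E × ℝ) (fun q => ratio s (C.incl q)) p v := by
        have h2 := mvfderiv_comp_apply p (f := fun q : C.P5 => a • q) (g := fun q => ratio s (C.incl q))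
          ((h.contMDiffAt_ratio hs hp').mdifferentiableAt (by simp)) hR v
        refine h2.symm.trans ?_
        have h3 : ((fun q => ratio s (C.incl q)) ∘ fun q : C.P5 => a • q) =
            (fun _ => (a : ℝ)) * (fun q => ratio s (C.incl q)) := funext hκ
        rw [h3, mvfderiv_mul mdifferentiableAt_const
          ((h.contMDiffAt_ratio hs hp).mdifferentiableAt (by simp)), mvfderiv_const]
        simp
      have e1 := (hl (a • p) hp' _).trans (congrArg₂ (· + ·) (pull l)
        (congrArg ((ratio s (C.incl (a • p)))⁻¹ * ·) h1))
      rw [e1, hl p hp, hκ]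
      refine congrArg₂ (· + ·) rfl ?_
      have := a.ne_zero
      change (↑a * ratio s (C.incl p))⁻¹ * (↑a * _) = _
      field_simp
    · change C.tautological (a • p) _ = ((((a⁻¹)⁻¹ : ℝˣ) : ℝ) ^ 4 * (C.tautological p v).1,
        (((a⁻¹)⁻¹ : ℝˣ) : ℝ) ^ 3 * (C.tautological p v).2.1,
        (((a⁻¹)⁻¹ : ℝˣ) : ℝ) ^ 2 * (C.tautological p v).2.2.1,
        ((((a⁻¹)⁻¹ : ℝˣ) : ℝ) : ℂ) * (C.tautological p v).2.2.2)
      rw [inv_inv, ← scaleValue_apply, tautological_eq hs h.finrank_eq hp',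
        tautological_eq hs h.finrank_eq hp, ContinuousLinearMap.comp_apply,
        ContinuousLinearMap.comp_apply, pull s, hκ]
      have e1 : scaleReal (a * ratio s (C.incl p)) = (scaleValue a).comp (scaleReal (ratio s (C.incl p))) :=
        scaleValue_mul a (Units.mk0 _ h0)
      rw [e1]
      rfl
  bijective p := by
    obtain ⟨U, s, hs, hp, hinj⟩ := h.eq_zero_of_mfderiv p
    obtain ⟨l, hl⟩ := h.structureForm_apply hΛ hs
    have h0 := (hs.incl_eq h.finrank_eq hp).1
    have h1 : Function.Injective (show E × ℝ →L[ℝ] ℝ × CoframeValue from C.cartanForm Λ p) := by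
      refine injective_of_ker (A := E × ℝ) (B := ℝ × CoframeValue) _ fun v hv => ?_
      have k1 : Λ p v = 0 := congrArg Prod.fst hv
      have k2 : C.tautological p v = 0 := congrArg Prod.snd hv
      have k3 : mfderiv 𝓘(ℝ, E × ℝ) 𝓘(ℝ, E) C.proj p v = 0 := by
        rw [tautological_eq hs h.finrank_eq hp] at k2
        change scaleValue (Units.mk0 _ h0) (s (C.proj p) (mfderiv 𝓘(ℝ, E × ℝ) 𝓘(ℝ, E) C.proj p v)) = 0 at k2
        have k4 := congrArg (scaleValue (Units.mk0 _ h0)⁻¹) k2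
        rw [← ContinuousLinearMap.comp_apply, ← scaleValue_mul, inv_mul_cancel, scaleValue_one,
          map_zero, ContinuousLinearMap.id_apply] at k4
        exact (hs.isInvertible h.finrank_eq hp).injective (k4.trans (map_zero _).symm)
      refine hinj v k3 ?_
      have k5 := (hl p hp v).symm.trans k1
      rw [k3, map_zero, zero_add] at k5
      exact (mul_eq_zero.1 k5).resolve_left (inv_ne_zero h0)
    have h2 : Module.finrank ℝ (E × ℝ) = Module.finrank ℝ (ℝ × CoframeValue) := by
      rw [Module.finrank_prod, Module.finrank_prod, Module.finrank_prod, Module.finrank_prod,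
        Module.finrank_prod, h.finrank_eq, Module.finrank_self, Complex.finrank_real_complex]
    exact ⟨h1, (LinearMap.injective_iff_surjective_of_finrank_eq_finrank h2
      (f := ((show E × ℝ →L[ℝ] ℝ × CoframeValue from C.cartanForm Λ p) : E × ℝ →ₗ[ℝ] ℝ × CoframeValue))).1 h1⟩

end StructureForm


/-! ### Polynomial fields on the model -/

/-- The coefficients of the polynomial vector fields
`(l x + p) ∂x + (l y + q) ∂y + f₁ ∂₁ + f₂ ∂₂ + f₃ ∂₃` on the model in which `f₁`, `f₂`, `f₃`
are combinations of the monomials that occur in the model frame and in the symmetries. -/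
structure PolyCoeff where
  l : ℝ := 0
  p : ℝ := 0
  q : ℝ := 0
  a₀ : ℝ := 0
  ax : ℝ := 0
  ay : ℝ := 0
  b₀ : ℝ := 0
  bx : ℝ := 0
  bxx : ℝ := 0
  bxy : ℝ := 0
  byy : ℝ := 0
  bu : ℝ := 0
  c₀ : ℝ := 0
  cx : ℝ := 0
  cxx : ℝ := 0
  cxxx : ℝ := 0
  cxxy : ℝ := 0
  cxyy : ℝ := 0
  cyyy : ℝ := 0
  cu : ℝ := 0

/-- The polynomial vector field with the given coefficients. -/
def polyField (k : PolyCoeff) (n : ModelN) : ModelN :=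
  (⟨k.l * n.1.re + k.p, k.l * n.1.im + k.q⟩,
   2 * k.l * n.2.1 + k.a₀ + k.ax * n.1.re + k.ay * n.1.im,
   3 * k.l * n.2.2.1 + k.b₀ + k.bx * n.1.re + k.bxx * n.1.re ^ 2 + k.bxy * (n.1.re * n.1.im)
     + k.byy * n.1.im ^ 2 + k.bu * n.2.1,
   4 * k.l * n.2.2.2 + k.c₀ + k.cx * n.1.re + k.cxx * n.1.re ^ 2 + k.cxxx * n.1.re ^ 3
     + k.cxxy * (n.1.re ^ 2 * n.1.im) + k.cxyy * (n.1.re * n.1.im ^ 2) + k.cyyy * n.1.im ^ 3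
     + k.cu * n.2.2.1)

/-- The derivative of `polyField k` at `n` in the direction of `v`. -/
def polyDeriv (k : PolyCoeff) (n v : ModelN) : ModelN :=
  (⟨k.l * v.1.re, k.l * v.1.im⟩,
   2 * k.l * v.2.1 + k.ax * v.1.re + k.ay * v.1.im,
   3 * k.l * v.2.2.1 + k.bx * v.1.re + 2 * k.bxx * (n.1.re * v.1.re)
     + k.bxy * (n.1.re * v.1.im + n.1.im * v.1.re) + 2 * k.byy * (n.1.im * v.1.im) + k.bu * v.2.1,
   4 * k.l * v.2.2.2 + k.cx * v.1.re + 2 * k.cxx * (n.1.re * v.1.re)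
     + 3 * k.cxxx * (n.1.re ^ 2 * v.1.re)
     + k.cxxy * (n.1.re ^ 2 * v.1.im + 2 * n.1.re * n.1.im * v.1.re)
     + k.cxyy * (2 * n.1.re * n.1.im * v.1.im + n.1.im ^ 2 * v.1.re)
     + 3 * k.cyyy * (n.1.im ^ 2 * v.1.im) + k.cu * v.2.2.1)

theorem contDiff_polyField (k : PolyCoeff) : ContDiff ℝ ∞ (polyField k) := by
  have hx : ContDiff ℝ ∞ (fun n : ModelN => n.1.re) := Complex.reCLM.contDiff.comp contDiff_fst
  have hy : ContDiff ℝ ∞ (fun n : ModelN => n.1.im) := Complex.imCLM.contDiff.comp contDiff_fst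
  have hz : ContDiff ℝ ∞ (fun n : ModelN => (⟨k.l * n.1.re + k.p, k.l * n.1.im + k.q⟩ : ℂ)) :=
    Complex.equivRealProdCLM.symm.contDiff.comp (f := fun n : ModelN =>
      (k.l * n.1.re + k.p, k.l * n.1.im + k.q)) (by fun_prop)
  unfold polyField
  fun_prop

theorem fderiv_polyField (k : PolyCoeff) (n v : ModelN) :
    fderiv ℝ (polyField k) n v = polyDeriv k n v := by
  have h0 : HasDerivAt (fun t : ℝ => polyField k (n + t • v))
      (fderiv ℝ (polyField k) n v) 0 := by
    have h1 := ((contDiff_polyField k).differentiable (by simp) n).hasFDerivAt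
    have h2 : HasDerivAt (fun t : ℝ => n + t • v) v 0 := by
      simpa using ((hasDerivAt_id (0 : ℝ)).smul_const v).const_add n
    exact HasFDerivAt.comp_hasDerivAt_of_eq (0 : ℝ) h1 h2 (by simp)
  have hx : HasDerivAt (fun t : ℝ => (n + t • v).1.re) v.1.re 0 := by
    simpa using ((hasDerivAt_id (0 : ℝ)).mul_const v.1.re).const_add n.1.re
  have hy : HasDerivAt (fun t : ℝ => (n + t • v).1.im) v.1.im 0 := by
    simpa using ((hasDerivAt_id (0 : ℝ)).mul_const v.1.im).const_add n.1.im
  have h1 : HasDerivAt (fun t : ℝ => (n + t • v).2.1) v.2.1 0 := by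
    simpa using ((hasDerivAt_id (0 : ℝ)).mul_const v.2.1).const_add n.2.1
  have h2 : HasDerivAt (fun t : ℝ => (n + t • v).2.2.1) v.2.2.1 0 := by
    simpa using ((hasDerivAt_id (0 : ℝ)).mul_const v.2.2.1).const_add n.2.2.1
  have h3 : HasDerivAt (fun t : ℝ => (n + t • v).2.2.2) v.2.2.2 0 := by
    simpa using ((hasDerivAt_id (0 : ℝ)).mul_const v.2.2.2).const_add n.2.2.2
  have eL : ∀ L : ModelN →L[ℝ] ℝ, HasDerivAt (fun t : ℝ => L (polyField k (n + t • v)))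
      (L (fderiv ℝ (polyField k) n v)) 0 := fun L => L.hasFDerivAt.comp_hasDerivAt (0 : ℝ) h0
  refine Prod.ext (Complex.ext ?_ ?_) (Prod.ext ?_ (Prod.ext ?_ ?_))
  · refine (eL (Complex.reCLM.comp (.fst ℝ _ _))).unique ?_
    refine ((hx.const_mul k.l).add_const k.p).congr_deriv ?_
    simp [polyDeriv]
  · refine (eL (Complex.imCLM.comp (.fst ℝ _ _))).unique ?_
    refine ((hy.const_mul k.l).add_const k.q).congr_deriv ?_
    simp [polyDeriv]
  · refine (eL ((ContinuousLinearMap.fst ℝ _ _).comp (.snd ℝ _ _))).unique ?_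
    refine ((((h1.const_mul (2 * k.l)).add_const k.a₀).add (hx.const_mul k.ax)).add
      (hy.const_mul k.ay)).congr_deriv ?_
    simp [polyDeriv]
  · refine (eL ((ContinuousLinearMap.fst ℝ _ _).comp ((ContinuousLinearMap.snd ℝ _ _).comp
      (.snd ℝ _ _)))).unique ?_
    refine (((((((h2.const_mul (3 * k.l)).add_const k.b₀).add (hx.const_mul k.bx)).add
      ((hx.pow 2).const_mul k.bxx)).add ((hx.mul hy).const_mul k.bxy)).add
      ((hy.pow 2).const_mul k.byy)).add (h1.const_mul k.bu)).congr_deriv ?_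
    simp [polyDeriv]; ring
  · refine (eL ((ContinuousLinearMap.snd ℝ _ _).comp ((ContinuousLinearMap.snd ℝ _ _).comp
      (.snd ℝ _ _)))).unique ?_
    refine (((((((((h3.const_mul (4 * k.l)).add_const k.c₀).add (hx.const_mul k.cx)).add
      ((hx.pow 2).const_mul k.cxx)).add ((hx.pow 3).const_mul k.cxxx)).add
      (((hx.pow 2).mul hy).const_mul k.cxxy)).add ((hx.mul (hy.pow 2)).const_mul k.cxyy)).add
      ((hy.pow 3).const_mul k.cyyy)).add (h2.const_mul k.cu)).congr_deriv ?_
    simp [polyDeriv]; ring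

theorem smoothFieldAt_polyField (k : PolyCoeff) (n : ModelN) :
    SmoothFieldAt (F := ModelN) (polyField k) n :=
  contMDiffAt_vectorSpace_iff_contDiffAt.2 (contDiff_polyField k).contDiffAt

theorem mlieBracket_polyField (k k' : PolyCoeff) (n : ModelN) :
    mlieBracket 𝓘(ℝ, ModelN) (polyField k) (polyField k') n =
      (polyDeriv k' n (polyField k n) - polyDeriv k n (polyField k' n) : ModelN) := by
  have h := congrFun (mlieBracketWithin_eq_lieBracketWithin (𝕜 := ℝ) (V := polyField k)
    (W := polyField k') (s := Set.univ)) n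
  refine Eq.trans (b := lieBracketWithin ℝ (polyField k) (polyField k') Set.univ n) h ?_
  rw [lieBracketWithin_univ]
  rw [lieBracket, fderiv_polyField, fderiv_polyField]

/-- The symmetry of the model which corresponds to an element of its Lie algebra. -/
def symmCoeff (x : ModelAlgebra) : PolyCoeff where
  l := x.cα
  p := x.cζ.re
  q := x.cζ.im
  a₀ := -2 * x.cρ
  ax := 2 * x.cζ.im
  ay := -2 * x.cζ.re
  b₀ := 4 * x.cσ
  bxx := 2 * x.cζ.im
  bxy := -4 * x.cζ.re
  byy := -2 * x.cζ.im
  bu := 4 * x.cζ.re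
  c₀ := -12 * x.cτ
  cxxx := 2 * x.cζ.im
  cxxy := -6 * x.cζ.re
  cxyy := -6 * x.cζ.im
  cyyy := 2 * x.cζ.re
  cu := 6 * x.cζ.re

/-- The field `A`, where `A - i B` spans the CR-bundle of the model. -/
def coeffA : PolyCoeff := { p := 1, ay := 2, bxy := 4, cxxy := 6, cyyy := -2 }
/-- The field `B`, where `A - i B` spans the CR-bundle of the model. -/
def coeffB : PolyCoeff := { q := 1, ax := -2, bxx := -6, byy := -2, cxxx := -14, cxyy := -6 }
/-- The field `T = -[A, B]`. -/
def coeffT : PolyCoeff := { a₀ := 4, bx := 16, cxx := 48 }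
/-- The field `S = [A, T]`. -/
def coeffS : PolyCoeff := { b₀ := 16, cx := 96 }
/-- The field `R = [A, S]`. -/
def coeffR : PolyCoeff := { c₀ := 96 }

/-- The isomorphism of the model algebra with the symmetries of the model. -/
def modelSymm : ModelAlgebra →ₗ[ℝ] (∀ n : ModelN, TangentSpace 𝓘(ℝ, ModelN) n) where
  toFun x := polyField (symmCoeff x)
  map_add' x y := by
    funext n
    have e : polyField (symmCoeff (x + y)) n =
        polyField (symmCoeff x) n + polyField (symmCoeff y) n := by
      refine Prod.ext (Complex.ext ?_ ?_) (Prod.ext ?_ (Prod.ext ?_ ?_)) <;>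
      · simp [polyField, symmCoeff]; ring
    exact e
  map_smul' c x := by
    funext n
    have e : polyField (symmCoeff (c • x)) n = c • polyField (symmCoeff x) n := by
      refine Prod.ext (Complex.ext ?_ ?_) (Prod.ext ?_ (Prod.ext ?_ ?_)) <;>
      · simp [polyField, symmCoeff]; ring
    exact e

theorem modelSymm_lie (x y : ModelAlgebra) :
    modelSymm ⁅x, y⁆ = mlieBracket 𝓘(ℝ, ModelN) (modelSymm x) (modelSymm y) := by
  funext n
  refine Eq.trans ?_ (mlieBracket_polyField _ _ n).symm
  change polyField (symmCoeff ⁅x, y⁆) n = _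
  refine Prod.ext (Complex.ext ?_ ?_) (Prod.ext ?_ (Prod.ext ?_ ?_)) <;>
  · simp [polyField, polyDeriv, symmCoeff]; ring

theorem injective_modelSymm : Function.Injective modelSymm := by
  rw [injective_iff_map_eq_zero]
  intro x hx
  have h : ∀ n, polyField (symmCoeff x) n = 0 := fun n => congrFun hx n
  have h0 := h 0
  have h1 := h (1, 0, 0, 0)
  simp [polyField, symmCoeff, Prod.ext_iff, Complex.ext_iff] at h0 h1
  refine ModelAlgebra.ext' ?_ ?_ ?_ ?_ (Complex.ext ?_ ?_) <;> simp <;> simp_all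


/-! ### Symmetries of the model -/

/-- The value of the complex linear extension of `g` on `a + i b`. -/
theorem liftBaseChange_conj {T : Type*} [AddCommGroup T] [Module ℝ T] (g : T →ₗ[ℝ] ℂ) (a b : T) :
    LinearMap.liftBaseChange ℂ (Complex.conjAe.toLinearMap ∘ₗ g)
      ((1 : ℂ) ⊗ₜ[ℝ] a + Complex.I ⊗ₜ[ℝ] b) = (starRingEnd ℂ) (g a - Complex.I * g b) := by
  rw [map_add, LinearMap.liftBaseChange_tmul, LinearMap.liftBaseChange_tmul]
  simp [sub_eq_add_neg]

/-- The CR-bundle of the model in terms of the derivative of the embedding: a complex vector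
belongs to it if the antiholomorphic components of its image vanish. -/
theorem val_mem_modelL_iff {Z : ComplexField ModelN ModelN} {n v v' : ModelN} (hv : Z.re n = v)
    (hv' : Z.im n = v') : Z.val n ∈ modelL n ↔
      ∀ j : Fin 4, fderiv ℝ (fun m : ModelN => modelEmb m j) n v =
        Complex.I * fderiv ℝ (fun m : ModelN => modelEmb m j) n v' := by
  refine (Submodule.mem_iInf _).trans (forall_congr' fun j => ?_)
  obtain ⟨f, hf⟩ : ∃ f : ModelN →L[ℝ] ℂ, f = fderiv ℝ (fun m : ModelN => modelEmb m j) n := ⟨_, rfl⟩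
  rw [← hf, LinearMap.mem_ker]
  have e : (LinearMap.liftBaseChange ℂ (Complex.conjAe.toLinearMap ∘ₗ (f : ModelN →ₗ[ℝ] ℂ) :
        TangentSpace 𝓘(ℝ, ModelN) n →ₗ[ℝ] ℂ)) (Z.val n) =
      (starRingEnd ℂ) (f v - Complex.I * f v') := by
    rw [← hv, ← hv']
    exact liftBaseChange_conj (T := TangentSpace 𝓘(ℝ, ModelN) n) f.toLinearMap (Z.re n) (Z.im n)
  rw [e, map_eq_zero, sub_eq_zero]

/-- The derivative of the embedding of the model, whose imaginary parts are the graph functions. -/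
theorem fderiv_modelEmb (n v : ModelN) :
    fderiv ℝ (fun m : ModelN => modelEmb m 0) n v = v.1 ∧
    fderiv ℝ (fun m : ModelN => modelEmb m 1) n v =
      ⟨v.2.1, 2 * n.1.re * v.1.re + 2 * n.1.im * v.1.im⟩ ∧
    fderiv ℝ (fun m : ModelN => modelEmb m 2) n v =
      ⟨v.2.2.1, (6 * n.1.re ^ 2 + 2 * n.1.im ^ 2) * v.1.re + 4 * n.1.re * n.1.im * v.1.im⟩ ∧
    fderiv ℝ (fun m : ModelN => modelEmb m 3) n v =
      ⟨v.2.2.2, (14 * n.1.re ^ 3 + 6 * n.1.re * n.1.im ^ 2) * v.1.re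
        + (6 * n.1.re ^ 2 * n.1.im - 2 * n.1.im ^ 3) * v.1.im⟩ := by
  have hz : HasFDerivAt (fun m : ModelN => m.1) (ContinuousLinearMap.fst ℝ ℂ (ℝ × ℝ × ℝ)) n :=
    (ContinuousLinearMap.fst ℝ ℂ (ℝ × ℝ × ℝ)).hasFDerivAt
  have hc : HasFDerivAt (fun m : ModelN => (starRingEnd ℂ) m.1)
      ((Complex.conjCLE : ℂ →L[ℝ] ℂ).comp (ContinuousLinearMap.fst ℝ ℂ (ℝ × ℝ × ℝ))) n :=
    ((Complex.conjCLE : ℂ →L[ℝ] ℂ).comp (ContinuousLinearMap.fst ℝ ℂ (ℝ × ℝ × ℝ))).hasFDerivAt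
  have hu : ∀ L : ModelN →L[ℝ] ℝ, HasFDerivAt (fun m : ModelN => ((L m : ℝ) : ℂ))
      (Complex.ofRealCLM.comp L) n := fun L => (Complex.ofRealCLM.comp L).hasFDerivAt
  have hr := hz.mul hc
  refine ⟨?_, ?_, ?_, ?_⟩
  · exact congrArg (fun L : ModelN →L[ℝ] ℂ => L v) hz.fderiv
  · have h := (hu ((ContinuousLinearMap.fst ℝ _ _).comp (.snd ℝ _ _))).add
      (hr.const_mul Complex.I)
    refine (congrArg (fun L : ModelN →L[ℝ] ℂ => L v) h.fderiv).trans ?_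
    apply Complex.ext <;> simp <;> ring
  · have h := (hu ((ContinuousLinearMap.fst ℝ _ _).comp ((ContinuousLinearMap.snd ℝ _ _).comp
      (.snd ℝ _ _)))).add ((hr.mul (hz.add hc)).const_mul Complex.I)
    refine (congrArg (fun L : ModelN →L[ℝ] ℂ => L v) h.fderiv).trans ?_
    apply Complex.ext <;> simp <;> ring
  · have h := (hu ((ContinuousLinearMap.snd ℝ _ _).comp ((ContinuousLinearMap.snd ℝ _ _).comp
      (.snd ℝ _ _)))).add ((hr.mul (((hz.pow 2).add (hr.const_mul (3 / 2))).add
        (hc.pow 2))).const_mul Complex.I)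
    refine (congrArg (fun L : ModelN →L[ℝ] ℂ => L v) h.fderiv).trans ?_
    apply Complex.ext <;> simp [pow_two] <;> ring

/-- The CR-bundle of the model is spanned by `A - i B`. -/
theorem val_mem_modelL_iff_eq {Z : ComplexField ModelN ModelN} {n v v' : ModelN} (hv : Z.re n = v)
    (hv' : Z.im n = v') : Z.val n ∈ modelL n ↔
      v = v.1.re • polyField coeffA n + v.1.im • polyField coeffB n ∧
      v' = v.1.im • polyField coeffA n - v.1.re • polyField coeffB n := by
  rw [val_mem_modelL_iff hv hv', Fin.forall_fin_succ, Fin.forall_fin_succ, Fin.forall_fin_succ,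
    Fin.forall_fin_succ]
  obtain ⟨h0, h1, h2, h3⟩ := fderiv_modelEmb n v
  obtain ⟨h0', h1', h2', h3'⟩ := fderiv_modelEmb n v'
  have e : (fderiv ℝ (fun m : ModelN => modelEmb m 0) n v =
        Complex.I * fderiv ℝ (fun m : ModelN => modelEmb m 0) n v' ∧
      fderiv ℝ (fun m : ModelN => modelEmb m 1) n v =
        Complex.I * fderiv ℝ (fun m : ModelN => modelEmb m 1) n v' ∧
      fderiv ℝ (fun m : ModelN => modelEmb m 2) n v =
        Complex.I * fderiv ℝ (fun m : ModelN => modelEmb m 2) n v' ∧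
      fderiv ℝ (fun m : ModelN => modelEmb m 3) n v =
        Complex.I * fderiv ℝ (fun m : ModelN => modelEmb m 3) n v') ↔ 
      v = v.1.re • polyField coeffA n + v.1.im • polyField coeffB n ∧
      v' = v.1.im • polyField coeffA n - v.1.re • polyField coeffB n := by
    rw [h0, h1, h2, h3, h0', h1', h2', h3']
    clear h0 h1 h2 h3 h0' h1' h2' h3' hv hv'
    obtain ⟨⟨a, b⟩, c, d, e⟩ := v
    obtain ⟨⟨a', b'⟩, c', d', e'⟩ := v'
    simp only [Complex.ext_iff, Prod.ext_iff, polyField, coeffA, coeffB]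
    simp
    constructor
    · rintro ⟨⟨rfl, rfl⟩, ⟨h3, h4⟩, ⟨h5, h6⟩, ⟨h7, h8⟩⟩
      refine ⟨⟨?_, ?_, ?_⟩, ⟨rfl, ?_⟩, ?_, ?_, ?_⟩ <;> linarith
    · rintro ⟨⟨h3, h4, h5⟩, ⟨rfl, rfl⟩, h6, h7, h8⟩
      refine ⟨⟨?_, ?_⟩, ⟨?_, ?_⟩, ⟨?_, ?_⟩, ⟨?_, ?_⟩⟩ <;> linarith
  refine Iff.trans ⟨fun h => ?_, fun h => ?_⟩ e
  · exact ⟨h.1, h.2.1, h.2.2.1, h.2.2.2.1⟩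
  · exact ⟨h.1, h.2.1, h.2.2.1, h.2.2.2, fun i => i.elim0⟩

/-- The restriction of a polynomial field to an open set. -/
def polyRes (U : Opens ModelN) (k : PolyCoeff) : SmoothField (F := ModelN) U :=
  SmoothField.res U (polyField k) fun n _ => smoothFieldAt_polyField k n

theorem polyRes_lie (U : Opens ModelN) (k k' : PolyCoeff) (x : U) :
    ⁅polyRes U k, polyRes U k'⁆.1 x =
      (polyDeriv k' x (polyField k x) - polyDeriv k x (polyField k' x) : ModelN) := by
  exact (congrFun (congrArg Subtype.val (SmoothField.res_lie (U := U) _ _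
    (fun n _ => smoothFieldAt_polyField k n) fun n _ => smoothFieldAt_polyField k' n)) x).trans
    (mlieBracket_polyField k k' x)

theorem smoothField_ext {U : Opens ModelN} {V W : SmoothField (F := ModelN) U}
    (h : ∀ x : U, (V.1 x : ModelN) = W.1 x) : V = W := Subtype.ext (funext h)

theorem isModelFrame_polyRes (U : Opens ModelN) : IsModelFrame (polyRes U coeffR)
    (polyRes U coeffS) (polyRes U coeffT) (polyRes U coeffA) (polyRes U coeffB) := by
  have key : ∀ (k k' : PolyCoeff) (W : SmoothField (F := ModelN) U),
      (∀ n : U, polyDeriv k' n (polyField k n) - polyDeriv k n (polyField k' n) =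
        (W.1 n : ModelN)) → ⁅polyRes U k, polyRes U k'⁆ = W := fun k k' W h =>
    smoothField_ext fun x => (polyRes_lie U k k' x).trans (h x)
  constructor <;> refine key _ _ _ fun n => ?_
  · change _ = -polyField coeffT n
    simp [polyField, polyDeriv, coeffA, coeffB, coeffT, Prod.ext_iff, Complex.ext_iff]
    refine ⟨?_, ?_, ?_⟩ <;> ring
  · change _ = polyField coeffS n
    simp [polyField, polyDeriv, coeffA, coeffS, coeffT, Prod.ext_iff, Complex.ext_iff]
    norm_num
  · change _ = polyField coeffR n
    simp [polyField, polyDeriv, coeffA, coeffS, coeffR, Complex.ext_iff]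
  all_goals
    change _ = (0 : ModelN)
    simp [polyField, polyDeriv, coeffA, coeffB, coeffT, coeffS, coeffR]

/-- The fields `R, S, T, A, B` of the model are independent at each point. -/
theorem polyField_indep {n : ModelN} {r s t a b : ℝ}
    (h : r • polyField coeffR n + s • polyField coeffS n + t • polyField coeffT n
      + a • polyField coeffA n + b • polyField coeffB n = 0) :
    r = 0 ∧ s = 0 ∧ t = 0 ∧ a = 0 ∧ b = 0 := by
  simp [polyField, coeffA, coeffB, coeffT, coeffS, coeffR, Prod.ext_iff, Complex.ext_iff] at h
  obtain ⟨⟨h3, h4⟩, h2, h1, h0⟩ := h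
  have e2 : t = 0 := by rw [h3, h4] at h2; linarith
  have e1 : s = 0 := by rw [h3, h4, e2] at h1; linarith
  have e0 : r = 0 := by rw [h3, h4, e2, e1] at h0; linarith
  exact ⟨e0, e1, e2, h3, h4⟩

theorem isFrame_polyRes (U : Opens ModelN) : IsFrame (SmoothFun (F := ModelN) U) (polyRes U coeffR)
    (polyRes U coeffS) (polyRes U coeffT) (polyRes U coeffA) (polyRes U coeffB) := by
  refine isFrame_of_isInvertible fun x => ?_
  rw [isInvertible_frameMap_iff (by simp [Module.finrank_prod]), Fintype.linearIndependent_iff]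
  intro c hc
  have h1 := frameMap_five (polyRes U coeffR) (polyRes U coeffS) (polyRes U coeffT)
    (polyRes U coeffA) (polyRes U coeffB) x c
  rw [frameMap_apply] at h1
  obtain ⟨e0, e1, e2, e3, e4⟩ := polyField_indep (n := x) (h1.symm.trans hc)
  intro i
  fin_cases i
  exacts [e0, e1, e2, e3, e4]

/-- The brackets of the symmetries with `A` and `B`. -/
theorem polyRes_symm_lie (U : Opens ModelN) (x : ModelAlgebra) :
    (∀ n : U, ⁅polyRes U (symmCoeff x), polyRes U coeffA⁆.1 n =
      -x.cα • (polyRes U coeffA).1 n) ∧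
    ∀ n : U, ⁅polyRes U (symmCoeff x), polyRes U coeffB⁆.1 n =
      -x.cα • (polyRes U coeffB).1 n := by
  refine ⟨fun n => (polyRes_lie U _ _ n).trans ?_, fun n => (polyRes_lie U _ _ n).trans ?_⟩
  · change _ = -x.cα • polyField coeffA n
    simp [polyField, polyDeriv, coeffA, symmCoeff, Prod.ext_iff, Complex.ext_iff]
    refine ⟨?_, ?_, ?_⟩ <;> ring
  · change _ = -x.cα • polyField coeffB n
    simp [polyField, polyDeriv, coeffB, symmCoeff, Prod.ext_iff, Complex.ext_iff]
    refine ⟨?_, ?_, ?_⟩ <;> ring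


/-! ### Infinitesimal automorphisms of the model -/

/-- A field for which `[X, A - i B]` is a multiple of `A - i B` multiplies it by a real constant. -/
theorem IsModelFrame.exists_factor {𝔽 𝔛 : Type*} [CommRing 𝔽] [LieRing 𝔛] [Module 𝔽 𝔛]
    {D : 𝔛 → 𝔽 → 𝔽} (hD : IsAnchor D) {q : 𝔽} (hq : 30 * q = 1) {R S T A B X : 𝔛} {c d : 𝔽}
    (hfr : IsFrame 𝔽 R S T A B) (h : IsModelFrame R S T A B)
    (hX : ⁅X, A⁆ = c • A + d • B ∧ ⁅X, -B⁆ = d • A - c • B) :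
    ∃ c : 𝔽, (∀ V, D V c = 0) ∧ ⁅X, A⁆ = c • A ∧ ⁅X, B⁆ = c • B := by
  have hB : ⁅X, B⁆ = (-d) • A + c • B := by
    rw [← neg_neg B, lie_neg, hX.2]
    module
  obtain ⟨rfl, hc⟩ := h.symmetry_factor hD hq hfr hX.1 hB
  exact ⟨c, hc, by rw [hX.1]; module, by rw [hB]; module⟩

theorem lie_sub_eq_zero {𝔛 : Type*} [LieRing 𝔛] {X Y A V : 𝔛} (h : ⁅X, A⁆ = V) (h' : ⁅Y, A⁆ = V) :
    ⁅A, X - Y⁆ = 0 := by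
  rw [← lie_skew, sub_lie, h, h', sub_self, neg_zero]

/-- If `X` multiplies `A - i B` by a function, then it preserves the complex multiples of `A - i B`. -/
theorem IsAnchor.lie_rotate {𝔽 𝔛 : Type*} [CommRing 𝔽] [LieRing 𝔛] [Module 𝔽 𝔛] {D : 𝔛 → 𝔽 → 𝔽}
    (hD : IsAnchor D) {X A B : 𝔛} {c : 𝔽} (hA : ⁅X, A⁆ = c • A) (hB : ⁅X, B⁆ = c • B) (p q : 𝔽) :
    ∃ P Q : 𝔽, ⁅X, p • A + q • B⁆ = P • A + Q • B ∧ ⁅X, q • A - p • B⁆ = Q • A - P • B := by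
  refine ⟨p * c + D X p, q * c + D X q, ?_, ?_⟩
  · rw [lie_add, hD.lie_smul, hD.lie_smul, hA, hB]
    module
  · rw [lie_sub, hD.lie_smul, hD.lie_smul, hA, hB]
    module

theorem val_mem_modelL {Z : ComplexField ModelN ModelN} {n v v' : ModelN} (hv : Z.re n = v)
    (hv' : Z.im n = v') {p q : ℝ} (h : v = p • polyField coeffA n + q • polyField coeffB n)
    (h' : v' = q • polyField coeffA n - p • polyField coeffB n) : Z.val n ∈ modelL n := by
  have e : v.1.re = p ∧ v.1.im = q := by
    rw [h]
    simp [polyField, coeffA, coeffB]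
  rw [val_mem_modelL_iff_eq hv hv', e.1, e.2]
  exact ⟨h, h'⟩

/-- The smooth function given by a real linear form on the values of a smooth field. -/
def coordFun {U : Opens ModelN} (L : ModelN →L[ℝ] ℝ) (V : SmoothField (F := ModelN) U) :
    SmoothFun (F := ModelN) U :=
  SmoothFun.res U (fun n => L (extV V.1 n)) fun n hn =>
    (L.contDiff.contDiffAt.comp (f := extV V.1) n
      (contMDiffAt_vectorSpace_iff_contDiffAt.1 (V.2 ⟨n, hn⟩))).contMDiffAt

theorem coordFun_apply {U : Opens ModelN} (L : ModelN →L[ℝ] ℝ) (V : SmoothField (F := ModelN) U)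
    (n : U) : (coordFun L V).1 n = L (V.1 n) := congrArg L (extV_coe V.1 n)

/-- The real part of the `z`-coordinate. -/
def coordX : ModelN →L[ℝ] ℝ := Complex.reCLM.comp (.fst ℝ _ _)

/-- The imaginary part of the `z`-coordinate. -/
def coordY : ModelN →L[ℝ] ℝ := Complex.imCLM.comp (.fst ℝ _ _)

/-- A complex field `a + i b` with values in the CR-bundle of the model is the multiple of `A - i B` by
the `z`-coordinate of `a`. -/
theorem eq_of_val_mem {U : Opens ModelN} {Z : ComplexField ModelN ModelN}
    {a b A B : SmoothField (F := ModelN) U} (hA : A = polyRes U coeffA) (hB : B = polyRes U coeffB)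
    (hZ : Z.On a b) (h : ∀ n ∈ U, Z.val n ∈ modelL n) :
    a = coordFun coordX a • A + coordFun coordY a • B ∧
    b = coordFun coordY a • A - coordFun coordX a • B := by
  subst hA hB
  have key : ∀ n : U, _ := fun n => (val_mem_modelL_iff_eq (hZ n).1 (hZ n).2).1 (h n n.2)
  refine ⟨smoothField_ext fun n => (key n).1.trans ?_, smoothField_ext fun n => (key n).2.trans ?_⟩
  · change _ = (coordFun coordX a).1 n • polyField coeffA n +
      (coordFun coordY a).1 n • polyField coeffB n
    rw [coordFun_apply, coordFun_apply]
    rfl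
  · change _ = (coordFun coordY a).1 n • polyField coeffA n -
      (coordFun coordX a).1 n • polyField coeffB n
    rw [coordFun_apply, coordFun_apply]
    rfl

theorem isInfinitesimalCRAut_modelSymm (x : ModelAlgebra) :
    IsInfinitesimalCRAut modelL (modelSymm x) := by
  refine ⟨fun n => smoothFieldAt_polyField (symmCoeff x) n, fun U₀ Z hU hZ hL n hn => ?_⟩
  obtain ⟨U, rfl⟩ : ∃ U : Opens ModelN, (U : Set ModelN) = U₀ := ⟨⟨U₀, hU⟩, rfl⟩
  obtain ⟨a, b, hab⟩ : ∃ a b : SmoothField (F := ModelN) U, Z.On a b :=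
    ⟨SmoothField.res U Z.re fun x hx => (hZ.1 x hx).contMDiffAt (hU.mem_nhds hx),
      SmoothField.res U Z.im fun x hx => (hZ.2 x hx).contMDiffAt (hU.mem_nhds hx),
      fun x => ⟨rfl, rfl⟩⟩
  obtain ⟨p, q, ha, hb⟩ : ∃ p q : SmoothFun (F := ModelN) U,
      a = p • polyRes U coeffA + q • polyRes U coeffB ∧
      b = q • polyRes U coeffA - p • polyRes U coeffB := ⟨_, _, eq_of_val_mem rfl rfl hab hL⟩
  have hX : (⟨modelSymm x, fun _ => 0⟩ : ComplexField ModelN ModelN).On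
      (polyRes U (symmCoeff x)) 0 := fun n => ⟨rfl, rfl⟩
  have hbr := hX.bracket hab ⟨n, hn⟩
  rw [zero_lie, zero_lie, sub_zero, add_zero] at hbr
  obtain ⟨c, hc⟩ : ∃ c : SmoothFun (F := ModelN) U, c = algebraMap ℝ _ (-x.cα) := ⟨_, rfl⟩
  have hA : ⁅polyRes U (symmCoeff x), polyRes U coeffA⁆ = c • polyRes U coeffA :=
    smoothField_ext fun n => ((polyRes_symm_lie U x).1 n).trans (by rw [hc]; rfl)
  have hB : ⁅polyRes U (symmCoeff x), polyRes U coeffB⁆ = c • polyRes U coeffB :=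
    smoothField_ext fun n => ((polyRes_symm_lie U x).2 n).trans (by rw [hc]; rfl)
  have hD := SmoothField.isAnchor_deriv (F := ModelN) (U := U)
  obtain ⟨P, Q, h1, h2⟩ := hD.lie_rotate hA hB p q
  rw [← ha] at h1
  rw [← hb] at h2
  rw [h1, h2] at hbr
  have e1 : (P • polyRes U coeffA + Q • polyRes U coeffB).1 ⟨n, hn⟩ =
      (P.1 ⟨n, hn⟩ • polyField coeffA n + Q.1 ⟨n, hn⟩ • polyField coeffB n : ModelN) := rfl
  have e2 : (Q • polyRes U coeffA - P • polyRes U coeffB).1 ⟨n, hn⟩ =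
      (Q.1 ⟨n, hn⟩ • polyField coeffA n - P.1 ⟨n, hn⟩ • polyField coeffB n : ModelN) := rfl
  exact val_mem_modelL (hbr.1.trans e1) (hbr.2.trans e2) rfl rfl

/-- A function annihilated by all fields is constant; the model is the whole of a vector space. -/
theorem SmoothFun.eq_of_deriv_eq_zero {f : SmoothFun (F := ModelN) ⊤}
    (h : ∀ V : SmoothField (F := ModelN) ⊤, SmoothField.deriv V f = 0) (m n : (⊤ : Opens ModelN)) :
    f.1 m = f.1 n := by
  have hd : Differentiable ℝ (extF f.1) := fun n =>
    ((f.2 ⟨n, trivial⟩).contDiffAt).differentiableAt (by simp)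
  have h0 : ∀ n, fderiv ℝ (extF f.1) n = 0 := by
    intro n
    refine ContinuousLinearMap.ext fun v => ?_
    have h1 := congrFun (congrArg Subtype.val (h (SmoothField.res ⊤ (fun _ => v) fun n _ =>
      contMDiffAt_vectorSpace_iff_contDiffAt.2 contDiffAt_const))) ⟨n, trivial⟩
    rw [SmoothField.deriv_apply] at h1
    unfold mvfderiv at h1
    rw [mfderiv_eq_fderiv] at h1
    exact h1
  have := is_const_of_fderiv_eq_zero hd h0 m n
  rwa [extF_coe, extF_coe] at this

/-- An infinitesimal CR-automorphism `X` of the model is determined as a symmetry by the factor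
of `[X, A - i B]` and the value of `X` at the origin. -/
theorem mem_range_modelSymm {X : ∀ n : ModelN, TangentSpace 𝓘(ℝ, ModelN) n}
    (hX : IsInfinitesimalCRAut modelL X) : X ∈ Set.range modelSymm := by
  obtain ⟨Y, hY⟩ : ∃ Y : SmoothField (F := ModelN) (⊤ : Opens ModelN), Y = SmoothField.res (⊤ : Opens ModelN) X fun n _ => hX.1 n := ⟨_, rfl⟩
  obtain ⟨A, hA⟩ : ∃ A : SmoothField (F := ModelN) (⊤ : Opens ModelN), A = polyRes ⊤ coeffA := ⟨_, rfl⟩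
  obtain ⟨B, hB⟩ : ∃ B : SmoothField (F := ModelN) (⊤ : Opens ModelN), B = polyRes ⊤ coeffB := ⟨_, rfl⟩
  have hD := SmoothField.isAnchor_deriv (F := ModelN) (U := (⊤ : Opens ModelN))
  have hfr := isFrame_polyRes ⊤
  have hmf := isModelFrame_polyRes ⊤
  rw [← hA, ← hB] at hfr hmf
  have hgen : ∀ n ∈ (⊤ : Opens ModelN), (gen A B).val n ∈ modelL n := fun n hn =>
    val_mem_modelL (v := polyField coeffA n) (v' := -polyField coeffB n)
      ((gen_on A B ⟨n, hn⟩).1.trans (by rw [hA]; rfl))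
      ((gen_on A B ⟨n, hn⟩).2.trans (by rw [hB]; rfl)) (p := 1) (q := 0) (by simp) (by simp)
  have hXY : (⟨X, fun _ => 0⟩ : ComplexField ModelN ModelN).On Y 0 := fun n =>
    ⟨by rw [hY]; rfl, rfl⟩
  have hbr := hXY.bracket (gen_on A B)
  rw [zero_lie, zero_lie, sub_zero, add_zero] at hbr
  have hq : 30 * (algebraMap ℝ (SmoothFun (F := ModelN) (⊤ : Opens ModelN)) (1 / 30)) = 1 := by
    ext n
    change (30 : ℝ) * (1 / 30) = 1
    norm_num
  obtain ⟨c, hc, hYA, hYB⟩ := hmf.exists_factor hD hq hfr (eq_of_val_mem hA hB hbr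
    (hX.2 _ _ (⊤ : Opens ModelN).isOpen (gen_smoothOn A B) hgen))
  obtain ⟨o, ho⟩ : ∃ o : (⊤ : Opens ModelN), o = ⟨0, trivial⟩ := ⟨_, rfl⟩
  obtain ⟨v, hv⟩ : ∃ v : ModelN, v = Y.1 o := ⟨_, rfl⟩
  -- the component along `e_α` is given by the factor `c`, the others by the value at the origin
  obtain ⟨x, hx⟩ : ∃ x : ModelAlgebra, x = ModelAlgebra.mk (-c.1 o)
      (-v.2.2.2 / 12, v.2.2.1 / 4, -v.2.1 / 2, v.1) := ⟨_, rfl⟩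
  have hsA : ⁅polyRes ⊤ (symmCoeff x), A⁆ = c • A := by
    refine smoothField_ext fun n => ?_
    rw [hA]
    refine ((polyRes_symm_lie ⊤ x).1 n).trans ?_
    have : -x.cα = c.1 n := by rw [hx, SmoothFun.eq_of_deriv_eq_zero hc n o]; simp
    rw [this]
    rfl
  have hsB : ⁅polyRes ⊤ (symmCoeff x), B⁆ = c • B := by
    refine smoothField_ext fun n => ?_
    rw [hB]
    refine ((polyRes_symm_lie ⊤ x).2 n).trans ?_
    have : -x.cα = c.1 n := by rw [hx, SmoothFun.eq_of_deriv_eq_zero hc n o]; simp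
    rw [this]
    rfl
  -- The difference commutes with `A` and `B`, and it vanishes at the origin.
  obtain ⟨W, hW⟩ : ∃ W, W = Y - polyRes ⊤ (symmCoeff x) := ⟨_, rfl⟩
  have hAW : ⁅A, W⁆ = 0 := by
    rw [hW]
    exact lie_sub_eq_zero hYA hsA
  have hBW : ⁅B, W⁆ = 0 := by
    rw [hW]
    exact lie_sub_eq_zero hYB hsB
  have hW0 : W.1 o = (0 : ModelN) := by
    have e : polyField (symmCoeff x) 0 = v := by
      rw [hx]
      refine Prod.ext (Complex.ext ?_ ?_) (Prod.ext ?_ (Prod.ext ?_ ?_)) <;>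
        simp [polyField, symmCoeff] <;> ring
    have e2 : Y.1 o = polyField (symmCoeff x) o := by
      refine hv.symm.trans ?_
      rw [ho]
      exact e.symm
    rw [hW]
    exact sub_eq_zero_of_eq (G := TangentSpace 𝓘(ℝ, ModelN) (o : ModelN)) e2
  obtain ⟨r, s, t, a, b, hWe⟩ := hfr.span W
  rw [hWe] at hAW hBW
  obtain ⟨hab, ht, hs, hr⟩ := hmf.coeff_const hD hfr hAW hBW
  have hcoef : r.1 o = 0 ∧ s.1 o = 0 ∧ t.1 o = 0 ∧ a.1 o = 0 ∧ b.1 o = 0 := by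
    refine polyField_indep (n := o) ?_
    rw [← hW0, hWe, hA, hB]
    rfl
  have hzero : ∀ f : SmoothFun (F := ModelN) ⊤, (∀ V, SmoothField.deriv V f = 0) → f.1 o = 0 →
      f = 0 := fun f hf h0 => by
    ext n
    exact (SmoothFun.eq_of_deriv_eq_zero hf n o).trans h0
  have ha0 := hzero a (fun V => (hab V).1) hcoef.2.2.2.1
  have hb0 := hzero b (fun V => (hab V).2) hcoef.2.2.2.2
  have ht0 := hzero t (ht ha0 hb0) hcoef.2.2.1
  have hs0 := hzero s (hs ha0 hb0 ht0) hcoef.2.1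
  have hr0 := hzero r (hr ha0 hb0 ht0 hs0) hcoef.1
  rw [ha0, hb0, ht0, hs0, hr0, hW] at hWe
  simp only [zero_smul, add_zero, sub_eq_zero] at hWe
  refine ⟨x, funext fun n => ?_⟩
  have := congrFun (congrArg Subtype.val hWe) ⟨n, trivial⟩
  rw [hY] at this
  exact this.symm

end
end CRThreeTwo

theorem mainTheorem2 {E : Type*} [NormedAddCommGroup E] [NormedSpace ℝ E] [FiniteDimensional ℝ E]
    (hE : Module.finrank ℝ E = 5)
    {M : Type*} [TopologicalSpace M] [T2Space M] [SecondCountableTopology M]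
    [ChartedSpace E M] [IsManifold 𝓘(ℝ, E) ∞ M]
    (C : CRStructure E M) (hC : C.IsClassIII2) :
    (∃ Φ : ModelAlgebra →ₗ[ℝ] (∀ n : ModelN, TangentSpace 𝓘(ℝ, ModelN) n),
      Function.Injective Φ ∧
      Set.range Φ = {X | IsInfinitesimalCRAut modelL X} ∧
      ∀ x y : ModelAlgebra, Φ ⁅x, y⁆ = mlieBracket 𝓘(ℝ, ModelN) (Φ x) (Φ y)) ∧
    ∃ (_ : ChartedSpace (E × ℝ) C.P5) (_ : IsManifold 𝓘(ℝ, E × ℝ) ∞ C.P5) (_ : MulAction ℝˣ C.P5),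
      (∀ (a : ℝˣ) (p : C.P5), C.incl (a • p) = scaleCoframe a (C.incl p)) ∧
      ContMDiff 𝓘(ℝ, E × ℝ) (𝓘(ℝ, E).prod 𝓘(ℝ, E →L[ℝ] CoframeValue)) ∞ C.incl ∧
      (∀ p : C.P5, Function.Injective
        (mfderiv 𝓘(ℝ, E × ℝ) (𝓘(ℝ, E).prod 𝓘(ℝ, E →L[ℝ] CoframeValue)) C.incl p)) ∧
      IsPrincipalBundle (E := E) (F := E × ℝ) C.proj ∧
      (∃! Λ : ∀ p : C.P5, TangentSpace 𝓘(ℝ, E × ℝ) p →L[ℝ] ℝ, C.IsStructureForm Λ) ∧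
      ∀ Λ : ∀ p : C.P5, TangentSpace 𝓘(ℝ, E × ℝ) p →L[ℝ] ℝ, C.IsStructureForm Λ →
        IsCartanConnection (C.cartanForm Λ) := by
  have hloc : ∀ x₀ : M, ∃ (U : Opens M) (s : ∀ x : M, TangentSpace 𝓘(ℝ, E) x →L[ℝ] CoframeValue),
      x₀ ∈ U ∧ C.IsNormalizedCoframe U s := fun x₀ => exists_isNormalizedCoframe hE hC x₀
  refine ⟨⟨modelSymm, injective_modelSymm, Set.Subset.antisymm ?_ fun X hX =>
    mem_range_modelSymm hX, modelSymm_lie⟩, ?_⟩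
  · rintro _ ⟨x, rfl⟩
    exact isInfinitesimalCRAut_modelSymm x
  choose U s hU hs using hloc
  let _ := p5ChartedSpace hE U s hU hs
  have hM := isManifold_p5 hE U s hU hs
  have h : IsP5Charted C := ⟨hE, fun p => ⟨U (C.proj p), s (C.proj p), hs _, hU _, rfl⟩⟩
  let _ := p5MulAction C
  have hloc := fun x => exists_isNormalizedCoframe hE hC x
  exact ⟨_, hM, _, fun _ _ => rfl, h.contMDiff_incl, h.injective_mfderiv_incl,
    h.isPrincipalBundle (fun _ _ => rfl) hloc, h.existsUnique_structureForm hloc,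
    fun Λ hΛ => h.isCartanConnection (fun _ _ => rfl) hloc hΛ⟩
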